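/- **Setting.** A *model of type theory* is a category $\mathcal C$ of contexts with a terminal object, a presheaf of types $\mathrm{Ty}$, a presheaf of terms $\mathrm{Tm}$ over it, and representable context extension (a natural model, equivalently a category with families); all type formers are strictly stable under substitution. A *model of* $\mathrm{ITT}$ is such a $\mathcal C$ with $\Pi$- and $\Sigma$-types and a unit type satisfying the strict $\beta$ and $\eta$ rules, intensional identity types (with the path induction eliminator and its strict $\beta$ rule), an empty type, binary coproduct types with strict $\beta$ rules, and one universe $\mathcal U$ closed under these type formers. It has *extensive finite coproducts of types* (with strict $\eta$) if terms depending on $A_0+A_1$ are determined strictly by their restrictions along the two inclusions, any two terms depending on the empty type $0$ are strictly equal, and from types $P_0$ over $A_0$ and $P_1$ over $A_1$ one can form, stably under substitution, a type $[P_0,P_1]$ over $A_0+A_1$ that restricts strictly to $P_0$ and $P_1$. For functions $f,g:\prod_{a:A}B(a)$ write $f\sim g$ for $\prod_{a:A}f(a)=g(a)$. A function $f:A\to B$ is an *equivalence* if there are $s,r:B\to A$ with $f\circ s\sim\mathrm{id}_B$ and $r\circ f\sim\mathrm{id}_A$; it is a *categorical equivalence* if there are $s,r:B\to A$ with identifications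 $f\circ s=\mathrm{id}_B$ in $B\to B$ and $r\circ f=\mathrm{id}_A$ in $A\to A$. Write $A\simeq B$ and $A\cong B$ for the types of equivalences and of categorical equivalences. * $\mathrm{FE}$: for every family of types $B$ over a type $A$ and all $f,g:\prod_{a:A}B(a)$, the canonical map $(f=g)\to(f\sim g)$ is an equivalence. * $\mathrm{UA}_{\mathcal U}$: for all $A,B:\mathcal U$, the map $(A=_{\mathcal U}B)\to(A\simeq B)$ defined by path induction from the identity equivalence is an equivalence. * $\mathrm{CCUA}_{\mathcal U}$ (*categorical categorical univalence*): for all $A,B:\mathcal U$, the map $\mathrm{idToCEq}:(A=_{\mathcal U}B)\to(A\cong B)$ defined by path induction from the identity categorical equivalence is a *categorical* equivalence. A model *validates* such a principle if the corresponding types are inhabited in every context. **The polynomial model.** Let $\mathcal C$ be a model of $\mathrm{ITT}$ with extensive finite coproducts of types. The polynomial model $\mathrm{Poly}(\mathcal C)$ has as contexts the pairs $\Gamma=(\Gamma^{s},\Gamma^{p})$ of a context $\Gamma^{s}$ of $\mathcal C$ (shapes) and a type $\Gamma^{p}$ over it (positions); a morphism $\sigma:\Delta\to\Gamma$ is a morphism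 $\sigma^{s}:\Delta^{s}\to\Gamma^{s}$ with a map $\Gamma^{p}\sigma^{s}\to\Delta^{p}$ over $\Delta^{s}$. A type over $\Gamma$ is a type $A^{s}$ over $\Gamma^{s}$ with a type $A^{p}$ over $\Gamma^{s}.A^{s}$; a term of it is a term $a^{s}$ of $A^{s}$ with a map $A^{p}(a^{s})\to\Gamma^{p}$ over $\Gamma^{s}$. Context extension is $(\Gamma^{s}.A^{s},\ \Gamma^{p}+A^{p})$. The type formers are: * $\Sigma_AB$: shapes $\sum_{a:A^{s}}B^{s}(a)$, positions over $(a,b)$: $A^{p}(a)+B^{p}(a,b)$; * $u=_Av$: shapes $u^{s}=_{A^{s}}v^{s}$, positions $0$; * $\Pi_AB$: shapes $\sum_{f:\prod_{a:A^{s}}B^{s}(a)}\prod_{a:A^{s}}\bigl(B^{p}(a,f(a))\to 1+A^{p}(a)\bigr)$, positions over $(f,\check f)$: the triples of an $a:A^{s}$, a $b:B^{p}(a,f(a))$ and an element of $[1,0](\check f(a,b))$, where $[1,0]$ is the family over $1+A^{p}(a)$ that is $1$ on the left and $0$ on the right summand; * $\mathcal U$: shapes $\sum_{A:\mathcal U}(A\to\mathcal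 U)$, positions $0$; the code $(A,P)$ decodes to the type with shapes $A$ and positions $P$. **Proposition.** If $\mathcal C$ is a model of $\mathrm{ITT}$ with extensive finite coproducts of types that validates $\mathrm{FE}$ and $\mathrm{UA}_{\mathcal U}$, then $\mathrm{Poly}(\mathcal C)$ validates $\mathrm{CCUA}_{\mathcal U}$. -/

import Mathlib

open CategoryTheory

universe w v u

set_option linter.unusedSectionVars false
set_option linter.unusedVariables false
set_option linter.unusedSimpArgs false

namespace TT

/-- A model of the structural rules of dependent type theory, as a natural model: a category of
contexts with a chosen terminal object, a presheaf of types, a presheaf of terms with a natural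
typing map `ty`, and a representation (context extension) of each fibre of the typing map.
The elements of `Tm A` below are the terms of type `A`. -/
class NaturalModel (C : Type u) [Category.{v} C] where
  Ty : C → Type w
  Term : C → Type w
  ty : ∀ {Γ : C}, Term Γ → Ty Γ
  tySub : ∀ {Γ Δ : C}, Ty Γ → (Δ ⟶ Γ) → Ty Δ
  tmSub : ∀ {Γ Δ : C}, Term Γ → (Δ ⟶ Γ) → Term Δ
  tySub_id : ∀ {Γ : C} (A : Ty Γ), tySub A (𝟙 Γ) = A
  tySub_comp : ∀ {Γ Δ Θ : C} (A : Ty Γ) (σ : Δ ⟶ Γ) (τ : Θ ⟶ Δ),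
    tySub A (τ ≫ σ) = tySub (tySub A σ) τ
  tmSub_id : ∀ {Γ : C} (a : Term Γ), tmSub a (𝟙 Γ) = a
  tmSub_comp : ∀ {Γ Δ Θ : C} (a : Term Γ) (σ : Δ ⟶ Γ) (τ : Θ ⟶ Δ),
    tmSub a (τ ≫ σ) = tmSub (tmSub a σ) τ
  ty_sub : ∀ {Γ Δ : C} (a : Term Γ) (σ : Δ ⟶ Γ), ty (tmSub a σ) = tySub (ty a) σ
  /-- the empty context -/
  emp : C
  toEmp : ∀ Γ : C, Γ ⟶ emp
  toEmp_uniq : ∀ {Γ : C} (σ : Γ ⟶ emp), σ = toEmp Γ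
  /-- context extension, with its display map, its variable and its universal property -/
  ext : ∀ Γ : C, Ty Γ → C
  p : ∀ {Γ : C} (A : Ty Γ), ext Γ A ⟶ Γ
  q : ∀ {Γ : C} (A : Ty Γ), Term (ext Γ A)
  ty_q : ∀ {Γ : C} (A : Ty Γ), ty (q A) = tySub A (p A)
  pair : ∀ {Γ Δ : C} (σ : Δ ⟶ Γ) (A : Ty Γ) (a : Term Δ), ty a = tySub A σ → (Δ ⟶ ext Γ A)
  pair_p : ∀ {Γ Δ : C} (σ : Δ ⟶ Γ) (A : Ty Γ) (a : Term Δ) (h : ty a = tySub A σ),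
    pair σ A a h ≫ p A = σ
  pair_q : ∀ {Γ Δ : C} (σ : Δ ⟶ Γ) (A : Ty Γ) (a : Term Δ) (h : ty a = tySub A σ),
    tmSub (q A) (pair σ A a h) = a
  pair_uniq : ∀ {Γ Δ : C} (A : Ty Γ) (σ τ : Δ ⟶ ext Γ A),
    σ ≫ p A = τ ≫ p A → tmSub (q A) σ = tmSub (q A) τ → σ = τ

open NaturalModel

infixl:75 " ▹ " => NaturalModel.ext
infixl:80 " ◂ " => NaturalModel.tySub
infixl:80 " ◃ " => NaturalModel.tmSub

attribute [simp] tySub_id tmSub_id ty_sub ty_q pair_p pair_q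

section Basic

variable {C : Type u} [Category.{v} C] [NaturalModel.{w} C] {Γ Δ Θ Ξ : C}

theorem tySub_tySub (A : Ty Γ) (σ : Δ ⟶ Γ) (τ : Θ ⟶ Δ) : (A ◂ σ) ◂ τ = A ◂ (τ ≫ σ) :=
  (tySub_comp A σ τ).symm

theorem tmSub_tmSub (a : Term Γ) (σ : Δ ⟶ Γ) (τ : Θ ⟶ Δ) : (a ◃ σ) ◃ τ = a ◃ (τ ≫ σ) :=
  (tmSub_comp a σ τ).symm

attribute [simp] tySub_tySub tmSub_tmSub

@[simp] theorem pair_p_assoc (σ : Δ ⟶ Γ) (A : Ty Γ) (a : Term Δ) (h : ty a = A ◂ σ)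
    (τ : Γ ⟶ Θ) : pair σ A a h ≫ p A ≫ τ = σ ≫ τ := by
  rw [← Category.assoc, pair_p]

theorem comp_pair_ty {σ : Δ ⟶ Γ} {A : Ty Γ} {a : Term Δ} (τ : Θ ⟶ Δ) (h : ty a = A ◂ σ) :
    ty (a ◃ τ) = A ◂ (τ ≫ σ) := by
  rw [ty_sub, h, tySub_tySub]

theorem comp_pair_ty' {A : Ty Γ} {a : Term Γ} (h : ty a = A) (σ : Δ ⟶ Γ) :
    ty (a ◃ σ) = A ◂ σ := by rw [ty_sub, h]

@[simp] theorem comp_pair (σ : Δ ⟶ Γ) (A : Ty Γ) (a : Term Δ) (h : ty a = A ◂ σ) (τ : Θ ⟶ Δ) :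
    τ ≫ pair σ A a h = pair (τ ≫ σ) A (a ◃ τ) (comp_pair_ty τ h) := by
  apply pair_uniq <;> simp [Category.assoc, ← tmSub_tmSub]

@[simp] theorem toEmp_comp (σ : Δ ⟶ Γ) : σ ≫ toEmp Γ = toEmp Δ := toEmp_uniq _

theorem pair_pq (A : Ty Γ) (h : ty (q A) = A ◂ p A) : pair (p A) A (q A) h = 𝟙 _ := by
  apply pair_uniq <;> simp

theorem pair_eta (A : Ty Γ) (σ : Δ ⟶ Γ ▹ A) (h) : pair (σ ≫ p A) A (q A ◃ σ) h = σ := by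
  apply pair_uniq <;> simp

attribute [simp] pair_pq pair_eta

/-- The terms of type `A`. -/
structure Tm (A : Ty Γ) : Type w where
  val : Term Γ
  prop : ty val = A

/-- Transport of a term along a strict equality of types. -/
def Tm.cast {A B : Ty Γ} (a : Tm A) (h : A = B) : Tm B := ⟨a.1, a.2.trans h⟩

def Tm.sub {A : Ty Γ} (a : Tm A) (σ : Δ ⟶ Γ) : Tm (A ◂ σ) := ⟨a.1 ◃ σ, by rw [ty_sub, a.2]⟩

@[simp] theorem Tm.cast_val {A B : Ty Γ} (a : Tm A) (h : A = B) : (a.cast h).1 = a.1 := rfl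

@[simp] theorem Tm.sub_val {A : Ty Γ} (a : Tm A) (σ : Δ ⟶ Γ) : (a.sub σ).1 = a.1 ◃ σ := rfl

theorem Tm.ext {A : Ty Γ} {a b : Tm A} (h : a.1 = b.1) : a = b := by
  cases a; cases b; cases h; rfl

/-- The last variable of a context. -/
def var (A : Ty Γ) : Tm (A ◂ p A) := ⟨q A, ty_q A⟩

@[simp] theorem var_val (A : Ty Γ) : (var A).1 = q A := rfl

/-- The substitution `⟨σ, a⟩`. -/
def cons (σ : Δ ⟶ Γ) {A : Ty Γ} (a : Tm (A ◂ σ)) : Δ ⟶ Γ ▹ A := pair σ A a.1 a.2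

/-- The substitution `[a] = ⟨id, a⟩`. -/
def inst {A : Ty Γ} (a : Tm A) : Γ ⟶ Γ ▹ A := cons (𝟙 Γ) (a.cast (tySub_id A).symm)

/-- The weakening `⟨p ≫ σ, q⟩` of `σ` under a binder, with a prescribed form `A'` of `A ◂ σ`. -/
def liftTo (σ : Δ ⟶ Γ) {A : Ty Γ} {A' : Ty Δ} (h : A ◂ σ = A') : Δ ▹ A' ⟶ Γ ▹ A :=
  cons (p A' ≫ σ) ((var A').cast (by rw [← h, tySub_tySub]))

/-- The weakening of `σ` under a binder. -/
def lift (σ : Δ ⟶ Γ) (A : Ty Γ) : Δ ▹ (A ◂ σ) ⟶ Γ ▹ A := liftTo σ rfl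

theorem cons_eq (σ : Δ ⟶ Γ) {A : Ty Γ} (a : Tm (A ◂ σ)) : cons σ a = pair σ A a.1 a.2 := by
  rw [cons]

theorem inst_eq {A : Ty Γ} (a : Tm A) :
    inst a = pair (𝟙 Γ) A a.1 (a.2.trans (tySub_id A).symm) := by
  rw [inst, cons_eq]; rfl

theorem liftTo_eq (σ : Δ ⟶ Γ) {A : Ty Γ} {A' : Ty Δ} (h : A ◂ σ = A') :
    liftTo σ h = pair (p A' ≫ σ) A (q A') (by simp [← h]) := by
  rw [liftTo, cons_eq]; rfl

theorem lift_eq (σ : Δ ⟶ Γ) (A : Ty Γ) : lift σ A = pair (p _ ≫ σ) A (q _) (by simp) := by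
  rw [lift, liftTo_eq]

theorem sub_inst {A : Ty Γ} (a : Tm A) (σ : Δ ⟶ Γ) :
    σ ≫ inst a = inst (a.sub σ) ≫ lift σ A := by
  simp [inst_eq, lift_eq]

end Basic

/-! Type formers. Each is stable under substitution. -/

/-- Dependent products, with strict `β` and `η`. -/
class HasPi (C : Type u) [Category.{v} C] [NaturalModel.{w} C] where
  Pi : ∀ {Γ : C} (A : Ty Γ), Ty (Γ ▹ A) → Ty Γ
  lam : ∀ {Γ : C} {A : Ty Γ} {B : Ty (Γ ▹ A)}, Tm B → Tm (Pi A B)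
  app : ∀ {Γ : C} {A : Ty Γ} {B : Ty (Γ ▹ A)}, Tm (Pi A B) → Tm B
  app_lam : ∀ {Γ : C} {A : Ty Γ} {B : Ty (Γ ▹ A)} (b : Tm B), app (lam b) = b
  lam_app : ∀ {Γ : C} {A : Ty Γ} {B : Ty (Γ ▹ A)} (f : Tm (Pi A B)), lam (app f) = f
  Pi_sub : ∀ {Γ Δ : C} (A : Ty Γ) (B : Ty (Γ ▹ A)) (σ : Δ ⟶ Γ),
    Pi A B ◂ σ = Pi (A ◂ σ) (B ◂ lift σ A)
  lam_sub : ∀ {Γ Δ : C} {A : Ty Γ} {B : Ty (Γ ▹ A)} (b : Tm B) (σ : Δ ⟶ Γ),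
    ((lam b).sub σ).1 = (lam (b.sub (lift σ A))).1

/-- Dependent sums, with strict `β` and `η`. -/
class HasSigma (C : Type u) [Category.{v} C] [NaturalModel.{w} C] where
  Sig : ∀ {Γ : C} (A : Ty Γ), Ty (Γ ▹ A) → Ty Γ
  dpair : ∀ {Γ : C} {A : Ty Γ} {B : Ty (Γ ▹ A)} (a : Tm A), Tm (B ◂ inst a) → Tm (Sig A B)
  fst : ∀ {Γ : C} {A : Ty Γ} {B : Ty (Γ ▹ A)}, Tm (Sig A B) → Tm A
  snd : ∀ {Γ : C} {A : Ty Γ} {B : Ty (Γ ▹ A)} (t : Tm (Sig A B)), Tm (B ◂ inst (fst t))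
  fst_dpair : ∀ {Γ : C} {A : Ty Γ} {B : Ty (Γ ▹ A)} (a : Tm A) (b : Tm (B ◂ inst a)),
    fst (dpair a b) = a
  snd_dpair : ∀ {Γ : C} {A : Ty Γ} {B : Ty (Γ ▹ A)} (a : Tm A) (b : Tm (B ◂ inst a)),
    (snd (dpair a b)).1 = b.1
  dpair_eta : ∀ {Γ : C} {A : Ty Γ} {B : Ty (Γ ▹ A)} (t : Tm (Sig A B)), dpair (fst t) (snd t) = t
  Sig_sub : ∀ {Γ Δ : C} (A : Ty Γ) (B : Ty (Γ ▹ A)) (σ : Δ ⟶ Γ),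
    Sig A B ◂ σ = Sig (A ◂ σ) (B ◂ lift σ A)
  dpair_sub : ∀ {Γ Δ : C} {A : Ty Γ} {B : Ty (Γ ▹ A)} (a : Tm A) (b : Tm (B ◂ inst a)) (σ : Δ ⟶ Γ),
    ((dpair a b).sub σ).1 =
      (dpair (a.sub σ) ((b.sub σ).cast (by rw [tySub_tySub, tySub_tySub, sub_inst]))).1

/-- The formation and introduction rules of intensional identity types. -/
class HasIdIntro (C : Type u) [Category.{v} C] [NaturalModel.{w} C] where
  IdTy : ∀ {Γ : C} {A : Ty Γ}, Tm A → Tm A → Ty Γ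
  refl : ∀ {Γ : C} {A : Ty Γ} (a : Tm A), Tm (IdTy a a)
  IdTy_sub : ∀ {Γ Δ : C} {A : Ty Γ} (a b : Tm A) (σ : Δ ⟶ Γ),
    IdTy a b ◂ σ = IdTy (a.sub σ) (b.sub σ)
  refl_sub : ∀ {Γ Δ : C} {A : Ty Γ} (a : Tm A) (σ : Δ ⟶ Γ),
    ((refl a).sub σ).1 = (refl (a.sub σ)).1

open HasPi HasSigma HasIdIntro

section IdIntro

variable {C : Type u} [Category.{v} C] [NaturalModel.{w} C] [HasIdIntro C] {Γ Δ : C}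

theorem IdTy_congr {A A' : Ty Γ} {a b : Tm A} {a' b' : Tm A'} (hA : A = A')
    (ha : a.1 = a'.1) (hb : b.1 = b'.1) : IdTy a b = IdTy a' b' := by
  subst hA; rw [Tm.ext ha, Tm.ext hb]

/-- The family `y : A ⊢ a = y`. -/
def IdFam {A : Ty Γ} (a : Tm A) : Ty (Γ ▹ A) := IdTy (a.sub (p A)) (var A)

theorem IdFam_inst {A : Ty Γ} (a b : Tm A) : IdFam a ◂ inst b = IdTy a b := by
  rw [IdFam, IdTy_sub]
  exact IdTy_congr (by simp [inst_eq]) (by simp [inst_eq]) (by simp [inst_eq])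

theorem IdFam_sub {A : Ty Γ} (a : Tm A) (σ : Δ ⟶ Γ) :
    IdFam a ◂ lift σ A = IdFam (a.sub σ) := by
  rw [IdFam, IdTy_sub]
  exact IdTy_congr (by simp [lift_eq]) (by simp [lift_eq]) (by simp [lift_eq])

/-- The substitution `[b, e]` into `Γ, y : A, e : a = y`. -/
def instId {A : Ty Γ} (a : Tm A) {b : Tm A} (e : Tm (IdTy a b)) : Γ ⟶ Γ ▹ A ▹ IdFam a :=
  cons (inst b) (e.cast (IdFam_inst a b).symm)

theorem sub_instId {A : Ty Γ} (a : Tm A) {b : Tm A} (e : Tm (IdTy a b)) (σ : Δ ⟶ Γ) :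
    σ ≫ instId a e = instId (a.sub σ) ((e.sub σ).cast (IdTy_sub a b σ)) ≫
      liftTo (lift σ A) (IdFam_sub a σ) := by
  simp [instId, cons_eq, inst_eq, lift_eq, liftTo_eq]

theorem sub_instId_refl {A : Ty Γ} (a : Tm A) (P : Ty (Γ ▹ A ▹ IdFam a)) (σ : Δ ⟶ Γ) :
    (P ◂ instId a (refl a)) ◂ σ =
      (P ◂ liftTo (lift σ A) (IdFam_sub a σ)) ◂ instId (a.sub σ) (refl (a.sub σ)) := by
  have h : ((refl a).sub σ).cast (IdTy_sub a a σ) = refl (a.sub σ) := Tm.ext (refl_sub a σ)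
  rw [tySub_tySub, tySub_tySub, sub_instId, h]

end IdIntro

/-- Intensional identity types: the eliminator `J`, based at `a`, with its strict `β` rule. -/
class HasId (C : Type u) [Category.{v} C] [NaturalModel.{w} C] extends HasIdIntro C where
  J : ∀ {Γ : C} {A : Ty Γ} (a : Tm A) (P : Ty (Γ ▹ A ▹ IdFam a)) (_ : Tm (P ◂ instId a (refl a)))
    {b : Tm A} (e : Tm (IdTy a b)), Tm (P ◂ instId a e)
  J_refl : ∀ {Γ : C} {A : Ty Γ} (a : Tm A) (P : Ty (Γ ▹ A ▹ IdFam a))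
    (w : Tm (P ◂ instId a (refl a))), J a P w (refl a) = w
  J_sub : ∀ {Γ Δ : C} {A : Ty Γ} (a : Tm A) (P : Ty (Γ ▹ A ▹ IdFam a))
    (w : Tm (P ◂ instId a (refl a))) {b : Tm A} (e : Tm (IdTy a b)) (σ : Δ ⟶ Γ),
    ((J a P w e).sub σ).1 =
      (J (a.sub σ) (P ◂ liftTo (lift σ A) (IdFam_sub a σ))
        ((w.sub σ).cast (sub_instId_refl a P σ))
        ((e.sub σ).cast (IdTy_sub a b σ))).1

/-- The unit type, with strict `η`. -/
class HasUnit (C : Type u) [Category.{v} C] [NaturalModel.{w} C] where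
  UnitTy : ∀ Γ : C, Ty Γ
  star : ∀ Γ : C, Tm (UnitTy Γ)
  star_eta : ∀ {Γ : C} (t : Tm (UnitTy Γ)), t = star Γ
  UnitTy_sub : ∀ {Γ Δ : C} (σ : Δ ⟶ Γ), UnitTy Γ ◂ σ = UnitTy Δ

/-- The empty type. -/
class HasEmpty (C : Type u) [Category.{v} C] [NaturalModel.{w} C] where
  EmptyTy : ∀ Γ : C, Ty Γ
  EmptyTy_sub : ∀ {Γ Δ : C} (σ : Δ ⟶ Γ), EmptyTy Γ ◂ σ = EmptyTy Δ
  elim : ∀ {Γ : C} (P : Ty (Γ ▹ EmptyTy Γ)), Tm P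
  elim_sub : ∀ {Γ Δ : C} (P : Ty (Γ ▹ EmptyTy Γ)) (σ : Δ ⟶ Γ),
    ((elim P).sub (liftTo σ (EmptyTy_sub σ))).1 = (elim (P ◂ liftTo σ (EmptyTy_sub σ))).1

/-- The formation and introduction rules of binary coproduct types. -/
class HasSumTyIntro (C : Type u) [Category.{v} C] [NaturalModel.{w} C] where
  SumTy : ∀ {Γ : C}, Ty Γ → Ty Γ → Ty Γ
  inl : ∀ {Γ : C} {A : Ty Γ} (B : Ty Γ), Tm A → Tm (SumTy A B)
  inr : ∀ {Γ : C} (A : Ty Γ) {B : Ty Γ}, Tm B → Tm (SumTy A B)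
  SumTy_sub : ∀ {Γ Δ : C} (A B : Ty Γ) (σ : Δ ⟶ Γ), SumTy A B ◂ σ = SumTy (A ◂ σ) (B ◂ σ)
  inl_sub : ∀ {Γ Δ : C} {A : Ty Γ} (B : Ty Γ) (a : Tm A) (σ : Δ ⟶ Γ),
    ((inl B a).sub σ).1 = (inl (B ◂ σ) (a.sub σ)).1
  inr_sub : ∀ {Γ Δ : C} (A : Ty Γ) {B : Ty Γ} (b : Tm B) (σ : Δ ⟶ Γ),
    ((inr A b).sub σ).1 = (inr (A ◂ σ) (b.sub σ)).1

open HasUnit HasEmpty HasSumTyIntro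

section SumIntro

variable {C : Type u} [Category.{v} C] [NaturalModel.{w} C] [HasSumTyIntro C] {Γ Δ : C}

theorem inl_congr {A A' B B' : Ty Γ} {a : Tm A} {a' : Tm A'} (hA : A = A') (hB : B = B')
    (ha : a.1 = a'.1) : (inl B a).1 = (inl B' a').1 := by
  subst hA hB; rw [Tm.ext ha]

theorem inr_congr {A A' B B' : Ty Γ} {b : Tm B} {b' : Tm B'} (hA : A = A') (hB : B = B')
    (hb : b.1 = b'.1) : (inr A b).1 = (inr A' b').1 := by
  subst hA hB; rw [Tm.ext hb]

/-- The substitution `Γ, a : A → Γ, v : A + B` given by the left inclusion. -/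
def inlMap (A B : Ty Γ) : Γ ▹ A ⟶ Γ ▹ SumTy A B :=
  cons (p A) ((inl (B ◂ p A) (var A)).cast (SumTy_sub A B (p A)).symm)

/-- The substitution `Γ, b : B → Γ, v : A + B` given by the right inclusion. -/
def inrMap (A B : Ty Γ) : Γ ▹ B ⟶ Γ ▹ SumTy A B :=
  cons (p B) ((inr (A ◂ p B) (var B)).cast (SumTy_sub A B (p B)).symm)

theorem lift_inlMap (A B : Ty Γ) (σ : Δ ⟶ Γ) :
    lift σ A ≫ inlMap A B = inlMap (A ◂ σ) (B ◂ σ) ≫ liftTo σ (SumTy_sub A B σ) := by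
  apply pair_uniq
  · simp [inlMap, cons_eq, lift_eq, liftTo_eq]
  · simp only [inlMap, cons_eq, lift_eq, liftTo_eq, comp_pair, pair_q, Tm.cast_val]
    rw [← Tm.sub_val, inl_sub]
    exact inl_congr (by simp) (by simp) (by simp)

theorem lift_inrMap (A B : Ty Γ) (σ : Δ ⟶ Γ) :
    lift σ B ≫ inrMap A B = inrMap (A ◂ σ) (B ◂ σ) ≫ liftTo σ (SumTy_sub A B σ) := by
  apply pair_uniq
  · simp [inrMap, cons_eq, lift_eq, liftTo_eq]
  · simp only [inrMap, cons_eq, lift_eq, liftTo_eq, comp_pair, pair_q, Tm.cast_val]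
    rw [← Tm.sub_val, inr_sub]
    exact inr_congr (by simp) (by simp) (by simp)

end SumIntro

/-- Binary coproduct types: the dependent eliminator, with its strict `β` rules. -/
class HasSumTy (C : Type u) [Category.{v} C] [NaturalModel.{w} C] extends HasSumTyIntro C where
  case : ∀ {Γ : C} {A B : Ty Γ} (P : Ty (Γ ▹ SumTy A B)),
    Tm (P ◂ inlMap A B) → Tm (P ◂ inrMap A B) → Tm P
  case_inl : ∀ {Γ : C} {A B : Ty Γ} (P : Ty (Γ ▹ SumTy A B)) (l : Tm (P ◂ inlMap A B))
    (r : Tm (P ◂ inrMap A B)), (case P l r).sub (inlMap A B) = l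
  case_inr : ∀ {Γ : C} {A B : Ty Γ} (P : Ty (Γ ▹ SumTy A B)) (l : Tm (P ◂ inlMap A B))
    (r : Tm (P ◂ inrMap A B)), (case P l r).sub (inrMap A B) = r
  case_sub : ∀ {Γ Δ : C} {A B : Ty Γ} (P : Ty (Γ ▹ SumTy A B)) (l : Tm (P ◂ inlMap A B))
    (r : Tm (P ◂ inrMap A B)) (σ : Δ ⟶ Γ),
    ((case P l r).sub (liftTo σ (SumTy_sub A B σ))).1 =
      (case (P ◂ liftTo σ (SumTy_sub A B σ))
        ((l.sub (lift σ A)).cast (by rw [tySub_tySub, tySub_tySub, lift_inlMap]))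
        ((r.sub (lift σ B)).cast (by rw [tySub_tySub, tySub_tySub, lift_inrMap]))).1

/-- A universe: a closed type of codes and a family of types over it. -/
class HasUniv (C : Type u) [Category.{v} C] [NaturalModel.{w} C] where
  U₀ : Ty (emp : C)
  El₀ : Ty (emp ▹ U₀)

open HasId HasSumTy HasUniv

section Univ

variable {C : Type u} [Category.{v} C] [NaturalModel.{w} C] [HasUniv C] {Γ Δ : C}

/-- The universe, as a type in context `Γ`. -/
def U (Γ : C) : Ty Γ := U₀ ◂ toEmp Γ

theorem U_sub (σ : Δ ⟶ Γ) : U Γ ◂ σ = U Δ := by simp [U]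

/-- The type decoded by a code. -/
def El (A : Tm (U Γ)) : Ty Γ := El₀ ◂ cons (toEmp Γ) A

/-- Substitution in codes. -/
def usub (A : Tm (U Γ)) (σ : Δ ⟶ Γ) : Tm (U Δ) := (A.sub σ).cast (U_sub σ)

@[simp] theorem usub_val (A : Tm (U Γ)) (σ : Δ ⟶ Γ) : (usub A σ).1 = A.1 ◃ σ := rfl

theorem El_sub (A : Tm (U Γ)) (σ : Δ ⟶ Γ) : El A ◂ σ = El (usub A σ) := by
  simp only [El, tySub_tySub, cons, comp_pair]
  congr 2
  exact toEmp_comp σ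

/-- The variable of type `U`. -/
def uvar (Γ : C) : Tm (U (Γ ▹ U Γ)) := (var (U Γ)).cast (U_sub _)

theorem El_inst (A B : Tm (U Γ)) : El (usub A (p (U Γ))) ◂ inst B = El A := by
  rw [El_sub]; exact congrArg El (Tm.ext (by simp [inst_eq]))

theorem El_uvar_inst (B : Tm (U Γ)) : El (uvar Γ) ◂ inst B = El B := by
  rw [El_sub]; exact congrArg El (Tm.ext (by simp [inst_eq, uvar]))

end Univ

/-- The universe is closed under the type formers (strictly, à la Tarski). -/
class UnivClosed (C : Type u) [Category.{v} C] [NaturalModel.{w} C] [HasPi C] [HasSigma C]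
    [HasId C] [HasUnit C] [HasEmpty C] [HasSumTy C] [HasUniv C] where
  piCode : ∀ {Γ : C} (A : Tm (U Γ)), Tm (U (Γ ▹ El A)) → Tm (U Γ)
  El_piCode : ∀ {Γ : C} (A : Tm (U Γ)) (B : Tm (U (Γ ▹ El A))),
    El (piCode A B) = Pi (El A) (El B)
  piCode_sub : ∀ {Γ Δ : C} (A : Tm (U Γ)) (B : Tm (U (Γ ▹ El A))) (σ : Δ ⟶ Γ),
    usub (piCode A B) σ = piCode (usub A σ) (usub B (liftTo σ (El_sub A σ)))
  sigCode : ∀ {Γ : C} (A : Tm (U Γ)), Tm (U (Γ ▹ El A)) → Tm (U Γ)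
  El_sigCode : ∀ {Γ : C} (A : Tm (U Γ)) (B : Tm (U (Γ ▹ El A))),
    El (sigCode A B) = Sig (El A) (El B)
  sigCode_sub : ∀ {Γ Δ : C} (A : Tm (U Γ)) (B : Tm (U (Γ ▹ El A))) (σ : Δ ⟶ Γ),
    usub (sigCode A B) σ = sigCode (usub A σ) (usub B (liftTo σ (El_sub A σ)))
  idCode : ∀ {Γ : C} (A : Tm (U Γ)), Tm (El A) → Tm (El A) → Tm (U Γ)
  El_idCode : ∀ {Γ : C} (A : Tm (U Γ)) (a b : Tm (El A)), El (idCode A a b) = IdTy a b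
  idCode_sub : ∀ {Γ Δ : C} (A : Tm (U Γ)) (a b : Tm (El A)) (σ : Δ ⟶ Γ),
    usub (idCode A a b) σ =
      idCode (usub A σ) ((a.sub σ).cast (El_sub A σ)) ((b.sub σ).cast (El_sub A σ))
  unitCode : ∀ Γ : C, Tm (U Γ)
  El_unitCode : ∀ Γ : C, El (unitCode Γ) = UnitTy Γ
  unitCode_sub : ∀ {Γ Δ : C} (σ : Δ ⟶ Γ), usub (unitCode Γ) σ = unitCode Δ
  emptyCode : ∀ Γ : C, Tm (U Γ)
  El_emptyCode : ∀ Γ : C, El (emptyCode Γ) = EmptyTy Γ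
  emptyCode_sub : ∀ {Γ Δ : C} (σ : Δ ⟶ Γ), usub (emptyCode Γ) σ = emptyCode Δ
  sumCode : ∀ {Γ : C}, Tm (U Γ) → Tm (U Γ) → Tm (U Γ)
  El_sumCode : ∀ {Γ : C} (A B : Tm (U Γ)), El (sumCode A B) = SumTy (El A) (El B)
  sumCode_sub : ∀ {Γ Δ : C} (A B : Tm (U Γ)) (σ : Δ ⟶ Γ),
    usub (sumCode A B) σ = sumCode (usub A σ) (usub B σ)

/-- A model of intensional Martin-Löf type theory: `Π`, `Σ`, identity, unit, empty and binary
coproduct types, and one universe closed under all of them. -/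
class ITT (C : Type u) [Category.{v} C] [NaturalModel.{w} C] extends HasPi C, HasSigma C,
  HasId C, HasUnit C, HasEmpty C, HasSumTy C, HasUniv C, UnivClosed C

/-- Finite coproducts of types satisfy the strict `η` rule (terms over a coproduct type are
tested on the inclusions) and are extensive (families over a binary coproduct type
can be defined by cases). -/
class ExtensiveCoproducts (C : Type u) [Category.{v} C] [NaturalModel.{w} C] [HasEmpty C]
    [HasSumTy C] where
  empty_eta : ∀ {Γ : C} (P : Ty (Γ ▹ EmptyTy Γ)) (t t' : Tm P), t = t'
  sum_eta : ∀ {Γ : C} {A B : Ty Γ} (P : Ty (Γ ▹ SumTy A B)) (t t' : Tm P),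
    t.sub (inlMap A B) = t'.sub (inlMap A B) → t.sub (inrMap A B) = t'.sub (inrMap A B) → t = t'
  copair : ∀ {Γ : C} {A B : Ty Γ}, Ty (Γ ▹ A) → Ty (Γ ▹ B) → Ty (Γ ▹ SumTy A B)
  copair_inl : ∀ {Γ : C} {A B : Ty Γ} (P : Ty (Γ ▹ A)) (Q : Ty (Γ ▹ B)),
    copair P Q ◂ inlMap A B = P
  copair_inr : ∀ {Γ : C} {A B : Ty Γ} (P : Ty (Γ ▹ A)) (Q : Ty (Γ ▹ B)),
    copair P Q ◂ inrMap A B = Q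
  copair_sub : ∀ {Γ Δ : C} {A B : Ty Γ} (P : Ty (Γ ▹ A)) (Q : Ty (Γ ▹ B)) (σ : Δ ⟶ Γ),
    copair P Q ◂ liftTo σ (SumTy_sub A B σ) = copair (P ◂ lift σ A) (Q ◂ lift σ B)

open ExtensiveCoproducts

/-! The principles of function extensionality, univalence and categorical categorical
univalence, in the fragment of the type theory in which they are stated. -/

section Logic

variable {C : Type u} [Category.{v} C] [NaturalModel.{w} C] {Γ Δ : C}

section Pi
variable [HasPi C]

theorem Pi_sub_eq {A : Ty Γ} {B : Ty (Γ ▹ A)} (σ : Δ ⟶ Γ) {A' : Ty Δ} {B' : Ty (Δ ▹ A')}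
    (hA : A ◂ σ = A') (hB : B ◂ liftTo σ hA = B') : Pi A B ◂ σ = Pi A' B' := by
  subst hA hB; exact Pi_sub A B σ

theorem lam_sub_eq {A : Ty Γ} {B : Ty (Γ ▹ A)} (σ : Δ ⟶ Γ) {A' : Ty Δ} {B' : Ty (Δ ▹ A')}
    (hA : A ◂ σ = A') {b : Tm B} {b' : Tm B'} (hb : b.1 ◃ liftTo σ hA = b'.1) :
    (lam b).1 ◃ σ = (lam b').1 := by
  obtain ⟨b', rfl⟩ := b'
  obtain ⟨b, rfl⟩ := b
  subst hA
  dsimp only at hb; subst hb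
  refine (lam_sub _ σ).trans ?_
  have key : ∀ (B'' : Ty (Δ ▹ (A ◂ σ))) (x : Tm B''), (lam x).1 = (lam ⟨x.1, rfl⟩).1 := by
    rintro _ ⟨x, rfl⟩; rfl
  exact key _ _

theorem lam_congr {A : Ty Γ} {B B' : Ty (Γ ▹ A)} {b : Tm B} {b' : Tm B'} (h : b.1 = b'.1) :
    (lam b).1 = (lam b').1 := by
  obtain ⟨b, rfl⟩ := b
  obtain ⟨b', rfl⟩ := b'
  dsimp only at h; subst h; rfl

theorem app_congr {A : Ty Γ} {B B' : Ty (Γ ▹ A)} (hB : B = B') {f : Tm (Pi A B)}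
    {f' : Tm (Pi A B')} (h : f.1 = f'.1) : (app f).1 = (app f').1 := by
  subst hB; rw [Tm.ext h]

theorem app_sub_eq {A : Ty Γ} {B : Ty (Γ ▹ A)} (σ : Δ ⟶ Γ) {A' : Ty Δ} {B' : Ty (Δ ▹ A')}
    (hA : A ◂ σ = A') (hB : B ◂ liftTo σ hA = B') {f : Tm (Pi A B)} {f' : Tm (Pi A' B')}
    (hf : f.1 ◃ σ = f'.1) : (app f).1 ◃ liftTo σ hA = (app f').1 := by
  subst hA hB
  obtain ⟨b, rfl⟩ : ∃ b, f = lam b := ⟨app f, (lam_app f).symm⟩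
  have : f' = lam (b.sub (lift σ A)) := Tm.ext (hf.symm.trans (lam_sub b σ))
  rw [app_lam, this]
  exact (congrArg Tm.val (app_lam (b.sub (lift σ A)))).symm

/-- The type of functions `A → B`. -/
def Arr (A B : Ty Γ) : Ty Γ := Pi A (B ◂ p A)

theorem Arr_sub_eq {A B : Ty Γ} (σ : Δ ⟶ Γ) {A' B' : Ty Δ} (hA : A ◂ σ = A')
    (hB : B ◂ σ = B') : Arr A B ◂ σ = Arr A' B' := by
  subst hB; exact Pi_sub_eq σ hA (by simp [liftTo_eq])

theorem Arr_sub (A B : Ty Γ) (σ : Δ ⟶ Γ) : Arr A B ◂ σ = Arr (A ◂ σ) (B ◂ σ) :=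
  Arr_sub_eq σ rfl rfl

/-- Substitution in functions. -/
def fsub {A B : Ty Γ} (f : Tm (Arr A B)) (σ : Δ ⟶ Γ) : Tm (Arr (A ◂ σ) (B ◂ σ)) :=
  (f.sub σ).cast (Arr_sub A B σ)

/-- The variable of function type. -/
def fvar (A B : Ty Γ) : Tm (Arr (A ◂ p (Arr A B)) (B ◂ p (Arr A B))) :=
  (var (Arr A B)).cast (Arr_sub A B _)

@[simp] theorem fsub_val {A B : Ty Γ} (f : Tm (Arr A B)) (σ : Δ ⟶ Γ) :
    (fsub f σ).1 = f.1 ◃ σ := rfl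

@[simp] theorem fvar_val (A B : Ty Γ) : (fvar A B).1 = q (Arr A B) := rfl

/-- The identity function. -/
def idFun (A : Ty Γ) : Tm (Arr A A) := lam (var A)

theorem idFun_sub_eq {A : Ty Γ} (σ : Δ ⟶ Γ) {A' : Ty Δ} (hA : A ◂ σ = A') :
    (idFun A).1 ◃ σ = (idFun A').1 :=
  lam_sub_eq σ hA (by simp [liftTo_eq])

/-- The substitution `Γ, a : A → Γ, b : B` given by a function. -/
def appMap {A B : Ty Γ} (f : Tm (Arr A B)) : Γ ▹ A ⟶ Γ ▹ B := cons (p A) (app f)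

theorem appMap_eq {A B : Ty Γ} (f : Tm (Arr A B)) :
    appMap f = pair (p A) B (app f).1 (app f).2 := by rw [appMap, cons_eq]

theorem appMap_sub_eq {A B : Ty Γ} (σ : Δ ⟶ Γ) {A' B' : Ty Δ} (hA : A ◂ σ = A')
    (hB : B ◂ σ = B') {f : Tm (Arr A B)} {f' : Tm (Arr A' B')} (hf : f.1 ◃ σ = f'.1) :
    liftTo σ hA ≫ appMap f = appMap f' ≫ liftTo σ hB := by
  have h := app_sub_eq σ hA (by rw [← hB]; simp [liftTo_eq]) hf
  apply pair_uniq
  · simp [appMap_eq, liftTo_eq]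
  · rw [appMap_eq, comp_pair, pair_q, h]
    simp [appMap_eq, liftTo_eq]

/-- Composition of functions. -/
def comp {A B D : Ty Γ} (g : Tm (Arr B D)) (f : Tm (Arr A B)) : Tm (Arr A D) :=
  lam (((app g).sub (appMap f)).cast (by simp [appMap_eq]))

theorem comp_sub_eq {A B D : Ty Γ} (σ : Δ ⟶ Γ) {A' B' D' : Ty Δ} (hA : A ◂ σ = A')
    (hB : B ◂ σ = B') (hD : D ◂ σ = D') {g : Tm (Arr B D)} {g' : Tm (Arr B' D')}
    {f : Tm (Arr A B)} {f' : Tm (Arr A' B')} (hg : g.1 ◃ σ = g'.1) (hf : f.1 ◃ σ = f'.1) :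
    (comp g f).1 ◃ σ = (comp g' f').1 := by
  refine lam_sub_eq σ hA ?_
  have h := app_sub_eq σ hB (by rw [← hD]; simp [liftTo_eq]) hg
  rw [Tm.cast_val, Tm.sub_val, Tm.cast_val, Tm.sub_val, tmSub_tmSub, appMap_sub_eq σ hA hB hf,
    ← tmSub_tmSub, h]

theorem comp_idFun {A : Ty Γ} : comp (idFun A) (idFun A) = idFun A := by
  have h : app (idFun A) = var A := app_lam _
  refine Tm.ext (lam_congr ?_)
  rw [Tm.cast_val, Tm.sub_val, appMap_eq, h]
  simp

end Pi

section Sigma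
variable [HasSigma C]

theorem Sig_sub_eq {A : Ty Γ} {B : Ty (Γ ▹ A)} (σ : Δ ⟶ Γ) {A' : Ty Δ} {B' : Ty (Δ ▹ A')}
    (hA : A ◂ σ = A') (hB : B ◂ liftTo σ hA = B') : Sig A B ◂ σ = Sig A' B' := by
  subst hA hB; exact Sig_sub A B σ

/-- The product of two types. -/
def Prod (A B : Ty Γ) : Ty Γ := Sig A (B ◂ p A)

theorem Prod_sub_eq {A B : Ty Γ} (σ : Δ ⟶ Γ) {A' B' : Ty Δ} (hA : A ◂ σ = A')
    (hB : B ◂ σ = B') : Prod A B ◂ σ = Prod A' B' := by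
  subst hB; exact Sig_sub_eq σ hA (by simp [liftTo_eq])

/-- Pairing, without dependency. -/
def prodMk {A B : Ty Γ} (a : Tm A) (b : Tm B) : Tm (Prod A B) :=
  dpair a (b.cast (by simp [inst_eq]))

end Sigma

theorem IdTy_sub_eq [HasIdIntro C] {A : Ty Γ} {a b : Tm A} (σ : Δ ⟶ Γ) {A' : Ty Δ}
    {a' b' : Tm A'} (ha : a.1 ◃ σ = a'.1) (hb : b.1 ◃ σ = b'.1) :
    IdTy a b ◂ σ = IdTy a' b' := by
  rw [IdTy_sub]
  refine IdTy_congr ?_ ha hb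
  rw [← (a.sub σ).2, ← a'.2]; exact congrArg ty ha

/-- The map `(a = b) → Q b` defined from `w : Q a` by path induction. -/
def idRec [HasPi C] [HasId C] {A : Ty Γ} (a : Tm A) (Q : Ty (Γ ▹ A)) (w : Tm (Q ◂ inst a))
    (b : Tm A) : Tm (Arr (IdTy a b) (Q ◂ inst b)) :=
  lam ((J (a.sub (p (IdTy a b))) (Q ◂ (p _ ≫ lift (p (IdTy a b)) A))
    ((w.sub (p (IdTy a b))).cast (by simp [instId, cons_eq, inst_eq, lift_eq]))
    ((var (IdTy a b)).cast (IdTy_sub a b _))).cast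
      (by simp [instId, cons_eq, inst_eq, lift_eq]))

section Homotopy
variable [HasPi C] [HasIdIntro C]

/-- The type of homotopies `f ∼ g`. -/
def Htpy {A : Ty Γ} {B : Ty (Γ ▹ A)} (f g : Tm (Pi A B)) : Ty Γ := Pi A (IdTy (app f) (app g))

theorem Htpy_sub_eq {A : Ty Γ} {B : Ty (Γ ▹ A)} {f g : Tm (Pi A B)} (σ : Δ ⟶ Γ) {A' : Ty Δ}
    {B' : Ty (Δ ▹ A')} {f' g' : Tm (Pi A' B')} (hA : A ◂ σ = A') (hB : B ◂ liftTo σ hA = B')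
    (hf : f.1 ◃ σ = f'.1) (hg : g.1 ◃ σ = g'.1) : Htpy f g ◂ σ = Htpy f' g' :=
  Pi_sub_eq σ hA (IdTy_sub_eq _ (app_sub_eq σ hA hB hf) (app_sub_eq σ hA hB hg))

/-- The constant homotopy. -/
def Htpy.refl {A : Ty Γ} {B : Ty (Γ ▹ A)} (f : Tm (Pi A B)) : Tm (Htpy f f) :=
  lam (HasIdIntro.refl (app f))

end Homotopy

section Equivalences
variable [HasPi C] [HasSigma C] [HasIdIntro C]

/-- Sections of `f` up to equality of functions: pairs of `s` and a path `f ∘ s = id`. -/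
def Sec {A B : Ty Γ} (f : Tm (Arr A B)) : Ty Γ :=
  Sig (Arr B A) (IdTy (comp (fsub f (p _)) (fvar B A)) (idFun (B ◂ p _)))

/-- Retractions of `f` up to equality of functions: pairs of `r` and a path `r ∘ f = id`. -/
def Ret {A B : Ty Γ} (f : Tm (Arr A B)) : Ty Γ :=
  Sig (Arr B A) (IdTy (comp (fvar B A) (fsub f (p _))) (idFun (A ◂ p _)))

/-- `f` is a categorical equivalence. -/
def isCEq {A B : Ty Γ} (f : Tm (Arr A B)) : Ty Γ := Prod (Sec f) (Ret f)

/-- Homotopy sections of `f`: pairs of `s` and a homotopy `f ∘ s ∼ id`. -/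
def HSec {A B : Ty Γ} (f : Tm (Arr A B)) : Ty Γ :=
  Sig (Arr B A) (Htpy (comp (fsub f (p _)) (fvar B A)) (idFun (B ◂ p _)))

/-- Homotopy retractions of `f`: pairs of `r` and a homotopy `r ∘ f ∼ id`. -/
def HRet {A B : Ty Γ} (f : Tm (Arr A B)) : Ty Γ :=
  Sig (Arr B A) (Htpy (comp (fvar B A) (fsub f (p _))) (idFun (A ◂ p _)))

/-- `f` is a (homotopy) equivalence: a homotopy bi-invertible map. -/
def isEquiv {A B : Ty Γ} (f : Tm (Arr A B)) : Ty Γ := Prod (HSec f) (HRet f)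

/-- The type of categorical equivalences from `A` to `B`. -/
def CEq (A B : Ty Γ) : Ty Γ := Sig (Arr A B) (isCEq (fvar A B))

/-- The type of equivalences from `A` to `B`. -/
def Eqv (A B : Ty Γ) : Ty Γ := Sig (Arr A B) (isEquiv (fvar A B))

theorem Sec_sub_eq {A B : Ty Γ} (σ : Δ ⟶ Γ) {A' B' : Ty Δ} (hA : A ◂ σ = A')
    (hB : B ◂ σ = B') {f : Tm (Arr A B)} {f' : Tm (Arr A' B')} (hf : f.1 ◃ σ = f'.1) :
    Sec f ◂ σ = Sec f' := by
  refine Sig_sub_eq σ (Arr_sub_eq σ hB hA)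
    (IdTy_sub_eq _ (comp_sub_eq _ ?_ ?_ ?_ ?_ ?_) (idFun_sub_eq _ ?_))
  all_goals simp [liftTo_eq, ← hA, ← hB, ← hf]

theorem Ret_sub_eq {A B : Ty Γ} (σ : Δ ⟶ Γ) {A' B' : Ty Δ} (hA : A ◂ σ = A')
    (hB : B ◂ σ = B') {f : Tm (Arr A B)} {f' : Tm (Arr A' B')} (hf : f.1 ◃ σ = f'.1) :
    Ret f ◂ σ = Ret f' := by
  refine Sig_sub_eq σ (Arr_sub_eq σ hB hA)
    (IdTy_sub_eq _ (comp_sub_eq _ ?_ ?_ ?_ ?_ ?_) (idFun_sub_eq _ ?_))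
  all_goals simp [liftTo_eq, ← hA, ← hB, ← hf]

theorem HSec_sub_eq {A B : Ty Γ} (σ : Δ ⟶ Γ) {A' B' : Ty Δ} (hA : A ◂ σ = A')
    (hB : B ◂ σ = B') {f : Tm (Arr A B)} {f' : Tm (Arr A' B')} (hf : f.1 ◃ σ = f'.1) :
    HSec f ◂ σ = HSec f' := by
  refine Sig_sub_eq σ (Arr_sub_eq σ hB hA)
    (Htpy_sub_eq _ ?_ ?_ (comp_sub_eq _ ?_ ?_ ?_ ?_ ?_) (idFun_sub_eq _ ?_))
  all_goals simp [liftTo_eq, ← hA, ← hB, ← hf]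

theorem HRet_sub_eq {A B : Ty Γ} (σ : Δ ⟶ Γ) {A' B' : Ty Δ} (hA : A ◂ σ = A')
    (hB : B ◂ σ = B') {f : Tm (Arr A B)} {f' : Tm (Arr A' B')} (hf : f.1 ◃ σ = f'.1) :
    HRet f ◂ σ = HRet f' := by
  refine Sig_sub_eq σ (Arr_sub_eq σ hB hA)
    (Htpy_sub_eq _ ?_ ?_ (comp_sub_eq _ ?_ ?_ ?_ ?_ ?_) (idFun_sub_eq _ ?_))
  all_goals simp [liftTo_eq, ← hA, ← hB, ← hf]

theorem isCEq_sub_eq {A B : Ty Γ} (σ : Δ ⟶ Γ) {A' B' : Ty Δ} (hA : A ◂ σ = A')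
    (hB : B ◂ σ = B') {f : Tm (Arr A B)} {f' : Tm (Arr A' B')} (hf : f.1 ◃ σ = f'.1) :
    isCEq f ◂ σ = isCEq f' :=
  Prod_sub_eq σ (Sec_sub_eq σ hA hB hf) (Ret_sub_eq σ hA hB hf)

theorem isEquiv_sub_eq {A B : Ty Γ} (σ : Δ ⟶ Γ) {A' B' : Ty Δ} (hA : A ◂ σ = A')
    (hB : B ◂ σ = B') {f : Tm (Arr A B)} {f' : Tm (Arr A' B')} (hf : f.1 ◃ σ = f'.1) :
    isEquiv f ◂ σ = isEquiv f' :=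
  Prod_sub_eq σ (HSec_sub_eq σ hA hB hf) (HRet_sub_eq σ hA hB hf)

theorem CEq_sub_eq {A B : Ty Γ} (σ : Δ ⟶ Γ) {A' B' : Ty Δ} (hA : A ◂ σ = A')
    (hB : B ◂ σ = B') : CEq A B ◂ σ = CEq A' B' := by
  refine Sig_sub_eq σ (Arr_sub_eq σ hA hB) (isCEq_sub_eq _ ?_ ?_ ?_)
  all_goals simp [liftTo_eq, ← hA, ← hB]

theorem Eqv_sub_eq {A B : Ty Γ} (σ : Δ ⟶ Γ) {A' B' : Ty Δ} (hA : A ◂ σ = A')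
    (hB : B ◂ σ = B') : Eqv A B ◂ σ = Eqv A' B' := by
  refine Sig_sub_eq σ (Arr_sub_eq σ hA hB) (isEquiv_sub_eq _ ?_ ?_ ?_)
  all_goals simp [liftTo_eq, ← hA, ← hB]

/-- Identity functions are categorical equivalences. -/
def isCEq_idFun (A : Ty Γ) : Tm (isCEq (idFun A)) :=
  prodMk
    (dpair (idFun A) ((refl (idFun A)).cast (Eq.symm (IdTy_sub_eq _ (by
      rw [comp_sub_eq (inst (idFun A)) (by simp [inst_eq]) (by simp [inst_eq])
        (by simp [inst_eq]) (g' := idFun A) (f' := idFun A) (by simp [inst_eq])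
        (by simp [inst_eq]), comp_idFun]) (idFun_sub_eq _ (by simp [inst_eq]))))))
    (dpair (idFun A) ((refl (idFun A)).cast (Eq.symm (IdTy_sub_eq _ (by
      rw [comp_sub_eq (inst (idFun A)) (by simp [inst_eq]) (by simp [inst_eq])
        (by simp [inst_eq]) (g' := idFun A) (f' := idFun A) (by simp [inst_eq])
        (by simp [inst_eq]), comp_idFun]) (idFun_sub_eq _ (by simp [inst_eq]))))))

/-- Identity functions are equivalences. -/
def isEquiv_idFun (A : Ty Γ) : Tm (isEquiv (idFun A)) :=
  prodMk
    (dpair (idFun A) ((Htpy.refl (idFun A)).cast (Eq.symm (Htpy_sub_eq _ (by simp [inst_eq])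
      (by simp [inst_eq, liftTo_eq]) (by
      rw [comp_sub_eq (inst (idFun A)) (by simp [inst_eq]) (by simp [inst_eq])
        (by simp [inst_eq]) (g' := idFun A) (f' := idFun A) (by simp [inst_eq])
        (by simp [inst_eq]), comp_idFun]) (idFun_sub_eq _ (by simp [inst_eq]))))))
    (dpair (idFun A) ((Htpy.refl (idFun A)).cast (Eq.symm (Htpy_sub_eq _ (by simp [inst_eq])
      (by simp [inst_eq, liftTo_eq]) (by
      rw [comp_sub_eq (inst (idFun A)) (by simp [inst_eq]) (by simp [inst_eq])
        (by simp [inst_eq]) (g' := idFun A) (f' := idFun A) (by simp [inst_eq])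
        (by simp [inst_eq]), comp_idFun]) (idFun_sub_eq _ (by simp [inst_eq]))))))

/-- The identity categorical equivalence. -/
def idCEq (A : Ty Γ) : Tm (CEq A A) :=
  dpair (idFun A) ((isCEq_idFun A).cast
    (Eq.symm (isCEq_sub_eq _ (by simp [inst_eq]) (by simp [inst_eq]) (by simp [inst_eq]))))

/-- The identity equivalence. -/
def idEqv (A : Ty Γ) : Tm (Eqv A A) :=
  dpair (idFun A) ((isEquiv_idFun A).cast
    (Eq.symm (isEquiv_sub_eq _ (by simp [inst_eq]) (by simp [inst_eq]) (by simp [inst_eq]))))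

end Equivalences

section Principles
variable [HasPi C] [HasSigma C] [HasId C]

/-- The canonical map `(f = g) → (f ∼ g)`, sending `refl` to the constant homotopy. -/
def happly {A : Ty Γ} {B : Ty (Γ ▹ A)} (f g : Tm (Pi A B)) : Tm (Arr (IdTy f g) (Htpy f g)) :=
  (idRec f
    (Htpy ((f.sub (p (Pi A B))).cast (Pi_sub A B _)) ((var (Pi A B)).cast (Pi_sub A B _)))
    ((Htpy.refl f).cast (Eq.symm (Htpy_sub_eq _ (by simp [inst_eq])
      (by simp [inst_eq, liftTo_eq, lift_eq]) (by simp [inst_eq]) (by simp [inst_eq])))) g).cast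
    (congrArg (Arr _) (Htpy_sub_eq _ (by simp [inst_eq])
      (by simp [inst_eq, liftTo_eq, lift_eq]) (by simp [inst_eq]) (by simp [inst_eq])))

variable [HasUniv C]

/-- The canonical map from paths in the universe to categorical equivalences, defined by path
induction and sending `refl` to the identity categorical equivalence. -/
def idToCEq (A B : Tm (U Γ)) : Tm (Arr (IdTy A B) (CEq (El A) (El B))) :=
  (idRec A (CEq (El (usub A (p (U Γ)))) (El (uvar Γ)))
    ((idCEq (El A)).cast (Eq.symm (CEq_sub_eq _ (El_inst A A) (El_uvar_inst A)))) B).cast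
    (congrArg (Arr _) (CEq_sub_eq _ (El_inst A B) (El_uvar_inst B)))

/-- The canonical map from paths in the universe to equivalences, defined by path induction and
sending `refl` to the identity equivalence. -/
def idToEqv (A B : Tm (U Γ)) : Tm (Arr (IdTy A B) (Eqv (El A) (El B))) :=
  (idRec A (Eqv (El (usub A (p (U Γ)))) (El (uvar Γ)))
    ((idEqv (El A)).cast (Eq.symm (Eqv_sub_eq _ (El_inst A A) (El_uvar_inst A)))) B).cast
    (congrArg (Arr _) (Eqv_sub_eq _ (El_inst A B) (El_uvar_inst B)))

end Principles

end Logic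

section Validity

variable (C : Type u) [Category.{v} C] [NaturalModel.{w} C] [HasPi C] [HasSigma C] [HasId C]

/-- Function extensionality, for all families of types of the model. -/
def FunExt : Prop :=
  ∀ {Γ : C} {A : Ty Γ} {B : Ty (Γ ▹ A)} (f g : Tm (Pi A B)), Nonempty (Tm (isEquiv (happly f g)))

/-- Univalence of the universe. -/
def Univalence [HasUniv C] : Prop :=
  ∀ {Γ : C} (A B : Tm (U Γ)), Nonempty (Tm (isEquiv (idToEqv A B)))

/-- Categorical categorical univalence of the universe: the canonical map from paths to
categorical equivalences is a categorical equivalence. -/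
def CategoricalCategoricalUnivalence [HasUniv C] : Prop :=
  ∀ {Γ : C} (A B : Tm (U Γ)), Nonempty (Tm (isCEq (idToCEq A B)))

end Validity

/-! The polynomial model. -/

section Families

variable {C : Type u} [Category.{v} C] [NaturalModel.{w} C] {Γ Δ Θ : C}

/-- The elements of the presheaf exponential `Ty^{Tm A}` at `Γ`: natural families of types indexed
by the generalized terms of `A`. By `Fam.equiv` this is the same as a type in context `Γ ▹ A`. -/
structure Fam (A : Ty Γ) : Type (max u v w) where
  obj : ∀ {Δ : C} (σ : Δ ⟶ Γ) (a : Term Δ), ty a = A ◂ σ → Ty Δ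
  nat : ∀ {Δ Θ : C} (σ : Δ ⟶ Γ) (a : Term Δ) (h : ty a = A ◂ σ) (τ : Θ ⟶ Δ),
    obj σ a h ◂ τ = obj (τ ≫ σ) (a ◃ τ) (comp_pair_ty τ h)

/-- Morphisms `A ⟶ B` in the category of types over `Γ`, as natural maps from the generalized
terms of `A` to those of `B`. By `FibHom.equiv` this is the same as a term of `B` in context
`Γ ▹ A`, that is, as a morphism `Γ ▹ A ⟶ Γ ▹ B` over `Γ`. -/
structure FibHom (A B : Ty Γ) : Type (max u v w) where
  map : ∀ {Δ : C} (σ : Δ ⟶ Γ) (a : Term Δ), ty a = A ◂ σ → Term Δ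
  ty_map : ∀ {Δ : C} (σ : Δ ⟶ Γ) (a : Term Δ) (h : ty a = A ◂ σ), ty (map σ a h) = B ◂ σ
  nat : ∀ {Δ Θ : C} (σ : Δ ⟶ Γ) (a : Term Δ) (h : ty a = A ◂ σ) (τ : Θ ⟶ Δ),
    map σ a h ◃ τ = map (τ ≫ σ) (a ◃ τ) (comp_pair_ty τ h)

theorem Fam.ext {A : Ty Γ} {F G : Fam A}
    (h : ∀ {Δ : C} (σ : Δ ⟶ Γ) (a : Term Δ) (h : ty a = A ◂ σ), F.obj σ a h = G.obj σ a h) :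
    F = G := by
  obtain ⟨F, _⟩ := F
  obtain ⟨G, _⟩ := G
  have : @F = @G := by funext Δ σ a k; exact h σ a k
  subst this; rfl

theorem Fam.obj_congr {A : Ty Γ} (F : Fam A) {σ σ' : Δ ⟶ Γ} {a a' : Term Δ} (hσ : σ = σ')
    (ha : a = a') (h : ty a = A ◂ σ) (h' : ty a' = A ◂ σ') : F.obj σ a h = F.obj σ' a' h' := by
  subst hσ ha; rfl

/-- The family given by a type in context `Γ ▹ A`. -/
def Fam.ofTy {A : Ty Γ} (P : Ty (Γ ▹ A)) : Fam A where
  obj σ a h := P ◂ pair σ A a h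
  nat σ a h τ := by simp

/-- The type in context `Γ ▹ A` given by a family. -/
def Fam.toTy {A : Ty Γ} (F : Fam A) : Ty (Γ ▹ A) := F.obj (p A) (q A) (ty_q A)

theorem Fam.toTy_pair {A : Ty Γ} (F : Fam A) (σ : Δ ⟶ Γ) (a : Term Δ) (h : ty a = A ◂ σ) :
    F.toTy ◂ pair σ A a h = F.obj σ a h := by
  rw [Fam.toTy, F.nat]; exact F.obj_congr (by simp) (by simp) _ _

def Fam.equiv (A : Ty Γ) : Fam A ≃ Ty (Γ ▹ A) where
  toFun := Fam.toTy
  invFun := Fam.ofTy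
  left_inv F := Fam.ext fun σ a h => F.toTy_pair σ a h
  right_inv P := by simp [Fam.toTy, Fam.ofTy]

/-- Substitution in families. -/
def Fam.sub {A : Ty Γ} (F : Fam A) (σ : Δ ⟶ Γ) : Fam (A ◂ σ) where
  obj τ a h := F.obj (τ ≫ σ) a (by rw [h, tySub_tySub])
  nat τ a h ρ := by
    rw [F.nat]; exact F.obj_congr (by simp) rfl _ _

namespace FibHom

theorem ext {A B : Ty Γ} {f g : FibHom A B}
    (h : ∀ {Δ : C} (σ : Δ ⟶ Γ) (a : Term Δ) (h : ty a = A ◂ σ), f.map σ a h = g.map σ a h) :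
    f = g := by
  obtain ⟨f, _, _⟩ := f
  obtain ⟨g, _, _⟩ := g
  have : @f = @g := by funext Δ σ a k; exact h σ a k
  subst this; rfl

theorem map_congr {A B : Ty Γ} (f : FibHom A B) {σ σ' : Δ ⟶ Γ} {a a' : Term Δ} (hσ : σ = σ')
    (ha : a = a') (h : ty a = A ◂ σ) (h' : ty a' = A ◂ σ') : f.map σ a h = f.map σ' a' h' := by
  subst hσ ha; rfl

/-- The morphism given by a term in context `Γ ▹ A`. -/
def ofTm {A B : Ty Γ} (b : Tm (B ◂ p A)) : FibHom A B where
  map σ a h := b.1 ◃ pair σ A a h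
  ty_map σ a h := by rw [ty_sub, b.2]; simp
  nat σ a h τ := by simp

/-- The term in context `Γ ▹ A` given by a morphism. -/
def toTm {A B : Ty Γ} (f : FibHom A B) : Tm (B ◂ p A) := ⟨f.map (p A) (q A) (ty_q A), f.ty_map _ _ _⟩

theorem toTm_pair {A B : Ty Γ} (f : FibHom A B) (σ : Δ ⟶ Γ) (a : Term Δ) (h : ty a = A ◂ σ) :
    f.toTm.1 ◃ pair σ A a h = f.map σ a h := by
  rw [toTm, f.nat]; exact f.map_congr (by simp) (by simp) _ _

def equiv (A B : Ty Γ) : FibHom A B ≃ Tm (B ◂ p A) where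
  toFun := toTm
  invFun := ofTm
  left_inv f := ext fun σ a h => f.toTm_pair σ a h
  right_inv b := Tm.ext (by simp [toTm, ofTm])

/-- Identity morphisms. -/
def id (A : Ty Γ) : FibHom A A where
  map _ a _ := a
  ty_map _ _ h := h
  nat _ _ _ _ := rfl

/-- Composition of morphisms, in diagrammatic order. -/
def comp {A B D : Ty Γ} (f : FibHom A B) (g : FibHom B D) : FibHom A D where
  map σ a h := g.map σ (f.map σ a h) (f.ty_map σ a h)
  ty_map σ a h := g.ty_map _ _ _
  nat σ a h τ := by rw [g.nat]; exact g.map_congr rfl (f.nat _ _ _ _) _ _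

/-- Substitution in morphisms. -/
def sub {A B : Ty Γ} (f : FibHom A B) (σ : Δ ⟶ Γ) : FibHom (A ◂ σ) (B ◂ σ) where
  map τ a h := f.map (τ ≫ σ) a (by rw [h, tySub_tySub])
  ty_map τ a h := by rw [f.ty_map, tySub_tySub]
  nat τ a h ρ := by rw [f.nat]; exact f.map_congr (by simp) rfl _ _

/-- Transport of a morphism along strict equalities of types. -/
def cast {A B A' B' : Ty Γ} (f : FibHom A B) (hA : A = A') (hB : B = B') : FibHom A' B' where
  map σ a h := f.map σ a (by rw [h, hA])
  ty_map σ a h := by rw [f.ty_map, hB]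
  nat σ a h τ := f.nat _ _ _ _

end FibHom

end Families

section Coproducts

variable {C : Type u} [Category.{v} C] [NaturalModel.{w} C] [HasEmpty C] [HasSumTy C]
  [ExtensiveCoproducts C] {Γ Δ Θ : C}

namespace FibHom

/-- The unique morphism out of the empty type. -/
def empty (A : Ty Γ) : FibHom (EmptyTy Γ) A := ofTm (elim (A ◂ p (EmptyTy Γ)))

theorem empty_uniq {E A : Ty Γ} (hE : E = EmptyTy Γ) (f g : FibHom E A) : f = g := by
  subst hE; exact (equiv _ _).injective (empty_eta _ _ _)

/-- The inclusions of a coproduct. -/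
def inl (A B : Ty Γ) : FibHom A (SumTy A B) where
  map σ a h := (HasSumTyIntro.inl (B ◂ σ) ⟨a, h⟩).1
  ty_map σ a h := by rw [Tm.prop, SumTy_sub]
  nat σ a h τ := by
    rw [← Tm.sub_val, inl_sub]; exact inl_congr (by simp) (by simp) (by simp)

def inr (A B : Ty Γ) : FibHom B (SumTy A B) where
  map σ b h := (HasSumTyIntro.inr (A ◂ σ) ⟨b, h⟩).1
  ty_map σ a h := by rw [Tm.prop, SumTy_sub]
  nat σ a h τ := by
    rw [← Tm.sub_val, inr_sub]; exact inr_congr (by simp) (by simp) (by simp)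

theorem inlMap_eq (A B : Ty Γ) : inlMap A B = pair (p A) _ ((inl A B).map (p A) (q A) (ty_q A))
    ((inl A B).ty_map _ _ _) := by rw [inlMap, cons_eq]; rfl

theorem inrMap_eq (A B : Ty Γ) : inrMap A B = pair (p B) _ ((inr A B).map (p B) (q B) (ty_q B))
    ((inr A B).ty_map _ _ _) := by rw [inrMap, cons_eq]; rfl

/-- The morphism out of a coproduct defined by cases. -/
def copair {A B D : Ty Γ} (f : FibHom A D) (g : FibHom B D) : FibHom (SumTy A B) D :=
  ofTm (case _ (f.toTm.cast (by simp [inlMap_eq])) (g.toTm.cast (by simp [inrMap_eq])))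

theorem copair_inl {A B D : Ty Γ} (f : FibHom A D) (g : FibHom B D) (σ : Δ ⟶ Γ) (a : Term Δ)
    (h : ty a = A ◂ σ) (h') :
    (copair f g).map σ ((inl A B).map σ a h) h' = f.map σ a h := by
  have e : pair σ (SumTy A B) ((inl A B).map σ a h) h' = pair σ A a h ≫ inlMap A B := by
    rw [inlMap_eq, comp_pair]
    congr 1
    · simp
    · rw [FibHom.nat]; exact (map_congr _ (by simp) (by simp) _ _)
  change (case _ _ _).1 ◃ pair σ (SumTy A B) _ h' = _
  rw [e, ← tmSub_tmSub, ← Tm.sub_val, case_inl, Tm.cast_val, toTm_pair]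

theorem copair_inr {A B D : Ty Γ} (f : FibHom A D) (g : FibHom B D) (σ : Δ ⟶ Γ) (b : Term Δ)
    (h : ty b = B ◂ σ) (h') :
    (copair f g).map σ ((inr A B).map σ b h) h' = g.map σ b h := by
  have e : pair σ (SumTy A B) ((inr A B).map σ b h) h' = pair σ B b h ≫ inrMap A B := by
    rw [inrMap_eq, comp_pair]
    congr 1
    · simp
    · rw [FibHom.nat]; exact (map_congr _ (by simp) (by simp) _ _)
  change (case _ _ _).1 ◃ pair σ (SumTy A B) _ h' = _
  rw [e, ← tmSub_tmSub, ← Tm.sub_val, case_inr, Tm.cast_val, toTm_pair]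

theorem sum_ext {A B D S : Ty Γ} (hS : S = SumTy A B) (f g : FibHom S D)
    (hl : ∀ {Δ : C} (σ : Δ ⟶ Γ) (a : Term Δ) (h : ty a = A ◂ σ) (h'),
      f.map σ ((inl A B).map σ a h) h' = g.map σ ((inl A B).map σ a h) h')
    (hr : ∀ {Δ : C} (σ : Δ ⟶ Γ) (b : Term Δ) (h : ty b = B ◂ σ) (h'),
      f.map σ ((inr A B).map σ b h) h' = g.map σ ((inr A B).map σ b h) h') : f = g := by
  subst hS
  refine (equiv _ _).injective (sum_eta _ _ _ (Tm.ext ?_) (Tm.ext ?_))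
  · simp only [Tm.sub_val, inlMap_eq]
    exact (f.toTm_pair _ _ _).trans ((hl _ _ _ _).trans (g.toTm_pair _ _ _).symm)
  · simp only [Tm.sub_val, inrMap_eq]
    exact (f.toTm_pair _ _ _).trans ((hr _ _ _ _).trans (g.toTm_pair _ _ _).symm)

theorem sum_ext_map {A B D S S' : Ty Γ} (hS : S = SumTy A B) (hS' : S' = SumTy A B)
    (f : FibHom S D) (g : FibHom S' D)
    (hl : ∀ {Δ : C} (σ : Δ ⟶ Γ) (a : Term Δ) (h : ty a = A ◂ σ) (h₁ h₂),
      f.map σ ((inl A B).map σ a h) h₁ = g.map σ ((inl A B).map σ a h) h₂)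
    (hr : ∀ {Δ : C} (σ : Δ ⟶ Γ) (b : Term Δ) (h : ty b = B ◂ σ) (h₁ h₂),
      f.map σ ((inr A B).map σ b h) h₁ = g.map σ ((inr A B).map σ b h) h₂)
    (σ : Δ ⟶ Γ) (x : Term Δ) (h h') : f.map σ x h = g.map σ x h' := by
  subst hS'
  subst hS
  rw [sum_ext rfl f g (fun σ a h h' => hl σ a h h' h') fun σ a h h' => hr σ a h h' h']

theorem inl_sub (A B : Ty Γ) (σ : Δ ⟶ Γ) (τ : Θ ⟶ Δ) (a : Term Θ) (h h') :
    (inl (A ◂ σ) (B ◂ σ)).map τ a h = (inl A B).map (τ ≫ σ) a h' :=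
  inl_congr (by simp) (by simp) rfl

theorem inr_sub (A B : Ty Γ) (σ : Δ ⟶ Γ) (τ : Θ ⟶ Δ) (b : Term Θ) (h h') :
    (inr (A ◂ σ) (B ◂ σ)).map τ b h = (inr A B).map (τ ≫ σ) b h' :=
  inr_congr (by simp) (by simp) rfl

theorem inl_map_congr {A A' B B' : Ty Γ} (hA : A = A') (hB : B = B') (σ : Δ ⟶ Γ) (a : Term Δ)
    (h h') : (inl A B).map σ a h = (inl A' B').map σ a h' := by
  subst hA hB; rfl

theorem inr_map_congr {A A' B B' : Ty Γ} (hA : A = A') (hB : B = B') (σ : Δ ⟶ Γ) (b : Term Δ)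
    (h h') : (inr A B).map σ b h = (inr A' B').map σ b h' := by
  subst hA hB; rfl

end FibHom

end Coproducts

/-- The objects of the polynomial model: pairs of a context of shapes and a type of positions. -/
structure Poly (C : Type u) [Category.{v} C] [NaturalModel.{w} C] : Type (max u w) where
  shape : C
  pos : Ty shape

/-- Types of the polynomial model over a context with shapes `Γ`: a type of shapes and a family of
positions over it. -/
structure PTy {C : Type u} [Category.{v} C] [NaturalModel.{w} C] (Γ : C) : Type (max u v w) where
  shape : Ty Γ
  pos : Fam shape

namespace Poly

section Category

variable {C : Type u} [Category.{v} C] [NaturalModel.{w} C]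

/-- Morphisms of the polynomial model: a substitution on shapes and a map backwards on
positions. -/
structure Hom (Δ Γ : Poly C) : Type (max u v w) where
  shape : Δ.shape ⟶ Γ.shape
  pos : FibHom (Γ.pos ◂ shape) Δ.pos

theorem Hom.ext {Δ Γ : Poly C} {σ τ : Hom Δ Γ} (hs : σ.shape = τ.shape)
    (hp : ∀ {Θ : C} (ρ : Θ ⟶ Δ.shape) (x : Term Θ) (h h'), σ.pos.map ρ x h = τ.pos.map ρ x h') :
    σ = τ := by
  obtain ⟨s, f⟩ := σ
  obtain ⟨t, g⟩ := τ
  dsimp only at hs; subst hs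
  obtain rfl : f = g := FibHom.ext fun ρ x h => hp ρ x h h
  rfl

theorem Hom.congr_pos {Δ Γ : Poly C} {σ τ : Hom Δ Γ} (e : σ = τ) {Θ : C} (ρ : Θ ⟶ Δ.shape)
    (x : Term Θ) (h h') : σ.pos.map ρ x h = τ.pos.map ρ x h' := by
  subst e; rfl

instance : Category.{max u v w} (Poly C) where
  Hom := Hom
  id Γ := ⟨𝟙 _, (FibHom.id Γ.pos).cast (by simp) rfl⟩
  comp {Θ Δ Γ} σ τ := ⟨σ.shape ≫ τ.shape,
    ((τ.pos.sub σ.shape).cast (tySub_tySub _ _ _) rfl).comp σ.pos⟩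
  id_comp σ := Hom.ext (Category.id_comp _) fun ρ x h h' =>
    FibHom.map_congr _ (Category.comp_id _) rfl _ _
  comp_id σ := Hom.ext (Category.comp_id _) fun ρ x h h' => rfl
  assoc σ τ υ := Hom.ext (Category.assoc _ _ _) fun ρ x h h' => by
    simp only [FibHom.comp, FibHom.cast, FibHom.sub, Category.assoc]

@[simp] theorem id_shape (Γ : Poly C) : Hom.shape (𝟙 Γ) = 𝟙 Γ.shape := rfl

@[simp] theorem comp_shape {Θ Δ Γ : Poly C} (τ : Θ ⟶ Δ) (σ : Δ ⟶ Γ) :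
    Hom.shape (τ ≫ σ) = Hom.shape τ ≫ Hom.shape σ := rfl

end Category

end Poly

section Types

variable {C : Type u} [Category.{v} C] [NaturalModel.{w} C] {Γ Δ Θ : C}

theorem PTy.ext {A B : PTy Γ} (hs : A.shape = B.shape)
    (hp : ∀ {Δ : C} (σ : Δ ⟶ Γ) (a : Term Δ) (h h'), A.pos.obj σ a h = B.pos.obj σ a h') :
    A = B := by
  obtain ⟨s, F⟩ := A
  obtain ⟨t, G⟩ := B
  dsimp only at hs; subst hs
  obtain rfl : F = G := Fam.ext fun σ a h => hp σ a h h
  rfl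

theorem PTy.congr_pos {A B : PTy Γ} (e : A = B) (σ : Δ ⟶ Γ) (a : Term Δ) (h h') :
    A.pos.obj σ a h = B.pos.obj σ a h' := by
  subst e; rfl

/-- Substitution in types of the polynomial model. -/
def PTy.sub (A : PTy Γ) (σ : Δ ⟶ Γ) : PTy Δ := ⟨A.shape ◂ σ, A.pos.sub σ⟩

/-- The positions over the shape of a term. -/
def PTy.posAt (A : PTy Γ) (a : Term Γ) (h : ty a = A.shape) : Ty Γ :=
  A.pos.obj (𝟙 Γ) a (by rw [h, tySub_id])

theorem PTy.posAt_sub (A : PTy Γ) (a : Term Γ) (h : ty a = A.shape) (σ : Δ ⟶ Γ) (h') :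
    A.posAt a h ◂ σ = A.pos.obj σ (a ◃ σ) h' := by
  rw [PTy.posAt, A.pos.nat]; exact A.pos.obj_congr (by simp) rfl _ _

theorem PTy.sub_posAt (A : PTy Γ) (σ : Δ ⟶ Γ) (a : Term Δ) (h : ty a = (A.sub σ).shape) :
    (A.sub σ).posAt a h = A.pos.obj σ a h :=
  A.pos.obj_congr (by simp) rfl _ _

theorem PTy.posAt_congr {A B : PTy Γ} (e : A = B) {a b : Term Γ} (k : a = b) (h h') :
    A.posAt a h = B.posAt b h' := by
  subst e k; rfl

end Types

/-- Terms of the polynomial model: a type `A`, a term of the shapes of `A`, and a map from the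
positions of `A` over that term to the positions of the context. -/
structure PTerm {C : Type u} [Category.{v} C] [NaturalModel.{w} C] (Γ : Poly C) :
    Type (max u v w) where
  type : PTy Γ.shape
  shape : Term Γ.shape
  ty_shape : ty shape = type.shape
  pos : FibHom (type.posAt shape ty_shape) Γ.pos

section Terms

variable {C : Type u} [Category.{v} C] [NaturalModel.{w} C] {Γ Δ Θ : Poly C}

theorem PTerm.ext {a b : PTerm Γ} (ht : a.type = b.type) (hs : a.shape = b.shape)
    (hp : ∀ {Δ : C} (σ : Δ ⟶ Γ.shape) (x : Term Δ) (h h'),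
      a.pos.map σ x h = b.pos.map σ x h') : a = b := by
  obtain ⟨A, s, h, f⟩ := a
  obtain ⟨B, t, k, g⟩ := b
  dsimp only at ht hs; subst ht hs
  obtain rfl : f = g := FibHom.ext fun σ a h => hp σ a h h
  rfl

theorem PTerm.congr_pos {a b : PTerm Γ} (e : a = b) {Δ : C} (σ : Δ ⟶ Γ.shape) (x : Term Δ)
    (h h') : a.pos.map σ x h = b.pos.map σ x h' := by
  subst e; rfl

/-- Substitution in terms of the polynomial model. -/
def PTerm.sub (a : PTerm Γ) (σ : Δ ⟶ Γ) : PTerm Δ where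
  type := a.type.sub (Poly.Hom.shape σ)
  shape := a.shape ◃ Poly.Hom.shape σ
  ty_shape := by rw [ty_sub, a.ty_shape]; rfl
  pos := ((a.pos.sub (Poly.Hom.shape σ)).cast (by
    rw [PTy.sub_posAt, PTy.posAt_sub _ _ _ _ (by rw [ty_sub, a.ty_shape])]) rfl).comp (Poly.Hom.pos σ)

end Terms

namespace Poly

variable {C : Type u} [Category.{v} C] [NaturalModel.{w} C] [HasEmpty C] [HasSumTy C]
  [ExtensiveCoproducts C]

/-- Context extension in the polynomial model. -/
def extend (Γ : Poly C) (A : PTy Γ.shape) : Poly C :=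
  ⟨Γ.shape ▹ A.shape, SumTy (Γ.pos ◂ p A.shape) A.pos.toTy⟩

theorem extend_pos_pair {Γ Δ : Poly C} (A : PTy Γ.shape) (σ : Δ.shape ⟶ Γ.shape) (a : Term Δ.shape)
    (h : ty a = A.shape ◂ σ) :
    (extend Γ A).pos ◂ pair σ A.shape a h = SumTy (Γ.pos ◂ σ) (A.pos.obj σ a h) := by
  change SumTy _ _ ◂ pair σ A.shape a h = _
  rw [SumTy_sub, A.pos.toTy_pair, tySub_tySub, pair_p]

/-- The extension `⟨σ, a⟩` of a morphism by a term. -/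
def pcons {Γ Δ : Poly C} (σ : Δ ⟶ Γ) (A : PTy Γ.shape) (a : PTerm Δ)
    (h : a.type = A.sub (Hom.shape σ)) : Hom Δ (extend Γ A) where
  shape := pair (Hom.shape σ) A.shape a.shape (by rw [a.ty_shape, h]; rfl)
  pos := (FibHom.copair (Hom.pos σ)
    (a.pos.cast ((PTy.posAt_congr h rfl _ (by rw [a.ty_shape, h])).trans
      (PTy.sub_posAt _ _ _ _)) rfl)).cast (extend_pos_pair _ _ _ _).symm rfl

/-- The display map of a type. -/
def disp {Γ : Poly C} (A : PTy Γ.shape) : Hom (extend Γ A) Γ := ⟨p A.shape, FibHom.inl _ _⟩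

/-- The variable of a type. -/
def pvar {Γ : Poly C} (A : PTy Γ.shape) : PTerm (extend Γ A) where
  type := A.sub (p A.shape)
  shape := q A.shape
  ty_shape := ty_q _
  pos := (FibHom.inr _ _).cast (PTy.sub_posAt _ _ _ _).symm rfl

theorem pcons_disp {Γ Δ : Poly C} (σ : Δ ⟶ Γ) (A : PTy Γ.shape) (a : PTerm Δ)
    (h : a.type = A.sub (Hom.shape σ)) :
    CategoryStruct.comp (Y := extend Γ A) (pcons σ A a h) (disp A) = σ := by
  refine Hom.ext (pair_p _ _ _ _) fun ρ x k k' => ?_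
  change (FibHom.copair (Hom.pos σ) _).map ρ ((FibHom.inl (Γ.pos ◂ p A.shape) A.pos.toTy).map
    (ρ ≫ pair (Hom.shape σ) A.shape a.shape _) x _) _ = _
  refine Eq.trans (FibHom.map_congr _ rfl ?_ _ ?_) (FibHom.copair_inl _ _ ρ x k' ?_)
  · exact inl_congr (by rw [tySub_tySub, tySub_tySub, Category.assoc, pair_p])
      (by rw [← tySub_tySub, A.pos.toTy_pair]) rfl
  all_goals exact FibHom.ty_map _ _ _ _

theorem pvar_pcons {Γ Δ : Poly C} (σ : Δ ⟶ Γ) (A : PTy Γ.shape) (a : PTerm Δ)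
    (h : a.type = A.sub (Hom.shape σ)) : (pvar A).sub (pcons σ A a h) = a := by
  have e : ((pvar A).sub (pcons σ A a h)).type = a.type := by
    rw [h]
    refine PTy.ext ?_ fun ρ x k k' => A.pos.obj_congr ?_ rfl _ _
    · change (A.shape ◂ p A.shape) ◂ pair _ _ _ _ = _
      rw [tySub_tySub, pair_p]; rfl
    · change (ρ ≫ pair _ _ _ _) ≫ p A.shape = _
      rw [Category.assoc, pair_p]
  refine PTerm.ext e (pair_q _ _ _ _) fun ρ x k k' => ?_
  have k'' : ty x = A.pos.obj (Hom.shape σ) a.shape (by rw [a.ty_shape, h]; rfl) ◂ ρ := by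
    rw [k']; congr 1
    exact (PTy.posAt_congr h rfl _ (by rw [a.ty_shape, h])).trans (PTy.sub_posAt _ _ _ _)
  change (FibHom.copair (Hom.pos σ) _).map ρ ((FibHom.inr (Γ.pos ◂ p A.shape) A.pos.toTy).map
    (ρ ≫ pair (Hom.shape σ) A.shape a.shape _) x _) _ = _
  refine Eq.trans (FibHom.map_congr _ rfl ?_ _ ?_) (FibHom.copair_inr _ _ ρ x k'' ?_)
  · exact inr_congr (by rw [tySub_tySub, tySub_tySub, Category.assoc, pair_p])
      (by rw [← tySub_tySub, A.pos.toTy_pair]) rfl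
  all_goals exact FibHom.ty_map _ _ _ _

theorem pcons_uniq {Γ Δ : Poly C} (A : PTy Γ.shape) (σ τ : Δ ⟶ extend Γ A)
    (hp : σ ≫ (disp A : extend Γ A ⟶ Γ) = τ ≫ (disp A : extend Γ A ⟶ Γ))
    (hq : (pvar A).sub σ = (pvar A).sub τ) : σ = τ := by
  have hs : Hom.shape σ = Hom.shape τ :=
    pair_uniq _ _ _ (congrArg Hom.shape hp) (congrArg PTerm.shape hq)
  refine Hom.ext hs ?_
  obtain ⟨s, f⟩ := σ
  obtain ⟨t, g⟩ := τ
  dsimp only at hs; subst hs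
  have : f = g := by
    refine FibHom.sum_ext (SumTy_sub _ _ _) f g ?_ ?_
    · intro Θ ρ x h h'
      have k : ty x = Γ.pos ◂ (s ≫ p A.shape) ◂ ρ := by
        have aux : ∀ s : Δ.shape ⟶ Γ.shape ▹ A.shape,
          Γ.pos ◂ p A.shape ◂ s ◂ ρ = Γ.pos ◂ (s ≫ p A.shape) ◂ ρ := fun s => by simp
        exact h.trans (aux s)
      have := Hom.congr_pos hp ρ x k k
      refine Eq.trans ?_ (this.trans ?_)
      · exact f.map_congr rfl (FibHom.inl_sub _ _ _ _ _ _ _) _ _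
      · exact g.map_congr rfl (FibHom.inl_sub _ _ _ _ _ _ _).symm _ _
    · intro Θ ρ x h h'
      have e : ty x = ((pvar A).sub ⟨s, f⟩).type.posAt _ (PTerm.ty_shape _) ◂ ρ := by
        rw [h]; congr 1
        have aux : ∀ (s : Δ.shape ⟶ Γ.shape ▹ A.shape) (h'),
          A.pos.toTy ◂ s = A.pos.obj ((𝟙 _ ≫ s) ≫ p A.shape) (q A.shape ◃ s) h' := fun s h' => by
            rw [Fam.toTy, Fam.nat]; exact A.pos.obj_congr (by simp) rfl _ _
        exact aux s _
      have := PTerm.congr_pos hq ρ x e e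
      refine Eq.trans ?_ (this.trans ?_)
      · exact f.map_congr rfl (FibHom.inr_sub _ _ _ _ _ _ _) _ _
      · exact g.map_congr rfl (FibHom.inr_sub _ _ _ _ _ _ _).symm _ _
  subst this
  intros; rfl

instance : NaturalModel.{max u v w} (Poly C) where
  Ty Γ := PTy Γ.shape
  Term Γ := PTerm Γ
  ty a := a.type
  tySub A σ := A.sub (Hom.shape σ)
  tmSub a σ := a.sub σ
  tySub_id A := PTy.ext (tySub_id _) fun σ a h h' =>
    A.pos.obj_congr (Category.comp_id _) rfl _ _
  tySub_comp A σ τ := PTy.ext (tySub_comp _ _ _) fun ρ a h h' =>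
    A.pos.obj_congr (Category.assoc _ _ _).symm rfl _ _
  tmSub_id a := PTerm.ext (PTy.ext (tySub_id _) fun σ x h h' =>
    a.type.pos.obj_congr (Category.comp_id _) rfl _ _) (tmSub_id _) fun σ x h h' =>
      a.pos.map_congr (Category.comp_id _) rfl _ _
  tmSub_comp a σ τ := PTerm.ext (PTy.ext (tySub_comp _ _ _) fun ρ x h h' =>
    a.type.pos.obj_congr (Category.assoc _ _ _).symm rfl _ _) (tmSub_comp _ _ _) fun ρ x h h' => by
      have := Category.assoc ρ (Hom.shape τ) (Hom.shape σ)
      change (Hom.pos τ).map ρ ((Hom.pos σ).map (ρ ≫ Hom.shape τ)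
        (a.pos.map (ρ ≫ Hom.shape τ ≫ Hom.shape σ) x _) _) _ =
          (Hom.pos τ).map ρ ((Hom.pos σ).map (ρ ≫ Hom.shape τ)
        (a.pos.map ((ρ ≫ Hom.shape τ) ≫ Hom.shape σ) x _) _) _
      simp only [this]
  ty_sub a σ := rfl
  emp := (⟨emp, EmptyTy (emp : C)⟩ : Poly C)
  toEmp Γ := ⟨toEmp Γ.shape, (FibHom.empty _).cast (EmptyTy_sub _).symm rfl⟩
  toEmp_uniq σ := by
    obtain ⟨s, f⟩ := σ
    obtain rfl := toEmp_uniq s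
    have : f = (FibHom.empty _).cast (EmptyTy_sub _).symm rfl :=
      FibHom.empty_uniq (EmptyTy_sub (toEmp _)) _ _
    rw [this]
  ext := extend
  p := disp
  q := pvar
  ty_q A := rfl
  pair := pcons
  pair_p := pcons_disp
  pair_q := pvar_pcons
  pair_uniq := pcons_uniq

end Poly

section SigmaAt

variable {C : Type u} [Category.{v} C] [NaturalModel.{w} C] {Γ Δ Θ : C}

theorem pair_congr {A : Ty Γ} {σ σ' : Δ ⟶ Γ} {a a' : Term Δ} (hσ : σ = σ') (ha : a = a')
    (h : ty a = A ◂ σ) (h' : ty a' = A ◂ σ') : pair σ A a h = pair σ' A a' h' := by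
  subst hσ ha; rfl

theorem tySub_trans {A : Ty Γ} {A' : Ty Δ} {σ : Δ ⟶ Γ} (h : A' = A ◂ σ) (ρ : Θ ⟶ Δ) :
    A' ◂ ρ = A ◂ (ρ ≫ σ) := by rw [h, tySub_tySub]

theorem cons_congr {A : Ty Γ} {σ σ' : Δ ⟶ Γ} {a : Tm (A ◂ σ)} {a' : Tm (A ◂ σ')}
    (ha : a.1 = a'.1) (hσ : σ = σ' := by rfl) : cons σ a = cons σ' a' := by
  rw [cons_eq, cons_eq]; exact pair_congr hσ ha _ _

theorem cons_lift {A : Ty Γ} (ρ : Θ ⟶ Δ) (σ : Δ ⟶ Γ) (a : Tm (A ◂ σ ◂ ρ)) :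
    cons ρ a ≫ lift σ A = cons (ρ ≫ σ) (a.cast (tySub_tySub _ _ _)) := by
  simp [cons_eq, lift_eq]

variable [HasSigma C]

theorem dpair_sub_eq {A : Ty Γ} {B : Ty (Γ ▹ A)} (σ : Δ ⟶ Γ) {A' : Ty Δ} {B' : Ty (Δ ▹ A')}
    (hA : A ◂ σ = A') (hB : B ◂ liftTo σ hA = B') {a : Tm A} {b : Tm (B ◂ inst a)} {a' : Tm A'}
    {b' : Tm (B' ◂ inst a')} (ha : a.1 ◃ σ = a'.1) (hb : b.1 ◃ σ = b'.1) :
    (dpair a b).1 ◃ σ = (dpair a' b').1 := by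
  subst hA hB
  obtain rfl : a.sub σ = a' := Tm.ext ha
  exact (dpair_sub a b σ).trans (congrArg (fun x => (dpair (a.sub σ) x).1) (Tm.ext hb))

theorem fst_sub_eq {A : Ty Γ} {B : Ty (Γ ▹ A)} (σ : Δ ⟶ Γ) {A' : Ty Δ} {B' : Ty (Δ ▹ A')}
    (hA : A ◂ σ = A') (hB : B ◂ liftTo σ hA = B') {t : Tm (Sig A B)} {t' : Tm (Sig A' B')}
    (ht : t.1 ◃ σ = t'.1) : (fst t).1 ◃ σ = (fst t').1 := by
  subst hA hB
  have : t' = dpair ((fst t).sub σ) (((snd t).sub σ).cast (by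
      rw [tySub_tySub, tySub_tySub, sub_inst]; rfl)) := by
    refine Tm.ext (ht.symm.trans ?_)
    rw [← dpair_sub_eq (a := fst t) (b := snd t) σ rfl rfl rfl rfl, dpair_eta]
  rw [this, fst_dpair]; rfl

theorem snd_sub_eq {A : Ty Γ} {B : Ty (Γ ▹ A)} (σ : Δ ⟶ Γ) {A' : Ty Δ} {B' : Ty (Δ ▹ A')}
    (hA : A ◂ σ = A') (hB : B ◂ liftTo σ hA = B') {t : Tm (Sig A B)} {t' : Tm (Sig A' B')}
    (ht : t.1 ◃ σ = t'.1) : (snd t).1 ◃ σ = (snd t').1 := by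
  subst hA hB
  have : t' = dpair ((fst t).sub σ) (((snd t).sub σ).cast (by
      rw [tySub_tySub, tySub_tySub, sub_inst]; rfl)) := by
    refine Tm.ext (ht.symm.trans ?_)
    rw [← dpair_sub_eq (a := fst t) (b := snd t) σ rfl rfl rfl rfl, dpair_eta]
  rw [this, snd_dpair]; rfl

/-- The first projection of a generalized term of a dependent sum. -/
def fstAt (σ : Δ ⟶ Γ) (A : Ty Γ) (B : Ty (Γ ▹ A)) (t : Term Δ) (h : ty t = Sig A B ◂ σ) :
    Tm (A ◂ σ) :=
  fst (B := B ◂ lift σ A) ⟨t, h.trans (Sig_sub A B σ)⟩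

/-- The second projection of a generalized term of a dependent sum. -/
def sndAt (σ : Δ ⟶ Γ) (A : Ty Γ) (B : Ty (Γ ▹ A)) (t : Term Δ) (h : ty t = Sig A B ◂ σ) :
    Tm (B ◂ cons σ (fstAt σ A B t h)) :=
  (snd (B := B ◂ lift σ A) ⟨t, h.trans (Sig_sub A B σ)⟩).cast
    (by rw [fstAt, tySub_tySub]; simp [inst_eq, lift_eq, cons_eq])

theorem fstAt_sub (σ : Δ ⟶ Γ) (A : Ty Γ) (B : Ty (Γ ▹ A)) (t : Term Δ) (h) (τ : Θ ⟶ Δ) :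
    (fstAt σ A B t h).1 ◃ τ = (fstAt (τ ≫ σ) A B (t ◃ τ) (comp_pair_ty τ h)).1 :=
  fst_sub_eq τ (by simp) (by simp [liftTo_eq, lift_eq]) rfl

theorem sndAt_sub (σ : Δ ⟶ Γ) (A : Ty Γ) (B : Ty (Γ ▹ A)) (t : Term Δ) (h) (τ : Θ ⟶ Δ) :
    (sndAt σ A B t h).1 ◃ τ = (sndAt (τ ≫ σ) A B (t ◃ τ) (comp_pair_ty τ h)).1 :=
  snd_sub_eq τ (by simp) (by simp [liftTo_eq, lift_eq]) rfl

theorem fstAt_base (σ : Δ ⟶ Γ) (A : Ty Γ) (B : Ty (Γ ▹ A)) (ρ : Θ ⟶ Δ) (t : Term Θ) (h h') :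
    (fstAt ρ (A ◂ σ) (B ◂ lift σ A) t h).1 = (fstAt (ρ ≫ σ) A B t h').1 := by
  rw [← tmSub_id (fstAt ρ (A ◂ σ) (B ◂ lift σ A) t h).1]
  exact fst_sub_eq (𝟙 Θ) (by simp) (by simp [liftTo_eq, lift_eq]) (by simp)

theorem sndAt_base (σ : Δ ⟶ Γ) (A : Ty Γ) (B : Ty (Γ ▹ A)) (ρ : Θ ⟶ Δ) (t : Term Θ) (h h') :
    (sndAt ρ (A ◂ σ) (B ◂ lift σ A) t h).1 = (sndAt (ρ ≫ σ) A B t h').1 := by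
  rw [← tmSub_id (sndAt ρ (A ◂ σ) (B ◂ lift σ A) t h).1]
  exact snd_sub_eq (𝟙 Θ) (by simp) (by simp [liftTo_eq, lift_eq]) (by simp)

theorem fstAt_id {A : Ty Γ} {B : Ty (Γ ▹ A)} (t : Tm (Sig A B)) (h) :
    (fstAt (𝟙 Γ) A B t.1 h).1 = (fst t).1 := by
  rw [← tmSub_id (fst t).1]
  exact (fst_sub_eq (𝟙 Γ) (by simp) (by simp [liftTo_eq, lift_eq]) (by simp)).symm

theorem sndAt_id {A : Ty Γ} {B : Ty (Γ ▹ A)} (t : Tm (Sig A B)) (h) :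
    (sndAt (𝟙 Γ) A B t.1 h).1 = (snd t).1 := by
  rw [← tmSub_id (snd t).1]
  exact (snd_sub_eq (𝟙 Γ) (by simp) (by simp [liftTo_eq, lift_eq]) (by simp)).symm

end SigmaAt

namespace Poly

section TypedTerms

variable {C : Type u} [Category.{v} C] [NaturalModel.{w} C] [HasEmpty C] [HasSumTy C]
  [ExtensiveCoproducts C] {Γ Δ : Poly C}

/-- The shape of a typed term. -/
def sh {A : Ty Γ} (a : Tm A) : Tm (PTy.shape A) :=
  ⟨PTerm.shape a.1, (PTerm.ty_shape a.1).trans (congrArg PTy.shape a.2)⟩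

/-- The action of a typed term on positions. -/
def ps {A : Ty Γ} (a : Tm A) : FibHom (PTy.posAt A (sh a).1 (sh a).2) Γ.pos :=
  (PTerm.pos a.1).cast (PTy.posAt_congr a.2 rfl _ _) rfl

/-- A typed term from its shape and its action on positions. -/
def ptm {A : Ty Γ} (s : Tm (PTy.shape A)) (f : FibHom (PTy.posAt A s.1 s.2) Γ.pos) :
    Tm A := ⟨(⟨A, s.1, s.2, f⟩ : PTerm Γ), rfl⟩

theorem term_ext {A B : Ty Γ} {a : Tm A} {b : Tm B} (hAB : A = B) (hs : (sh a).1 = (sh b).1)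
    (hp : ∀ {Θ : C} (σ : Θ ⟶ Γ.shape) (x : Term Θ) (h h'),
      (ps a).map σ x h = (ps b).map σ x h') : a.1 = b.1 := by
  subst hAB
  obtain ⟨a, rfl⟩ := a
  obtain ⟨b, hb⟩ := b
  exact PTerm.ext hb.symm hs fun σ x h h' => hp σ x h
    (h'.trans (congrArg (· ◂ σ) (PTy.posAt_congr hb rfl _ _)))

theorem ptm_ext {A : Ty Γ} {a b : Tm A} (hs : (sh a).1 = (sh b).1)
    (hp : ∀ {Θ : C} (σ : Θ ⟶ Γ.shape) (x : Term Θ) (h h'),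
      (ps a).map σ x h = (ps b).map σ x h') : a = b :=
  Tm.ext (term_ext rfl hs hp)

theorem posAt_sub_eq {A : Ty Γ} (a : Tm A) (σ : Δ ⟶ Γ) :
    PTy.posAt (A ◂ σ) (sh (a.sub σ)).1 (sh (a.sub σ)).2 =
      PTy.posAt A (sh a).1 (sh a).2 ◂ Hom.shape σ :=
  (PTy.sub_posAt A (Hom.shape σ) _ (sh (a.sub σ)).2).trans (PTy.posAt_sub A _ (sh a).2 _ _).symm

end TypedTerms

section Sigma

variable {C : Type u} [Category.{v} C] [NaturalModel.{w} C] [HasSigma C] [HasEmpty C] [HasSumTy C]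
  [ExtensiveCoproducts C]

/-- Dependent sums: positions over `⟨a, b⟩` are positions over `a` or over `b`. -/
def PSig {Γ : C} (A : PTy Γ) (B : PTy (Γ ▹ A.shape)) : PTy Γ where
  shape := Sig A.shape B.shape
  pos :=
    { obj := fun σ t h => SumTy
        (A.pos.obj σ (fstAt σ A.shape B.shape t h).1 (fstAt σ A.shape B.shape t h).2)
        (B.pos.obj (cons σ (fstAt σ A.shape B.shape t h)) (sndAt σ A.shape B.shape t h).1
          (sndAt σ A.shape B.shape t h).2)
      nat := fun σ t h τ => by
        rw [SumTy_sub, A.pos.nat, B.pos.nat]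
        congr 1
        · exact A.pos.obj_congr rfl (fstAt_sub _ _ _ _ _ _) _ _
        · exact B.pos.obj_congr (by simp [cons_eq, fstAt_sub]) (sndAt_sub _ _ _ _ _ _) _ _ }

theorem PSig_sub {Γ Δ : C} (A : PTy Γ) (B : PTy (Γ ▹ A.shape)) (σ : Δ ⟶ Γ) :
    (PSig A B).sub σ = PSig (A.sub σ) (B.sub (lift σ A.shape)) :=
  PTy.ext (Sig_sub _ _ _) fun ρ t h h' => by
    have e := fstAt_base σ A.shape B.shape ρ t h' (h.trans (tySub_tySub _ _ _))
    refine congrArg₂ SumTy ?_ ?_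
    · exact A.pos.obj_congr rfl e.symm _ _
    · refine B.pos.obj_congr ?_ (sndAt_base _ _ _ _ _ _ _).symm _ _
      exact (cons_congr e).symm.trans (cons_lift _ _ _).symm

theorem PSig_posAt {Γ : C} (A : PTy Γ) (B : PTy (Γ ▹ A.shape)) (t : Tm (PSig A B).shape) :
    (PSig A B).posAt t.1 t.2 = SumTy (A.posAt (fst t).1 (fst t).2)
      ((B.sub (inst (fst t))).posAt (snd t).1 (snd t).2) := by
  have e := fstAt_id t (t.2.trans (tySub_id _).symm)
  refine congrArg₂ SumTy ?_ ?_
  · exact A.pos.obj_congr rfl e _ _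
  · refine B.pos.obj_congr ?_ (sndAt_id _ _) _ _
    rw [Category.id_comp]
    exact cons_congr e

theorem PSig_posAt_dpair {Γ : C} (A : PTy Γ) (B : PTy (Γ ▹ A.shape)) (a : Tm A.shape)
    (b : Tm (B.shape ◂ inst a)) : (PSig A B).posAt (dpair a b).1 (dpair a b).2 =
      SumTy (A.posAt a.1 a.2) ((B.sub (inst a)).posAt b.1 b.2) := by
  refine (PSig_posAt A B _).trans (congrArg₂ SumTy ?_ ?_)
  · exact PTy.posAt_congr rfl (congrArg Tm.val (fst_dpair _ _)) _ _
  · exact PTy.posAt_congr (by rw [fst_dpair]) (snd_dpair _ _) _ _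

/-- Dependent sums of types of the polynomial model. -/
def sigma {Γ : Poly C} (A : Ty Γ) (B : Ty (Γ ▹ A)) : Ty Γ := PSig (Γ := Γ.shape) A B

/-- The pairing of the polynomial model. -/
def pdpair {Γ : Poly C} {A : Ty Γ} {B : Ty (Γ ▹ A)} (a : Tm A) (b : Tm (B ◂ inst a)) :
    Tm (sigma A B) :=
  ptm (A := sigma A B) (dpair (sh a) (sh b : Tm (PTy.shape B ◂ inst (sh a))))
    (((ps a).copair (ps b)).cast (PSig_posAt_dpair (Γ := Γ.shape) A B (sh a) (sh b)).symm rfl)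

def pfst {Γ : Poly C} {A : Ty Γ} {B : Ty (Γ ▹ A)} (t : Tm (sigma A B)) : Tm A :=
  ptm (fst (sh t)) ((FibHom.inl _ _).comp ((ps t).cast (PSig_posAt (Γ := Γ.shape) A B (sh t)) rfl))

def psnd {Γ : Poly C} {A : Ty Γ} {B : Ty (Γ ▹ A)} (t : Tm (sigma A B)) :
    Tm (B ◂ inst (pfst t)) :=
  ptm (A := B ◂ inst (pfst t)) (snd (sh t))
    ((FibHom.inr _ _).comp ((ps t).cast (PSig_posAt (Γ := Γ.shape) A B (sh t)) rfl))

theorem pfst_pdpair {Γ : Poly C} {A : Ty Γ} {B : Ty (Γ ▹ A)} (a : Tm A) (b : Tm (B ◂ inst a)) :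
    pfst (pdpair a b) = a :=
  ptm_ext (congrArg Tm.val (fst_dpair _ _)) fun σ x h h' => by
    change (FibHom.copair (ps a) (ps b)).map σ ((FibHom.inl _ _).map σ x h) _ = _
    refine Eq.trans (FibHom.map_congr _ rfl (FibHom.inl_map_congr ?_ ?_ _ _ _ ?_) _ ?_)
      (FibHom.copair_inl (ps a) (ps b) σ x h' ?_)
    · exact PTy.posAt_congr rfl (congrArg Tm.val (fst_dpair _ _)) _ _
    · exact PTy.posAt_congr (congrArg (fun y => PTy.sub B (inst y)) (fst_dpair _ _))
        (snd_dpair _ _) _ _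
    · exact h'
    all_goals exact FibHom.ty_map _ _ _ _

theorem psnd_pdpair {Γ : Poly C} {A : Ty Γ} {B : Ty (Γ ▹ A)} (a : Tm A) (b : Tm (B ◂ inst a)) :
    (psnd (pdpair a b)).1 = b.1 :=
  term_ext (by rw [pfst_pdpair]) (snd_dpair _ _) fun σ x h h' => by
    change (FibHom.copair (ps a) (ps b)).map σ ((FibHom.inr _ _).map σ x h) _ = _
    refine Eq.trans (FibHom.map_congr _ rfl (FibHom.inr_map_congr ?_ ?_ _ _ _ ?_) _ ?_)
      (FibHom.copair_inr (ps a) (ps b) σ x h' ?_)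
    · exact PTy.posAt_congr rfl (congrArg Tm.val (fst_dpair _ _)) _ _
    · exact PTy.posAt_congr (congrArg (fun y => PTy.sub B (inst y)) (fst_dpair _ _))
        (snd_dpair _ _) _ _
    · exact h'
    all_goals exact FibHom.ty_map _ _ _ _

theorem pdpair_eta {Γ : Poly C} {A : Ty Γ} {B : Ty (Γ ▹ A)} (t : Tm (sigma A B)) :
    pdpair (pfst t) (psnd t) = t := by
  refine ptm_ext (congrArg Tm.val (dpair_eta (sh t))) ?_
  have key : (ps (pfst t)).copair (ps (psnd t)) =
      (ps t).cast (PSig_posAt (Γ := Γ.shape) A B (sh t)) rfl :=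
    FibHom.sum_ext rfl _ _ (fun σ a h h' => FibHom.copair_inl (ps (pfst t)) (ps (psnd t)) σ a h h')
      (fun σ a h h' => FibHom.copair_inr (ps (pfst t)) (ps (psnd t)) σ a h h')
  intro Θ σ x h h'
  have h'' := h'.trans (congrArg (· ◂ σ) (PSig_posAt (Γ := Γ.shape) A B (sh t)))
  exact congrArg (fun f : FibHom _ Γ.pos => f.map σ x h'') key

theorem pdpair_sub {Γ Δ : Poly C} {A : Ty Γ} {B : Ty (Γ ▹ A)} (a : Tm A) (b : Tm (B ◂ inst a))
    (σ : Δ ⟶ Γ) (h : B ◂ inst a ◂ σ = B ◂ lift σ A ◂ inst (a.sub σ)) :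
    ((pdpair a b).sub σ).1 = (pdpair (a.sub σ) ((b.sub σ).cast h)).1 := by
  have hT := PSig_sub (Γ := Γ.shape) A B (Hom.shape σ)
  refine term_ext hT (dpair_sub_eq _ rfl rfl rfl rfl) ?_
  have ea : PTy.posAt (A ◂ σ) (sh (a.sub σ)).1 (sh (a.sub σ)).2 =
      PTy.posAt A (sh a).1 (sh a).2 ◂ Hom.shape σ := posAt_sub_eq a σ
  have eb : PTy.posAt (B ◂ lift σ A ◂ inst (a.sub σ)) (sh ((b.sub σ).cast h)).1
      (sh ((b.sub σ).cast h)).2 = PTy.posAt (B ◂ inst a) (sh b).1 (sh b).2 ◂ Hom.shape σ :=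
    (PTy.posAt_congr h.symm rfl _ _).trans (posAt_sub_eq b σ)
  have hS := PSig_posAt_dpair (Γ := Δ.shape) (A ◂ σ) (B ◂ lift σ A) (sh (a.sub σ))
    (sh ((b.sub σ).cast h))
  intro Θ ρ x k k'
  refine FibHom.sum_ext_map (Eq.trans ?_ hS) hS (ps ((pdpair a b).sub σ))
    (ps (pdpair (a.sub σ) ((b.sub σ).cast h))) ?_ ?_ ρ x k k'
  · exact PTy.posAt_congr hT (dpair_sub_eq _ rfl rfl rfl rfl) _ _
  · intro Θ ρ x k _ _
    refine Eq.trans ?_ (FibHom.copair_inl (ps (a.sub σ)) (ps ((b.sub σ).cast h)) ρ x k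
      (FibHom.ty_map _ _ _ _)).symm
    change (Hom.pos σ).map ρ ((FibHom.copair (ps a) (ps b)).map (ρ ≫ Hom.shape σ) _ _) _ =
      (Hom.pos σ).map ρ ((ps a).map (ρ ≫ Hom.shape σ) x (k.trans (tySub_trans ea ρ))) _
    refine FibHom.map_congr _ rfl (Eq.trans (FibHom.map_congr _ rfl ?_ _ ?_)
      (FibHom.copair_inl (ps a) (ps b) _ x (k.trans (tySub_trans ea ρ)) ?_)) _ _
    · exact inl_congr (tySub_trans ea ρ) (tySub_trans eb ρ) rfl
    all_goals exact FibHom.ty_map _ _ _ _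
  · intro Θ ρ x k _ _
    refine Eq.trans ?_ (FibHom.copair_inr (ps (a.sub σ)) (ps ((b.sub σ).cast h)) ρ x k
      (FibHom.ty_map _ _ _ _)).symm
    change (Hom.pos σ).map ρ ((FibHom.copair (ps a) (ps b)).map (ρ ≫ Hom.shape σ) _ _) _ =
      (Hom.pos σ).map ρ ((ps b).map (ρ ≫ Hom.shape σ) x (k.trans (tySub_trans eb ρ))) _
    refine FibHom.map_congr _ rfl (Eq.trans (FibHom.map_congr _ rfl ?_ _ ?_)
      (FibHom.copair_inr (ps a) (ps b) _ x (k.trans (tySub_trans eb ρ)) ?_)) _ _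
    · exact inr_congr (tySub_trans ea ρ) (tySub_trans eb ρ) rfl
    all_goals exact FibHom.ty_map _ _ _ _

instance : HasSigma (Poly C) where
  Sig A B := sigma A B
  dpair := pdpair
  fst := pfst
  snd := psnd
  fst_dpair := pfst_pdpair
  snd_dpair := psnd_pdpair
  dpair_eta := pdpair_eta
  Sig_sub _ _ _ := PSig_sub _ _ _
  dpair_sub a b σ := pdpair_sub a b σ _

end Sigma

end Poly

section IdAt

variable {C : Type u} [Category.{v} C] [NaturalModel.{w} C] [HasId C] {Γ Δ Θ : C}

theorem IdFam_sub_eq {A : Ty Γ} {a : Tm A} (σ : Δ ⟶ Γ) {A' : Ty Δ} {a' : Tm A'}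
    (hA : A ◂ σ = A') (ha : a.1 ◃ σ = a'.1) : IdFam a ◂ liftTo σ hA = IdFam a' := by
  subst hA
  obtain rfl : a.sub σ = a' := Tm.ext ha
  exact IdFam_sub a σ

theorem J_sub_eq {A : Ty Γ} {a : Tm A} {P : Ty (Γ ▹ A ▹ IdFam a)} {w : Tm (P ◂ instId a (refl a))}
    {b : Tm A} {e : Tm (IdTy a b)} (σ : Δ ⟶ Γ) {A' : Ty Δ} {a' b' : Tm A'}
    {P' : Ty (Δ ▹ A' ▹ IdFam a')} {w' : Tm (P' ◂ instId a' (refl a'))} {e' : Tm (IdTy a' b')}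
    (hA : A ◂ σ = A') (ha : a.1 ◃ σ = a'.1)
    (hP : P ◂ liftTo (liftTo σ hA) (IdFam_sub_eq σ hA ha) = P') (hw : w.1 ◃ σ = w'.1)
    (hb : b.1 ◃ σ = b'.1) (he : e.1 ◃ σ = e'.1) :
    (J a P w e).1 ◃ σ = (J a' P' w' e').1 := by
  subst hA
  obtain rfl : a.sub σ = a' := Tm.ext ha
  obtain rfl : b.sub σ = b' := Tm.ext hb
  subst hP
  obtain rfl : (w.sub σ).cast (sub_instId_refl a P σ) = w' := Tm.ext hw
  obtain rfl : (e.sub σ).cast (IdTy_sub a b σ) = e' := Tm.ext he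
  exact J_sub a P w e σ

theorem instId_liftTo {A : Ty Γ} {a : Tm A} (σ : Δ ⟶ Γ) {A' : Ty Δ} {a' b : Tm A'}
    (hA : A ◂ σ = A') (h : IdFam a ◂ liftTo σ hA = IdFam a') (e : Tm (IdTy a' b))
    (τ : Δ ⟶ Γ ▹ A ▹ IdFam a) (h₁ : τ ≫ p _ ≫ p _ = σ) (h₂ : q A ◃ (τ ≫ p _) = b.1)
    (h₃ : q (IdFam a) ◃ τ = e.1) : instId a' e ≫ liftTo (liftTo σ hA) h = τ := by
  apply pair_uniq
  · apply pair_uniq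
    · simp [instId, cons_eq, inst_eq, liftTo_eq, h₁]
    · simpa [instId, cons_eq, inst_eq, liftTo_eq] using h₂.symm
  · rw [h₃]; simp [instId, cons_eq, liftTo_eq]

/-- The conclusion of `J` in the generic case. -/
def Jgen {A : Ty Γ} (a : Tm A) (P : Ty (Γ ▹ A ▹ IdFam a)) (w : Tm (P ◂ instId a (refl a))) :
    Tm P :=
  (J (a.sub (p (IdFam a) ≫ p A)) (P ◂ liftTo (lift (p (IdFam a) ≫ p A) A) (IdFam_sub a _))
    ((w.sub (p (IdFam a) ≫ p A)).cast (sub_instId_refl a P _))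
    (b := ((var A).sub (p (IdFam a))).cast (tySub_tySub _ _ _))
    ((var (IdFam a)).cast (IdTy_sub_eq _ (by simp) (by simp)))).cast
    (by
      rw [tySub_tySub]
      exact (congrArg (P ◂ ·) (instId_liftTo (p (IdFam a) ≫ p A) rfl (IdFam_sub a _) _ (𝟙 _)
        (by simp) (by simp) (tmSub_id _))).trans (tySub_id P))

theorem Jgen_instId {A : Ty Γ} (a : Tm A) (P : Ty (Γ ▹ A ▹ IdFam a))
    (w : Tm (P ◂ instId a (refl a))) {b : Tm A} (e : Tm (IdTy a b)) :
    (Jgen a P w).1 ◃ instId a e = (J a P w e).1 := by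
  refine J_sub_eq _ ?_ ?_ ?_ ?_ ?_ ?_
  case refine_4 => change w.1 ◃ _ ◃ _ = _; simp [instId, cons_eq, inst_eq]
  case refine_6 => change q _ ◃ _ = _; simp [instId, cons_eq]
  all_goals simp [instId, cons_eq, inst_eq, lift_eq, liftTo_eq]

theorem Jgen_sub {A : Ty Γ} (a : Tm A) (P : Ty (Γ ▹ A ▹ IdFam a))
    (w : Tm (P ◂ instId a (refl a))) (σ : Δ ⟶ Γ) :
    (Jgen a P w).1 ◃ liftTo (lift σ A) (IdFam_sub a σ) =
      (Jgen (a.sub σ) (P ◂ liftTo (lift σ A) (IdFam_sub a σ))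
        ((w.sub σ).cast (sub_instId_refl a P σ))).1 := by
  refine J_sub_eq _ ?_ ?_ ?_ ?_ ?_ ?_
  case refine_4 => change w.1 ◃ _ ◃ _ = w.1 ◃ _ ◃ _; simp [lift_eq, liftTo_eq]
  case refine_6 => change q _ ◃ _ = q _; simp [liftTo_eq]
  all_goals simp [instId, cons_eq, inst_eq, lift_eq, liftTo_eq]

end IdAt

/-- The type of the polynomial model with a given type of shapes and no positions. -/
def PTy.bare {C : Type u} [Category.{v} C] [NaturalModel.{w} C] [HasEmpty C] {Γ : C} (S : Ty Γ) :
    PTy Γ where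
  shape := S
  pos := { obj := fun {Δ} _ _ _ => EmptyTy Δ, nat := fun _ _ _ τ => EmptyTy_sub τ }

namespace Poly

section Identity

variable {C : Type u} [Category.{v} C] [NaturalModel.{w} C] [HasPi C] [HasId C] [HasEmpty C]
  [HasSumTy C] [ExtensiveCoproducts C]

/-- Identity types: identity types of shapes, without positions. -/
def ident {Γ : Poly C} {A : Ty Γ} (a b : Tm A) : Ty Γ := PTy.bare (IdTy (sh a) (sh b))

/-- A term of a type without positions is given by its shape. -/
def bareTm {Γ : Poly C} {S : Ty Γ.shape} (s : Tm S) :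
    Tm (C := Poly C) (Γ := Γ) (PTy.bare S) :=
  ptm (Γ := Γ) (A := PTy.bare S) s (FibHom.empty _)

theorem bare_ext {Γ : Poly C} {S : Ty Γ.shape} {B : Ty Γ} (hB : PTy.bare S = B)
    {s : Tm (C := Poly C) (Γ := Γ) (PTy.bare S)} {t : Tm B}
    (h : (sh s).1 = (sh t).1) : s.1 = t.1 := by
  subst hB
  refine term_ext rfl h ?_
  have := FibHom.empty_uniq (E := EmptyTy Γ.shape) rfl (ps s) (ps t)
  exact fun {Θ} σ x h h' => congrArg (fun f : FibHom _ Γ.pos => f.map σ x h') this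

theorem bare_sub {Γ Δ : C} (S : Ty Γ) (σ : Δ ⟶ Γ) : (PTy.bare S).sub σ = PTy.bare (S ◂ σ) := rfl

instance : HasIdIntro (Poly C) where
  IdTy a b := ident a b
  refl a := bareTm (refl (sh a))
  IdTy_sub a b σ := congrArg PTy.bare (IdTy_sub (sh a) (sh b) (Hom.shape σ))
  refl_sub a σ := bare_ext (congrArg PTy.bare (IdTy_sub (sh a) (sh a) (Hom.shape σ)))
    (refl_sub (sh a) (Hom.shape σ))

section Transport
variable {Γ Δ : C} {A : Ty Γ} (a : Tm A) (P : PTy (Γ ▹ A ▹ IdFam a))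
  (w : Tm (P.shape ◂ instId a (refl a)))

/-- The positions over the base case of an induction. -/
def posBase : Ty Γ := P.pos.obj (instId a (refl a)) w.1 w.2

/-- The family of the functions from the positions over the result of an induction to the
positions over the base case. -/
def transpTy : Ty (Γ ▹ A ▹ IdFam a) :=
  Arr (P.posAt (Jgen a P.shape w).1 (Jgen a P.shape w).2) (posBase a P w ◂ (p _ ≫ p _))

theorem transpTy_instId {b : Tm A} (e : Tm (IdTy a b)) :
    transpTy a P w ◂ instId a e =
      Arr (P.pos.obj (instId a e) (J a P.shape w e).1 (J a P.shape w e).2) (posBase a P w) := by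
  refine Arr_sub_eq _ ?_ ?_
  · rw [PTy.posAt_sub _ _ _ _ (by rw [Jgen_instId]; exact (J a P.shape w e).2)]
    exact P.pos.obj_congr rfl (Jgen_instId _ _ _ _) _ _
  · simp [instId, cons_eq, inst_eq]

/-- Transport of positions along a path, by induction on the path. -/
def transp {b : Tm A} (e : Tm (IdTy a b)) :
    Tm (Arr (P.pos.obj (instId a e) (J a P.shape w e).1 (J a P.shape w e).2) (posBase a P w)) :=
  (J a (transpTy a P w) ((idFun (posBase a P w)).cast (Eq.symm ((transpTy_instId a P w _).trans
    (congrArg (Arr · _) (P.pos.obj_congr rfl (congrArg Tm.val (J_refl _ _ _)) _ _))))) e).cast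
    (transpTy_instId a P w e)

theorem transp_refl : (transp a P w (refl a)).1 = (idFun (posBase a P w)).1 := by
  rw [transp, Tm.cast_val, J_refl]; rfl

theorem posBase_sub (σ : Δ ⟶ Γ) : posBase a P w ◂ σ =
    posBase (a.sub σ) (P.sub (liftTo (lift σ A) (IdFam_sub a σ)))
      ((w.sub σ).cast (sub_instId_refl a P.shape σ)) := by
  refine (P.pos.nat _ _ _ _).trans (P.pos.obj_congr ?_ rfl _ _)
  rw [sub_instId]
  exact congrArg (fun e => instId (a.sub σ) e ≫ _) (Tm.ext (refl_sub a σ))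

theorem transp_sub (σ : Δ ⟶ Γ) {b : Tm A} (e : Tm (IdTy a b)) :
    (transp a P w e).1 ◃ σ = (transp (a.sub σ) (P.sub (liftTo (lift σ A) (IdFam_sub a σ)))
        ((w.sub σ).cast (sub_instId_refl a P.shape σ)) ((e.sub σ).cast (IdTy_sub a b σ))).1 := by
  have hb := posBase_sub a P w σ
  refine J_sub_eq σ rfl rfl ?_ (idFun_sub_eq σ hb) rfl rfl
  refine Arr_sub_eq _ ?_ ?_
  · refine Eq.trans ?_ (PTy.sub_posAt P _ _ _).symm
    refine (PTy.posAt_sub P _ _ _ (comp_pair_ty' (Jgen a P.shape w).2 _)).trans ?_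
    exact P.pos.obj_congr rfl (Jgen_sub a P.shape w σ) _ _
  · rw [← hb, tySub_tySub, tySub_tySub]; simp [liftTo_eq]

end Transport

/-- Transport of positions along a path, as a morphism. -/
def transpHom {Γ : C} {A : Ty Γ} (a : Tm A) (P : PTy (Γ ▹ A ▹ IdFam a))
    (w : Tm (P.shape ◂ instId a (refl a))) {b : Tm A} (e : Tm (IdTy a b)) :
    FibHom (P.pos.obj (instId a e) (J a P.shape w e).1 (J a P.shape w e).2) (posBase a P w) :=
  FibHom.ofTm (app (transp a P w e))

theorem app_idFun_map {Γ Δ : C} {X Q : Ty Γ} (hX : X = Q) (f : Tm (Arr X Q))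
    (hf : f.1 = (idFun Q).1) (σ : Δ ⟶ Γ) (x : Term Δ) (h : ty x = X ◂ σ) :
    (FibHom.ofTm (app f)).map σ x h = x := by
  subst hX
  obtain rfl : f = idFun X := Tm.ext hf
  rw [idFun, app_lam]
  exact pair_q _ _ _ _

theorem app_sub_map {Γ Δ Θ : C} {X Q : Ty Γ} {X' Q' : Ty Δ} (s : Δ ⟶ Γ) (hX : X ◂ s = X')
    (hQ : Q ◂ s = Q') (f : Tm (Arr X Q)) (f' : Tm (Arr X' Q')) (hf : f.1 ◃ s = f'.1) (σ : Θ ⟶ Δ)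
    (x : Term Θ) (h : ty x = X' ◂ σ) (h' : ty x = X ◂ (σ ≫ s)) :
    (FibHom.ofTm (app f')).map σ x h = (FibHom.ofTm (app f)).map (σ ≫ s) x h' := by
  have := app_sub_eq s hX (by rw [← hQ]; simp [liftTo_eq]) hf
  change (app f').1 ◃ _ = (app f).1 ◃ _
  rw [← this]
  simp [liftTo_eq]

theorem transpHom_refl {Γ Δ : C} {A : Ty Γ} (a : Tm A) (P : PTy (Γ ▹ A ▹ IdFam a))
    (w : Tm (P.shape ◂ instId a (refl a))) (σ : Δ ⟶ Γ) (x : Term Δ) (h) :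
    (transpHom a P w (refl a)).map σ x h = x :=
  app_idFun_map (P.pos.obj_congr rfl (congrArg Tm.val (J_refl _ _ _)) _ _) _
    (transp_refl a P w) _ _ _

theorem transpHom_sub {Γ Δ Θ : C} {A : Ty Γ} (a : Tm A) (P : PTy (Γ ▹ A ▹ IdFam a))
    (w : Tm (P.shape ◂ instId a (refl a))) {b : Tm A} (e : Tm (IdTy a b)) (s : Δ ⟶ Γ)
    (σ : Θ ⟶ Δ) (x : Term Θ) (h h') :
    (transpHom (a.sub s) (P.sub (liftTo (lift s A) (IdFam_sub a s)))
        ((w.sub s).cast (sub_instId_refl a P.shape s)) ((e.sub s).cast (IdTy_sub a b s))).map σ x h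
      = (transpHom a P w e).map (σ ≫ s) x h' := by
  refine app_sub_map s ?_ (posBase_sub a P w s) _ _ (transp_sub a P w s e) σ x h h'
  refine (P.pos.nat _ _ _ _).trans (P.pos.obj_congr ?_ (J_sub a P.shape w e s) _ _)
  exact sub_instId a e s

/-- The eliminator of identity types: on shapes it is the eliminator of the base model, and the
positions over the result are transported to the positions over the base case. -/
def pJ {Γ : Poly C} {A : Ty Γ} (a : Tm A) (P : Ty (Γ ▹ A ▹ IdFam a))
    (w : Tm (P ◂ instId a (refl a))) {b : Tm A} (e : Tm (IdTy a b)) : Tm (P ◂ instId a e) :=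
  ptm (A := P ◂ instId a e) (J (sh a) (PTy.shape P) (sh w) (sh e))
    (((transpHom (Γ := Γ.shape) (sh a) P (sh w) (sh e)).cast
      (PTy.sub_posAt (Γ := Γ.shape ▹ PTy.shape A ▹ IdFam (sh a)) P (instId (sh a) (sh e)) _ _).symm
      (PTy.sub_posAt (Γ := Γ.shape ▹ PTy.shape A ▹ IdFam (sh a)) P _ _ _).symm).comp (ps w))

theorem pJ_refl {Γ : Poly C} {A : Ty Γ} (a : Tm A) (P : Ty (Γ ▹ A ▹ IdFam a))
    (w : Tm (P ◂ instId a (refl a))) : pJ a P w (refl a) = w :=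
  ptm_ext (congrArg Tm.val (J_refl (sh a) (PTy.shape P) (sh w))) fun σ x _ _ =>
    FibHom.map_congr _ rfl (transpHom_refl (Γ := Γ.shape) (sh a) P (sh w) σ x _) _ _

theorem pJ_sub {Γ Δ : Poly C} {A : Ty Γ} (a : Tm A) (P : Ty (Γ ▹ A ▹ IdFam a))
    (w : Tm (P ◂ instId a (refl a))) {b : Tm A} (e : Tm (IdTy a b)) (σ : Δ ⟶ Γ) :
    ((pJ a P w e).sub σ).1 =
      (pJ (a.sub σ) (P ◂ liftTo (lift σ A) (IdFam_sub a σ))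
        ((w.sub σ).cast (sub_instId_refl a P σ))
        ((e.sub σ).cast (IdTy_sub a b σ))).1 := by
  refine term_ext ?_ (J_sub (sh a) (PTy.shape P) (sh w) (sh e) (Hom.shape σ)) ?_
  · rw [tySub_tySub, tySub_tySub, sub_instId]
  · intro Θ ρ x h h'
    have hx := h.trans ((congrArg (· ◂ ρ) (posAt_sub_eq (pJ a P w e) σ)).trans
      ((tySub_tySub _ _ _).trans (congrArg (· ◂ _)
        (PTy.sub_posAt (Γ := Γ.shape ▹ PTy.shape A ▹ IdFam (sh a)) P _ _ (sh (pJ a P w e)).2))))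
    have key := transpHom_sub (Γ := Γ.shape) (sh a) P (sh w) (sh e) (Hom.shape σ) ρ x
      (h'.trans (congrArg (· ◂ ρ) (PTy.sub_posAt _ _ _ _)))
      hx
    have k := (FibHom.ty_map (transpHom (Γ := Γ.shape) (sh a) P (sh w) (sh e)) _ x hx).trans
      (congrArg (· ◂ (ρ ≫ Hom.shape σ))
        (PTy.sub_posAt (Γ := Γ.shape ▹ PTy.shape A ▹ IdFam (sh a)) P _ _ (sh w).2).symm)
    refine FibHom.map_congr (Hom.pos σ) rfl
      (FibHom.map_congr (ps w) rfl key.symm k ((congrArg ty key).trans k)) _ _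

instance : HasId (Poly C) where
  J := pJ
  J_refl := pJ_refl
  J_sub := pJ_sub

end Identity

end Poly

section SigmaHom

variable {C : Type u} [Category.{v} C] [NaturalModel.{w} C] [HasSigma C] {Γ Δ Θ : C}

theorem cons_q (A : Ty Γ) (σ : Δ ⟶ Γ ▹ A) {σ' : Δ ⟶ Γ} (hσ : A ◂ p A ◂ σ = A ◂ σ')
    (h : σ' = σ ≫ p A := by first | rfl | simp) : cons σ' (((var A).sub σ).cast hσ) = σ := by
  subst h; rw [cons_eq]; exact pair_eta A σ _

/-- Pairing of generalized terms. -/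
def dpairAt (σ : Δ ⟶ Γ) {A : Ty Γ} {B : Ty (Γ ▹ A)} (a : Tm (A ◂ σ)) (b : Tm (B ◂ cons σ a)) :
    Tm (Sig A B ◂ σ) :=
  (dpair a (b.cast (by simp [cons_eq, inst_eq, lift_eq]))).cast (Sig_sub A B σ).symm

theorem fstAt_dpairAt (σ : Δ ⟶ Γ) {A : Ty Γ} {B : Ty (Γ ▹ A)} (a : Tm (A ◂ σ))
    (b : Tm (B ◂ cons σ a)) (h) : (fstAt σ A B (dpairAt σ a b).1 h).1 = a.1 :=
  congrArg Tm.val (fst_dpair (B := B ◂ lift σ A) a _)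

theorem sndAt_dpairAt (σ : Δ ⟶ Γ) {A : Ty Γ} {B : Ty (Γ ▹ A)} (a : Tm (A ◂ σ))
    (b : Tm (B ◂ cons σ a)) (h) : (sndAt σ A B (dpairAt σ a b).1 h).1 = b.1 :=
  snd_dpair (B := B ◂ lift σ A) a _

theorem dpairAt_eta (σ : Δ ⟶ Γ) {A : Ty Γ} {B : Ty (Γ ▹ A)} (t : Term Δ) (h) :
    (dpairAt σ (fstAt σ A B t h) (sndAt σ A B t h)).1 = t :=
  congrArg Tm.val (dpair_eta (A := A ◂ σ) (B := B ◂ lift σ A) ⟨t, h.trans (Sig_sub A B σ)⟩)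

theorem dpairAt_congr {σ σ' : Δ ⟶ Γ} (hσ : σ = σ') {A : Ty Γ} {B : Ty (Γ ▹ A)} {a : Tm (A ◂ σ)}
    {b : Tm (B ◂ cons σ a)} {a' : Tm (A ◂ σ')} {b' : Tm (B ◂ cons σ' a')} (ha : a.1 = a'.1)
    (hb : b.1 = b'.1) : (dpairAt σ a b).1 = (dpairAt σ' a' b').1 := by
  subst hσ
  obtain rfl : a = a' := Tm.ext ha
  rw [Tm.ext hb]

theorem dpairAt_sub (σ : Δ ⟶ Γ) {A : Ty Γ} {B : Ty (Γ ▹ A)} (a : Tm (A ◂ σ))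
    (b : Tm (B ◂ cons σ a)) (τ : Θ ⟶ Δ) (a' : Tm (A ◂ (τ ≫ σ))) (b' : Tm (B ◂ cons (τ ≫ σ) a'))
    (ha : a.1 ◃ τ = a'.1) (hb : b.1 ◃ τ = b'.1) :
    (dpairAt σ a b).1 ◃ τ = (dpairAt (τ ≫ σ) a' b').1 :=
  dpair_sub_eq τ (by simp) (by simp [liftTo_eq, lift_eq]) ha hb

theorem dpairAt_base (σ : Δ ⟶ Γ) {A : Ty Γ} {B : Ty (Γ ▹ A)} (ρ : Θ ⟶ Δ) (a : Tm (A ◂ σ ◂ ρ))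
    (b : Tm (B ◂ lift σ A ◂ cons ρ a)) (a' : Tm (A ◂ (ρ ≫ σ))) (b' : Tm (B ◂ cons (ρ ≫ σ) a'))
    (ha : a.1 = a'.1) (hb : b.1 = b'.1) :
    (dpairAt ρ a b).1 = (dpairAt (ρ ≫ σ) a' b').1 := by
  rw [← tmSub_id (dpairAt ρ a b).1]
  exact dpair_sub_eq (𝟙 Θ) (by simp) (by simp [liftTo_eq, lift_eq]) (by simpa) (by simpa)

namespace FibHom

/-- Pairing with the variable. -/
def mkPair (A : Ty Γ) (B : Ty (Γ ▹ A)) : FibHom B (Sig A B ◂ p A) where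
  map σ b h := (dpairAt (σ ≫ p A) ((var A).sub σ |>.cast (tySub_tySub _ _ _))
    ⟨b, h.trans (congrArg (B ◂ ·) (cons_q A σ _).symm)⟩).1
  ty_map σ b h := by rw [Tm.prop, tySub_tySub]
  nat σ b h τ := by
    rw [dpairAt_sub (a' := ((var A).sub (τ ≫ σ)).cast (by rw [tySub_tySub, Category.assoc]))
      (b' := ⟨b ◃ τ, (comp_pair_ty τ h).trans (congrArg (B ◂ ·) (cons_q A (τ ≫ σ) _).symm)⟩)]
    · exact dpairAt_congr (by simp) rfl rfl
    · simp
    · rfl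

/-- Morphisms out of a dependent sum, from morphisms over its base. -/
def uncurry {A : Ty Γ} {B : Ty (Γ ▹ A)} {D : Ty Γ} (f : FibHom B (D ◂ p A)) :
    FibHom (Sig A B) D where
  map σ t h := f.map (cons σ (fstAt σ A B t h)) (sndAt σ A B t h).1 (sndAt σ A B t h).2
  ty_map σ t h := by rw [f.ty_map]; simp [cons_eq]
  nat σ t h τ := by
    rw [f.nat]
    exact f.map_congr (by simp [cons_eq, fstAt_sub]) (sndAt_sub _ _ _ _ _ _) _ _

/-- The inverse of `uncurry`. -/
def curry {A : Ty Γ} {B : Ty (Γ ▹ A)} {D : Ty Γ} (g : FibHom (Sig A B) D) :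
    FibHom B (D ◂ p A) := (mkPair A B).comp (g.sub (p A))

theorem curry_uncurry {A : Ty Γ} {B : Ty (Γ ▹ A)} {D : Ty Γ} (f : FibHom B (D ◂ p A)) :
    curry (uncurry f) = f := ext fun σ x h => by
  refine f.map_congr ?_ (sndAt_dpairAt _ _ _ _) _ _
  refine (cons_congr (fstAt_dpairAt _ _ _ _)).trans ?_
  rw [cons_eq]; exact pair_eta A σ _

theorem uncurry_curry {A : Ty Γ} {B : Ty (Γ ▹ A)} {D : Ty Γ} (g : FibHom (Sig A B) D) :
    uncurry (curry g) = g := ext fun σ t h => by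
  refine g.map_congr (by simp [cons_eq]) ?_ _ _
  refine Eq.trans ?_ (dpairAt_eta σ t h)
  exact dpairAt_congr (by simp [cons_eq]) (by simp [cons_eq]) rfl

end FibHom

end SigmaHom

section ArrHom

variable {C : Type u} [Category.{v} C] [NaturalModel.{w} C] [HasPi C] {Γ Δ Θ : C}

namespace FibHom

/-- The morphism given by a function. -/
def ofFun {A B : Ty Γ} (f : Tm (Arr A B)) : FibHom A B := ofTm (app f)

/-- The function given by a morphism. -/
def toFun {A B : Ty Γ} (f : FibHom A B) : Tm (Arr A B) := lam f.toTm

theorem ofFun_toFun {A B : Ty Γ} (f : FibHom A B) : ofFun (toFun f) = f := by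
  rw [ofFun, toFun, app_lam]; exact (equiv A B).left_inv f

theorem toFun_ofFun {A B : Ty Γ} (f : Tm (Arr A B)) : toFun (ofFun f) = f := by
  have : (ofFun f).toTm = app f := (equiv A B).right_inv (app f)
  rw [toFun, this]; exact lam_app f

theorem toFun_sub {A B : Ty Γ} (f : FibHom A B) (σ : Δ ⟶ Γ) {A' B' : Ty Δ} (f' : FibHom A' B')
    (hA : A ◂ σ = A')
    (hf : ∀ {Θ : C} (τ : Θ ⟶ Δ) (x : Term Θ) (h h'), f.map (τ ≫ σ) x h = f'.map τ x h') :
    (toFun f).1 ◃ σ = (toFun f').1 := by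
  refine lam_sub_eq σ hA ?_
  rw [toTm, f.nat]
  refine Eq.trans (f.map_congr ?_ ?_ _ ?_) (hf (p A') (q A') ?_ (ty_q A'))
  · simp [liftTo_eq]
  · simp [liftTo_eq]
  all_goals simp [← hA]

theorem ofFun_sub {A B : Ty Γ} {A' B' : Ty Δ} (σ : Δ ⟶ Γ) (hA : A ◂ σ = A')
    (hB : B ◂ σ = B') (f : Tm (Arr A B)) (f' : Tm (Arr A' B')) (hf : f.1 ◃ σ = f'.1) (τ : Θ ⟶ Δ)
    (x : Term Θ) (h : ty x = A' ◂ τ) (h' : ty x = A ◂ (τ ≫ σ)) :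
    (ofFun f').map τ x h = (ofFun f).map (τ ≫ σ) x h' := by
  have := app_sub_eq σ hA (by rw [← hB]; simp [liftTo_eq]) hf
  change (app f').1 ◃ _ = (app f).1 ◃ _
  rw [← this]
  simp [liftTo_eq]

theorem toFun_congr {A A' B B' : Ty Γ} {f : FibHom A B} {f' : FibHom A' B'} (hA : A = A')
    (hf : ∀ {Δ : C} (σ : Δ ⟶ Γ) (x : Term Δ) (h h'), f.map σ x h = f'.map σ x h') :
    (toFun f).1 = (toFun f').1 := by
  subst hA
  exact lam_congr (hf _ _ _ _)

theorem ofFun_congr {A A' B B' : Ty Γ} {f : Tm (Arr A B)} {f' : Tm (Arr A' B')} (hA : A = A')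
    (hB : B = B') (hf : f.1 = f'.1) (σ : Δ ⟶ Γ) (x : Term Δ) (h h') :
    (ofFun f).map σ x h = (ofFun f').map σ x h' := by
  subst hA hB
  obtain rfl : f = f' := Tm.ext hf
  rfl

end FibHom

end ArrHom

section CaseHom

variable {C : Type u} [Category.{v} C] [NaturalModel.{w} C] [HasPi C] [HasEmpty C] [HasSumTy C]
  [ExtensiveCoproducts C] {Γ Δ Θ : C}

namespace FibHom

theorem pair_inl (A B : Ty Γ) (σ : Δ ⟶ Γ) (a : Term Δ) (h h') :
    pair σ (SumTy A B) ((inl A B).map σ a h) h' = pair σ A a h ≫ inlMap A B := by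
  rw [inlMap_eq, comp_pair]
  refine pair_congr (by simp) ?_ _ _
  rw [FibHom.nat]; exact (map_congr _ (by simp) (by simp) _ _)

theorem pair_inr (A B : Ty Γ) (σ : Δ ⟶ Γ) (b : Term Δ) (h h') :
    pair σ (SumTy A B) ((inr A B).map σ b h) h' = pair σ B b h ≫ inrMap A B := by
  rw [inrMap_eq, comp_pair]
  refine pair_congr (by simp) ?_ _ _
  rw [FibHom.nat]; exact (map_congr _ (by simp) (by simp) _ _)

/-- Morphisms over a coproduct, defined by cases. -/
def caseHom {A B : Ty Γ} {K D : Ty (Γ ▹ SumTy A B)} (l : FibHom (K ◂ inlMap A B) (D ◂ inlMap A B))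
    (r : FibHom (K ◂ inrMap A B) (D ◂ inrMap A B)) : FibHom K D :=
  ofFun (case (Arr K D) (l.toFun.cast (Arr_sub _ _ _).symm) (r.toFun.cast (Arr_sub _ _ _).symm))

theorem caseHom_inl {A B : Ty Γ} {K D : Ty (Γ ▹ SumTy A B)}
    (l : FibHom (K ◂ inlMap A B) (D ◂ inlMap A B)) (r : FibHom (K ◂ inrMap A B) (D ◂ inrMap A B))
    (σ : Δ ⟶ Γ ▹ A) (k : Term Δ) (h h') :
    (caseHom l r).map (σ ≫ inlMap A B) k h = l.map σ k h' := by
  refine (ofFun_sub (inlMap A B) rfl rfl _ l.toFun ?_ σ k h' h).symm.trans ?_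
  · exact congrArg Tm.val (case_inl (Arr K D) (l.toFun.cast (Arr_sub _ _ _).symm)
      (r.toFun.cast (Arr_sub _ _ _).symm))
  · rw [ofFun_toFun]

theorem caseHom_inr {A B : Ty Γ} {K D : Ty (Γ ▹ SumTy A B)}
    (l : FibHom (K ◂ inlMap A B) (D ◂ inlMap A B)) (r : FibHom (K ◂ inrMap A B) (D ◂ inrMap A B))
    (σ : Δ ⟶ Γ ▹ B) (k : Term Δ) (h h') :
    (caseHom l r).map (σ ≫ inrMap A B) k h = r.map σ k h' := by
  refine (ofFun_sub (inrMap A B) rfl rfl _ r.toFun ?_ σ k h' h).symm.trans ?_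
  · exact congrArg Tm.val (case_inr (Arr K D) (l.toFun.cast (Arr_sub _ _ _).symm)
      (r.toFun.cast (Arr_sub _ _ _).symm))
  · rw [ofFun_toFun]

theorem caseHom_ext {A B : Ty Γ} {K D : Ty (Γ ▹ SumTy A B)} (f g : FibHom K D)
    (hl : ∀ {Δ : C} (σ : Δ ⟶ Γ ▹ A) (k : Term Δ) (h),
      f.map (σ ≫ inlMap A B) k h = g.map (σ ≫ inlMap A B) k h)
    (hr : ∀ {Δ : C} (σ : Δ ⟶ Γ ▹ B) (k : Term Δ) (h),
      f.map (σ ≫ inrMap A B) k h = g.map (σ ≫ inrMap A B) k h) : f = g := by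
  have : f.toFun = g.toFun := by
    refine sum_eta _ _ _ (Tm.ext ?_) (Tm.ext ?_)
    · refine (toFun_sub f (inlMap A B) (g.sub (inlMap A B)) rfl fun τ x h h' => hl τ x h).trans ?_
      exact (toFun_sub g (inlMap A B) (g.sub (inlMap A B)) rfl fun τ x h h' => rfl).symm
    · refine (toFun_sub f (inrMap A B) (g.sub (inrMap A B)) rfl fun τ x h h' => hr τ x h).trans ?_
      exact (toFun_sub g (inrMap A B) (g.sub (inrMap A B)) rfl fun τ x h h' => rfl).symm
  rw [← ofFun_toFun f, this, ofFun_toFun]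

end FibHom

end CaseHom

section Split

variable {C : Type u} [Category.{v} C] [NaturalModel.{w} C] [HasPi C] [HasSigma C] [HasUnit C]
  [HasEmpty C] [HasSumTy C] [ExtensiveCoproducts C] {Γ Δ Θ : C}

/-- The type family over `1 + Y` that is the unit type on the left summand and empty on the right
summand. -/
def isInc0 (Y : Ty Γ) : Ty (Γ ▹ SumTy (UnitTy Γ) Y) := copair (UnitTy _) (EmptyTy _)

theorem isInc0_inl (Y : Ty Γ) : isInc0 Y ◂ inlMap (UnitTy Γ) Y = UnitTy _ := copair_inl _ _

theorem isInc0_inr (Y : Ty Γ) : isInc0 Y ◂ inrMap (UnitTy Γ) Y = EmptyTy _ := copair_inr _ _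

theorem isInc0_sub (Y : Ty Γ) (σ : Δ ⟶ Γ)
    (h : SumTy (UnitTy Γ) Y ◂ σ = SumTy (UnitTy Δ) (Y ◂ σ)) :
    isInc0 Y ◂ liftTo σ h = isInc0 (Y ◂ σ) := by
  have key : ∀ (X : Ty Δ) (hX : X = UnitTy Δ) (h : SumTy (UnitTy Γ) Y ◂ σ = SumTy X (Y ◂ σ)),
      UnitTy Γ ◂ σ = X → isInc0 Y ◂ liftTo σ h = copair (UnitTy (Δ ▹ X)) (EmptyTy _) := by
    rintro _ - h rfl
    exact (copair_sub _ _ σ).trans (congrArg₂ copair (UnitTy_sub _) (EmptyTy_sub _))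
  exact key _ rfl h (UnitTy_sub σ)

/-- The type `Σ (u : 1 + Y), Z ^ isInc0 u`, which is strictly isomorphic to `Z + Y`. -/
def SplitTy (Y Z : Ty Γ) : Ty Γ := Sig (SumTy (UnitTy Γ) Y) (Arr (isInc0 Y) (Z ◂ p _))

theorem splitTy_fibre (Y Z : Ty Γ) (σ : Δ ⟶ Γ) (v : Tm (SumTy (UnitTy Γ) Y ◂ σ)) :
    Arr (isInc0 Y) (Z ◂ p _) ◂ cons σ v = Arr (isInc0 Y ◂ cons σ v) (Z ◂ σ) :=
  Arr_sub_eq _ rfl (by simp [cons_eq])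

/-- The elements of `SplitTy`. -/
def splitMk {Y Z : Ty Γ} (σ : Δ ⟶ Γ) (v : Tm (SumTy (UnitTy Γ) Y ◂ σ))
    (k : FibHom (isInc0 Y ◂ cons σ v) (Z ◂ σ)) : Tm (SplitTy Y Z ◂ σ) :=
  dpairAt σ v (k.toFun.cast (splitTy_fibre Y Z σ v).symm)

/-- The component in `1 + Y` of an element of `SplitTy`. -/
def splitFst (Y Z : Ty Γ) (σ : Δ ⟶ Γ) (d : Term Δ) (h : ty d = SplitTy Y Z ◂ σ) :
    Tm (SumTy (UnitTy Γ) Y ◂ σ) := fstAt σ _ _ d h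

/-- The partial element of `Z` of an element of `SplitTy`. -/
def splitSnd (Y Z : Ty Γ) (σ : Δ ⟶ Γ) (d : Term Δ) (h : ty d = SplitTy Y Z ◂ σ) :
    FibHom (isInc0 Y ◂ cons σ (splitFst Y Z σ d h)) (Z ◂ σ) :=
  FibHom.ofFun ((sndAt σ _ _ d h).cast (splitTy_fibre Y Z σ _))

theorem splitMk_sub {Y Z : Ty Γ} (σ : Δ ⟶ Γ) (v : Tm (SumTy (UnitTy Γ) Y ◂ σ))
    (k : FibHom (isInc0 Y ◂ cons σ v) (Z ◂ σ)) (τ : Θ ⟶ Δ)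
    (v' : Tm (SumTy (UnitTy Γ) Y ◂ (τ ≫ σ))) (k' : FibHom (isInc0 Y ◂ cons (τ ≫ σ) v') (Z ◂ (τ ≫ σ)))
    (hv : v.1 ◃ τ = v'.1)
    (hk : ∀ {Ξ : C} (ρ : Ξ ⟶ Θ) (x : Term Ξ) (h h'), k.map (ρ ≫ τ) x h = k'.map ρ x h') :
    (splitMk σ v k).1 ◃ τ = (splitMk (τ ≫ σ) v' k').1 :=
  dpairAt_sub σ _ _ τ _ _ hv (FibHom.toFun_sub k τ k' (by
    rw [tySub_tySub]; exact congrArg (isInc0 Y ◂ ·) (by simp [cons_eq, hv])) hk)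

theorem splitMk_congr {Y Z : Ty Γ} {σ σ' : Δ ⟶ Γ} (hσ : σ = σ')
    {v : Tm (SumTy (UnitTy Γ) Y ◂ σ)} {v' : Tm (SumTy (UnitTy Γ) Y ◂ σ')}
    {k : FibHom (isInc0 Y ◂ cons σ v) (Z ◂ σ)} {k' : FibHom (isInc0 Y ◂ cons σ' v') (Z ◂ σ')}
    (hv : v.1 = v'.1)
    (hk : ∀ {Ξ : C} (ρ : Ξ ⟶ Δ) (x : Term Ξ) (h h'), k.map ρ x h = k'.map ρ x h') :
    (splitMk σ v k).1 = (splitMk σ' v' k').1 := by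
  subst hσ
  obtain rfl : v = v' := Tm.ext hv
  obtain rfl : k = k' := FibHom.ext fun ρ x h => hk ρ x h h
  rfl

theorem splitMk_eta {Y Z : Ty Γ} (σ : Δ ⟶ Γ) (d : Term Δ) (h) :
    (splitMk σ (splitFst Y Z σ d h) (splitSnd Y Z σ d h)).1 = d := by
  refine Eq.trans ?_ (dpairAt_eta σ d h)
  refine dpairAt_congr rfl rfl ?_
  rw [splitSnd, FibHom.toFun_ofFun]; rfl

theorem splitFst_mk {Y Z : Ty Γ} (σ : Δ ⟶ Γ) (v : Tm (SumTy (UnitTy Γ) Y ◂ σ))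
    (k : FibHom (isInc0 Y ◂ cons σ v) (Z ◂ σ)) (h) :
    splitFst Y Z σ (splitMk σ v k).1 h = v :=
  Tm.ext (fstAt_dpairAt _ _ _ _)

theorem splitSnd_mk {Y Z : Ty Γ} (σ : Δ ⟶ Γ) (v : Tm (SumTy (UnitTy Γ) Y ◂ σ))
    (k : FibHom (isInc0 Y ◂ cons σ v) (Z ◂ σ)) (h) (ρ : Θ ⟶ Δ) (x : Term Θ) (h' h'') :
    (splitSnd Y Z σ (splitMk σ v k).1 h).map ρ x h' = k.map ρ x h'' := by
  refine (FibHom.ofFun_congr (f' := k.toFun) ?_ rfl ?_ _ _ _ ?_).trans ?_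
  · rw [splitFst_mk]
  · exact sndAt_dpairAt σ v _ h
  · exact h''
  · rw [FibHom.ofFun_toFun]

theorem splitFst_sub (Y Z : Ty Γ) (σ : Δ ⟶ Γ) (d : Term Δ) (h) (τ : Θ ⟶ Δ) (h') :
    (splitFst Y Z σ d h).1 ◃ τ = (splitFst Y Z (τ ≫ σ) (d ◃ τ) h').1 := fstAt_sub _ _ _ _ _ _

theorem splitSnd_sub (Y Z : Ty Γ) (σ : Δ ⟶ Γ) (d : Term Δ) (h) (τ : Θ ⟶ Δ) (h') {Ξ : C}
    (ρ : Ξ ⟶ Θ) (x : Term Ξ) (k k') :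
    (splitSnd Y Z (τ ≫ σ) (d ◃ τ) h').map ρ x k = (splitSnd Y Z σ d h).map (ρ ≫ τ) x k' := by
  refine FibHom.ofFun_sub τ ?_ (tySub_tySub _ _ _) _ _ ?_ ρ x k k'
  · rw [tySub_tySub]
    refine congrArg (isInc0 Y ◂ ·) ?_
    rw [cons_eq, comp_pair]
    exact pair_congr rfl (splitFst_sub Y Z σ d h τ h') _ _
  · exact sndAt_sub _ _ _ _ h τ

theorem splitFst_congr {Y Z : Ty Γ} {σ σ' : Δ ⟶ Γ} (hσ : σ = σ') {d d' : Term Δ} (hd : d = d')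
    (h h') : (splitFst Y Z σ d h).1 = (splitFst Y Z σ' d' h').1 := by
  subst hσ hd; rfl

theorem splitSnd_congr {Y Z : Ty Γ} {σ σ' : Δ ⟶ Γ} (hσ : σ = σ') {d d' : Term Δ} (hd : d = d')
    (h h') {ρ ρ' : Θ ⟶ Δ} (hρ : ρ = ρ') {x x' : Term Θ} (hx : x = x') (k k') :
    (splitSnd Y Z σ d h).map ρ x k = (splitSnd Y Z σ' d' h').map ρ' x' k' := by
  subst hσ hd hρ hx; rfl

theorem star_eq {σ : Δ ⟶ Γ} {a b : Term Δ} (ha : ty a = UnitTy Γ ◂ σ) (hb : ty b = UnitTy Γ ◂ σ) :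
    a = b :=
  (congrArg Tm.val (star_eta ⟨a, ha.trans (UnitTy_sub σ)⟩)).trans
    (congrArg Tm.val (star_eta ⟨b, hb.trans (UnitTy_sub σ)⟩)).symm

/-- The left point of `1 + Y`. -/
def leftAt (Y : Ty Γ) (σ : Δ ⟶ Γ) : Tm (SumTy (UnitTy Γ) Y ◂ σ) :=
  ⟨(FibHom.inl (UnitTy Γ) Y).map σ (star Δ).1 ((HasUnit.star Δ).2.trans (UnitTy_sub σ).symm),
    FibHom.ty_map _ _ _ _⟩

/-- The points of `1 + Y` given by points of `Y`. -/
def rightAt (Y : Ty Γ) (σ : Δ ⟶ Γ) (y : Term Δ) (h : ty y = Y ◂ σ) :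
    Tm (SumTy (UnitTy Γ) Y ◂ σ) :=
  ⟨(FibHom.inr (UnitTy Γ) Y).map σ y h, FibHom.ty_map _ _ _ _⟩

theorem isInc0_leftAt (Y : Ty Γ) (σ : Δ ⟶ Γ) : isInc0 Y ◂ cons σ (leftAt Y σ) = UnitTy Δ := by
  rw [cons_eq, leftAt, FibHom.pair_inl, ← tySub_tySub, isInc0_inl, UnitTy_sub]

theorem isInc0_rightAt (Y : Ty Γ) (σ : Δ ⟶ Γ) (y : Term Δ) (h) :
    isInc0 Y ◂ cons σ (rightAt Y σ y h) = EmptyTy Δ := by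
  rw [cons_eq, rightAt, FibHom.pair_inr, ← tySub_tySub, isInc0_inr, EmptyTy_sub]

theorem FibHom.empty_map {E D : Ty Γ} {E' D' : Ty Δ} (τ : Δ ⟶ Γ) (hE : E = EmptyTy Γ)
    (hE' : E' = EmptyTy Δ) (hD : D ◂ τ = D') (k : FibHom E D) (k' : FibHom E' D') (ρ : Θ ⟶ Δ)
    (x : Term Θ) (h h') : k.map (ρ ≫ τ) x h = k'.map ρ x h' := by
  subst hE hE' hD
  have := FibHom.empty_uniq rfl ((k.sub τ).cast (EmptyTy_sub τ) rfl) k'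
  exact congrArg (fun f : FibHom (EmptyTy Δ) (D ◂ τ) => f.map ρ x h') this

/-- Constant morphisms. -/
def FibHom.const (X : Ty Γ) {D : Ty Γ} (d : Tm D) : FibHom X D where
  map σ _ _ := d.1 ◃ σ
  ty_map σ _ _ := by rw [ty_sub, d.2]
  nat σ _ _ τ := tmSub_tmSub _ _ _

/-- The isomorphism from `Z + Y` to `SplitTy Y Z`. -/
def splitHom (Y Z : Ty Γ) : FibHom (SumTy Z Y) (SplitTy Y Z) :=
  FibHom.copair
    { map := fun σ z h => (splitMk σ (leftAt Y σ) (FibHom.const _ ⟨z, h⟩)).1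
      ty_map := fun σ z h => Tm.prop _
      nat := fun σ z h τ => splitMk_sub _ _ _ _ _ _
        (((FibHom.inl (UnitTy _) Y).nat _ _ _ _).trans (FibHom.map_congr _ rfl
          (star_eq (comp_pair_ty τ ((HasUnit.star _).2.trans (UnitTy_sub σ).symm))
            ((HasUnit.star _).2.trans (UnitTy_sub _).symm)) _ _))
        fun ρ x h h' => (tmSub_tmSub _ _ _).symm }
    { map := fun σ y h => (splitMk σ (rightAt Y σ y h)
        ((FibHom.empty _).cast (isInc0_rightAt Y σ y h).symm rfl)).1
      ty_map := fun σ y h => Tm.prop _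
      nat := fun σ y h τ => splitMk_sub _ _ _ _ _ _ ((FibHom.inr (UnitTy _) Y).nat _ _ _ _)
        fun ρ x h h' => FibHom.empty_map τ (isInc0_rightAt Y σ y _)
          (isInc0_rightAt Y _ _ _) (tySub_tySub _ _ _) _ _ ρ x h h' }

/-- The value at the point of a partial element of `Z` that is defined. -/
def evalLeft (Y Z : Ty Γ) (σ : Δ ⟶ Γ ▹ UnitTy Γ) (k : Term Δ)
    (h : ty k = Arr (isInc0 Y) (Z ◂ p _) ◂ inlMap (UnitTy Γ) Y ◂ σ) : Term Δ :=
  (FibHom.ofFun (A := UnitTy Δ) (B := Z ◂ (σ ≫ p _)) ⟨k, h.trans (by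
    rw [tySub_tySub]
    exact Arr_sub_eq _ (by rw [← tySub_tySub, isInc0_inl, UnitTy_sub])
      (by simp [inlMap, cons_eq]))⟩).map (𝟙 Δ) (HasUnit.star Δ).1
    ((HasUnit.star Δ).2.trans (tySub_id _).symm)

theorem evalLeft_ty (Y Z : Ty Γ) (σ : Δ ⟶ Γ ▹ UnitTy Γ) (k : Term Δ) (h) :
    ty (evalLeft Y Z σ k h) = Z ◂ (σ ≫ p _) := by
  rw [evalLeft, FibHom.ty_map, tySub_id]

theorem evalLeft_sub (Y Z : Ty Γ) (σ : Δ ⟶ Γ ▹ UnitTy Γ) (k : Term Δ) (h) (τ : Θ ⟶ Δ) (h') :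
    evalLeft Y Z σ k h ◃ τ = evalLeft Y Z (τ ≫ σ) (k ◃ τ) h' := by
  rw [evalLeft, FibHom.nat]
  refine Eq.trans (FibHom.map_congr _ ?_ ?_ _ ?_) (FibHom.ofFun_sub (A := UnitTy Δ)
    (B := Z ◂ (σ ≫ p _)) τ (UnitTy_sub τ) ?_ _ _ ?_ (𝟙 Θ) (HasUnit.star Θ).1
      ((HasUnit.star Θ).2.trans (tySub_id _).symm) ?_).symm
  · simp
  · exact star_eq (σ := τ) (comp_pair_ty' (HasUnit.star _).2 _)
      ((HasUnit.star _).2.trans (UnitTy_sub _).symm)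
  · rw [Category.id_comp, UnitTy_sub]; exact (HasUnit.star Θ).2
  · simp
  · rfl
  · rw [Category.id_comp, UnitTy_sub]; exact (HasUnit.star Θ).2

/-- The inverse of `splitHom`, in curried form. -/
def mergeCase (Y Z : Ty Γ) :
    FibHom (Arr (isInc0 Y) (Z ◂ p _)) (SumTy Z Y ◂ p (SumTy (UnitTy Γ) Y)) :=
  FibHom.caseHom
    { map := fun σ k h => (FibHom.inl Z Y).map (σ ≫ p _) (evalLeft Y Z σ k h)
        (evalLeft_ty Y Z σ k h)
      ty_map := fun σ k h => by rw [FibHom.ty_map]; simp [inlMap, cons_eq]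
      nat := fun σ k h τ => by
        rw [FibHom.nat]
        exact FibHom.map_congr _ (Category.assoc _ _ _).symm (evalLeft_sub _ _ _ _ _ _ _) _ _ }
    { map := fun σ _ _ => (FibHom.inr Z Y).map (σ ≫ p _) (q Y ◃ σ) (by simp)
      ty_map := fun σ k h => by rw [FibHom.ty_map]; simp [inrMap, cons_eq]
      nat := fun σ k h τ => by
        rw [FibHom.nat]
        exact FibHom.map_congr _ (by simp) (by simp) _ _ }

/-- The inverse of `splitHom`. -/
def mergeHom (Y Z : Ty Γ) : FibHom (SplitTy Y Z) (SumTy Z Y) := FibHom.uncurry (mergeCase Y Z)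

theorem splitHom_inl (Y Z : Ty Γ) (σ : Δ ⟶ Γ) (z : Term Δ) (h : ty z = Z ◂ σ) (h') :
    (splitHom Y Z).map σ ((FibHom.inl Z Y).map σ z h) h' =
      (splitMk σ (leftAt Y σ) (FibHom.const _ ⟨z, h⟩)).1 :=
  FibHom.copair_inl _ _ _ _ _ _

theorem splitHom_inr (Y Z : Ty Γ) (σ : Δ ⟶ Γ) (y : Term Δ) (h : ty y = Y ◂ σ) (h') :
    (splitHom Y Z).map σ ((FibHom.inr Z Y).map σ y h) h' =
      (splitMk σ (rightAt Y σ y h)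
        ((FibHom.empty (Z ◂ σ)).cast (isInc0_rightAt Y σ y h).symm rfl)).1 :=
  FibHom.copair_inr _ _ _ _ _ _

theorem mergeCase_inl (Y Z : Ty Γ) (σ : Δ ⟶ Γ ▹ UnitTy Γ) (k : Term Δ) (h h') :
    (mergeCase Y Z).map (σ ≫ inlMap (UnitTy Γ) Y) k h =
      (FibHom.inl Z Y).map (σ ≫ p _) (evalLeft Y Z σ k h') (evalLeft_ty Y Z σ k h') :=
  FibHom.caseHom_inl _ _ _ _ _ _

theorem mergeCase_inr (Y Z : Ty Γ) (σ : Δ ⟶ Γ ▹ Y) (k : Term Δ) (h h') :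
    (mergeCase Y Z).map (σ ≫ inrMap (UnitTy Γ) Y) k h =
      (FibHom.inr Z Y).map (σ ≫ p _) (q Y ◃ σ) h' :=
  FibHom.caseHom_inr _ _ _ _ _ (h.trans (tySub_tySub _ _ _).symm)

theorem mergeHom_mk {Y Z : Ty Γ} (σ : Δ ⟶ Γ) (v : Tm (SumTy (UnitTy Γ) Y ◂ σ))
    (k : FibHom (isInc0 Y ◂ cons σ v) (Z ◂ σ)) (h h') :
    (mergeHom Y Z).map σ (splitMk σ v k).1 h = (mergeCase Y Z).map (cons σ v) k.toFun.1 h' :=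
  FibHom.map_congr (mergeCase Y Z) (cons_congr (fstAt_dpairAt σ v _ h)) (sndAt_dpairAt σ v _ h) _ _

theorem cons_leftAt (Y : Ty Γ) (σ : Δ ⟶ Γ) : cons σ (leftAt Y σ) =
    pair σ (UnitTy Γ) (HasUnit.star Δ).1 ((HasUnit.star Δ).2.trans (UnitTy_sub σ).symm) ≫
      inlMap (UnitTy Γ) Y := by
  rw [cons_eq, leftAt, FibHom.pair_inl]

theorem cons_rightAt (Y : Ty Γ) (σ : Δ ⟶ Γ) (y : Term Δ) (h : ty y = Y ◂ σ) :
    cons σ (rightAt Y σ y h) = pair σ Y y h ≫ inrMap (UnitTy Γ) Y := by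
  rw [cons_eq, rightAt, FibHom.pair_inr]

theorem mergeHom_left {Y Z : Ty Γ} (σ : Δ ⟶ Γ)
    (k : FibHom (isInc0 Y ◂ cons σ (leftAt Y σ)) (Z ◂ σ)) (h h' h'') :
    (mergeHom Y Z).map σ (splitMk σ (leftAt Y σ) k).1 h =
      (FibHom.inl Z Y).map σ (k.map (𝟙 Δ) (HasUnit.star Δ).1 h') h'' := by
  have e : ty k.toFun.1 = Arr (isInc0 Y) (Z ◂ p _) ◂ inlMap (UnitTy Γ) Y ◂
      pair σ (UnitTy Γ) (HasUnit.star Δ).1 ((HasUnit.star Δ).2.trans (UnitTy_sub σ).symm) := by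
    rw [tySub_tySub, ← cons_leftAt, splitTy_fibre]; exact k.toFun.2
  refine (mergeHom_mk σ _ k h (k.toFun.2.trans (splitTy_fibre Y Z σ _).symm)).trans ?_
  refine (FibHom.map_congr _ (cons_leftAt Y σ) rfl _ (e.trans (tySub_tySub _ _ _))).trans ?_
  refine (mergeCase_inl Y Z _ _ _ e).trans
    (FibHom.map_congr (FibHom.inl Z Y) (pair_p _ _ _ _) ?_ _ _)
  refine (FibHom.ofFun_congr (f' := k.toFun) (isInc0_leftAt Y σ).symm
    (congrArg (Z ◂ ·) (pair_p _ _ _ _)) rfl _ _ _ h').trans ?_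
  rw [FibHom.ofFun_toFun]

theorem mergeHom_right {Y Z : Ty Γ} (σ : Δ ⟶ Γ) (y : Term Δ) (hy : ty y = Y ◂ σ)
    (k : FibHom (isInc0 Y ◂ cons σ (rightAt Y σ y hy)) (Z ◂ σ)) (h) :
    (mergeHom Y Z).map σ (splitMk σ (rightAt Y σ y hy) k).1 h = (FibHom.inr Z Y).map σ y hy := by
  have e : ty k.toFun.1 = Arr (isInc0 Y) (Z ◂ p _) ◂ inrMap (UnitTy Γ) Y ◂ pair σ Y y hy := by
    rw [tySub_tySub, ← cons_rightAt, splitTy_fibre]; exact k.toFun.2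
  refine (mergeHom_mk σ _ k h (k.toFun.2.trans (splitTy_fibre Y Z σ _).symm)).trans ?_
  refine (FibHom.map_congr _ (cons_rightAt Y σ y hy) rfl _ (e.trans (tySub_tySub _ _ _))).trans ?_
  exact (mergeCase_inr Y Z _ _ _ (by simpa)).trans
    (FibHom.map_congr (FibHom.inr Z Y) (pair_p _ _ _ _) (pair_q _ _ _ _) _ _)

theorem merge_split (Y Z : Ty Γ) : (splitHom Y Z).comp (mergeHom Y Z) = FibHom.id _ := by
  refine FibHom.sum_ext rfl _ _ (fun {Δ} σ z h h' => ?_) fun σ y h h' => ?_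
  · refine (FibHom.map_congr (mergeHom Y Z) rfl (splitHom_inl Y Z σ z h h') _ (Tm.prop _)).trans ?_
    refine (mergeHom_left σ _ _ (by rw [isInc0_leftAt, UnitTy_sub]; exact (HasUnit.star Δ).2)
      (by rw [FibHom.ty_map, tySub_id])).trans ?_
    exact FibHom.map_congr (FibHom.inl Z Y) rfl (tmSub_id _) _ _
  · refine (FibHom.map_congr (mergeHom Y Z) rfl (splitHom_inr Y Z σ y h h') _ (Tm.prop _)).trans ?_
    exact mergeHom_right σ y h _ _

theorem evalLeft_map (Y Z : Ty Γ) (σ : Δ ⟶ Γ ▹ UnitTy Γ) (k : Term Δ) (h)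
    (k' : Tm (Arr (UnitTy Δ) (Z ◂ (σ ≫ p _)))) (hk : k = k'.1) (ρ : Θ ⟶ Δ) (x : Term Θ) (h') :
    (FibHom.ofFun k').map ρ x h' = evalLeft Y Z σ k h ◃ ρ := by
  subst hk
  rw [evalLeft, FibHom.nat]
  exact FibHom.map_congr _ (by simp) (star_eq h' (comp_pair_ty' (HasUnit.star _).2 ρ)) _ _

theorem FibHom.empty_toFun {E E' D : Ty Γ} (hE : E = EmptyTy Γ) (hE' : E' = EmptyTy Γ)
    (f : FibHom E D) (f' : FibHom E' D) : f.toFun.1 = f'.toFun.1 := by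
  subst hE hE'; rw [FibHom.empty_uniq rfl f f']

theorem arr_inl (Y Z : Ty Γ) (σ : Δ ⟶ Γ ▹ UnitTy Γ) :
    Arr (isInc0 Y) (Z ◂ p _) ◂ (σ ≫ inlMap (UnitTy Γ) Y) = Arr (UnitTy Δ) (Z ◂ (σ ≫ p _)) :=
  Arr_sub_eq _ (by rw [← tySub_tySub, isInc0_inl, UnitTy_sub]) (by simp [inlMap, cons_eq])

theorem arr_inr (Y Z : Ty Γ) (σ : Δ ⟶ Γ ▹ Y) :
    Arr (isInc0 Y) (Z ◂ p _) ◂ (σ ≫ inrMap (UnitTy Γ) Y) = Arr (EmptyTy Δ) (Z ◂ (σ ≫ p _)) :=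
  Arr_sub_eq _ (by rw [← tySub_tySub, isInc0_inr, EmptyTy_sub]) (by simp [inrMap, cons_eq])

theorem leftAt_val (Y : Ty Γ) (σ : Δ ⟶ Γ ▹ UnitTy Γ) :
    (leftAt Y (σ ≫ p _)).1 = q _ ◃ (σ ≫ inlMap (UnitTy Γ) Y) := by
  rw [FibHom.inlMap_eq, comp_pair, pair_q, FibHom.nat]
  exact FibHom.map_congr (FibHom.inl (UnitTy Γ) Y) rfl
    (star_eq (σ := σ ≫ p _) ((HasUnit.star _).2.trans (UnitTy_sub _).symm)
      (by rw [ty_sub, ty_q, tySub_tySub])) _ _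

theorem rightAt_val (Y : Ty Γ) (σ : Δ ⟶ Γ ▹ Y) (h) :
    (rightAt Y (σ ≫ p _) (q Y ◃ σ) h).1 = q _ ◃ (σ ≫ inrMap (UnitTy Γ) Y) := by
  rw [FibHom.inrMap_eq, comp_pair, pair_q, FibHom.nat]
  rfl

theorem split_merge (Y Z : Ty Γ) : (mergeHom Y Z).comp (splitHom Y Z) = FibHom.id _ := by
  suffices h : (mergeCase Y Z).comp ((splitHom Y Z).sub (p _)) = FibHom.mkPair _ _ by
    have h1 : (mergeHom Y Z).comp (splitHom Y Z) =
      FibHom.uncurry ((mergeCase Y Z).comp ((splitHom Y Z).sub (p _))) := FibHom.ext fun σ t h =>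
        FibHom.map_congr (splitHom Y Z) (by rw [cons_eq, pair_p]) rfl _ _
    rw [h1, h]
    exact FibHom.uncurry_curry (FibHom.id (SplitTy Y Z))
  refine FibHom.caseHom_ext _ _ (fun {Δ} σ k h => ?_) fun {Δ} σ k h => ?_
  · have h' := h.trans (tySub_tySub _ _ _).symm
    have e := mergeCase_inl Y Z σ k h h'
    refine (FibHom.map_congr (splitHom Y Z) (σ' := σ ≫ p _) ?_ e _ (FibHom.ty_map _ _ _ _)).trans ?_
    · simp [inlMap, cons_eq]
    · refine (splitHom_inl _ _ _ _ _ _).trans ?_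
      refine dpairAt_congr (by simp [inlMap, cons_eq]) ?_ ?_
      · exact (leftAt_val Y σ)
      · have k' := h'.trans ((tySub_tySub _ _ _).trans (arr_inl Y Z σ))
        have hk := congrArg Tm.val (FibHom.toFun_ofFun ⟨k, k'⟩)
        refine Eq.trans ?_ hk
        exact FibHom.toFun_congr (isInc0_leftAt Y _) fun ρ x _ hx =>
          (evalLeft_map Y Z σ k h' ⟨k, k'⟩ rfl ρ x hx).symm
  · have h' := h.trans (tySub_tySub _ _ _).symm
    have e := mergeCase_inr Y Z σ k h (by simp)
    refine (FibHom.map_congr (splitHom Y Z) (σ' := σ ≫ p _) ?_ e _ (FibHom.ty_map _ _ _ _)).trans ?_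
    · simp [inrMap, cons_eq]
    · refine (splitHom_inr _ _ _ _ _ _).trans ?_
      refine dpairAt_congr (by simp [inrMap, cons_eq]) ?_ ?_
      · exact rightAt_val Y σ _
      · have k' := h.trans (arr_inr Y Z σ)
        have hk := congrArg Tm.val (FibHom.toFun_ofFun ⟨k, k'⟩)
        refine Eq.trans ?_ hk
        exact FibHom.empty_toFun (isInc0_rightAt Y _ _ _) rfl _ _

end Split

section SplitNat

variable {C : Type u} [Category.{v} C] [NaturalModel.{w} C] [HasPi C] [HasSigma C] [HasUnit C]
  [HasEmpty C] [HasSumTy C] [ExtensiveCoproducts C] {Γ Δ Θ : C}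

theorem sumUnit_sub (Y : Ty Γ) (s : Δ ⟶ Γ) :
    SumTy (UnitTy Γ) Y ◂ s = SumTy (UnitTy Δ) (Y ◂ s) := by rw [SumTy_sub, UnitTy_sub]

theorem sumUnit_sub_sub (Y : Ty Γ) (s : Δ ⟶ Γ) (ρ : Θ ⟶ Δ) :
    SumTy (UnitTy Γ) Y ◂ (ρ ≫ s) = SumTy (UnitTy Δ) (Y ◂ s) ◂ ρ := by
  rw [← tySub_tySub, sumUnit_sub]

theorem isInc0_base (Y : Ty Γ) (s : Δ ⟶ Γ) (ρ : Θ ⟶ Δ) (v : Tm (SumTy (UnitTy Γ) Y ◂ (ρ ≫ s)))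
    (v' : Tm (SumTy (UnitTy Δ) (Y ◂ s) ◂ ρ)) (hv : v.1 = v'.1) :
    isInc0 Y ◂ cons (ρ ≫ s) v = isInc0 (Y ◂ s) ◂ cons ρ v' := by
  rw [← isInc0_sub Y s (sumUnit_sub Y s), tySub_tySub]
  refine congrArg (isInc0 Y ◂ ·) ?_
  rw [cons_eq, cons_eq, liftTo_eq, comp_pair]
  exact pair_congr (by simp) (by simpa using hv) _ _

theorem splitSnd_sub' (Y Z : Ty Γ) (σ : Δ ⟶ Γ) (d : Term Δ) (h) (τ : Θ ⟶ Δ) {σ' : Θ ⟶ Γ}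
    (hσ : σ' = τ ≫ σ) (h') {Ξ : C} (ρ : Ξ ⟶ Θ) (x : Term Ξ) (k k') :
    (splitSnd Y Z σ' (d ◃ τ) h').map ρ x k = (splitSnd Y Z σ d h).map (ρ ≫ τ) x k' := by
  subst hσ; exact splitSnd_sub Y Z σ d h τ h' ρ x k k'

theorem FibHom.empty_map₂ {E E' D : Ty Γ} (hE : E = EmptyTy Γ) (hE' : E' = EmptyTy Γ)
    (f : FibHom E D) (g : FibHom E' D) (σ : Δ ⟶ Γ) (x : Term Δ) (h h') :
    f.map σ x h = g.map σ x h' := by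
  subst hE hE'; rw [FibHom.empty_uniq rfl f g]

variable (Y Z : Ty Γ) (s : Δ ⟶ Γ) {Z' : Ty Δ} (h : FibHom (Z ◂ s) Z')

/-- The action of a substitution and of a morphism on elements of `SplitTy`. -/
def splitMap : FibHom (SplitTy Y Z ◂ s) (SplitTy (Y ◂ s) Z') where
  map ρ d k := (splitMk ρ
    ((splitFst Y Z (ρ ≫ s) d (k.trans (tySub_tySub _ _ _))).cast (sumUnit_sub_sub Y s ρ))
    (((splitSnd Y Z (ρ ≫ s) d (k.trans (tySub_tySub _ _ _))).cast (isInc0_base Y s ρ _ _ rfl)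
      (tySub_tySub _ _ _).symm).comp (h.sub ρ))).1
  ty_map ρ d k := Tm.prop _
  nat ρ d k τ := by
    refine splitMk_sub _ _ _ _ _ _ ?_ fun υ x e e' => ?_
    · refine (splitFst_sub Y Z (ρ ≫ s) d (k.trans (tySub_tySub _ _ _)) τ ?_).trans ?_
      · exact (comp_pair_ty' k τ).trans (by simp)
      · exact splitFst_congr (by simp) rfl _ _
    · refine h.map_congr (by simp) ?_ _ _
      exact (splitSnd_sub' Y Z (ρ ≫ s) d _ τ (Category.assoc _ _ _) _ υ x _ _).symm

theorem splitMap_mk (ρ : Θ ⟶ Δ) (v : Tm (SumTy (UnitTy Γ) Y ◂ (ρ ≫ s)))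
    (k : FibHom (isInc0 Y ◂ cons (ρ ≫ s) v) (Z ◂ (ρ ≫ s))) (e)
    (v' : Tm (SumTy (UnitTy Δ) (Y ◂ s) ◂ ρ)) (k' : FibHom (isInc0 (Y ◂ s) ◂ cons ρ v') (Z' ◂ ρ))
    (hv : v.1 = v'.1)
    (hk : ∀ {Ξ : C} (τ : Ξ ⟶ Θ) (x : Term Ξ) (e₁ e₂ e₃),
      h.map (τ ≫ ρ) (k.map τ x e₁) e₂ = k'.map τ x e₃) :
    (splitMap Y Z s h).map ρ (splitMk (ρ ≫ s) v k).1 e = (splitMk ρ v' k').1 := by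
  refine splitMk_congr rfl ?_ fun τ x e₁ e₂ => ?_
  · exact (congrArg Tm.val (splitFst_mk (ρ ≫ s) v k _)).trans hv
  · have e₃ := e₂.trans (congrArg (· ◂ τ) (isInc0_base Y s ρ v v' hv).symm)
    refine (FibHom.map_congr h rfl (splitSnd_mk (ρ ≫ s) v k _ τ x _ e₃) _ ?_).trans
      (hk τ x _ ?_ _)
    all_goals exact (FibHom.ty_map _ _ _ _).trans (by simp)

theorem splitHom_nat {S : Ty Δ} (hS : S = SumTy Z Y ◂ s) (T : FibHom S (SumTy Z' (Y ◂ s)))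
    (hl : ∀ {Θ : C} (ρ : Θ ⟶ Δ) (z : Term Θ) (e e' e''),
      T.map ρ ((FibHom.inl (Z ◂ s) (Y ◂ s)).map ρ z e) e' =
        (FibHom.inl Z' (Y ◂ s)).map ρ (h.map ρ z e) e'')
    (hr : ∀ {Θ : C} (ρ : Θ ⟶ Δ) (y : Term Θ) (e e'),
      T.map ρ ((FibHom.inr (Z ◂ s) (Y ◂ s)).map ρ y e) e' = (FibHom.inr Z' (Y ◂ s)).map ρ y e)
    (ρ : Θ ⟶ Δ) (d : Term Θ) (e e' e'' e₃) :
    (splitMap Y Z s h).map ρ ((splitHom Y Z).map (ρ ≫ s) d e) e' =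
      (splitHom (Y ◂ s) Z').map ρ (T.map ρ d e'') e₃ := by
  subst hS
  have := FibHom.sum_ext (SumTy_sub Z Y s) (((splitHom Y Z).sub s).comp (splitMap Y Z s h))
    (T.comp (splitHom (Y ◂ s) Z')) (fun {Θ} ρ z e e' => ?_) (fun {Θ} ρ y e e' => ?_)
  · exact congrArg (fun f : FibHom (SumTy Z Y ◂ s) _ => f.map ρ d e'') this
  · have e₁ : ty z = Z ◂ (ρ ≫ s) := e.trans (tySub_tySub _ _ _)
    have h1 : (splitHom Y Z).map (ρ ≫ s) ((FibHom.inl (Z ◂ s) (Y ◂ s)).map ρ z e)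
      (e'.trans (tySub_tySub _ _ _)) = _ := (FibHom.map_congr (splitHom Y Z) rfl
        (FibHom.inl_sub Z Y s ρ z e e₁) _ (FibHom.ty_map _ _ _ _)).trans
          (splitHom_inl Y Z (ρ ≫ s) z e₁ _)
    have h2 := (FibHom.map_congr (splitHom (Y ◂ s) Z') rfl
        (hl ρ z e e' (FibHom.ty_map _ _ _ _)) (FibHom.ty_map _ _ _ _) (FibHom.ty_map _ _ _ _)).trans
          (splitHom_inl (Y ◂ s) Z' ρ _ (FibHom.ty_map _ _ _ _) _)
    have ek := (Tm.prop (splitMk (ρ ≫ s) (leftAt Y (ρ ≫ s)) (FibHom.const _ ⟨z, e₁⟩))).trans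
      (tySub_tySub (SplitTy Y Z) s ρ).symm
    refine Eq.trans ?_ h2.symm
    refine (FibHom.map_congr (splitMap Y Z s h) rfl h1 ((congrArg ty h1).trans ek) ek).trans
      (splitMap_mk Y Z s h ρ _ _ ek _ _ ?_ ?_)
    · exact (FibHom.inl_sub _ _ _ _ _ ((HasUnit.star _).2.trans (by simp [UnitTy_sub])) _).symm.trans
        (FibHom.inl_map_congr (UnitTy_sub s) rfl _ _ _ _)
    · exact fun τ x _ _ _ => (h.nat _ _ _ _).symm
  · have e₁ : ty y = Y ◂ (ρ ≫ s) := e.trans (tySub_tySub _ _ _)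
    have h1 : (splitHom Y Z).map (ρ ≫ s) ((FibHom.inr (Z ◂ s) (Y ◂ s)).map ρ y e)
      (e'.trans (tySub_tySub _ _ _)) = _ := (FibHom.map_congr (splitHom Y Z) rfl
        (FibHom.inr_sub Z Y s ρ y e e₁) _ (FibHom.ty_map _ _ _ _)).trans
          (splitHom_inr Y Z (ρ ≫ s) y e₁ _)
    have h2 := (FibHom.map_congr (splitHom (Y ◂ s) Z') rfl
        (hr ρ y e e') (FibHom.ty_map _ _ _ _) (FibHom.ty_map _ _ _ _)).trans
          (splitHom_inr (Y ◂ s) Z' ρ y e (FibHom.ty_map _ _ _ _))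
    have ek := (Tm.prop (splitMk (ρ ≫ s) (rightAt Y (ρ ≫ s) y e₁) ((FibHom.empty (Z ◂ (ρ ≫ s))).cast
      (isInc0_rightAt Y (ρ ≫ s) y e₁).symm rfl))).trans (tySub_tySub (SplitTy Y Z) s ρ).symm
    refine Eq.trans ?_ h2.symm
    refine (FibHom.map_congr (splitMap Y Z s h) rfl h1 ((congrArg ty h1).trans ek) ek).trans
      (splitMap_mk Y Z s h ρ _ _ ek _ _ ?_ ?_)
    · exact (FibHom.inr_sub _ _ _ _ _ (by rw [e₁, tySub_tySub]) _).symm.trans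
        (FibHom.inr_map_congr (UnitTy_sub s) rfl _ _ _ _)
    · intro Ξ τ x k₁ k₂ k₃
      exact FibHom.empty_map₂ (isInc0_rightAt Y (ρ ≫ s) y e₁) (isInc0_rightAt (Y ◂ s) ρ y e)
        (((FibHom.empty (Z ◂ (ρ ≫ s))).cast (isInc0_rightAt Y (ρ ≫ s) y e₁).symm
          (tySub_tySub Z s ρ).symm).comp (h.sub ρ))
        ((FibHom.empty (Z' ◂ ρ)).cast (isInc0_rightAt (Y ◂ s) ρ y e).symm rfl) τ x k₁ k₃

end SplitNat

section Raw

variable {C : Type u} [Category.{v} C] [NaturalModel.{w} C] [HasPi C] [HasSigma C] [HasUnit C]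
  [HasEmpty C] [HasSumTy C] [ExtensiveCoproducts C] {Γ Δ Θ : C}

theorem lift_p (σ : Δ ⟶ Γ) (A : Ty Γ) : lift σ A ≫ p A = p _ ≫ σ := by rw [lift_eq, pair_p]

theorem fstAt_congr {A : Ty Γ} {B : Ty (Γ ▹ A)} {σ σ' : Δ ⟶ Γ} (hσ : σ = σ') {t t' : Term Δ}
    (ht : t = t') (h h') : (fstAt σ A B t h).1 = (fstAt σ' A B t' h').1 := by
  subst hσ ht; rfl

theorem sndAt_congr {A : Ty Γ} {B : Ty (Γ ▹ A)} {σ σ' : Δ ⟶ Γ} (hσ : σ = σ') {t t' : Term Δ}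
    (ht : t = t') (h h') : (sndAt σ A B t h).1 = (sndAt σ' A B t' h').1 := by
  subst hσ ht; rfl

/-- The pairs of an `a : S` and of an `x : X a` with `u a x` in the left summand of `1 + Y a`. -/
def posOf (S : Ty Γ) (Y X : Ty (Γ ▹ S)) (u : Tm (SumTy (UnitTy _) Y ◂ p X)) : Ty Γ :=
  Sig S (Sig X (isInc0 Y ◂ cons (p X) u))

section Defs
variable {S P : Ty Γ} {Y X : Ty (Γ ▹ S)}

/-- The element of `SplitTy` given by a morphism into `P + Y`. -/
def toSplit (f : FibHom X (SumTy (P ◂ p S) Y)) : Tm (SplitTy Y (P ◂ p S) ◂ p X) :=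
  (f.comp (splitHom Y (P ◂ p S))).toTm

/-- The part of a morphism into `P + Y` that remembers `Y`. -/
def splitU (f : FibHom X (SumTy (P ◂ p S) Y)) : Tm (SumTy (UnitTy _) Y ◂ p X) :=
  splitFst Y (P ◂ p S) (p X) (toSplit f).1 (toSplit f).2

/-- The part of a morphism into `P + Y` with values in `P`. -/
def splitG (f : FibHom X (SumTy (P ◂ p S) Y)) : FibHom (posOf S Y X (splitU f)) P :=
  (splitSnd Y (P ◂ p S) (p X) (toSplit f).1 (toSplit f).2).uncurry.uncurry

/-- The morphism into `P + Y` obtained by gluing its two parts. -/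
def mergeUG (u : Tm (SumTy (UnitTy _) Y ◂ p X)) (g : FibHom (posOf S Y X u) P) :
    FibHom X (SumTy (P ◂ p S) Y) :=
  (FibHom.ofTm (splitMk (p X) u g.curry.curry)).comp (mergeHom Y (P ◂ p S))

theorem merge_splitUG (f : FibHom X (SumTy (P ◂ p S) Y)) : mergeUG (splitU f) (splitG f) = f := by
  have h : splitMk (p X) (splitU f) (splitG f).curry.curry = toSplit f := by
    refine Tm.ext (Eq.trans ?_ (splitMk_eta (p X) (toSplit f).1 (toSplit f).2))
    have h1 := FibHom.curry_uncurry (splitSnd Y (P ◂ p S) (p X) (toSplit f).1 (toSplit f).2).uncurry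
    have h2 := FibHom.curry_uncurry (splitSnd Y (P ◂ p S) (p X) (toSplit f).1 (toSplit f).2)
    exact congrArg (fun k => (splitMk (p X) (splitU f) k).1) ((congrArg FibHom.curry h1).trans h2)
  have h' : FibHom.ofTm (toSplit f) = f.comp (splitHom Y (P ◂ p S)) :=
    (FibHom.equiv _ _).left_inv _
  rw [mergeUG, h, h']
  exact congrArg (fun g => f.comp g) (merge_split Y (P ◂ p S))

theorem toSplit_merge (u : Tm (SumTy (UnitTy _) Y ◂ p X)) (g : FibHom (posOf S Y X u) P) :
    toSplit (mergeUG u g) = splitMk (p X) u g.curry.curry := by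
  have : (mergeUG u g).comp (splitHom Y (P ◂ p S)) =
      FibHom.ofTm (splitMk (p X) u g.curry.curry) :=
    congrArg (fun k => (FibHom.ofTm (splitMk (p X) u g.curry.curry)).comp k)
      (split_merge Y (P ◂ p S))
  rw [toSplit, this]
  exact (FibHom.equiv _ _).right_inv _

theorem splitU_merge (u : Tm (SumTy (UnitTy _) Y ◂ p X)) (g : FibHom (posOf S Y X u) P) :
    splitU (mergeUG u g) = u :=
  Tm.ext ((splitFst_congr rfl (congrArg Tm.val (toSplit_merge u g)) _ (Tm.prop _)).trans
    (congrArg Tm.val (splitFst_mk _ _ _ _)))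

theorem uncurry_congr {B B' : Ty (Γ ▹ S ▹ X)} (hB : B = B')
    {f : FibHom B (P ◂ p S ◂ p X)} {f' : FibHom B' (P ◂ p S ◂ p X)}
    (hf : ∀ {Δ : C} (σ : Δ ⟶ Γ ▹ S ▹ X) (x : Term Δ) (h h'), f.map σ x h = f'.map σ x h')
    (σ : Δ ⟶ Γ) (t : Term Δ) (h h') :
    f.uncurry.uncurry.map σ t h = f'.uncurry.uncurry.map σ t h' := by
  subst hB
  obtain rfl : f = f' := FibHom.ext fun σ x h => hf σ x h h
  rfl

theorem splitG_merge (u : Tm (SumTy (UnitTy _) Y ◂ p X)) (g : FibHom (posOf S Y X u) P)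
    (σ : Δ ⟶ Γ) (t : Term Δ) (h h') : (splitG (mergeUG u g)).map σ t h = g.map σ t h' := by
  have key : ∀ (d : Tm (SplitTy Y (P ◂ p S) ◂ p X)) (_ : d = splitMk (p X) u g.curry.curry) (h),
      (splitSnd Y (P ◂ p S) (p X) d.1 d.2).uncurry.uncurry.map σ t h = g.map σ t h' := by
    rintro _ rfl h
    have e : g.curry.curry.uncurry.uncurry = g := by
      rw [FibHom.uncurry_curry]; exact FibHom.uncurry_curry g
    refine Eq.trans ?_ (congrArg (fun k => k.map σ t h') e)
    exact uncurry_congr (congrArg (fun v => isInc0 Y ◂ cons (p X) v) (splitFst_mk _ _ _ _))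
      (fun σ x h h' => splitSnd_mk (p X) u g.curry.curry _ σ x h h') σ t _ _
  exact key _ (toSplit_merge u g) h

theorem splitU_congr {X' : Ty (Γ ▹ S)} {f : FibHom X (SumTy (P ◂ p S) Y)}
    {f' : FibHom X' (SumTy (P ◂ p S) Y)} (hX : X = X')
    (hf : ∀ {Δ : C} (σ : Δ ⟶ Γ ▹ S) (x : Term Δ) (h h'), f.map σ x h = f'.map σ x h') :
    (lam (splitU f)).1 = (lam (splitU f')).1 := by
  subst hX
  obtain rfl : f = f' := FibHom.ext fun σ x h => hf σ x h h
  rfl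

theorem splitG_congr {X' : Ty (Γ ▹ S)} {f : FibHom X (SumTy (P ◂ p S) Y)}
    {f' : FibHom X' (SumTy (P ◂ p S) Y)} (hX : X = X')
    (hf : ∀ {Δ : C} (σ : Δ ⟶ Γ ▹ S) (x : Term Δ) (h h'), f.map σ x h = f'.map σ x h')
    (σ : Δ ⟶ Γ) (t : Term Δ) (h h') : (splitG f).map σ t h = (splitG f').map σ t h' := by
  subst hX
  obtain rfl : f = f' := FibHom.ext fun σ x h => hf σ x h h
  rfl

theorem mergeUG_congr {X' : Ty (Γ ▹ S)} (hX : X = X') {u : Tm (SumTy (UnitTy _) Y ◂ p X)}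
    {u' : Tm (SumTy (UnitTy _) Y ◂ p X')} (hu : (lam u).1 = (lam u').1) {g : FibHom (posOf S Y X u) P}
    {g' : FibHom (posOf S Y X' u') P}
    (hg : ∀ {Δ : C} (σ : Δ ⟶ Γ) (t : Term Δ) (h h'), g.map σ t h = g'.map σ t h')
    (σ : Δ ⟶ Γ ▹ S) (x : Term Δ) (h h') :
    (mergeUG u g).map σ x h = (mergeUG u' g').map σ x h' := by
  subst hX
  obtain rfl : u = u' := by rw [← app_lam u, Tm.ext hu, app_lam]
  obtain rfl : g = g' := FibHom.ext fun σ x h => hg σ x h h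
  rfl

end Defs

section Nat
variable {S P : Ty Γ} {Y X : Ty (Γ ▹ S)} (s : Δ ⟶ Γ) {P' : Ty Δ} (h : FibHom (P ◂ s) P')
  {T : FibHom (SumTy (P ◂ p S) Y ◂ lift s S) (SumTy (P' ◂ p _) (Y ◂ lift s S))}
  {f : FibHom X (SumTy (P ◂ p S) Y)}
  {f' : FibHom (X ◂ lift s S) (SumTy (P' ◂ p (S ◂ s)) (Y ◂ lift s S))}

theorem splitFst_map (Y Z : Ty Γ) (s : Δ ⟶ Γ) {Z' : Ty Δ} (h : FibHom (Z ◂ s) Z') (ρ : Θ ⟶ Δ)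
    (d : Term Θ) (e e' e'') :
    (splitFst (Y ◂ s) Z' ρ ((splitMap Y Z s h).map ρ d e) e').1 =
      (splitFst Y Z (ρ ≫ s) d e'').1 :=
  congrArg Tm.val (splitFst_mk _ _ _ _)

theorem splitSnd_map (Y Z : Ty Γ) (s : Δ ⟶ Γ) {Z' : Ty Δ} (h : FibHom (Z ◂ s) Z') (ρ : Θ ⟶ Δ)
    (d : Term Θ) (e e' e'') {Ξ : C} (τ : Ξ ⟶ Θ) (x : Term Ξ) (k k' k'') :
    (splitSnd (Y ◂ s) Z' ρ ((splitMap Y Z s h).map ρ d e) e').map τ x k =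
      h.map (τ ≫ ρ) ((splitSnd Y Z (ρ ≫ s) d e'').map τ x k') k'' :=
  splitSnd_mk ρ _ _ e' τ x k (k'.trans (congrArg (· ◂ τ) (isInc0_base Y s ρ _ _ rfl)))

/-- A morphism over a context, seen over the extension of the context by a type. -/
def liftHom : FibHom (P ◂ p S ◂ lift s S) (P' ◂ p (S ◂ s)) :=
  (h.sub (p (S ◂ s))).cast (by simp [lift_eq]) rfl

theorem toSplit_nat
    (hl : ∀ {Θ : C} (ρ : Θ ⟶ Δ ▹ (S ◂ s)) (z : Term Θ) (e e' e''),
      T.map ρ ((FibHom.inl (P ◂ p S ◂ lift s S) (Y ◂ lift s S)).map ρ z e) e' =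
        (FibHom.inl (P' ◂ p _) (Y ◂ lift s S)).map ρ ((liftHom s h).map ρ z e) e'')
    (hr : ∀ {Θ : C} (ρ : Θ ⟶ Δ ▹ (S ◂ s)) (y : Term Θ) (e e'),
      T.map ρ ((FibHom.inr (P ◂ p S ◂ lift s S) (Y ◂ lift s S)).map ρ y e) e' =
        (FibHom.inr (P' ◂ p _) (Y ◂ lift s S)).map ρ y e)
    (hf : ∀ {Θ : C} (ρ : Θ ⟶ Δ ▹ (S ◂ s)) (x : Term Θ) (e e' e''),
      f'.map ρ x e = T.map ρ (f.map (ρ ≫ lift s S) x e') e'') (e) :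
    (toSplit f').1 = (splitMap Y (P ◂ p S) (lift s S) (liftHom s h)).map (p _)
      ((toSplit f).1 ◃ lift (lift s S) X) e := by
  have e₁ : (toSplit f).1 ◃ lift (lift s S) X = (splitHom Y (P ◂ p S)).map (p _ ≫ lift s S)
      (f.map (p _ ≫ lift s S) (q (X ◂ lift s S)) (by simp)) (by rw [FibHom.ty_map]) := by
    rw [toSplit, FibHom.toTm, FibHom.nat]
    exact FibHom.map_congr _ (by simp [lift_eq]) (by simp [lift_eq]) _ _
  have e₂ : ty (T.map (p _) (f.map (p (X ◂ lift s S) ≫ lift s S) (q (X ◂ lift s S)) (by simp))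
      (by rw [FibHom.ty_map, tySub_tySub])) = SumTy (P' ◂ p (S ◂ s)) (Y ◂ lift s S) ◂ p _ :=
    FibHom.ty_map _ _ _ _
  refine Eq.trans ?_ ((splitHom_nat Y (P ◂ p S) (lift s S) (liftHom s h) rfl T hl hr (p _) _ _
    ((congrArg ty e₁).symm.trans e) _ e₂).symm.trans ?_)
  · exact FibHom.map_congr (splitHom _ _) rfl (hf (p _) (q _) _ _ _) _ _
  · exact FibHom.map_congr _ rfl e₁.symm _ _

theorem splitU_nat
    (hl : ∀ {Θ : C} (ρ : Θ ⟶ Δ ▹ (S ◂ s)) (z : Term Θ) (e e' e''),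
      T.map ρ ((FibHom.inl (P ◂ p S ◂ lift s S) (Y ◂ lift s S)).map ρ z e) e' =
        (FibHom.inl (P' ◂ p _) (Y ◂ lift s S)).map ρ ((liftHom s h).map ρ z e) e'')
    (hr : ∀ {Θ : C} (ρ : Θ ⟶ Δ ▹ (S ◂ s)) (y : Term Θ) (e e'),
      T.map ρ ((FibHom.inr (P ◂ p S ◂ lift s S) (Y ◂ lift s S)).map ρ y e) e' =
        (FibHom.inr (P' ◂ p _) (Y ◂ lift s S)).map ρ y e)
    (hf : ∀ {Θ : C} (ρ : Θ ⟶ Δ ▹ (S ◂ s)) (x : Term Θ) (e e' e''),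
      f'.map ρ x e = T.map ρ (f.map (ρ ≫ lift s S) x e') e'') :
    (splitU f).1 ◃ lift (lift s S) X = (splitU f').1 := by
  have eL : lift (lift s S) X ≫ p X = p _ ≫ lift s S := lift_p _ _
  have e₁ : ty ((toSplit f).1 ◃ lift (lift s S) X) =
      SplitTy Y (P ◂ p S) ◂ (lift (lift s S) X ≫ p X) := comp_pair_ty _ (toSplit f).2
  have e₂ := e₁.trans (congrArg (SplitTy Y (P ◂ p S) ◂ ·) eL)
  have e₃ := e₂.trans (tySub_tySub _ _ _).symm
  have e := toSplit_nat s h hl hr hf e₃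
  refine (splitFst_sub Y (P ◂ p S) (p X) _ (toSplit f).2 _ e₁).trans ?_
  refine (splitFst_congr eL rfl e₁ e₂).trans ?_
  refine (splitFst_map Y (P ◂ p S) (lift s S) (liftHom s h) (p _) _ e₃
    (FibHom.ty_map _ _ _ _) _).symm.trans ?_
  exact splitFst_congr rfl e.symm _ _

theorem fstAt_base' {A : Ty Γ} {B : Ty (Γ ▹ A)} (σ : Δ ⟶ Γ) {A' : Ty Δ} {B' : Ty (Δ ▹ A')}
    (hA : A ◂ σ = A') (hB : B ◂ liftTo σ hA = B') (ρ : Θ ⟶ Δ) (t : Term Θ) (h h') :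
    (fstAt ρ A' B' t h).1 = (fstAt (ρ ≫ σ) A B t h').1 := by
  subst hA hB; exact fstAt_base σ A B ρ t h h'

theorem sndAt_base' {A : Ty Γ} {B : Ty (Γ ▹ A)} (σ : Δ ⟶ Γ) {A' : Ty Δ} {B' : Ty (Δ ▹ A')}
    (hA : A ◂ σ = A') (hB : B ◂ liftTo σ hA = B') (ρ : Θ ⟶ Δ) (t : Term Θ) (h h') :
    (sndAt ρ A' B' t h).1 = (sndAt (ρ ≫ σ) A B t h').1 := by
  subst hA hB; exact sndAt_base σ A B ρ t h h'

theorem isInc0_cons_sub {S : Ty Γ} {Y X : Ty (Γ ▹ S)} (s : Δ ⟶ Γ)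
    (u : Tm (SumTy (UnitTy _) Y ◂ p X))
    (u' : Tm (SumTy (UnitTy _) (Y ◂ lift s S) ◂ p (X ◂ lift s S)))
    (hu : u.1 ◃ lift (lift s S) X = u'.1) :
    isInc0 Y ◂ cons (p X) u ◂ lift (lift s S) X = isInc0 (Y ◂ lift s S) ◂ cons (p _) u' := by
  have eL : lift (lift s S) X ≫ p X = p _ ≫ lift s S := lift_p _ _
  have e : ty (u.1 ◃ lift (lift s S) X) =
    SumTy (UnitTy _) Y ◂ (p (X ◂ lift s S) ≫ lift s S) := by
      rw [ty_sub, u.2, tySub_tySub, eL]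
  refine Eq.trans ?_ (isInc0_base Y (lift s S) (p _) ⟨_, e⟩ u' hu)
  rw [tySub_tySub, cons_eq, cons_eq, comp_pair]
  exact congrArg (isInc0 Y ◂ ·) (pair_congr eL rfl _ _)

theorem posOf_sub {S : Ty Γ} {Y X : Ty (Γ ▹ S)} (s : Δ ⟶ Γ) (u : Tm (SumTy (UnitTy _) Y ◂ p X))
    (u' : Tm (SumTy (UnitTy _) (Y ◂ lift s S) ◂ p (X ◂ lift s S)))
    (hu : u.1 ◃ lift (lift s S) X = u'.1) :
    posOf S Y X u ◂ s = posOf (S ◂ s) (Y ◂ lift s S) (X ◂ lift s S) u' :=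
  Sig_sub_eq s rfl (Sig_sub_eq _ rfl (isInc0_cons_sub s u u' hu))

theorem splitG_nat
    (hl : ∀ {Θ : C} (ρ : Θ ⟶ Δ ▹ (S ◂ s)) (z : Term Θ) (e e' e''),
      T.map ρ ((FibHom.inl (P ◂ p S ◂ lift s S) (Y ◂ lift s S)).map ρ z e) e' =
        (FibHom.inl (P' ◂ p _) (Y ◂ lift s S)).map ρ ((liftHom s h).map ρ z e) e'')
    (hr : ∀ {Θ : C} (ρ : Θ ⟶ Δ ▹ (S ◂ s)) (y : Term Θ) (e e'),
      T.map ρ ((FibHom.inr (P ◂ p S ◂ lift s S) (Y ◂ lift s S)).map ρ y e) e' =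
        (FibHom.inr (P' ◂ p _) (Y ◂ lift s S)).map ρ y e)
    (hf : ∀ {Θ : C} (ρ : Θ ⟶ Δ ▹ (S ◂ s)) (x : Term Θ) (e e' e''),
      f'.map ρ x e = T.map ρ (f.map (ρ ≫ lift s S) x e') e'') {Θ : C} (ρ : Θ ⟶ Δ) (t : Term Θ) (k k' k'') :
    (splitG f').map ρ t k = h.map ρ ((splitG f).map (ρ ≫ s) t k') k'' := by
  have hu := splitU_nat s h hl hr hf
  have hI := isInc0_cons_sub s (splitU f) (splitU f') hu
  have hB := Sig_sub_eq (lift s S) (rfl : X ◂ lift s S = X ◂ lift s S) hI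
  have f1 := fstAt_base' s (rfl : S ◂ s = S ◂ s) hB ρ t k k'
  have s1 := sndAt_base' s (rfl : S ◂ s = S ◂ s) hB ρ t k k'
  have c1 : cons ρ (fstAt ρ _ _ t k) ≫ lift s S = cons (ρ ≫ s) (fstAt (ρ ≫ s) _ _ t k') :=
    (cons_lift _ _ _).trans (cons_congr f1)
  have kb := (sndAt ρ (S ◂ s) _ t k).2.trans ((congrArg (· ◂ cons ρ (fstAt ρ _ _ t k)) hB).symm.trans
    (tySub_tySub _ _ _))
  have f2 := (fstAt_base' (lift s S) (rfl : X ◂ lift s S = X ◂ lift s S) hI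
    (cons ρ (fstAt ρ _ _ t k)) _ (sndAt ρ (S ◂ s) _ t k).2 kb).trans
      (fstAt_congr c1 s1 _ (sndAt (ρ ≫ s) S _ t k').2)
  have s2 := (sndAt_base' (lift s S) (rfl : X ◂ lift s S = X ◂ lift s S) hI
    (cons ρ (fstAt ρ _ _ t k)) _ (sndAt ρ (S ◂ s) _ t k).2 kb).trans
      (sndAt_congr c1 s1 _ (sndAt (ρ ≫ s) S _ t k').2)
  have c2 : cons (cons ρ (fstAt ρ _ _ t k)) (fstAt _ _ _ _ (sndAt ρ (S ◂ s) _ t k).2) ≫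
      lift (lift s S) X = cons (cons (ρ ≫ s) (fstAt (ρ ≫ s) _ _ t k'))
        (fstAt _ _ _ _ (sndAt (ρ ≫ s) S _ t k').2) :=
    (cons_lift _ _ _).trans (cons_congr f2 c1)
  have eL : lift (lift s S) X ≫ p X = p _ ≫ lift s S := lift_p _ _
  have e₁ : ty ((toSplit f).1 ◃ lift (lift s S) X) =
      SplitTy Y (P ◂ p S) ◂ (lift (lift s S) X ≫ p X) := comp_pair_ty _ (toSplit f).2
  have e₂ := e₁.trans (congrArg (SplitTy Y (P ◂ p S) ◂ ·) eL)
  have e₃ := e₂.trans (tySub_tySub _ _ _).symm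
  have e := toSplit_nat s h hl hr hf e₃
  have ki := (sndAt _ _ _ _ (sndAt ρ (S ◂ s) _ t k).2).2
  refine (splitSnd_congr rfl e (toSplit f').2 (FibHom.ty_map _ _ _ _) rfl rfl _ ?_).trans ?_
  · exact ki.trans (congrArg (· ◂ _) (congrArg (isInc0 _ ◂ ·)
      (cons_congr (splitFst_congr rfl e _ (FibHom.ty_map _ _ _ _)))))
  refine (splitSnd_map Y (P ◂ p S) (lift s S) (liftHom s h) (p _) _ e₃ _ e₂ _ _ _ ?_ ?_).trans ?_
  · refine ki.trans (congrArg (· ◂ _) (hI.symm.trans ((tySub_tySub _ _ _).trans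
      (congrArg (isInc0 _ ◂ ·) ?_))))
    rw [cons_eq, cons_eq, comp_pair]
    exact pair_congr eL ((splitFst_sub _ _ _ _ _ _ e₁).trans (splitFst_congr eL rfl _ _)) _ _
  · exact (FibHom.ty_map _ _ _ _).trans (by simp)
  refine FibHom.map_congr h ?_ ?_ _ _
  · simp [cons_eq]
  refine (splitSnd_sub' Y (P ◂ p S) (p X) (toSplit f).1 (toSplit f).2 (lift (lift s S) X) eL.symm
    e₂ _ _ _ ?_).trans ?_
  · exact ki.trans ((congrArg (· ◂ _) hI.symm).trans (tySub_tySub _ _ _))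
  · exact FibHom.map_congr _ c2 s2 _ _

end Nat

end Raw

section PiRaw

variable {C : Type u} [Category.{v} C] [NaturalModel.{w} C] {Γ Δ Θ : C}

theorem PTy.sub_sub (A : PTy Γ) (σ : Δ ⟶ Γ) (τ : Θ ⟶ Δ) : (A.sub σ).sub τ = A.sub (τ ≫ σ) :=
  PTy.ext (tySub_tySub _ _ _) fun _ _ _ _ => A.pos.obj_congr (Category.assoc _ _ _) rfl _ _

theorem PTy.sub_id (A : PTy Γ) : A.sub (𝟙 Γ) = A :=
  PTy.ext (tySub_id _) fun _ _ _ _ => A.pos.obj_congr (Category.comp_id _) rfl _ _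

theorem PTy.toTy_sub_eq {A : PTy Γ} (σ : Δ ⟶ Γ) {A' : PTy Δ} (hA : A.sub σ = A') :
    A.pos.toTy ◂ liftTo σ (congrArg PTy.shape hA) = A'.pos.toTy := by
  subst hA
  change A.pos.toTy ◂ liftTo σ (A' := A.shape ◂ σ) rfl = _
  rw [liftTo_eq, Fam.toTy_pair]
  rfl

theorem liftTo_comp (σ : Δ ⟶ Γ) (τ : Θ ⟶ Δ) {A : Ty Γ} {A' : Ty Δ} {A'' : Ty Θ} (h : A ◂ σ = A')
    (h' : A' ◂ τ = A'') (h'' : A ◂ (τ ≫ σ) = A'') :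
    liftTo τ h' ≫ liftTo σ h = liftTo (τ ≫ σ) h'' := by
  subst h h'
  simp [liftTo_eq]

theorem liftTo_id {A : Ty Γ} (h : A ◂ 𝟙 Γ = A) : liftTo (𝟙 Γ) h = 𝟙 _ := by
  simp [liftTo_eq]

variable [HasPi C] [HasSigma C] [HasUnit C] [HasEmpty C] [HasSumTy C] [ExtensiveCoproducts C]

/-- The type of functions `f̌ : Π a, B.pos a (f a) → 1 + A.pos a`, in context `f`. -/
def piFam (A : PTy Γ) (B : PTy (Γ ▹ A.shape)) : Ty (Γ ▹ Pi A.shape B.shape) :=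
  Pi (A.shape ◂ p _) (Arr
    (B.pos.obj (lift (p _) A.shape) (app ((var (Pi A.shape B.shape)).cast (Pi_sub _ _ _))).1
      (Tm.prop _))
    (SumTy (UnitTy _) (A.pos.toTy ◂ lift (p _) A.shape)))

theorem piFam_cons (A : PTy Γ) (B : PTy (Γ ▹ A.shape)) (s : Δ ⟶ Γ) {S : Ty Δ}
    (hS : A.shape ◂ s = S) (g : Tm (Pi A.shape B.shape ◂ s)) (b : Tm (B.shape ◂ liftTo s hS))
    (hg : g.1 = (lam b).1) :
    piFam A B ◂ cons s g = Pi S (Arr (B.pos.obj (liftTo s hS) b.1 b.2)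
      (SumTy (UnitTy _) (A.pos.toTy ◂ liftTo s hS))) := by
  have h : A.shape ◂ p (Pi A.shape B.shape) ◂ cons s g = S := by
    rw [← hS]; simp [cons_eq]
  have hl : liftTo (cons s g) h ≫ lift (p _) A.shape = liftTo s hS := by
    simp [liftTo_eq, lift_eq, cons_eq]
  refine Pi_sub_eq _ h (Arr_sub_eq _ ?_ ?_)
  · rw [B.pos.nat]
    refine B.pos.obj_congr hl ?_ _ _
    refine (app_sub_eq (cons s g) h (B' := B.shape ◂ liftTo s hS) ?_ (f' := lam b) ?_).trans
      (congrArg Tm.val (app_lam b))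
    · rw [tySub_tySub, hl]
    · simp [cons_eq, hg]
  · rw [SumTy_sub, UnitTy_sub, tySub_tySub, hl]

theorem piFam_inst (A : PTy Γ) (B : PTy (Γ ▹ A.shape)) (f : Tm (Pi A.shape B.shape)) :
    piFam A B ◂ inst f = Pi A.shape (Arr (B.posAt (app f).1 (app f).2)
      (SumTy (UnitTy _) A.pos.toTy)) := by
  have e := liftTo_id (tySub_id A.shape)
  rw [inst, piFam_cons A B (𝟙 Γ) (tySub_id A.shape) _
    ((app f).cast (by rw [e, tySub_id])) (by
      refine (congrArg Tm.val (lam_app f).symm).trans (lam_congr rfl))]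
  congr 2
  · exact B.pos.obj_congr e rfl _ _
  · rw [e, tySub_id]

theorem piFam_sub (A : PTy Γ) (B : PTy (Γ ▹ A.shape)) (s : Δ ⟶ Γ) :
    piFam A B ◂ liftTo s (Pi_sub A.shape B.shape s) = piFam (A.sub s) (B.sub (lift s A.shape)) := by
  have e := liftTo_comp s (p (Pi (A.shape ◂ s) (B.shape ◂ lift s A.shape))) (A := A.shape) rfl rfl
    (tySub_tySub _ _ _).symm
  rw [liftTo, piFam_cons A B _ (tySub_tySub _ _ _).symm _
    ((app ((var (Pi (A.shape ◂ s) (B.shape ◂ lift s A.shape))).cast (Pi_sub _ _ _))).cast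
      (by rw [← e, ← tySub_tySub]; rfl)) (by
      refine Eq.trans ?_ ((congrArg Tm.val (lam_app ((var (Pi (A.shape ◂ s)
        (B.shape ◂ lift s A.shape))).cast (Pi_sub _ _ _))).symm).trans (lam_congr rfl))
      rfl)]
  refine congrArg₂ (fun X Y => Pi (A.shape ◂ s ◂ p _) (Arr X (SumTy (UnitTy _) Y))) ?_ ?_
  · exact B.pos.obj_congr e.symm rfl _ _
  · rw [← e, ← tySub_tySub]
    exact congrArg (· ◂ _) (PTy.toTy_sub_eq s rfl)

/-- The shapes of a dependent product of polynomials. -/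
def PiShape (A : PTy Γ) (B : PTy (Γ ▹ A.shape)) : Ty Γ := Sig (Pi A.shape B.shape) (piFam A B)

theorem PiShape_sub (A : PTy Γ) (B : PTy (Γ ▹ A.shape)) (s : Δ ⟶ Γ) :
    PiShape A B ◂ s = PiShape (A.sub s) (B.sub (lift s A.shape)) :=
  Sig_sub_eq s (Pi_sub _ _ _) (piFam_sub A B s)

section Elements
variable {A : PTy Γ} {B : PTy (Γ ▹ A.shape)}

/-- The action on shapes of an element of a dependent product of polynomials. -/
def piBase (t : Tm (PiShape A B)) : Tm B.shape := app (fst t)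

/-- The action on positions of an element of a dependent product of polynomials. -/
def piDir (t : Tm (PiShape A B)) :
    Tm (SumTy (UnitTy _) A.pos.toTy ◂ p (B.posAt (piBase t).1 (piBase t).2)) :=
  app (app ((snd t).cast (piFam_inst A B _)))

/-- The element of a dependent product of polynomials with given actions. -/
def piMk (b : Tm B.shape) (u : Tm (SumTy (UnitTy _) A.pos.toTy ◂ p (B.posAt b.1 b.2))) :
    Tm (PiShape A B) :=
  dpair (lam b) ((lam (lam u)).cast (by
    rw [piFam_inst]
    exact congrArg (fun X => Pi A.shape (Arr X (SumTy (UnitTy _) A.pos.toTy)))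
      (PTy.posAt_congr rfl (congrArg Tm.val (app_lam b).symm) _ _)))

theorem piBase_mk (b : Tm B.shape)
    (u : Tm (SumTy (UnitTy _) A.pos.toTy ◂ p (B.posAt b.1 b.2))) : piBase (piMk b u) = b := by
  rw [piBase, piMk, fst_dpair, app_lam]

theorem lam_piDir (t : Tm (PiShape A B)) : (lam (lam (piDir t))).1 = (snd t).1 := by
  rw [piDir, lam_app, lam_app]; rfl

theorem piDir_mk (b : Tm B.shape)
    (u : Tm (SumTy (UnitTy _) A.pos.toTy ◂ p (B.posAt b.1 b.2))) :
    (lam (piDir (piMk b u))).1 = (lam u).1 := by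
  have h : (lam (lam (piDir (piMk b u)))).1 = (lam (lam u)).1 :=
    (lam_piDir _).trans (snd_dpair _ _)
  have := app_congr (congrArg (fun X => Arr X _)
    (PTy.posAt_congr rfl (congrArg Tm.val (piBase_mk b u)) _ _)) h
  exact (congrArg Tm.val (app_lam _)).symm.trans (this.trans (congrArg Tm.val (app_lam _)))

theorem piMk_eta (t : Tm (PiShape A B)) : piMk (piBase t) (piDir t) = t := by
  refine Eq.trans ?_ (dpair_eta t)
  have key : ∀ (f : Tm (Pi A.shape B.shape)) (_ : f = fst t) (x : Tm (piFam A B ◂ inst f))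
      (_ : x.1 = (snd t).1), dpair f x = dpair (fst t) (snd t) := by
    rintro _ rfl x hx
    rw [Tm.ext hx]
  exact key _ (lam_app _) _ (lam_piDir t)

theorem PiShape_sub_eq (s : Δ ⟶ Γ) {A' : PTy Δ} {B' : PTy (Δ ▹ A'.shape)} (hA : A.sub s = A')
    (hB : B.sub (liftTo s (congrArg PTy.shape hA)) = B') : PiShape A B ◂ s = PiShape A' B' := by
  subst hA hB; exact PiShape_sub A B s

variable (s : Δ ⟶ Γ)

theorem piBase_sub {t : Tm (PiShape A B)} {t' : Tm (PiShape (A.sub s) (B.sub (lift s A.shape)))}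
    (ht : t.1 ◃ s = t'.1) : (piBase t).1 ◃ lift s A.shape = (piBase t').1 :=
  app_sub_eq s rfl rfl (fst_sub_eq s (Pi_sub _ _ _) (piFam_sub A B s) ht)

theorem posAt_lift {b : Tm B.shape} {b' : Tm (B.sub (lift s A.shape)).shape}
    (hb : b.1 ◃ lift s A.shape = b'.1) :
    B.posAt b.1 b.2 ◂ lift s A.shape = (B.sub (lift s A.shape)).posAt b'.1 b'.2 := by
  have k := b'.2
  rw [PTy.posAt_sub B b.1 b.2 _ (by rw [hb]; exact k), PTy.sub_posAt]
  exact B.pos.obj_congr rfl hb _ _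

theorem arr_lift {b : Tm B.shape} {b' : Tm (B.sub (lift s A.shape)).shape}
    (hb : b.1 ◃ lift s A.shape = b'.1) :
    Arr (B.posAt b.1 b.2) (SumTy (UnitTy _) A.pos.toTy) ◂ lift s A.shape =
      Arr ((B.sub (lift s A.shape)).posAt b'.1 b'.2) (SumTy (UnitTy _) (A.sub s).pos.toTy) := by
  refine Arr_sub_eq _ (posAt_lift s hb) ?_
  rw [SumTy_sub, UnitTy_sub]
  exact congrArg _ (PTy.toTy_sub_eq s rfl)

theorem piDir_sub {t : Tm (PiShape A B)} {t' : Tm (PiShape (A.sub s) (B.sub (lift s A.shape)))}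
    (ht : t.1 ◃ s = t'.1) : (lam (piDir t)).1 ◃ lift s A.shape = (lam (piDir t')).1 := by
  have h : (snd t).1 ◃ s = (snd t').1 := snd_sub_eq s (Pi_sub _ _ _) (piFam_sub A B s) ht
  rw [piDir, piDir, lam_app, lam_app]
  exact app_sub_eq s rfl (arr_lift s (piBase_sub s ht)) h

theorem piMk_sub {b : Tm B.shape} {u : Tm (SumTy (UnitTy _) A.pos.toTy ◂ p (B.posAt b.1 b.2))}
    {b' : Tm (B.sub (lift s A.shape)).shape}
    {u' : Tm (SumTy (UnitTy _) (A.sub s).pos.toTy ◂ p ((B.sub (lift s A.shape)).posAt b'.1 b'.2))}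
    (hb : b.1 ◃ lift s A.shape = b'.1) (hu : (lam u).1 ◃ lift s A.shape = (lam u').1) :
    (piMk b u).1 ◃ s = (piMk (A := A.sub s) (B := B.sub (lift s A.shape)) b' u').1 :=
  dpair_sub_eq s (Pi_sub _ _ _) (piFam_sub A B s) (lam_sub_eq s rfl hb) (lam_sub_eq s rfl hu)

/-- The positions of a dependent product of polynomials. -/
def piPos (t : Tm (PiShape A B)) : Ty Γ :=
  posOf A.shape A.pos.toTy (B.posAt (piBase t).1 (piBase t).2) (piDir t)

end Elements

theorem posOf_sub_eq {S : Ty Γ} {Y X : Ty (Γ ▹ S)} (s : Δ ⟶ Γ) (u : Tm (SumTy (UnitTy _) Y ◂ p X))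
    {Y' X' : Ty (Δ ▹ (S ◂ s))} (u' : Tm (SumTy (UnitTy _) Y' ◂ p X')) (hY : Y ◂ lift s S = Y')
    (hX : X ◂ lift s S = X') (hu : (lam u).1 ◃ lift s S = (lam u').1) :
    posOf S Y X u ◂ s = posOf (S ◂ s) Y' X' u' := by
  subst hX hY
  refine posOf_sub s u u' ?_
  have h := app_sub_eq (lift s S) (B' := SumTy (UnitTy _) (Y ◂ lift s S) ◂ p (X ◂ lift s S))
    rfl (by
      rw [← UnitTy_sub (lift s S), ← SumTy_sub, tySub_tySub, tySub_tySub]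
      exact congrArg _ (lift_p _ _)) hu
  exact (congrArg (fun y => y.1 ◃ _) (app_lam u)).symm.trans (h.trans (congrArg Tm.val (app_lam u')))

theorem piPos_sub {A : PTy Γ} {B : PTy (Γ ▹ A.shape)} {t : Tm (PiShape A B)} (s : Δ ⟶ Γ)
    {t' : Tm (PiShape (A.sub s) (B.sub (lift s A.shape)))} (ht : t.1 ◃ s = t'.1) :
    piPos t ◂ s = piPos t' :=
  posOf_sub_eq s _ _ (PTy.toTy_sub_eq s rfl) (posAt_lift s (piBase_sub s ht)) (piDir_sub s ht)

theorem piPos_sub_eq {A : PTy Γ} {B : PTy (Γ ▹ A.shape)} {t : Tm (PiShape A B)} (s : Δ ⟶ Γ)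
    {A' : PTy Δ} {B' : PTy (Δ ▹ A'.shape)} (hA : A.sub s = A')
    (hB : B.sub (liftTo s (congrArg PTy.shape hA)) = B') {t' : Tm (PiShape A' B')}
    (ht : t.1 ◃ s = t'.1) : piPos t ◂ s = piPos t' := by
  subst hA hB; exact piPos_sub s ht

/-- Dependent products. The shapes are pairs of `f : Π a, B.shape a` and
`f̌ : Π a, B.pos a (f a) → 1 + A.pos a`, and the positions over them are the pairs of an `a` and of
a position `b` of `B` over `f a` with `f̌ a b` in the left summand. -/
def PPi (A : PTy Γ) (B : PTy (Γ ▹ A.shape)) : PTy Γ where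
  shape := PiShape A B
  pos :=
    { obj := fun σ t h => piPos (A := A.sub σ) (B := B.sub (lift σ A.shape))
        ⟨t, h.trans (PiShape_sub A B σ)⟩
      nat := fun σ _ _ τ => piPos_sub_eq τ (PTy.sub_sub A σ τ)
        ((PTy.sub_sub B _ _).trans (congrArg B.sub (liftTo_comp σ τ rfl _ rfl))) rfl }

theorem PPi_sub (A : PTy Γ) (B : PTy (Γ ▹ A.shape)) (s : Δ ⟶ Γ) :
    (PPi A B).sub s = PPi (A.sub s) (B.sub (lift s A.shape)) :=
  PTy.ext (PiShape_sub A B s) fun ρ t h h' => by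
    refine (tySub_id _).symm.trans (piPos_sub_eq (𝟙 _) ?_ ?_ (tmSub_id _))
    · exact (PTy.sub_id _).trans (PTy.sub_sub _ _ _).symm
    · refine (PTy.sub_sub B _ _).trans (Eq.trans ?_ (PTy.sub_sub B (lift s A.shape) _).symm)
      have e : A.shape ◂ (𝟙 _ ≫ ρ ≫ s) = A.shape ◂ s ◂ ρ := by simp
      refine congrArg B.sub ((liftTo_comp (ρ ≫ s) (𝟙 _) rfl ((tySub_id _).trans
        (tySub_tySub _ _ _).symm) e).trans ?_)
      refine Eq.trans ?_ (liftTo_comp s ρ rfl rfl (tySub_tySub _ _ _).symm).symm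
      simp [liftTo_eq]

theorem PPi_posAt {A : PTy Γ} {B : PTy (Γ ▹ A.shape)} (t : Tm (PiShape A B)) :
    (PPi A B).posAt t.1 t.2 = piPos t := by
  refine (tySub_id _).symm.trans (piPos_sub_eq (𝟙 _) ?_ ?_ (tmSub_id _))
  · exact (PTy.sub_id _).trans (PTy.sub_id _)
  · refine (PTy.sub_sub B _ _).trans (Eq.trans (congrArg B.sub ?_) (PTy.sub_id B))
    exact (liftTo_comp (𝟙 Γ) (𝟙 Γ) rfl ((tySub_id _).trans (tySub_id _))
      (by simp)).trans (by simp [liftTo_eq])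

theorem posOf_congr {S : Ty Γ} {Y X X' : Ty (Γ ▹ S)} (hX : X = X')
    {u : Tm (SumTy (UnitTy _) Y ◂ p X)} {u' : Tm (SumTy (UnitTy _) Y ◂ p X')}
    (hu : (lam u).1 = (lam u').1) : posOf S Y X u = posOf S Y X' u' := by
  subst hX
  obtain rfl : u = u' := by rw [← app_lam u, Tm.ext hu, app_lam]
  rfl

theorem PPi_posAt_mk {A : PTy Γ} {B : PTy (Γ ▹ A.shape)} (b : Tm B.shape)
    (u : Tm (SumTy (UnitTy _) A.pos.toTy ◂ p (B.posAt b.1 b.2))) :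
    (PPi A B).posAt (piMk b u).1 (piMk b u).2 =
      posOf A.shape A.pos.toTy (B.posAt b.1 b.2) u :=
  (PPi_posAt _).trans (posOf_congr (PTy.posAt_congr rfl (congrArg Tm.val (piBase_mk b u)) _ _)
    (piDir_mk b u))

end PiRaw

section Nat

variable {C : Type u} [Category.{v} C] [NaturalModel.{w} C] [HasPi C] [HasSigma C] [HasUnit C]
  [HasEmpty C] [HasSumTy C] [ExtensiveCoproducts C] {Γ Δ Θ : C} {S P : Ty Γ} {Y X : Ty (Γ ▹ S)}
  (s : Δ ⟶ Γ) {P' : Ty Δ} (h : FibHom (P ◂ s) P') {Y' X' : Ty (Δ ▹ (S ◂ s))}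
  {T : FibHom (SumTy (P ◂ p S) Y ◂ lift s S) (SumTy (P' ◂ p _) Y')}
  {f : FibHom X (SumTy (P ◂ p S) Y)} {f' : FibHom X' (SumTy (P' ◂ p (S ◂ s)) Y')}

theorem splitU_nat' (hY : Y ◂ lift s S = Y') (hX : X ◂ lift s S = X')
    (hl : ∀ {Θ : C} (ρ : Θ ⟶ Δ ▹ (S ◂ s)) (z : Term Θ) (e e' e''),
      T.map ρ ((FibHom.inl (P ◂ p S ◂ lift s S) (Y ◂ lift s S)).map ρ z e) e' =
        (FibHom.inl (P' ◂ p _) Y').map ρ ((liftHom s h).map ρ z e) e'')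
    (hr : ∀ {Θ : C} (ρ : Θ ⟶ Δ ▹ (S ◂ s)) (y : Term Θ) (e e' e''),
      T.map ρ ((FibHom.inr (P ◂ p S ◂ lift s S) (Y ◂ lift s S)).map ρ y e) e' =
        (FibHom.inr (P' ◂ p _) Y').map ρ y e'')
    (hf : ∀ {Θ : C} (ρ : Θ ⟶ Δ ▹ (S ◂ s)) (x : Term Θ) (e e' e''),
      f'.map ρ x e = T.map ρ (f.map (ρ ≫ lift s S) x e') e'') :
    (lam (splitU f)).1 ◃ lift s S = (lam (splitU f')).1 := by
  subst hY hX
  exact lam_sub_eq (lift s S) rfl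
    (splitU_nat s h hl (fun ρ y e e' => hr ρ y e e' e) hf)

theorem splitG_nat' (hY : Y ◂ lift s S = Y') (hX : X ◂ lift s S = X')
    (hl : ∀ {Θ : C} (ρ : Θ ⟶ Δ ▹ (S ◂ s)) (z : Term Θ) (e e' e''),
      T.map ρ ((FibHom.inl (P ◂ p S ◂ lift s S) (Y ◂ lift s S)).map ρ z e) e' =
        (FibHom.inl (P' ◂ p _) Y').map ρ ((liftHom s h).map ρ z e) e'')
    (hr : ∀ {Θ : C} (ρ : Θ ⟶ Δ ▹ (S ◂ s)) (y : Term Θ) (e e' e''),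
      T.map ρ ((FibHom.inr (P ◂ p S ◂ lift s S) (Y ◂ lift s S)).map ρ y e) e' =
        (FibHom.inr (P' ◂ p _) Y').map ρ y e'')
    (hf : ∀ {Θ : C} (ρ : Θ ⟶ Δ ▹ (S ◂ s)) (x : Term Θ) (e e' e''),
      f'.map ρ x e = T.map ρ (f.map (ρ ≫ lift s S) x e') e'') (ρ : Θ ⟶ Δ) (t : Term Θ)
    (k k' k'') : (splitG f').map ρ t k = h.map ρ ((splitG f).map (ρ ≫ s) t k') k'' := by
  subst hY hX
  exact splitG_nat s h hl (fun ρ y e e' => hr ρ y e e' e) hf ρ t k k' k''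

end Nat

namespace Poly

section Pi

variable {C : Type u} [Category.{v} C] [NaturalModel.{w} C] [HasPi C] [HasSigma C] [HasUnit C]
  [HasEmpty C] [HasSumTy C] [ExtensiveCoproducts C] {Γ Δ : Poly C}

/-- Dependent products of types of the polynomial model. -/
def pi (A : Ty Γ) (B : Ty (Γ ▹ A)) : Ty Γ := PPi (Γ := Γ.shape) A B

variable {A : Ty Γ} {B : Ty (Γ ▹ A)}

/-- The action on positions of a term in an extended context. -/
def pdir (b : Tm B) : FibHom (PTy.posAt B (sh b).1 (sh b).2)
    (SumTy (Γ.pos ◂ p (PTy.shape A)) (PTy.pos A).toTy) := ps b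

/-- Abstraction in the polynomial model. -/
def plam (b : Tm B) : Tm (pi A B) :=
  ptm (A := pi A B) (piMk (Γ := Γ.shape) (A := A) (B := B) (sh b) (splitU (pdir b)))
    ((splitG (pdir b)).cast
      (PPi_posAt_mk (Γ := Γ.shape) (A := A) (B := B) (sh b) (splitU (pdir b))).symm rfl)

/-- Application in the polynomial model. -/
def papp (t : Tm (pi A B)) : Tm B :=
  ptm (A := B) (piBase (Γ := Γ.shape) (A := A) (B := B) (sh t))
    (mergeUG (piDir (Γ := Γ.shape) (A := A) (B := B) (sh t))
      ((ps t).cast (PPi_posAt (Γ := Γ.shape) (A := A) (B := B) (sh t)) rfl))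

theorem papp_plam (b : Tm B) : papp (plam b) = b := by
  have e := piBase_mk (Γ := Γ.shape) (A := A) (B := B) (sh b) (splitU (pdir b))
  refine ptm_ext (congrArg Tm.val e) fun σ x h h' => ?_
  refine Eq.trans ?_ (congrArg (fun f => f.map σ x h') (merge_splitUG (pdir b)))
  refine mergeUG_congr (PTy.posAt_congr rfl (congrArg Tm.val e) _ _)
    (piDir_mk (Γ := Γ.shape) (A := A) (B := B) (sh b) (splitU (pdir b))) (fun _ _ _ _ => rfl)
    σ x h h'

theorem plam_papp (t : Tm (pi A B)) : plam (papp t) = t := by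
  have e : splitU (pdir (papp t)) = piDir (Γ := Γ.shape) (A := A) (B := B) (sh t) :=
    splitU_merge _ _
  refine ptm_ext ?_ fun σ x h h' => ?_
  · refine Eq.trans ?_ (congrArg Tm.val (piMk_eta (Γ := Γ.shape) (A := A) (B := B) (sh t)))
    exact congrArg (fun u => (piMk (Γ := Γ.shape) (A := A) (B := B) _ u).1) e
  · exact splitG_merge _ _ σ x _ (h'.trans (congrArg (· ◂ σ)
      (PPi_posAt (Γ := Γ.shape) (A := A) (B := B) (sh t))))

theorem pos_lift_left (A : Ty Γ) (σ : Δ ⟶ Γ) :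
    Γ.pos ◂ p (PTy.shape A) ◂ lift (Hom.shape σ) (PTy.shape A) =
      Γ.pos ◂ (p (PTy.shape A ◂ Hom.shape σ) ≫ Hom.shape σ) :=
  (tySub_tySub _ _ _).trans (congrArg (Γ.pos ◂ ·) (lift_p _ _))

theorem pos_lift_right (A : Ty Γ) (σ : Δ ⟶ Γ) :
    (PTy.pos A).toTy ◂ lift (Hom.shape σ) (PTy.shape A) = (PTy.pos (A ◂ σ)).toTy :=
  PTy.toTy_sub_eq (A := A) (Hom.shape σ) rfl

theorem pos_lift (A : Ty Γ) (σ : Δ ⟶ Γ) :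
    SumTy (Γ.pos ◂ p (PTy.shape A)) (PTy.pos A).toTy ◂ lift (Hom.shape σ) (PTy.shape A) =
      SumTy (Γ.pos ◂ (p (PTy.shape A ◂ Hom.shape σ) ≫ Hom.shape σ)) (PTy.pos (A ◂ σ)).toTy :=
  (SumTy_sub _ _ _).trans (congrArg₂ SumTy (pos_lift_left A σ) (pos_lift_right A σ))

theorem pos_lift_inl (A : Ty Γ) (σ : Δ ⟶ Γ) {Θ : C}
    (ρ : Θ ⟶ Δ.shape ▹ (PTy.shape A ◂ Hom.shape σ)) (z : Term Θ) (e e' e'') :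
    (Hom.pos (lift σ A)).map ρ ((FibHom.inl
        (Γ.pos ◂ p (PTy.shape A) ◂ lift (Hom.shape σ) (PTy.shape A))
        ((PTy.pos A).toTy ◂ lift (Hom.shape σ) (PTy.shape A))).map ρ z e) e' =
      (FibHom.inl (Δ.pos ◂ p (PTy.shape A ◂ Hom.shape σ)) (PTy.pos (A ◂ σ)).toTy).map ρ
        ((liftHom (Hom.shape σ) (Hom.pos σ)).map ρ z e) e'' := by
  have k := e.trans (congrArg (· ◂ ρ) (pos_lift_left A σ))
  refine Eq.trans (FibHom.map_congr _ rfl (FibHom.inl_map_congr (pos_lift_left A σ)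
    (pos_lift_right A σ) _ _ _ k) _ ?_) (FibHom.copair_inl
    (Hom.pos (p (A ◂ σ) ≫ σ)) _ ρ z k (FibHom.ty_map _ _ _ _))
  exact (FibHom.ty_map _ _ _ _).trans (congrArg (· ◂ ρ) (pos_lift A σ)).symm

theorem pos_lift_inr (A : Ty Γ) (σ : Δ ⟶ Γ) {Θ : C}
    (ρ : Θ ⟶ Δ.shape ▹ (PTy.shape A ◂ Hom.shape σ)) (z : Term Θ) (e e' e'') :
    (Hom.pos (lift σ A)).map ρ ((FibHom.inr
        (Γ.pos ◂ p (PTy.shape A) ◂ lift (Hom.shape σ) (PTy.shape A))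
        ((PTy.pos A).toTy ◂ lift (Hom.shape σ) (PTy.shape A))).map ρ z e) e' =
      (FibHom.inr (Δ.pos ◂ p (PTy.shape A ◂ Hom.shape σ)) (PTy.pos (A ◂ σ)).toTy).map ρ z e'' := by
  refine Eq.trans (FibHom.map_congr _ rfl (FibHom.inr_map_congr (pos_lift_left A σ)
    (pos_lift_right A σ) _ _ _ e'') _ ?_) (FibHom.copair_inr
    (Hom.pos (p (A ◂ σ) ≫ σ)) _ ρ z e'' (FibHom.ty_map _ _ _ _))
  exact (FibHom.ty_map _ _ _ _).trans (congrArg (· ◂ ρ) (pos_lift A σ)).symm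

theorem plam_sub (b : Tm B) (σ : Δ ⟶ Γ) :
    ((plam b).sub σ).1 = (plam (b.sub (lift σ A))).1 := by
  have hT := PPi_sub (Γ := Γ.shape) A B (Hom.shape σ)
  have hY := pos_lift_right A σ
  have hX : PTy.posAt B (sh b).1 (sh b).2 ◂ lift (Hom.shape σ) (PTy.shape A) =
      PTy.posAt (B ◂ lift σ A) (sh (b.sub (lift σ A))).1 (sh (b.sub (lift σ A))).2 :=
    (posAt_sub_eq b (lift σ A)).symm
  have hu := splitU_nat' (Hom.shape σ) (Hom.pos σ) hY hX (T := Hom.pos (lift σ A))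
    (f := pdir b) (f' := pdir (b.sub (lift σ A))) (pos_lift_inl A σ) (pos_lift_inr A σ)
    (fun _ _ _ _ _ => rfl)
  have hs : (sh ((plam b).sub σ)).1 = (sh (plam (b.sub (lift σ A)))).1 :=
    piMk_sub (Γ := Γ.shape) (Hom.shape σ) rfl hu
  refine term_ext hT hs fun ρ x k k' => ?_
  refine Eq.trans ?_ (splitG_nat' (Hom.shape σ) (Hom.pos σ) hY hX (T := Hom.pos (lift σ A))
    (f := pdir b) (f' := pdir (b.sub (lift σ A))) (pos_lift_inl A σ) (pos_lift_inr A σ)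
    (fun _ _ _ _ _ => rfl) ρ x (k'.trans ?_) ?_ ?_).symm
  · rfl
  · exact congrArg (· ◂ ρ) (PPi_posAt_mk (Γ := Δ.shape) (A := A ◂ σ) (B := B ◂ lift σ A) _ _)

instance : HasPi (Poly C) where
  Pi A B := pi A B
  lam := plam
  app := papp
  app_lam := papp_plam
  lam_app := plam_papp
  Pi_sub _ _ _ := PPi_sub _ _ _
  lam_sub := plam_sub

end Pi

section Univ

variable {C : Type u} [Category.{v} C] [NaturalModel.{w} C] [HasPi C] [HasSigma C] [HasUniv C]

/-- The type of codes of families in context `Γ`: pairs of a code `A` of a type of shapes and of a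
function `A → U`. -/
def FamTy (Γ : C) : Ty Γ := Sig (U Γ) (Arr (El (uvar Γ)) (U (Γ ▹ U Γ)))

/-- The code of the type of shapes of the generic family. -/
def shapeCode (Γ : C) : Tm (U (Γ ▹ FamTy Γ)) :=
  (fstAt (p (FamTy Γ)) (U Γ) _ (q (FamTy Γ)) (ty_q _)).cast (U_sub _)

/-- The code of the type of positions of the generic family. -/
def posCode (Γ : C) : Tm (U (Γ ▹ FamTy Γ ▹ El (shapeCode Γ))) :=
  (app ((sndAt (p (FamTy Γ)) (U Γ) _ (q (FamTy Γ)) (ty_q _)).cast (Arr_sub_eq _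
    ((El_sub _ _).trans (congrArg El (a₂ := shapeCode Γ)
      (Tm.ext (by simp [uvar, cons_eq, shapeCode])))) (U_sub _)))).cast (U_sub _)

variable [HasEmpty C] [HasSumTy C] [ExtensiveCoproducts C]

/-- The universe of the polynomial model: its shapes are the codes of families of types in the
universe, and it has no positions. A code decodes to the family that it encodes. -/
instance : HasUniv (Poly C) where
  U₀ := PTy.bare (FamTy (emp : C))
  El₀ := (⟨El (shapeCode (emp : C)), Fam.ofTy (El (posCode (emp : C)))⟩ :
    PTy ((emp : C) ▹ FamTy (emp : C)))

end Univ

end Poly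

end TT

/-!
Write `J` for the based path eliminator. The canonical map `(A = B) → (A ≅ B)` of the polynomial
model is an instance of the map `(A = B) → Q B` that `J` defines from an element `w : Q A`, and such
a map has a pointwise section and a pointwise retraction as soon as `(A, w)` is a centre of
contraction of `Σ B, Q B` (`exists_inverse_of_cov`). Two things have to be shown: that the type of
pairs of a `B : U` and a categorical equivalence `A ≅ B` is contractible (`cov_idCEq`), and that the
two homotopies are induced by paths between functions, although the polynomial model need not satisfy
function extensionality.

*Homotopies.* A function of the polynomial model is a function `f` on shapes with a partial function
`f̌ : B.pos (f a) → 1 + A.pos a` on positions. If `B` has no positions, then `f̌` is unique, and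
function extensionality of the base model suffices (`Poly.path_of_pos_empty`). Identity types have
no positions by definition. The positions over a function are the arguments at which `f̌` is
undefined, and a function that is invertible up to paths is total on positions
(`Poly.inh_NoInc_tdir`): paths of the polynomial model are paths of shapes and `f̌` is part of the
shape, so the composite with a section has a total `f̌`, and then so has the function. Hence types of
categorical equivalences have no positions (`Poly.CEq_pos_empty`). This is where *categorical*
equivalences are needed, as a homotopy does not compare the partial functions on positions.

*Contractibility.* Identity functions are categorical equivalences in a unique way, because sections
and retractions of identities form singletons (`path_isCEq_idFun`). It remains to find a path from
`(A, id)` to `(B, F)` for every categorical equivalence `F : A → B` (`Poly.path_arrPair`). As there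
are no positions over `F` and its section, both can be restricted to a context without positions,
where paths are the same. There `A` and `B` are codes of families `(A, P)` and `(B, Q)` of types of
the base model, and `F` is an equivalence of the types of shapes together with a backwards map on
positions, which is a fibrewise equivalence (`Poly.isCEq_back`). By univalence for `A` and for the
fibres of `P`, and by function extensionality, the type of all such `(B, Q)` with an equivalence is
contractible in the base model (`exists_cov_isEqvMap`), and a path of the polynomial model between
two terms is a path of the base model between their shapes.

Most arguments only need that a type is inhabited, so they are phrased with `Inh`, with the relation
`Path` on raw terms, which ignores casts between equal types, and with the predicate `Cov` for centres
of contraction.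
-/

namespace TT

open NaturalModel HasPi HasSigma HasIdIntro HasId HasUnit HasEmpty HasSumTyIntro HasSumTy HasUniv
  ExtensiveCoproducts

/-! ### Inhabited types and paths -/

section Path

variable {C : Type u} [Category.{v} C] [NaturalModel.{w} C] {Γ Δ Θ Ξ : C}

/-- The type `A` has a term. -/
def Inh (A : Ty Γ) : Prop := Nonempty (Tm A)

theorem Tm.inh {A : Ty Γ} (a : Tm A) : Inh A := ⟨a⟩

theorem Inh.sub {A : Ty Γ} (h : Inh A) (σ : Δ ⟶ Γ) : Inh (A ◂ σ) := h.elim fun a => ⟨a.sub σ⟩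

theorem Inh.cast {A B : Ty Γ} (h : Inh A) (e : A = B) : Inh B := e ▸ h

theorem Inh.sub_eq {A : Ty Γ} (h : Inh A) (σ : Δ ⟶ Γ) {B : Ty Δ} (e : A ◂ σ = B) : Inh B :=
  (h.sub σ).cast e

theorem inh_Pi [HasPi C] {A : Ty Γ} {B : Ty (Γ ▹ A)} : Inh (Pi A B) ↔ Inh B :=
  ⟨fun ⟨f⟩ => ⟨app f⟩, fun ⟨b⟩ => ⟨lam b⟩⟩

theorem inh_Pi_sub [HasPi C] {A : Ty Γ} {B : Ty (Γ ▹ A)} (σ : Δ ⟶ Γ) {A' : Ty Δ}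
    (hA : A ◂ σ = A') : Inh (Pi A B ◂ σ) ↔ Inh (B ◂ liftTo σ hA) := by
  rw [Pi_sub_eq σ hA rfl, inh_Pi]

theorem inh_Sig_sub [HasSigma C] {A : Ty Γ} {B : Ty (Γ ▹ A)} (σ : Δ ⟶ Γ) :
    Inh (Sig A B ◂ σ) ↔ ∃ a : Tm (A ◂ σ), Inh (B ◂ cons σ a) :=
  ⟨fun ⟨t⟩ => ⟨fstAt σ A B t.1 t.2, ⟨sndAt σ A B t.1 t.2⟩⟩, fun ⟨a, ⟨b⟩⟩ => ⟨dpairAt σ a b⟩⟩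

theorem inh_Sig [HasSigma C] {A : Ty Γ} {B : Ty (Γ ▹ A)} :
    Inh (Sig A B) ↔ ∃ a : Tm A, Inh (B ◂ inst a) :=
  ⟨fun ⟨t⟩ => ⟨fst t, ⟨snd t⟩⟩, fun ⟨a, ⟨b⟩⟩ => ⟨dpair a b⟩⟩

variable [HasIdIntro C]

/-- The terms `a` and `b` have the same type and there is a path between them. The relation is
defined on terms without a prescribed type, so that it does not see casts. -/
def Path (a b : Term Γ) : Prop :=
  ∃ h : ty a = ty b, Inh (IdTy (⟨a, h⟩ : Tm (ty b)) ⟨b, rfl⟩)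

theorem path_iff {A : Ty Γ} {a b : Tm A} : Path a.1 b.1 ↔ Inh (IdTy a b) := by
  obtain ⟨a, ha⟩ := a
  obtain ⟨b, rfl⟩ := b
  exact ⟨fun h => h.2, fun h => ⟨ha, h⟩⟩

theorem inh_IdTy_sub {A : Ty Γ} {a b : Tm A} (σ : Δ ⟶ Γ) :
    Inh (IdTy a b ◂ σ) ↔ Path (a.1 ◃ σ) (b.1 ◃ σ) := by
  rw [IdTy_sub, ← path_iff]; rfl

theorem Path.refl (a : Term Γ) : Path a a := ⟨rfl, ⟨HasIdIntro.refl _⟩⟩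

theorem Path.of_eq {a b : Term Γ} (h : a = b) : Path a b := h ▸ Path.refl a

theorem Path.sub {a b : Term Γ} (h : Path a b) (σ : Δ ⟶ Γ) : Path (a ◃ σ) (b ◃ σ) :=
  (inh_IdTy_sub σ).1 (h.2.sub σ)

end Path

section Transport

variable {C : Type u} [Category.{v} C] [NaturalModel.{w} C] [HasId C] {Γ Δ Θ Ξ : C}

/-- Transport along a path in the last variable of a context, for inhabitation only. -/
theorem transport {A : Ty Γ} {σ τ : Δ ⟶ Γ ▹ A} (hp : σ ≫ p A = τ ≫ p A)
    (hq : Path (q A ◃ σ) (q A ◃ τ)) {P : Ty (Γ ▹ A)} (h : Inh (P ◂ σ)) : Inh (P ◂ τ) := by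
  have ha : ty (q A ◃ σ) = A ◂ (σ ≫ p A) := by simp
  have hb : ty (q A ◃ τ) = A ◂ (σ ≫ p A) := by simp [hp]
  obtain ⟨e⟩ := path_iff (a := ⟨q A ◃ σ, ha⟩) (b := ⟨q A ◃ τ, hb⟩) |>.1 hq
  obtain ⟨w⟩ := h
  refine (Tm.inh (J ⟨q A ◃ σ, ha⟩ (P ◂ (p _ ≫ lift (σ ≫ p A) A)) (w.cast ?_) e)).cast ?_
  · simp [instId, cons_eq, inst_eq, lift_eq]
  · rw [tySub_tySub]
    congr 1
    apply pair_uniq <;> simp [instId, cons_eq, inst_eq, lift_eq, hp]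

theorem Path.symm {a b : Term Γ} (h : Path a b) : Path b a := by
  have := transport (Γ := Γ) (A := ty b) (σ := inst ⟨a, h.1⟩) (τ := inst ⟨b, rfl⟩)
    (by simp [inst_eq]) (by simpa [inst_eq] using h)
    (P := IdTy (var (ty b)) ((⟨a, h.1⟩ : Tm (ty b)).sub (p _)))
  rw [inh_IdTy_sub, inh_IdTy_sub] at this
  simpa [inst_eq] using this (by simpa [inst_eq] using Path.refl a)

theorem Path.trans {a b c : Term Γ} (h : Path a b) (h' : Path b c) : Path a c := by
  have := transport (Γ := Γ) (A := ty c) (σ := inst ⟨b, h'.1⟩) (τ := inst ⟨c, rfl⟩)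
    (by simp [inst_eq]) (by simpa [inst_eq] using h')
    (P := IdTy ((⟨a, h.1.trans h'.1⟩ : Tm (ty c)).sub (p _)) (var (ty c)))
  rw [inh_IdTy_sub, inh_IdTy_sub] at this
  simpa [inst_eq] using this (by simpa [inst_eq] using h)

theorem Path.ap {A : Ty Γ} {σ τ : Δ ⟶ Γ ▹ A} (hp : σ ≫ p A = τ ≫ p A)
    (hq : Path (q A ◃ σ) (q A ◃ τ)) {B : Ty Γ} {t : Term (Γ ▹ A)} (ht : ty t = B ◂ p A) :
    Path (t ◃ σ) (t ◃ τ) := by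
  have h1 : pair (𝟙 Δ) (A ◂ (σ ≫ p A)) (q A ◃ σ) (by simp) ≫ lift (σ ≫ p A) A = σ := by
    apply pair_uniq <;> simp [lift_eq]
  have h2 : pair (𝟙 Δ) (A ◂ (σ ≫ p A)) (q A ◃ τ) (by simp [hp]) ≫ lift (σ ≫ p A) A = τ := by
    apply pair_uniq <;> simp [lift_eq, hp]
  have := transport (Γ := Δ) (A := A ◂ (σ ≫ p A))
    (σ := pair (𝟙 Δ) (A ◂ (σ ≫ p A)) (q A ◃ σ) (by simp))
    (τ := pair (𝟙 Δ) (A ◂ (σ ≫ p A)) (q A ◃ τ) (by simp [hp])) (by simp) (by simpa using hq)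
    (P := IdTy (A := B ◂ (p (A ◂ (σ ≫ p A)) ≫ σ ≫ p A)) ⟨t ◃ σ ◃ p _, by simp [ht]⟩
      ⟨t ◃ lift (σ ≫ p A) A, by simp [ht, lift_eq]⟩)
  rw [inh_IdTy_sub, inh_IdTy_sub] at this
  dsimp only at this
  rw [tmSub_tmSub _ (lift _ _), h1, tmSub_tmSub _ (lift _ _), h2] at this
  simpa using this (by simpa using Path.refl (t ◃ σ))

end Transport

section Cov

variable {C : Type u} [Category.{v} C] [NaturalModel.{w} C] {Γ Δ Θ Ξ : C}

/-- A type over the codomain of `i` is inhabited as soon as its restriction along `i` is. For the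
inclusion `cons (inst a) b` of a pair this says that `(a, b)` is a centre of contraction of the
dependent sum, but no dependent sum has to be formed to state it. -/
def Cov (i : Δ ⟶ Γ) : Prop := ∀ P : Ty Γ, Inh (P ◂ i) → Inh P

theorem cov_lift [HasPi C] {i : Δ ⟶ Γ} (h : Cov i) (A : Ty Γ) : Cov (lift i A) := fun P hP =>
  inh_Pi.1 (h _ ((inh_Pi_sub i rfl).2 hP))

theorem cov_instId [HasId C] {A : Ty Γ} (a : Tm A) : Cov (instId a (refl a)) := fun P ⟨w⟩ =>
  ⟨Jgen a P w⟩

end Cov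

section GenericPair

variable {C : Type u} [Category.{v} C] [NaturalModel.{w} C] {Γ Δ Θ Ξ : C}

theorem Cov.comp {i : Δ ⟶ Γ} {j : Θ ⟶ Δ} (hi : Cov i) (hj : Cov j) : Cov (j ≫ i) := fun P hP =>
  hi P (hj _ (hP.cast (tySub_tySub _ _ _).symm))

theorem cov_of_section {i : Δ ⟶ Γ} {s : Γ ⟶ Δ} (h : s ≫ i = 𝟙 Γ) : Cov i := fun P hP =>
  hP.sub_eq s (by rw [tySub_tySub, h, tySub_id])

variable [HasSigma C] {A : Ty Γ} {B : Ty (Γ ▹ A)}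

/-- This is `fstAt_congr` for models that are only assumed to have dependent sums. -/
theorem fstAt_congr' {σ σ' : Δ ⟶ Γ} (hσ : σ = σ') {t t' : Term Δ} (ht : t = t') (h h') :
    (fstAt σ A B t h).1 = (fstAt σ' A B t' h').1 := by
  subst hσ ht; rfl

/-- This is `sndAt_congr` for models that are only assumed to have dependent sums. -/
theorem sndAt_congr' {σ σ' : Δ ⟶ Γ} (hσ : σ = σ') {t t' : Term Δ} (ht : t = t') (h h') :
    (sndAt σ A B t h).1 = (sndAt σ' A B t' h').1 := by
  subst hσ ht; rfl

/-- The pair of the variables, in context `x : A, y : B`. -/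
def gpair (A : Ty Γ) (B : Ty (Γ ▹ A)) : Tm (Sig A B ◂ (p B ≫ p A)) :=
  dpairAt (p B ≫ p A) (((var A).sub (p B)).cast (tySub_tySub _ _ _))
    ((var B).cast (congrArg (B ◂ ·) (cons_q A (p B) (tySub_tySub _ _ _)).symm))

/-- The substitution `x : A, y : B → z : Σ A B`. -/
def pairMap (A : Ty Γ) (B : Ty (Γ ▹ A)) : Γ ▹ A ▹ B ⟶ Γ ▹ Sig A B := cons (p B ≫ p A) (gpair A B)

/-- The substitution `z : Σ A B → x : A, y : B`. -/
def unpair (A : Ty Γ) (B : Ty (Γ ▹ A)) : Γ ▹ Sig A B ⟶ Γ ▹ A ▹ B :=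
  cons (cons (p _) (fstAt (p _) A B (q _) (ty_q _))) (sndAt (p _) A B (q _) (ty_q _))

theorem pairMap_p : pairMap A B ≫ p (Sig A B) = p B ≫ p A := by simp [pairMap, cons_eq]

theorem unpair_pp : unpair A B ≫ p B ≫ p A = p (Sig A B) := by simp [unpair, cons_eq]

theorem gpair_cons (σ : Δ ⟶ Γ) (a : Tm (A ◂ σ)) (b : Tm (B ◂ cons σ a)) :
    (gpair A B).1 ◃ cons (cons σ a) b = (dpairAt σ a b).1 := by
  refine (dpairAt_sub _ _ _ _ (a.cast (by simp [cons_eq])) (b.cast ?_) ?_ ?_).trans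
    (dpairAt_congr (by simp [cons_eq]) rfl rfl)
  · exact congrArg (B ◂ ·) (cons_congr rfl (by simp [cons_eq]))
  · simp [cons_eq]
  · simp [cons_eq]

theorem unpair_pairMap : unpair A B ≫ pairMap A B = 𝟙 _ := by
  apply pair_uniq
  · rw [Category.assoc, pairMap_p, unpair_pp, Category.id_comp]
  · rw [pairMap, cons_eq, comp_pair, pair_q, unpair, gpair_cons, tmSub_id]
    exact dpairAt_eta _ _ _

theorem cons_unpair (σ : Δ ⟶ Γ) (t : Tm (Sig A B ◂ σ)) :
    cons σ t ≫ unpair A B = cons (cons σ (fstAt σ A B t.1 t.2)) (sndAt σ A B t.1 t.2) := by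
  have h1 : (fstAt (p _) A B (q _) (ty_q _)).1 ◃ cons σ t = (fstAt σ A B t.1 t.2).1 := by
    rw [fstAt_sub, ← tmSub_id (fstAt (cons σ t ≫ _) _ _ _ _).1]
    exact fst_sub_eq (𝟙 Δ) (by simp [cons_eq]) (by simp [liftTo_eq, lift_eq, cons_eq])
      (by simp [cons_eq])
  have h2 : (sndAt (p _) A B (q _) (ty_q _)).1 ◃ cons σ t = (sndAt σ A B t.1 t.2).1 := by
    rw [sndAt_sub, ← tmSub_id (sndAt (cons σ t ≫ _) _ _ _ _).1]
    exact snd_sub_eq (𝟙 Δ) (by simp [cons_eq]) (by simp [liftTo_eq, lift_eq, cons_eq])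
      (by simp [cons_eq])
  rw [unpair, cons_eq (cons _ _), comp_pair, cons_eq (cons σ _)]
  refine pair_congr ?_ h2 _ _
  rw [cons_eq (p (Sig A B)), comp_pair, cons_eq σ (fstAt σ A B t.1 t.2)]
  exact pair_congr (by simp [cons_eq]) h1 _ _

theorem pairMap_unpair : pairMap A B ≫ unpair A B = 𝟙 _ := by
  rw [pairMap, cons_unpair]
  apply pair_uniq
  · apply pair_uniq
    · simp [cons_eq]
    · simp only [cons_eq, pair_p, pair_q, Category.id_comp]
      exact fstAt_dpairAt _ _ _ _
  · simp only [cons_eq, pair_q, tmSub_id]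
    exact sndAt_dpairAt _ _ _ _

/-- A path between pairs allows transport in both variables at once. -/
theorem transport_gpair [HasId C] {σ τ : Δ ⟶ Γ ▹ A ▹ B} (hp : σ ≫ p B ≫ p A = τ ≫ p B ≫ p A)
    (h : Path ((gpair A B).1 ◃ σ) ((gpair A B).1 ◃ τ)) {P : Ty (Γ ▹ A ▹ B)}
    (hP : Inh (P ◂ σ)) : Inh (P ◂ τ) := by
  rw [← tySub_id P, ← pairMap_unpair, ← tySub_tySub, tySub_tySub] at hP ⊢
  refine transport (A := Sig A B) ?_ ?_ hP
  · rw [Category.assoc, Category.assoc, pairMap_p, hp]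
  · rw [pairMap, cons_eq, comp_pair, comp_pair, pair_q, pair_q]; exact h

/-- A centre of contraction has a path to the pair of the variables. -/
theorem Cov.path [HasId C] {i : Γ ⟶ Γ ▹ A ▹ B} (hi : i ≫ p B ≫ p A = 𝟙 Γ) (h : Cov i) :
    Path ((gpair A B).1 ◃ (p B ≫ p A ≫ i)) (gpair A B).1 := by
  have hT : ty ((gpair A B).1 ◃ (p B ≫ p A ≫ i)) = Sig A B ◂ (p B ≫ p A) := by
    rw [ty_sub, (gpair A B).2, tySub_tySub]; simp [hi]
  refine (path_iff (a := ⟨_, hT⟩)).2 (h _ ?_)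
  rw [inh_IdTy_sub]
  refine Path.of_eq ?_
  dsimp only
  rw [tmSub_tmSub, ← Category.assoc (p B), ← Category.assoc i, hi, Category.id_comp]

end GenericPair

/-! ### Functions and categorical equivalences -/

section Functions

variable {C : Type u} [Category.{v} C] [NaturalModel.{w} C] [HasPi C] {Γ Δ Θ Ξ : C}
  {A B D E : Ty Γ}

/-- Abstraction for functions without dependency. -/
def arrLam (t : Tm (B ◂ p A)) : Tm (Arr A B) := lam t

theorem app_arrLam (t : Tm (B ◂ p A)) : app (arrLam t) = t := app_lam t

theorem app_comp (g : Tm (Arr B D)) (f : Tm (Arr A B)) :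
    (app (comp g f)).1 = (app g).1 ◃ appMap f := by
  rw [comp, app_lam]; rfl

theorem app_idFun : app (idFun A) = var A := app_lam _

theorem appMap_comp (g : Tm (Arr B D)) (f : Tm (Arr A B)) :
    appMap (comp g f) = appMap f ≫ appMap g := by
  rw [appMap_eq, appMap_eq g, comp_pair]
  exact pair_congr (by simp [appMap_eq]) (app_comp g f) _ _

theorem appMap_idFun : appMap (idFun A) = 𝟙 _ := by
  rw [appMap_eq, ← pair_pq A (ty_q A)]
  exact pair_congr rfl (congrArg Tm.val app_idFun) _ _

theorem arr_ext {f g : Tm (Arr A B)} (h : (app f).1 = (app g).1) : f = g := by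
  rw [← lam_app f, ← lam_app g, Tm.ext h]

theorem comp_idFun_right (f : Tm (Arr A B)) : comp f (idFun A) = f :=
  arr_ext (by rw [app_comp, appMap_idFun, tmSub_id])

theorem comp_idFun_left (f : Tm (Arr A B)) : comp (idFun B) f = f :=
  arr_ext (by rw [app_comp, app_idFun, appMap_eq, var_val, pair_q])

theorem comp_assoc (h : Tm (Arr D E)) (g : Tm (Arr B D)) (f : Tm (Arr A B)) :
    comp h (comp g f) = comp (comp h g) f :=
  arr_ext (by rw [app_comp, app_comp, app_comp, tmSub_tmSub, appMap_comp])

theorem app_inst_comp (g : Tm (Arr B D)) (f : Tm (Arr A B)) :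
    (comp (fsub g (p (Arr A B))) (fvar A B)).1 ◃ inst f = (comp g f).1 :=
  comp_sub_eq _ (by simp [inst_eq]) (by simp [inst_eq]) (by simp [inst_eq]) (by simp [inst_eq])
    (by simp [inst_eq])

theorem app_inst_comp' (g : Tm (Arr B D)) (f : Tm (Arr A B)) :
    (comp (fvar B D) (fsub f (p (Arr B D)))).1 ◃ inst g = (comp g f).1 :=
  comp_sub_eq _ (by simp [inst_eq]) (by simp [inst_eq]) (by simp [inst_eq]) (by simp [inst_eq])
    (by simp [inst_eq])

section
variable [HasId C]

theorem Path.comp_left (g : Tm (Arr B D)) {f f' : Tm (Arr A B)} (h : Path f.1 f'.1) :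
    Path (comp g f).1 (comp g f').1 := by
  rw [← app_inst_comp g f, ← app_inst_comp g f']
  exact Path.ap (σ := inst f) (τ := inst f') (B := Arr A D) (by simp [inst_eq])
    (by simpa [inst_eq] using h) ((Tm.prop _).trans (Arr_sub _ _ _).symm)

theorem Path.comp_right {g g' : Tm (Arr B D)} (h : Path g.1 g'.1) (f : Tm (Arr A B)) :
    Path (comp g f).1 (comp g' f).1 := by
  rw [← app_inst_comp' g f, ← app_inst_comp' g' f]
  exact Path.ap (σ := inst g) (τ := inst g') (B := Arr A D) (by simp [inst_eq])
    (by simpa [inst_eq] using h) ((Tm.prop _).trans (Arr_sub _ _ _).symm)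

/-- Functions with a path between them agree on all arguments. -/
theorem Path.happly {B : Ty (Γ ▹ A)} {f g : Tm (Pi A B)} (h : Path f.1 g.1) :
    Path (app f).1 (app g).1 := by
  have := transport (A := Pi A B) (σ := inst f) (τ := inst g) (by simp [inst_eq])
    (by simpa [inst_eq] using h) (P := Htpy ((f.sub (p _)).cast (Pi_sub A B _))
      ((var (Pi A B)).cast (Pi_sub A B _)))
  rw [Htpy_sub_eq (inst f) (f' := f) (g' := f), Htpy_sub_eq (inst g) (f' := f) (g' := g),
    Htpy, Htpy, inh_Pi, inh_Pi, ← path_iff, ← path_iff] at this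
  · exact this (Path.refl _)
  all_goals simp [inst_eq, lift_eq, liftTo_eq]

/-- `f` has a section and a retraction up to paths between functions. -/
def IsCEq (f : Tm (Arr A B)) : Prop :=
  (∃ s : Tm (Arr B A), Path (comp f s).1 (idFun B).1) ∧
    ∃ r : Tm (Arr B A), Path (comp r f).1 (idFun A).1

theorem IsCEq.of_path {f g : Tm (Arr A B)} (hf : IsCEq f) (h : Path f.1 g.1) : IsCEq g := by
  obtain ⟨⟨s, hs⟩, r, hr⟩ := hf
  exact ⟨⟨s, (h.symm.comp_right s).trans hs⟩, r, (h.symm.comp_left r).trans hr⟩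

theorem isCEq_idFun' : IsCEq (idFun A) :=
  ⟨⟨idFun A, Path.of_eq (by rw [comp_idFun])⟩, idFun A, Path.of_eq (by rw [comp_idFun])⟩

/-- A section of a map with a retraction is also a retraction. -/
theorem section_retraction {f : Tm (Arr A B)} {s r : Tm (Arr B A)}
    (hs : Path (comp f s).1 (idFun B).1) (hr : Path (comp r f).1 (idFun A).1) :
    Path (comp s f).1 (idFun A).1 := by
  have h1 := (hr.comp_right (comp s f)).symm
  rw [comp_idFun_left, ← comp_assoc, comp_assoc f] at h1
  have h2 := (hs.comp_right f).comp_left r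
  rw [comp_idFun_left] at h2
  exact h1.trans (h2.trans hr)

/-- A retraction of a map with a section is also a section. -/
theorem retraction_section {f : Tm (Arr A B)} {s r : Tm (Arr B A)}
    (hs : Path (comp f s).1 (idFun B).1) (hr : Path (comp r f).1 (idFun A).1) :
    Path (comp f r).1 (idFun B).1 := by
  have h1 := (hs.comp_left (comp f r)).symm
  rw [comp_idFun_right, ← comp_assoc, comp_assoc r] at h1
  have h2 := (hr.comp_right s).comp_left f
  rw [comp_idFun_left] at h2
  exact h1.trans (h2.trans hs)

variable [HasSigma C]

theorem inh_Sec {f : Tm (Arr A B)} :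
    Inh (Sec f) ↔ ∃ s : Tm (Arr B A), Path (comp f s).1 (idFun B).1 := by
  refine inh_Sig.trans (exists_congr fun s => ?_)
  rw [inh_IdTy_sub, app_inst_comp, idFun_sub_eq (A' := B) (inst s) (by simp [inst_eq])]

theorem inh_Ret {f : Tm (Arr A B)} :
    Inh (Ret f) ↔ ∃ r : Tm (Arr B A), Path (comp r f).1 (idFun A).1 := by
  refine inh_Sig.trans (exists_congr fun s => ?_)
  rw [inh_IdTy_sub, app_inst_comp', idFun_sub_eq (A' := A) (inst s) (by simp [inst_eq])]

theorem inh_Prod {X Y : Ty Γ} : Inh (Prod X Y) ↔ Inh X ∧ Inh Y := by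
  refine inh_Sig.trans ⟨fun ⟨a, h⟩ => ⟨⟨a⟩, h.cast (by simp [inst_eq])⟩,
    fun ⟨⟨a⟩, h⟩ => ⟨a, h.cast (by simp [inst_eq])⟩⟩

theorem inh_isCEq {f : Tm (Arr A B)} : Inh (isCEq f) ↔ IsCEq f := by
  rw [isCEq, inh_Prod, inh_Sec, inh_Ret]; rfl

theorem inh_HSec {f : Tm (Arr A B)} :
    Inh (HSec f) ↔ ∃ s : Tm (Arr B A), Inh (Htpy (comp f s) (idFun B)) := by
  refine inh_Sig.trans (exists_congr fun s => ?_)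
  rw [Htpy_sub_eq (inst s) (by simp [inst_eq]) (by simp [inst_eq, liftTo_eq])
    (app_inst_comp f s) (idFun_sub_eq (inst s) (by simp [inst_eq]))]

theorem inh_Htpy {B : Ty (Γ ▹ A)} {f g : Tm (Pi A B)} :
    Inh (Htpy f g) ↔ Path (app f).1 (app g).1 := by
  rw [Htpy, inh_Pi, ← path_iff]

end

end Functions

/-! ### Based path induction and contractible families -/

section Rec

variable {C : Type u} [Category.{v} C] [NaturalModel.{w} C] [HasId C] {Γ Δ Θ Ξ : C}

/-- The composite of the inverse of a path `a = b` with a path `a = c`. -/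
def ldiv {A : Ty Γ} {a b c : Tm A} (e : Tm (IdTy a b)) (d : Tm (IdTy a c)) : Tm (IdTy b c) :=
  (J a (IdTy (var A) (c.sub (p A)) ◂ p (IdFam a))
    (d.cast (by
      rw [tySub_tySub]
      exact (IdTy_sub_eq _ (by simp [instId, cons_eq, inst_eq])
        (by simp [instId, cons_eq, inst_eq])).symm)) e).cast (by
      rw [tySub_tySub]
      exact IdTy_sub_eq _ (by simp [instId, cons_eq, inst_eq])
        (by simp [instId, cons_eq, inst_eq]))

theorem ldiv_sub_eq {A : Ty Γ} {a b c : Tm A} {e : Tm (IdTy a b)} {d : Tm (IdTy a c)}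
    (σ : Δ ⟶ Γ) {A' : Ty Δ} {a' b' c' : Tm A'} {e' : Tm (IdTy a' b')} {d' : Tm (IdTy a' c')}
    (hA : A ◂ σ = A') (ha : a.1 ◃ σ = a'.1) (hb : b.1 ◃ σ = b'.1) (hc : c.1 ◃ σ = c'.1)
    (he : e.1 ◃ σ = e'.1) (hd : d.1 ◃ σ = d'.1) : (ldiv e d).1 ◃ σ = (ldiv e' d').1 := by
  refine J_sub_eq σ hA ha ?_ (by simpa using hd) hb he
  rw [tySub_tySub, liftTo_eq (liftTo σ hA), pair_p, ← tySub_tySub]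
  congr 1
  exact IdTy_sub_eq _ (by simp [liftTo_eq]) (by simp [liftTo_eq, ← hc])

theorem ldiv_refl {A : Ty Γ} {a c : Tm A} (d : Tm (IdTy a c)) : (ldiv (refl a) d).1 = d.1 := by
  rw [ldiv, J_refl]; rfl

theorem refl_sub_eq {A : Ty Γ} {a : Tm A} (σ : Δ ⟶ Γ) {A' : Ty Δ} {a' : Tm A'} (hA : A ◂ σ = A')
    (ha : a.1 ◃ σ = a'.1) : (refl a).1 ◃ σ = (refl a').1 := by
  subst hA
  obtain rfl : a.sub σ = a' := Tm.ext ha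
  exact refl_sub a σ

theorem ldiv_self {A : Ty Γ} {a b : Tm A} (e : Tm (IdTy a b)) :
    Path (ldiv e e).1 (refl b).1 := by
  let a' : Tm (A ◂ (p (IdFam a) ≫ p A)) := a.sub _
  let b' : Tm (A ◂ (p (IdFam a) ≫ p A)) := ((var A).sub (p (IdFam a))).cast (tySub_tySub _ _ _)
  let e' : Tm (IdTy a' b') := (var (IdFam a)).cast (IdTy_sub_eq _ (by simp [a']) (by simp [b']))
  have key : ∀ {b : Tm A} (e : Tm (IdTy a b)), Inh (IdTy (ldiv e' e') (refl b') ◂ instId a e) ↔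
      Path (ldiv e e).1 (refl b).1 := by
    intro b e
    have hA : A ◂ (p (IdFam a) ≫ p A) ◂ instId a e = A := by simp [instId, cons_eq, inst_eq]
    have ha : a'.1 ◃ instId a e = a.1 := by simp [a', instId, cons_eq, inst_eq]
    have hb : b'.1 ◃ instId a e = b.1 := by simp [b', instId, cons_eq, inst_eq]
    have he : e'.1 ◃ instId a e = e.1 := by
      change q (IdFam a) ◃ _ = _; simp [instId, cons_eq]
    rw [inh_IdTy_sub, ldiv_sub_eq (instId a e) hA ha hb hb he he]
    rw [refl_sub_eq (instId a e) hA hb]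
  exact (key e).1 ((cov_instId a _ ((key (refl a)).2 (Path.of_eq (ldiv_refl _)))).sub _)

variable {A : Ty Γ} (a : Tm A) (Q : Ty (Γ ▹ A)) (w : Tm (Q ◂ inst a))

/-- The element of `Q` at the end of the generic path from `a`, obtained from `w : Q a`. -/
def genRec : Tm (Q ◂ p (IdFam a)) :=
  Jgen a (Q ◂ p (IdFam a)) (w.cast (by simp [instId, cons_eq]))

theorem genRec_refl : (genRec a Q w).1 ◃ instId a (refl a) = w.1 := by
  rw [genRec, Jgen_instId, J_refl]; rfl

theorem genRec_sub {a : Tm A} {Q : Ty (Γ ▹ A)} {w : Tm (Q ◂ inst a)} (σ : Δ ⟶ Γ) {A' : Ty Δ}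
    {a' : Tm A'} {Q' : Ty (Δ ▹ A')} {w' : Tm (Q' ◂ inst a')} (hA : A ◂ σ = A')
    (ha : a.1 ◃ σ = a'.1) (hQ : Q ◂ liftTo σ hA = Q') (hw : w.1 ◃ σ = w'.1) :
    (genRec a Q w).1 ◃ liftTo (liftTo σ hA) (IdFam_sub_eq σ hA ha) = (genRec a' Q' w').1 := by
  subst hA
  obtain rfl : a.sub σ = a' := Tm.ext ha
  subst hQ
  refine J_sub_eq _ ?_ ?_ ?_ ?_ ?_ ?_
  case refine_4 =>
    change w.1 ◃ _ ◃ _ = w'.1 ◃ _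
    rw [← hw]; simp [lift_eq, liftTo_eq]
  case refine_6 => change q _ ◃ _ = q _; simp [liftTo_eq]
  all_goals simp [instId, cons_eq, inst_eq, lift_eq, liftTo_eq]

/-- The map `(a, y, e) ↦ (a, y, t)` that sends paths from `a` to elements of `Q`. -/
def recMap : Γ ▹ A ▹ IdFam a ⟶ Γ ▹ A ▹ Q := cons (p (IdFam a)) (genRec a Q w)

theorem instId_recMap : instId a (refl a) ≫ recMap a Q w = cons (inst a) w := by
  rw [recMap, cons_eq, comp_pair, cons_eq]
  exact pair_congr (by simp [instId, cons_eq]) (genRec_refl a Q w) _ _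

/-- If the map from paths to `Q` has a section up to paths, then the pair `(a, w)` is a centre of
contraction. -/
theorem cov_of_rec_section (e : Tm (IdFam a ◂ p Q))
    (he : Path ((genRec a Q w).1 ◃ cons (p Q) e) (q Q)) : Cov (cons (inst a) w) := by
  intro P hP
  rw [← instId_recMap, ← tySub_tySub] at hP
  have h := (cov_instId a _ hP).sub (cons (p Q) e)
  rw [tySub_tySub] at h
  have := transport (τ := 𝟙 _) (by simp [recMap, cons_eq])
    (by simpa [recMap, cons_eq] using he) h
  rwa [tySub_id] at this

variable [HasPi C]

theorem app_idRec (b : Tm A) : (app (idRec a Q w b)).1 =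
    (genRec a Q w).1 ◃ liftTo (inst b) (IdFam_inst a b) := by
  rw [idRec, app_lam, Tm.cast_val, genRec, Jgen, Tm.cast_val]
  symm
  refine J_sub_eq _ ?_ ?_ ?_ ?_ ?_ ?_
  case refine_4 => change w.1 ◃ _ ◃ _ = w.1 ◃ _; simp [inst_eq, liftTo_eq]
  case refine_6 => change q _ ◃ _ = q _; simp [liftTo_eq]
  all_goals simp [instId, cons_eq, inst_eq, lift_eq, liftTo_eq]

variable [HasSigma C] {a Q w}

/-- If `(a, w)` is a centre of contraction, then every element of `Q` comes from a path. -/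
theorem exists_section_of_cov (hc : Cov (cons (inst a) w)) : ∃ e : Tm (IdFam a ◂ p Q),
    Path ((genRec a Q w).1 ◃ cons (p Q) e) (q Q) := by
  have key := hc (Sig (IdFam a ◂ p Q) (IdTy ((genRec a Q w).sub (lift (p Q) (IdFam a)))
    (((var Q).sub (p _)).cast (by simp [lift_eq]))))
  rw [inh_Sig_sub, inh_Sig] at key
  obtain ⟨e, he⟩ := key ⟨(refl a).cast (by
    rw [← IdFam_inst]; simp [cons_eq]), by
      rw [inh_IdTy_sub]
      refine Path.of_eq ?_
      rw [Tm.sub_val, tmSub_tmSub, cons_lift]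
      refine Eq.trans ?_ ((genRec_refl a Q w).trans ?_)
      · exact congrArg _ (cons_congr rfl (by simp [cons_eq]))
      · simp [cons_eq]⟩
  refine ⟨e, ?_⟩
  rw [inh_IdTy_sub, inst, Tm.sub_val, tmSub_tmSub, cons_lift] at he
  have h1 : cons (𝟙 (Γ ▹ A ▹ Q) ≫ p Q) ((e.cast (tySub_id _).symm).cast (tySub_tySub _ _ _)) =
      cons (p Q) e := cons_congr rfl (by simp)
  rw [h1] at he
  simpa [cons_eq] using he

/-- If `(a, w)` is a centre of contraction, then the canonical maps from paths to `Q` have a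
pointwise section and a pointwise retraction. -/
theorem exists_inverse_of_cov (hc : Cov (cons (inst a) w)) (b : Tm A) :
    (∃ s : Tm (Arr (Q ◂ inst b) (IdTy a b)),
      Path (app (comp (idRec a Q w b) s)).1 (app (idFun _)).1) ∧
    ∃ r : Tm (Arr (Q ◂ inst b) (IdTy a b)),
      Path (app (comp r (idRec a Q w b))).1 (app (idFun _)).1 := by
  obtain ⟨e, he⟩ := exists_section_of_cov hc
  have hT : IdFam a ◂ p Q ◂ lift (inst b) Q = IdTy a b ◂ p _ := by
    rw [← IdFam_inst]; simp [lift_eq]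
  constructor
  · refine ⟨arrLam ((e.sub (lift (inst b) Q)).cast hT), ?_⟩
    have h := he.sub (lift (inst b) Q)
    rw [app_comp, app_idFun, app_idRec, tmSub_tmSub, appMap_eq, app_arrLam]
    have h1 : pair (p (Q ◂ inst b)) (IdTy a b) ((e.sub (lift (inst b) Q)).cast hT).1
        ((e.sub (lift (inst b) Q)).cast hT).2 ≫ liftTo (inst b) (IdFam_inst a b) =
        lift (inst b) Q ≫ cons (p Q) e := by
      apply pair_uniq <;> simp [liftTo_eq, lift_eq, cons_eq]
    rw [h1, ← tmSub_tmSub]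
    simpa [lift_eq] using h
  · have hT' : IdFam a ◂ p Q ◂ cons (inst a) w = IdTy a a := by
      rw [← IdFam_inst]; simp [cons_eq]
    let a' : Tm (A ◂ (p Q ≫ p A)) := a.sub _
    let b' : Tm (A ◂ (p Q ≫ p A)) := ((var A).sub (p Q)).cast (tySub_tySub _ _ _)
    let u : Tm (IdTy a' a') := (((e.sub (cons (inst a) w)).cast hT').sub (p Q ≫ p A)).cast
      (IdTy_sub _ _ _)
    let v : Tm (IdTy a' b') := e.cast (by
      refine (IdTy_sub _ _ _).trans
        (IdTy_congr (tySub_tySub _ _ _) (by simp [a']) (by simp [b'])))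
    let D : Tm (IdTy a' b') := ldiv u v
    have hD : D.1 ◃ cons (inst a) w =
        (ldiv ((e.sub (cons (inst a) w)).cast hT') ((e.sub (cons (inst a) w)).cast hT')).1 :=
      ldiv_sub_eq _ (by simp [cons_eq, inst_eq]) (by simp [a', cons_eq, inst_eq])
        (by simp [a', cons_eq, inst_eq]) (by simp [b', cons_eq, inst_eq])
        (by simp [u, cons_eq, inst_eq]) rfl
    have hR : Path (D.1 ◃ recMap a Q w) (q (IdFam a)) := by
      have hDt : ty (D.1 ◃ recMap a Q w) = IdFam a ◂ p (IdFam a) := by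
        rw [ty_sub, D.2, IdTy_sub]
        refine Eq.trans ?_ (IdTy_sub _ _ _).symm
        exact IdTy_congr (by simp [recMap, cons_eq]) (by simp [a', recMap, cons_eq])
          (by simp [b', recMap, cons_eq])
      have := cov_instId a (IdTy ⟨_, hDt⟩ (var (IdFam a)))
      rw [inh_IdTy_sub, tmSub_tmSub, instId_recMap, hD, ← path_iff] at this
      refine this ((ldiv_self _).trans (Path.of_eq ?_))
      simp [instId, cons_eq]
    have hDb : IdTy a' b' ◂ lift (inst b) Q = IdTy a b ◂ p _ := by
      rw [IdTy_sub, IdTy_sub]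
      exact IdTy_congr (by simp [lift_eq, inst_eq]) (by simp [a', lift_eq, inst_eq])
        (by simp [b', lift_eq, inst_eq])
    refine ⟨arrLam ((D.sub (lift (inst b) Q)).cast hDb), ?_⟩
    rw [app_comp, app_idFun, app_arrLam, Tm.cast_val, Tm.sub_val, tmSub_tmSub]
    have h1 : appMap (idRec a Q w b) ≫ lift (inst b) Q =
        liftTo (inst b) (IdFam_inst a b) ≫ recMap a Q w := by
      apply pair_uniq
      · apply pair_uniq <;> simp [liftTo_eq, lift_eq, cons_eq, appMap_eq, recMap]
      · have h2 : q Q ◃ (appMap (idRec a Q w b) ≫ lift (inst b) Q) = (app (idRec a Q w b)).1 := by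
          simp [lift_eq, appMap_eq]
        rw [h2, app_idRec, recMap, cons_eq, comp_pair, pair_q]
    rw [h1, ← tmSub_tmSub]
    simpa [liftTo_eq] using hR.sub (liftTo (inst b) (IdFam_inst a b))

end Rec

/-! ### Contractible pairs -/

section Contractible

variable {C : Type u} [Category.{v} C] [NaturalModel.{w} C] [HasSigma C] {Γ Δ Θ Ξ : C}

theorem gpair_inst {A : Ty Γ} {B : Ty (Γ ▹ A)} (a : Tm A) (b : Tm (B ◂ inst a)) :
    (gpair A B).1 ◃ cons (inst a) b = (dpair a b).1 := by
  refine (gpair_cons (𝟙 Γ) _ b).trans ?_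
  refine (tmSub_id _).symm.trans (dpair_sub_eq (𝟙 Γ) ?_ ?_ (tmSub_id _) (tmSub_id _))
  · simp
  · simp [liftTo_eq, lift_eq]

variable [HasId C]

theorem Cov.path_dpair {A : Ty Γ} {B : Ty (Γ ▹ A)} {a : Tm A} {b : Tm (B ◂ inst a)}
    (h : Cov (cons (inst a) b)) (σ : Δ ⟶ Γ) (t : Tm (Sig A B ◂ σ)) :
    Path ((dpair a b).1 ◃ σ) t.1 := by
  have := (h.path (by simp [cons_eq, inst_eq])).sub
    (cons (cons σ (fstAt σ A B t.1 t.2)) (sndAt σ A B t.1 t.2))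
  rw [gpair_cons, dpairAt_eta] at this
  rw [← gpair_inst]
  simpa [cons_eq] using this

variable [HasPi C]

/-- If `(a, b)` is a centre of contraction of its first two components, and the fibre of `D` over
it is contractible, then a third component can be added. -/
theorem cov_cons {A : Ty Γ} {B : Ty (Γ ▹ A)} {D : Ty (Γ ▹ A ▹ B)} {i : Γ ⟶ Γ ▹ A ▹ B}
    (hi : i ≫ p B ≫ p A = 𝟙 Γ) (d : Tm (D ◂ i)) (hd : Path (d.1 ◃ p (D ◂ i)) (q (D ◂ i)))
    (h : Path ((gpair A B).1 ◃ (p D ≫ p B ≫ p A ≫ i)) ((gpair A B).1 ◃ p D)) :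
    Cov (cons i d) := fun P hP => by
  have h1 : Inh (P ◂ lift i D) := by
    refine transport (σ := p (D ◂ i) ≫ cons i d) ?_ ?_ (hP.sub_eq (p (D ◂ i)) (tySub_tySub _ _ _))
    · simp [cons_eq, lift_eq]
    · simpa [cons_eq, lift_eq] using hd
  have h2 : Inh (Pi D P ◂ i) := (inh_Pi_sub i rfl).2 h1
  have h3 := transport_gpair (τ := p D) (by simp [hi]) h
    (P := Pi D P) (h2.sub_eq (p D ≫ p B ≫ p A) (by rw [tySub_tySub]; simp))
  rw [inh_Pi_sub (p D) rfl] at h3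
  exact h3.sub_eq (inst (var D)) (by simp [inst_eq, liftTo_eq])

/-- Singletons `Σ x : A, x = t` are contractible, on terms given as pairs. -/
theorem path_dpair_refl {A : Ty Γ} {t : Tm A} {B : Ty (Γ ▹ A)}
    (hB : B = IdTy (var A) (t.sub (p A))) {r : Tm (B ◂ inst t)} (hr : r.1 = (refl t).1) (s : Tm A)
    (e : Tm (B ◂ inst s)) : Path (dpair t r).1 (dpair s e).1 := by
  subst hB
  have hI : ∀ {Θ : C} {A : Ty Θ} (t s : Tm A), IdTy (var A) (t.sub (p A)) ◂ inst s = IdTy s t := by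
    intro Θ A t s
    rw [IdTy_sub]
    exact IdTy_congr (by simp [inst_eq]) (by simp [inst_eq]) (by simp [inst_eq])
  let pt : ∀ {Θ : C} {A : Ty Θ} (t s : Tm A), Tm (IdTy s t) →
      Tm (Sig A (IdTy (var A) (t.sub (p A)))) := fun t s e => dpair s (e.cast (hI t s).symm)
  have pt_sub : ∀ {Θ Ξ : C} {A : Ty Θ} (σ : Ξ ⟶ Θ) (t s : Tm A) (e : Tm (IdTy s t)) {A' : Ty Ξ}
      (t' s' : Tm A') (e' : Tm (IdTy s' t')), A ◂ σ = A' → t.1 ◃ σ = t'.1 → s.1 ◃ σ = s'.1 →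
      e.1 ◃ σ = e'.1 → (pt t s e).1 ◃ σ = (pt t' s' e').1 := by
    intro Θ Ξ A σ t s e A' t' s' e' hA ht hs he
    refine dpair_sub_eq σ hA ?_ hs he
    exact IdTy_sub_eq _ (by simp [liftTo_eq]) (by simp [liftTo_eq, ← ht])
  have hr' : dpair t r = pt t t (refl t) := congrArg (dpair t) (Tm.ext hr)
  obtain ⟨e', rfl⟩ : ∃ e' : Tm (IdTy s t), e = e'.cast (hI t s).symm := ⟨e.cast (hI t s), rfl⟩
  rw [hr']
  change Path _ (pt t s e').1
  let s' : Tm (A ◂ (p (IdFam s) ≫ p A)) := s.sub _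
  let y : Tm (A ◂ (p (IdFam s) ≫ p A)) := ((var A).sub (p (IdFam s))).cast (tySub_tySub _ _ _)
  let d : Tm (IdTy s' y) := (var (IdFam s)).cast (IdTy_sub_eq _ (by simp [s']) (by simp [y]))
  have key : ∀ (t : Tm A) (e : Tm (IdTy s t)),
      Inh (IdTy (pt y y (refl y)) (pt y s' d) ◂ instId s e) ↔
        Path (pt t t (refl t)).1 (pt t s e).1 := by
    intro t e
    have hA : A ◂ (p (IdFam s) ≫ p A) ◂ instId s e = A := by simp [instId, cons_eq, inst_eq]
    have hs : s'.1 ◃ instId s e = s.1 := by simp [s', instId, cons_eq, inst_eq]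
    have hy : y.1 ◃ instId s e = t.1 := by simp [y, instId, cons_eq, inst_eq]
    have hd : d.1 ◃ instId s e = e.1 := by
      change q (IdFam s) ◃ _ = _; simp [instId, cons_eq]
    rw [inh_IdTy_sub, pt_sub (instId s e) y y (refl y) t t (refl t) hA hy hy (refl_sub_eq _ hA hy),
      pt_sub (instId s e) y s' d t s e hA hy hs hd]
  exact (key t e').1 ((cov_instId s _ ((key s (refl s)).2 (Path.refl _))).sub _)

theorem path_sig_refl {A : Ty Γ} {t : Tm A} {B : Ty (Γ ▹ A)}
    (hB : B = IdTy (var A) (t.sub (p A))) {r : Tm (B ◂ inst t)} (hr : r.1 = (refl t).1)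
    (z : Tm (Sig A B)) : Path (dpair t r).1 z.1 := by
  rw [← dpair_eta z]; exact path_dpair_refl hB hr _ _

theorem Path.prodMk {A B : Ty Γ} {a a' : Tm A} {b b' : Tm B} (ha : Path a.1 a'.1)
    (hb : Path b.1 b'.1) : Path (prodMk a b).1 (prodMk a' b').1 := by
  have ps : ∀ {Δ : C} (σ : Δ ⟶ Γ) {A : Ty Γ} {A' B' : Ty Δ} (a : Tm A) (b : Tm B) (a' : Tm A')
      (b' : Tm B'), A ◂ σ = A' → B ◂ σ = B' → a.1 ◃ σ = a'.1 → b.1 ◃ σ = b'.1 →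
      (TT.prodMk a b).1 ◃ σ = (TT.prodMk a' b').1 := by
    intro Δ σ A A' B' a b a' b' hA hB ha hb
    exact dpair_sub_eq σ hA (by rw [← hB]; simp [liftTo_eq]) ha hb
  have h1 : Path (TT.prodMk a b).1 (TT.prodMk a' b).1 := by
    have hA : ∀ x : Tm A, A ◂ p A ◂ inst x = A := fun x => by simp [inst_eq]
    have hB : ∀ x : Tm A, B ◂ p A ◂ inst x = B := fun x => by simp [inst_eq]
    have hs := fun x : Tm A => dpair_sub_eq (inst x) (hA x) (B := B ◂ p A ◂ p (A ◂ p A))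
      (B' := B ◂ p A) (by simp [inst_eq, liftTo_eq]) (a := var A)
      (b := (b.sub (p A)).cast (by simp [inst_eq])) (a' := x)
      (b' := b.cast (by simp [inst_eq])) (by simp [inst_eq]) (by simp [inst_eq])
    refine ((Path.of_eq (hs a).symm).trans (Path.ap (σ := inst a) (τ := inst a')
      (by simp [inst_eq]) (by simpa [inst_eq] using ha) (B := Prod A B) ?_)).trans
      (Path.of_eq (hs a'))
    exact (Tm.prop _).trans (Prod_sub_eq (p A) rfl rfl).symm
  have h2 : Path (TT.prodMk a' b).1 (TT.prodMk a' b').1 := by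
    have hA : ∀ x : Tm B, A ◂ p B ◂ inst x = A := fun x => by simp [inst_eq]
    have hB : ∀ x : Tm B, B ◂ p B ◂ inst x = B := fun x => by simp [inst_eq]
    have hs := fun x : Tm B => dpair_sub_eq (inst x) (hA x) (B := B ◂ p B ◂ p (A ◂ p B))
      (B' := B ◂ p A) (by simp [inst_eq, liftTo_eq]) (a := a'.sub (p B))
      (b := (var B).cast (by simp [inst_eq])) (a' := a')
      (b' := x.cast (by simp [inst_eq])) (by simp [inst_eq]) (by simp [inst_eq])
    refine ((Path.of_eq (hs b).symm).trans (Path.ap (σ := inst b) (τ := inst b')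
      (by simp [inst_eq]) (by simpa [inst_eq] using hb) (B := Prod A B) ?_)).trans
      (Path.of_eq (hs b'))
    exact (Tm.prop _).trans (Prod_sub_eq (p B) rfl rfl).symm
  exact h1.trans h2

theorem prodMk_eta {A B : Ty Γ} (t : Tm (Prod A B)) :
    prodMk (fst t) ((snd t).cast (by simp [inst_eq])) = t := dpair_eta t

/-- Being a categorical equivalence has a unique proof at identity functions, since the sections
and the retractions of identity functions are singletons. -/
theorem path_isCEq_idFun {A : Ty Γ} (c : Tm (isCEq (idFun A))) : Path (isCEq_idFun A).1 c.1 := by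
  have hi : fsub (idFun A) (p (Arr A A)) = idFun (A ◂ p _) := Tm.ext (idFun_sub_eq _ rfl)
  have hv : idFun (A ◂ p (Arr A A)) = ((idFun A).sub (p _)).cast (Arr_sub _ _ _) :=
    Tm.ext (idFun_sub_eq _ rfl).symm
  have hS : IdTy (comp (fsub (idFun A) (p _)) (fvar A A)) (idFun (A ◂ p _)) =
      IdTy (var (Arr A A)) ((idFun A).sub (p _)) := by
    rw [hi, comp_idFun_left]
    exact IdTy_congr (Arr_sub _ _ _).symm rfl (idFun_sub_eq _ rfl).symm
  have hR : IdTy (comp (fvar A A) (fsub (idFun A) (p _))) (idFun (A ◂ p _)) =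
      IdTy (var (Arr A A)) ((idFun A).sub (p _)) := by
    rw [hi, comp_idFun_right]
    exact IdTy_congr (Arr_sub _ _ _).symm rfl (idFun_sub_eq _ rfl).symm
  rw [← prodMk_eta c]
  refine Path.prodMk ?_ ?_
  · exact path_sig_refl hS rfl _
  · exact path_sig_refl hR rfl _

end Contractible

/-! ### Functions into contractible types of pairs -/

section FunExt

variable {C : Type u} [Category.{v} C] [NaturalModel.{w} C] [HasPi C] [HasSigma C] [HasId C]
  {Γ Δ Θ Ξ : C}

/-- Function extensionality, as a statement about the existence of paths. -/
theorem FunExt.path (hFE : FunExt C) {A : Ty Γ} {B : Ty (Γ ▹ A)} {f g : Tm (Pi A B)}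
    (h : Path (app f).1 (app g).1) : Path f.1 g.1 := by
  obtain ⟨s, -⟩ := inh_HSec.1 (inh_Prod.1 (hFE f g)).1
  obtain ⟨x⟩ := inh_Htpy.2 h
  exact path_iff.2 ((Tm.inh (app s)).sub_eq (inst x) (by simp [inst_eq]))

/-- The type of the second components of functions into a dependent sum. -/
def piSnd {X : Ty Γ} {A : Ty (Γ ▹ X)} (Q : Ty (Γ ▹ X ▹ A)) : Ty (Γ ▹ Pi X A) :=
  Pi (X ◂ p _) (Q ◂ cons (lift (p (Pi X A)) X) (app ((var (Pi X A)).cast (Pi_sub _ _ _))))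

variable {X : Ty Γ} {A : Ty (Γ ▹ X)} {Q : Ty (Γ ▹ X ▹ A)}

theorem piSnd_cons (σ : Δ ⟶ Γ) {X' : Ty Δ} (hX : X ◂ σ = X') (a : Tm (A ◂ liftTo σ hX))
    (f : Tm (Pi X A ◂ σ)) (hf : f.1 = (lam a).1) :
    piSnd Q ◂ cons σ f = Pi X' (Q ◂ cons (liftTo σ hX) a) := by
  have h : X ◂ p (Pi X A) ◂ cons σ f = X' := by rw [← hX]; simp [cons_eq]
  have hl : liftTo (cons σ f) h ≫ lift (p _) X = liftTo σ hX := by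
    simp [liftTo_eq, lift_eq, cons_eq]
  refine Pi_sub_eq _ h ?_
  rw [tySub_tySub]
  congr 1
  rw [cons_eq (lift _ _), comp_pair, cons_eq (liftTo σ hX)]
  refine pair_congr hl ?_ _ _
  refine (app_sub_eq (cons σ f) h (B' := A ◂ liftTo σ hX) ?_ (f' := lam a) ?_).trans
    (congrArg Tm.val (app_lam a))
  · rw [tySub_tySub, hl]
  · simp [cons_eq, hf]

/-- The pair of functions `λ x, a x` and `λ x, b x`, as a substitution. -/
def lamMap (σ : Δ ⟶ Γ) {X' : Ty Δ} (hX : X ◂ σ = X') (a : Tm (A ◂ liftTo σ hX))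
    (b : Tm (Q ◂ cons (liftTo σ hX) a)) : Δ ⟶ Γ ▹ Pi X A ▹ piSnd Q :=
  cons (cons σ ((lam a).cast (Pi_sub_eq σ hX rfl).symm))
    ((lam b).cast (piSnd_cons σ hX a _ rfl).symm)

/-- The generic function into a dependent sum, applied. -/
def genApp (Q : Ty (Γ ▹ X ▹ A)) :
    Tm (Sig A Q ◂ liftTo (p (Pi X (Sig A Q))) (rfl : X ◂ p _ = X ◂ p _)) :=
  app ((var (Pi X (Sig A Q))).cast (Pi_sub _ _ _))

/-- Functions into a dependent sum are pairs of functions. -/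
def splitPi (Q : Ty (Γ ▹ X ▹ A)) : Γ ▹ Pi X (Sig A Q) ⟶ Γ ▹ Pi X A ▹ piSnd Q :=
  lamMap (p (Pi X (Sig A Q))) rfl (fstAt _ A Q (genApp Q).1 (genApp Q).2)
    (sndAt _ A Q (genApp Q).1 (genApp Q).2)

theorem cons_splitPi (σ : Δ ⟶ Γ) {X' : Ty Δ} (hX : X ◂ σ = X') (a : Tm (A ◂ liftTo σ hX))
    (b : Tm (Q ◂ cons (liftTo σ hX) a)) (g : Tm (Pi X (Sig A Q) ◂ σ))
    (hg : g.1 = (lam (dpairAt (liftTo σ hX) a b)).1) :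
    cons σ g ≫ splitPi Q = lamMap σ hX a b := by
  have h : X ◂ p (Pi X (Sig A Q)) ◂ cons σ g = X' := by rw [← hX]; simp [cons_eq]
  have hl : liftTo (cons σ g) h ≫ liftTo (p _) (rfl : X ◂ p _ = X ◂ p _) = liftTo σ hX := by
    simp [liftTo_eq, cons_eq]
  have hv : (genApp Q).1 ◃ liftTo (cons σ g) h = (dpairAt (liftTo σ hX) a b).1 := by
    refine (app_sub_eq (cons σ g) h (B' := Sig A Q ◂ liftTo σ hX) ?_
      (f' := lam (dpairAt (liftTo σ hX) a b)) ?_).trans (congrArg Tm.val (app_lam _))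
    · rw [tySub_tySub]; exact congrArg _ hl
    · change q _ ◃ _ = _; simp [cons_eq, hg]
  have h1 : (fstAt _ A Q (genApp Q).1 (genApp Q).2).1 ◃ liftTo (cons σ g) h = a.1 :=
    (fstAt_sub _ _ _ _ _ _).trans ((fstAt_congr' hl hv _ (Tm.prop _)).trans
      (fstAt_dpairAt (liftTo σ hX) a b (Tm.prop _)))
  have h2 : (sndAt _ A Q (genApp Q).1 (genApp Q).2).1 ◃ liftTo (cons σ g) h = b.1 :=
    (sndAt_sub _ _ _ _ _ _).trans ((sndAt_congr' hl hv _ (Tm.prop _)).trans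
      (sndAt_dpairAt (liftTo σ hX) a b (Tm.prop _)))
  apply pair_uniq
  · apply pair_uniq
    · simp [splitPi, lamMap, cons_eq]
    · rw [splitPi, lamMap, cons_eq (cons _ _), comp_pair, pair_p, cons_eq (p _), comp_pair, pair_q,
        lamMap, cons_eq (cons _ _), pair_p, cons_eq σ ((lam a).cast _), pair_q]
      exact lam_sub_eq _ h h1
  · rw [splitPi, lamMap, cons_eq (cons _ _), comp_pair, pair_q, lamMap, cons_eq (cons _ _), pair_q]
    exact lam_sub_eq _ h h2

/-- Function extensionality makes families of contractible types of pairs contractible. -/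
theorem cov_lamMap (hFE : FunExt C) (a : Tm A) (b : Tm (Q ◂ inst a)) (h : Cov (cons (inst a) b))
    (a' : Tm (A ◂ liftTo (𝟙 Γ) (tySub_id X))) (b' : Tm (Q ◂ cons (liftTo (𝟙 Γ) (tySub_id X)) a'))
    (ha : a.1 = a'.1) (hb : b.1 = b'.1) : Cov (lamMap (𝟙 Γ) (tySub_id X) a' b') := by
  have e := liftTo_id (tySub_id X)
  let g : Tm (Pi X (Sig A Q)) := lam (dpair a b)
  have hg : Cov (inst g) := fun P hP => by
    have h1 : Path (g.1 ◃ p (Pi X (Sig A Q))) (q (Pi X (Sig A Q))) := by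
      have := hFE.path (f := (g.sub (p (Pi X (Sig A Q)))).cast (Pi_sub _ _ _))
        (g := (var (Pi X (Sig A Q))).cast (Pi_sub _ _ _)) ?_
      · exact this
      · have h2 := h.path_dpair (lift (p (Pi X (Sig A Q))) X)
          (app ((var (Pi X (Sig A Q))).cast (Pi_sub _ _ _)))
        refine Path.trans (Path.of_eq ?_) h2
        refine (app_sub_eq (f := g) (p (Pi X (Sig A Q))) rfl rfl rfl).symm.trans ?_
        rw [app_lam]; rfl
    have h2 := transport (σ := p (Pi X (Sig A Q)) ≫ inst g) (τ := 𝟙 _) (by simp [inst_eq])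
      (by simpa [inst_eq] using h1) (hP.sub_eq (p _) (tySub_tySub _ _ _))
    rwa [tySub_id] at h2
  -- functions into a dependent sum are pairs of functions, so contractibility carries over
  let π : Γ ▹ Pi X A ▹ piSnd Q ⟶ Γ := p (piSnd Q) ≫ p (Pi X A)
  let f : Tm (Pi (X ◂ π) (A ◂ liftTo π (rfl : X ◂ π = X ◂ π))) :=
    ((var (Pi X A)).sub (p (piSnd Q))).cast ((tySub_tySub _ _ _).trans (Pi_sub _ _ _))
  have hk : piSnd Q ◂ p (piSnd Q) = Pi (X ◂ π) (Q ◂ cons (liftTo π rfl) (app f)) := by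
    have := piSnd_cons (Q := Q) π rfl (app f)
      (((var (Pi X A)).sub (p (piSnd Q))).cast (tySub_tySub _ _ _))
      (congrArg Tm.val (lam_app f).symm)
    exact (congrArg (piSnd Q ◂ ·) (cons_q (Pi X A) (p (piSnd Q)) (tySub_tySub _ _ _) rfl).symm).trans
      this
  let k : Tm (Pi (X ◂ π) (Q ◂ cons (liftTo π rfl) (app f))) := (var (piSnd Q)).cast hk
  have hs : Cov (splitPi Q) := by
    refine cov_of_section (s := cons π ((lam (dpairAt (liftTo π rfl) (app f) (app k))).cast
      (Pi_sub _ _ _).symm)) ?_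
    refine (cons_splitPi π rfl (app f) (app k) _ rfl).trans ?_
    apply pair_uniq
    · apply pair_uniq
      · simp [lamMap, cons_eq, π]
      · simp only [lamMap, cons_eq, pair_p, pair_q, Category.id_comp, Tm.cast_val]
        exact congrArg Tm.val (lam_app f)
    · simp only [lamMap, cons_eq, pair_q, tmSub_id, Tm.cast_val]
      exact congrArg Tm.val (lam_app k)
  have := hs.comp hg
  rw [inst, cons_splitPi (𝟙 Γ) (tySub_id X) a' b'] at this
  · exact this
  · refine lam_congr ((tmSub_id _).symm.trans (dpair_sub_eq (𝟙 _) ?_ ?_ ?_ ?_))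
    · rw [e]
    · simp [liftTo_eq, lift_eq]
    · rw [tmSub_id, ha]
    · rw [tmSub_id, Tm.cast_val, hb]

end FunExt

/-! ### Equivalences and univalence -/

section Equivalences

variable {C : Type u} [Category.{v} C] [NaturalModel.{w} C] [HasPi C] [HasSigma C] {Γ Δ Θ Ξ : C}
  {A B : Ty Γ}

section
variable [HasIdIntro C]

theorem isEquiv_inst (f : Tm (Arr A B)) : isEquiv (fvar A B) ◂ inst f = isEquiv f :=
  isEquiv_sub_eq _ (by simp [inst_eq]) (by simp [inst_eq]) (by simp [inst_eq])

/-- The inverse of an equivalence, as given by its section. -/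
def eqvInv (t : Tm (Eqv A B)) : Tm (Arr B A) := fst (fst ((snd t).cast (isEquiv_inst (fst t))))

theorem fst_isEquiv_sub_eq (σ : Δ ⟶ Γ) {A' B' : Ty Δ} (hA : A ◂ σ = A') (hB : B ◂ σ = B')
    {f : Tm (Arr A B)} {f' : Tm (Arr A' B')} (hf : f.1 ◃ σ = f'.1) {c : Tm (isEquiv f)}
    {c' : Tm (isEquiv f')} (hc : c.1 ◃ σ = c'.1) : (fst (fst c)).1 ◃ σ = (fst (fst c')).1 := by
  refine fst_sub_eq σ (Arr_sub_eq σ hB hA)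
    (Htpy_sub_eq _ ?_ ?_ (comp_sub_eq _ ?_ ?_ ?_ ?_ ?_) (idFun_sub_eq _ ?_))
    (fst_sub_eq σ (HSec_sub_eq σ hA hB hf) ?_ hc)
  case refine_9 =>
    rw [← HRet_sub_eq σ hA hB hf]; simp [liftTo_eq]
  all_goals simp [liftTo_eq, ← hA, ← hB, ← hf]

theorem eqvInv_sub_eq (σ : Δ ⟶ Γ) {A' B' : Ty Δ} (hA : A ◂ σ = A') (hB : B ◂ σ = B')
    {t : Tm (Eqv A B)} {t' : Tm (Eqv A' B')} (ht : t.1 ◃ σ = t'.1) :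
    (eqvInv t).1 ◃ σ = (eqvInv t').1 := by
  have hc : isEquiv (fvar A B) ◂ liftTo σ (Arr_sub_eq σ hA hB) = isEquiv (fvar A' B') := by
    refine isEquiv_sub_eq _ ?_ ?_ ?_
    all_goals simp [liftTo_eq, ← hA, ← hB]
  exact fst_isEquiv_sub_eq σ hA hB (fst_sub_eq σ (Arr_sub_eq σ hA hB) hc ht)
    (snd_sub_eq σ (Arr_sub_eq σ hA hB) hc ht)

theorem eqvInv_mk (f : Tm (Arr A B)) (c : Tm (isEquiv f)) :
    eqvInv (dpair f (c.cast (isEquiv_inst f).symm)) = fst (fst c) := by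
  refine Tm.ext ((tmSub_id _).symm.trans
    (fst_isEquiv_sub_eq (𝟙 Γ) (tySub_id A) (tySub_id B) ?_ ?_))
  · rw [tmSub_id, fst_dpair]
  · rw [tmSub_id]; exact snd_dpair _ _

theorem eqvInv_idEqv : eqvInv (idEqv A) = idFun A := by
  refine (eqvInv_mk _ _).trans ?_
  refine (congrArg fst (fst_dpair _ _)).trans ?_
  exact fst_dpair _ _

theorem fst_idEqv : fst (idEqv A) = idFun A := fst_dpair _ _

theorem Htpy_refl_sub_eq {C : Type u} [Category.{v} C] [NaturalModel.{w} C] [HasPi C] [HasId C]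
    {Γ Δ : C} {A : Ty Γ} {B : Ty (Γ ▹ A)} {f : Tm (Pi A B)} (σ : Δ ⟶ Γ) {A' : Ty Δ}
    {B' : Ty (Δ ▹ A')} {f' : Tm (Pi A' B')} (hA : A ◂ σ = A') (hB : B ◂ liftTo σ hA = B')
    (hf : f.1 ◃ σ = f'.1) : (Htpy.refl f).1 ◃ σ = (Htpy.refl f').1 := by
  exact lam_sub_eq σ hA (refl_sub_eq (liftTo σ hA) hB (app_sub_eq σ hA hB hf))

theorem isEquiv_idFun_sub_eq {C : Type u} [Category.{v} C] [NaturalModel.{w} C] [HasPi C]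
    [HasSigma C] [HasId C] {Γ Δ : C} {A : Ty Γ} (σ : Δ ⟶ Γ) {A' : Ty Δ} (hA : A ◂ σ = A') :
    (isEquiv_idFun A).1 ◃ σ = (isEquiv_idFun A').1 := by
  have hf : (idFun A).1 ◃ σ = (idFun A').1 := idFun_sub_eq σ hA
  have hc : ∀ {Γ : C} (A : Ty Γ), comp (idFun A) (idFun A) = idFun A := fun A => comp_idFun
  have hr : (Htpy.refl (idFun A)).1 ◃ σ = (Htpy.refl (idFun A')).1 :=
    Htpy_refl_sub_eq σ hA (by simp [liftTo_eq, ← hA]) hf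
  refine dpair_sub_eq σ (HSec_sub_eq σ hA hA hf) ?_ (dpair_sub_eq σ (Arr_sub_eq σ hA hA) ?_ hf hr)
    (dpair_sub_eq σ (Arr_sub_eq σ hA hA) ?_ hf hr)
  · rw [← HRet_sub_eq σ hA hA hf]; simp [liftTo_eq]
  · refine Htpy_sub_eq _ ?_ ?_ (comp_sub_eq _ ?_ ?_ ?_ ?_ ?_) (idFun_sub_eq _ ?_)
    all_goals simp [liftTo_eq, ← hA, ← hf]
  · refine Htpy_sub_eq _ ?_ ?_ (comp_sub_eq _ ?_ ?_ ?_ ?_ ?_) (idFun_sub_eq _ ?_)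
    all_goals simp [liftTo_eq, ← hA, ← hf]

theorem idEqv_sub_eq {C : Type u} [Category.{v} C] [NaturalModel.{w} C] [HasPi C]
    [HasSigma C] [HasId C] {Γ Δ : C} {A : Ty Γ} (σ : Δ ⟶ Γ) {A' : Ty Δ} (hA : A ◂ σ = A') :
    (idEqv A).1 ◃ σ = (idEqv A').1 := by
  refine dpair_sub_eq σ (Arr_sub_eq σ hA hA) ?_ (idFun_sub_eq σ hA) (isEquiv_idFun_sub_eq σ hA)
  refine isEquiv_sub_eq _ ?_ ?_ ?_
  all_goals simp [liftTo_eq, ← hA]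

end

variable [HasId C]

theorem inh_HRet {f : Tm (Arr A B)} :
    Inh (HRet f) ↔ ∃ r : Tm (Arr B A), Inh (Htpy (comp r f) (idFun A)) := by
  refine inh_Sig.trans (exists_congr fun s => ?_)
  rw [Htpy_sub_eq (inst s) (by simp [inst_eq]) (by simp [inst_eq, liftTo_eq])
    (app_inst_comp' s f) (idFun_sub_eq (inst s) (by simp [inst_eq]))]

theorem Htpy_inst_comp (f : Tm (Arr A B)) (s : Tm (Arr B A)) :
    Htpy (comp (fsub f (p _)) (fvar B A)) (idFun (B ◂ p _)) ◂ inst s =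
      Htpy (comp f s) (idFun B) :=
  Htpy_sub_eq (inst s) (by simp [inst_eq]) (by simp [inst_eq, liftTo_eq])
    (app_inst_comp f s) (idFun_sub_eq (inst s) (by simp [inst_eq]))

/-- A function with a section and a retraction gives an equivalence whose inverse is the section. -/
theorem exists_eqv {f : Tm (Arr A B)} {s r : Tm (Arr B A)} (hs : Path (comp f s).1 (idFun B).1)
    (hr : Path (comp r f).1 (idFun A).1) : ∃ t : Tm (Eqv A B), fst t = f ∧ eqvInv t = s := by
  obtain ⟨h⟩ := inh_Htpy.2 hs.happly
  obtain ⟨k⟩ := inh_HRet.2 ⟨r, inh_Htpy.2 hr.happly⟩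
  let c : Tm (isEquiv f) := prodMk (dpair s (h.cast (Htpy_inst_comp f s).symm)) k
  refine ⟨dpair f (c.cast (isEquiv_inst f).symm), fst_dpair _ _, (eqvInv_mk f c).trans ?_⟩
  refine (congrArg fst (fst_dpair _ _)).trans ?_
  exact fst_dpair _ _

end Equivalences

section Univalence

variable {C : Type u} [Category.{v} C] [NaturalModel.{w} C] [HasPi C] [HasSigma C] [HasId C]
  [HasUniv C] {Γ Δ Θ Ξ : C}

/-- The type of equivalences from `A` to the variable of type `U`. -/
def EqvFam (A : Tm (U Γ)) : Ty (Γ ▹ U Γ) := Eqv (El (usub A (p (U Γ)))) (El (uvar Γ))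

theorem EqvFam_inst (A B : Tm (U Γ)) : EqvFam A ◂ inst B = Eqv (El A) (El B) :=
  Eqv_sub_eq _ (El_inst A B) (El_uvar_inst B)

/-- By univalence, the equivalences from a given type are contractible. -/
theorem Univalence.cov (hUA : Univalence C) (A : Tm (U Γ)) :
    Cov (cons (inst A) ((idEqv (El A)).cast (EqvFam_inst A A).symm)) := by
  let π : Γ ▹ U Γ ▹ EqvFam A ⟶ Γ := p (EqvFam A) ≫ p (U Γ)
  let A' : Tm (U (Γ ▹ U Γ ▹ EqvFam A)) := usub A π
  let B' : Tm (U (Γ ▹ U Γ ▹ EqvFam A)) := usub (uvar Γ) (p (EqvFam A))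
  have hE : EqvFam A ◂ p (EqvFam A) = Eqv (El A') (El B') := by
    refine Eqv_sub_eq _ ((El_sub _ _).trans (congrArg El (Tm.ext ?_))) (El_sub _ _)
    simp [A', π]
  let x : Tm (Eqv (El A') (El B')) := (var (EqvFam A)).cast hE
  obtain ⟨s, hs⟩ := inh_HSec.1 (inh_Prod.1 (hUA A' B')).1
  have hx : inst x ≫ p (Eqv (El A') (El B')) = 𝟙 _ := by rw [inst_eq, pair_p]
  have hI : IdTy A' B' ◂ p (Eqv (El A') (El B')) ◂ inst x = IdFam A ◂ p (EqvFam A) := by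
    rw [tySub_tySub, hx, tySub_id]
    exact (IdTy_sub_eq (a := A.sub (p _)) (b := var (U Γ)) (p (EqvFam A))
      (by simp [A', π]) rfl).symm
  let e : Tm (IdFam A ◂ p (EqvFam A)) := ((app s).sub (inst x)).cast hI
  refine cov_of_rec_section A (EqvFam A) _ e ?_
  have h := (inh_Htpy.1 hs).sub (inst x)
  have h1 : (app (idFun (Eqv (El A') (El B')))).1 ◃ inst x = q (EqvFam A) := by
    rw [app_idFun]; simp [inst_eq, x]
  have hQ : ∀ h : U Γ ◂ π = U _, EqvFam A ◂ liftTo π h = EqvFam A' := fun h =>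
    Eqv_sub_eq _ ((El_sub _ _).trans (congrArg El (Tm.ext (by simp [A', liftTo_eq]))))
      ((El_sub _ _).trans (congrArg El (Tm.ext (by simp [uvar, liftTo_eq]))))
  have hw : (idEqv (El A)).1 ◃ π = (idEqv (El A')).1 := idEqv_sub_eq π (El_sub A π)
  have h2 : (app (idToEqv A' B')).1 = (genRec A (EqvFam A) ((idEqv (El A)).cast
      (EqvFam_inst A A).symm)).1 ◃ (liftTo (inst B') (IdFam_inst A' B') ≫
        liftTo (liftTo π (U_sub π)) (IdFam_sub_eq π (U_sub π) rfl)) := by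
    have h3 : (app (idToEqv A' B')).1 = (app (idRec A' (EqvFam A')
        ((idEqv (El A')).cast (EqvFam_inst A' A').symm) B')).1 :=
      app_congr (by rw [EqvFam_inst]) rfl
    refine h3.trans ?_
    · refine (app_idRec A' (EqvFam A') _ B').trans ?_
      rw [← tmSub_tmSub]
      congr 1
      exact (genRec_sub π (U_sub π) rfl (hQ _) hw).symm
  rw [h1, app_comp, h2, tmSub_tmSub, tmSub_tmSub] at h
  have hs' : inst x ≫ appMap s ≫ p (IdTy A' B') = 𝟙 _ := by rw [appMap_eq, pair_p, hx]
  have hs'' : ∀ {X : C} (f : Γ ▹ U Γ ▹ EqvFam A ⟶ X),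
      inst x ≫ appMap s ≫ p (IdTy A' B') ≫ f = f := fun f => by
    simpa only [Category.assoc, Category.id_comp] using congrArg (· ≫ f) hs'
  refine Path.trans (Path.of_eq (congrArg _ ?_)) h
  apply pair_uniq
  · apply pair_uniq
    · simp only [cons_eq, liftTo_eq, comp_pair, pair_p, pair_p_assoc, Category.assoc, hs'']
      simp [inst_eq, π]
    · simp only [cons_eq, liftTo_eq, comp_pair, pair_p, pair_q, Category.assoc, hs'', Tm.cast_val,
        var_val, tmSub_tmSub]
      simp [inst_eq, B', uvar]
  · simp [cons_eq, liftTo_eq, appMap_eq, e]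

end Univalence

/-! ### Actions on positions that are total or equivalences -/

section Directions

variable {C : Type u} [Category.{v} C] [NaturalModel.{w} C] [HasPi C] [HasSigma C] [HasUnit C]
  [HasEmpty C] [HasSumTy C] [ExtensiveCoproducts C] {Γ Δ Θ : C}

/-- The map `Z + Y → 1 + Y` that forgets the left summand. -/
def forgetLeft (Z Y : Ty Γ) : FibHom (SumTy Z Y) (SumTy (UnitTy Γ) Y) :=
  FibHom.copair ((FibHom.const Z (star Γ)).comp (FibHom.inl _ _)) (FibHom.inr _ _)

theorem forgetLeft_inl (Z Y : Ty Γ) (σ : Δ ⟶ Γ) (z : Term Δ) (h : ty z = Z ◂ σ) (h') :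
    (forgetLeft Z Y).map σ ((FibHom.inl Z Y).map σ z h) h' = (leftAt Y σ).1 :=
  (FibHom.copair_inl _ _ σ z h h').trans ((FibHom.inl (UnitTy Γ) Y).map_congr rfl
    (star_eq ((FibHom.const Z (star Γ)).ty_map σ z h)
      ((star Δ).2.trans (UnitTy_sub σ).symm)) _ _)

theorem forgetLeft_inr (Z Y : Ty Γ) (σ : Δ ⟶ Γ) (y : Term Δ) (h : ty y = Y ◂ σ) (h') :
    (forgetLeft Z Y).map σ ((FibHom.inr Z Y).map σ y h) h' = (rightAt Y σ y h).1 :=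
  FibHom.copair_inr _ _ σ y h h'

/-- The partial function on positions that is stored in the shape of a function is the action on
positions with its values in the positions of the context forgotten. -/
theorem splitU_eq {S P : Ty Γ} {Y X : Ty (Γ ▹ S)}
    (f : FibHom X (SumTy (P ◂ p S) Y)) :
    splitU f = (f.comp (forgetLeft (P ◂ p S) Y)).toTm := by
  let g : FibHom (SplitTy Y (P ◂ p S)) (SumTy (UnitTy _) Y) :=
    { map := fun σ d h => (splitFst Y (P ◂ p S) σ d h).1
      ty_map := fun σ d h => Tm.prop _
      nat := fun σ d h τ => splitFst_sub Y _ σ d h τ _ }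
  have : (splitHom Y (P ◂ p S)).comp g = forgetLeft (P ◂ p S) Y := by
    refine FibHom.sum_ext rfl _ _ (fun σ z h h' => ?_) fun σ y h h' => ?_
    · rw [forgetLeft_inl]
      exact (splitFst_congr rfl (splitHom_inl _ _ σ z h h') _ (Tm.prop _)).trans
        (congrArg Tm.val (splitFst_mk _ _ _ _))
    · rw [forgetLeft_inr (h := h)]
      exact (splitFst_congr rfl (splitHom_inr _ _ σ y h h') _ (Tm.prop _)).trans
        (congrArg Tm.val (splitFst_mk _ _ _ _))
  rw [← this]
  rfl

/-- The right inclusion as a function. -/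
def inrFun (Q : Ty Γ) : Tm (Arr Q (SumTy (UnitTy Γ) Q)) := (FibHom.inr _ _).toFun

theorem sumUnit_sub_eq (σ : Δ ⟶ Γ) {Q : Ty Γ} {Q' : Ty Δ} (hQ : Q ◂ σ = Q') :
    SumTy (UnitTy Γ) Q ◂ σ = SumTy (UnitTy Δ) Q' := by
  rw [SumTy_sub, UnitTy_sub, hQ]

theorem inrFun_sub_eq (σ : Δ ⟶ Γ) {Q : Ty Γ} {Q' : Ty Δ} (hQ : Q ◂ σ = Q') :
    (inrFun Q).1 ◃ σ = (inrFun Q').1 := by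
  subst hQ
  exact FibHom.toFun_sub _ σ _ rfl fun τ x h h' => inr_congr (by simp [UnitTy_sub]) (by simp) rfl

section Iso
variable [HasIdIntro C] {D Q : Ty Γ}

/-- The type of factorizations of a partial function `D → 1 + Q` through a categorical equivalence
`D ≅ Q`. -/
def IsoDir (φ : Tm (Arr D (SumTy (UnitTy Γ) Q))) : Ty Γ :=
  Sig (Arr D Q) (Prod (isCEq (fvar D Q)) (IdTy (comp (inrFun (Q ◂ p _)) (fvar D Q))
    ((φ.sub (p (Arr D Q))).cast (Arr_sub_eq _ rfl (sumUnit_sub_eq _ rfl)))))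

theorem IsoDir_sub_eq (σ : Δ ⟶ Γ) {D' Q' : Ty Δ} (hD : D ◂ σ = D') (hQ : Q ◂ σ = Q')
    {φ : Tm (Arr D (SumTy (UnitTy Γ) Q))} {φ' : Tm (Arr D' (SumTy (UnitTy Δ) Q'))}
    (h : φ.1 ◃ σ = φ'.1) : IsoDir φ ◂ σ = IsoDir φ' := by
  have e1 : D ◂ p (Arr D Q) ◂ liftTo σ (Arr_sub_eq σ hD hQ) = D' ◂ p (Arr D' Q') := by
    simp [liftTo_eq, ← hD]
  have e2 : Q ◂ p (Arr D Q) ◂ liftTo σ (Arr_sub_eq σ hD hQ) = Q' ◂ p (Arr D' Q') := by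
    simp [liftTo_eq, ← hQ]
  have e3 : (fvar D Q).1 ◃ liftTo σ (Arr_sub_eq σ hD hQ) = (fvar D' Q').1 := by simp [liftTo_eq]
  refine Sig_sub_eq σ (Arr_sub_eq σ hD hQ) (Prod_sub_eq _ (isCEq_sub_eq _ e1 e2 e3)
    (IdTy_sub_eq _ (comp_sub_eq _ e1 e2 (sumUnit_sub_eq _ e2) (inrFun_sub_eq _ e2) e3) ?_))
  simp [liftTo_eq, ← h]

end Iso

theorem inh_IsoDir [HasId C] {D Q : Ty Γ} {φ : Tm (Arr D (SumTy (UnitTy Γ) Q))} :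
    Inh (IsoDir φ) ↔ ∃ κ : Tm (Arr D Q), IsCEq κ ∧ Path (comp (inrFun Q) κ).1 φ.1 := by
  refine inh_Sig.trans (exists_congr fun κ => ?_)
  have e1 : D ◂ p (Arr D Q) ◂ inst κ = D := by simp [inst_eq]
  have e2 : Q ◂ p (Arr D Q) ◂ inst κ = Q := by simp [inst_eq]
  have e3 : (fvar D Q).1 ◃ inst κ = κ.1 := by simp [inst_eq]
  rw [Prod_sub_eq (inst κ) (isCEq_sub_eq _ e1 e2 e3) (IdTy_sub_eq (inst κ)
    (a' := comp (inrFun Q) κ) (b' := φ) (comp_sub_eq _ e1 e2 (sumUnit_sub_eq _ e2)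
    (inrFun_sub_eq _ e2) e3) (by simp [inst_eq])), inh_Prod, inh_isCEq, path_iff]

/-- The type stating that a partial function `D → 1 + Q` takes no value in the left summand. -/
def NoInc {D Q : Ty Γ} (φ : Tm (Arr D (SumTy (UnitTy Γ) Q))) : Ty Γ :=
  Pi D (Arr (isInc0 Q ◂ appMap φ) (EmptyTy _))

theorem isInc0_sub_eq (σ : Δ ⟶ Γ) {Q : Ty Γ} {Q' : Ty Δ} (hQ : Q ◂ σ = Q') :
    isInc0 Q ◂ liftTo σ (sumUnit_sub_eq σ hQ) = isInc0 Q' := by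
  subst hQ; exact isInc0_sub Q σ _

theorem NoInc_sub_eq (σ : Δ ⟶ Γ) {D Q : Ty Γ} {D' Q' : Ty Δ} (hD : D ◂ σ = D') (hQ : Q ◂ σ = Q')
    {φ : Tm (Arr D (SumTy (UnitTy Γ) Q))} {φ' : Tm (Arr D' (SumTy (UnitTy Δ) Q'))}
    (h : φ.1 ◃ σ = φ'.1) : NoInc φ ◂ σ = NoInc φ' := by
  refine Pi_sub_eq σ hD (Arr_sub_eq _ ?_ (EmptyTy_sub _))
  rw [tySub_tySub, appMap_sub_eq σ hD (sumUnit_sub_eq σ hQ) h, ← tySub_tySub, isInc0_sub_eq σ hQ]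

theorem inh_NoInc {D Q : Ty Γ} {φ : Tm (Arr D (SumTy (UnitTy Γ) Q))} :
    Inh (NoInc φ) ↔ Nonempty (FibHom (isInc0 Q ◂ appMap φ) (EmptyTy _)) :=
  inh_Pi.trans ⟨fun ⟨f⟩ => ⟨FibHom.ofFun f⟩, fun ⟨f⟩ => ⟨f.toFun⟩⟩

end Directions

section PiTransport

variable {C : Type u} [Category.{v} C] [NaturalModel.{w} C] [HasPi C] [HasSigma C] [HasUnit C]
  [HasEmpty C] [HasSumTy C] [ExtensiveCoproducts C] {Γ Δ Θ : C} {A : PTy Γ}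
  {B : PTy (Γ ▹ A.shape)}

/-- The action on positions of an element of a dependent product, as a function. -/
def dirFun (t : Tm (PiShape A B)) :
    Tm (Arr (B.posAt (piBase t).1 (piBase t).2) (SumTy (UnitTy _) A.pos.toTy)) :=
  arrLam (piDir t)

theorem dirFun_sub_eq (σ : Δ ⟶ Γ) {A' : PTy Δ} {B' : PTy (Δ ▹ A'.shape)} (hA : A.sub σ = A')
    (hB : B.sub (liftTo σ (congrArg PTy.shape hA)) = B') {t : Tm (PiShape A B)}
    {t' : Tm (PiShape A' B')} (ht : t.1 ◃ σ = t'.1) :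
    (dirFun t).1 ◃ liftTo σ (congrArg PTy.shape hA) = (dirFun t').1 := by
  subst hA hB; exact piDir_sub σ ht

theorem piBase_sub_eq (σ : Δ ⟶ Γ) {A' : PTy Δ} {B' : PTy (Δ ▹ A'.shape)} (hA : A.sub σ = A')
    (hB : B.sub (liftTo σ (congrArg PTy.shape hA)) = B') {t : Tm (PiShape A B)}
    {t' : Tm (PiShape A' B')} (ht : t.1 ◃ σ = t'.1) :
    B.posAt (piBase t).1 (piBase t).2 ◂ liftTo σ (congrArg PTy.shape hA) =
      B'.posAt (piBase t').1 (piBase t').2 := by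
  subst hA hB; exact posAt_lift σ (piBase_sub σ ht)

/-- A path between elements of a dependent product transports factorizations of their actions on
positions through equivalences. -/
theorem inh_isoDir_of_path [HasId C] {t t' : Tm (PiShape A B)} (h : Path t.1 t'.1)
    (ht : Inh (IsoDir (dirFun t))) : Inh (IsoDir (dirFun t')) := by
  let v : Tm (PiShape (A.sub (p (PiShape A B))) (B.sub (lift (p _) A.shape))) :=
    (var (PiShape A B)).cast (PiShape_sub A B _)
  have key : ∀ t : Tm (PiShape A B), Pi (A.shape ◂ p _) (IsoDir (dirFun v)) ◂ inst t =
      Pi A.shape (IsoDir (dirFun t)) := fun t => by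
    have hA : (A.sub (p (PiShape A B))).sub (inst t) = A := by
      rw [PTy.sub_sub, inst_eq, pair_p, PTy.sub_id]
    have hB : (B.sub (lift (p (PiShape A B)) A.shape)).sub
        (liftTo (inst t) (congrArg PTy.shape hA)) = B := by
      rw [PTy.sub_sub]
      refine Eq.trans (congrArg B.sub ?_) (PTy.sub_id B)
      simp [inst_eq, lift_eq, liftTo_eq]
    have hv : v.1 ◃ inst t = t.1 := by simp [v, inst_eq]
    exact Pi_sub_eq _ (congrArg PTy.shape hA) (IsoDir_sub_eq _ (piBase_sub_eq _ hA hB hv)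
      (PTy.toTy_sub_eq _ hA) (dirFun_sub_eq _ hA hB hv))
  have := transport (A := PiShape A B) (σ := inst t) (τ := inst t') (by simp [inst_eq])
    (by simpa [inst_eq] using h) (P := Pi (A.shape ◂ p _) (IsoDir (dirFun v)))
  rw [key, key] at this
  exact inh_Pi.1 (this (inh_Pi.2 ht))

end PiTransport

/-! ### Functions of the polynomial model -/

namespace FibHom

variable {C : Type u} [Category.{v} C] [NaturalModel.{w} C] [HasEmpty C] [HasSumTy C]
  [ExtensiveCoproducts C] {Γ Δ Θ : C}

theorem copair_congr {A B A' B' D : Ty Γ} {f : FibHom A D} {g : FibHom B D} {f' : FibHom A' D}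
    {g' : FibHom B' D} (hA : A = A') (hB : B = B')
    (hf : ∀ {Δ : C} (σ : Δ ⟶ Γ) (x : Term Δ) (h h'), f.map σ x h = f'.map σ x h')
    (hg : ∀ {Δ : C} (σ : Δ ⟶ Γ) (x : Term Δ) (h h'), g.map σ x h = g'.map σ x h')
    (σ : Δ ⟶ Γ) (x : Term Δ) (h h') : (copair f g).map σ x h = (copair f' g').map σ x h' := by
  subst hA hB
  obtain rfl : f = f' := ext fun σ x h => hf σ x h h
  obtain rfl : g = g' := ext fun σ x h => hg σ x h h
  rfl

end FibHom

namespace Poly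

section Functions

variable {C : Type u} [Category.{v} C] [NaturalModel.{w} C] [HasPi C] [HasSigma C] [HasUnit C]
  [HasEmpty C] [HasSumTy C] [ExtensiveCoproducts C] {Γ Δ : Poly C} {X Y Z : Ty Γ}

/-- The shape of a function of the polynomial model. -/
def shArr (F : Tm (Arr X Y)) :
    Tm (PiShape (Γ := Γ.shape) X (PTy.sub Y (p (PTy.shape X)))) := sh F

/-- The action on shapes of a function of the polynomial model. -/
def base (F : Tm (Arr X Y)) : Tm (C := C) (Arr (PTy.shape X) (PTy.shape Y)) := fst (shArr F)

theorem posAt_app (f : Tm (C := C) (Arr (PTy.shape X) (PTy.shape Y)))  :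
    (PTy.sub Y (p (PTy.shape X))).posAt (app f).1 (app f).2 = (PTy.pos Y).toTy ◂ appMap f := by
  refine (PTy.sub_posAt Y (p (PTy.shape X)) (app f).1 (app f).2).trans ?_
  rw [appMap_eq]
  exact ((PTy.pos Y).toTy_pair _ _ _).symm

/-- The action on positions of a function of the polynomial model. -/
def dirM (F : Tm (Arr X Y)) : FibHom ((PTy.pos Y).toTy ◂ appMap (base F))
    (SumTy (Γ.pos ◂ p (PTy.shape X)) (PTy.pos X).toTy) :=
  (pdir (papp F)).cast (posAt_app (base F)) rfl

theorem dirFun_shArr (F : Tm (Arr X Y)) :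
    (dirFun (shArr F)).1 = ((dirM F).comp (forgetLeft _ _)).toFun.1 := by
  have e : splitU (pdir (papp F)) = piDir (shArr F) := splitU_merge _ _
  refine (congrArg (fun u => (arrLam u).1) (e.symm.trans (splitU_eq _))).trans ?_
  exact FibHom.toFun_congr (posAt_app (base F)) fun _ _ _ _ => rfl

theorem base_comp (G : Tm (Arr Y Z)) (F : Tm (Arr X Y)) :
    base (comp G F) = comp (base G) (base F) := fst_dpair _ _

theorem base_idFun : base (idFun X) = idFun (PTy.shape X) := fst_dpair _ _

theorem posAt_plam (b : Tm (Y ◂ p X)) : PTy.posAt (Y ◂ p X) (sh b).1 (sh b).2 =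
    (PTy.pos Y).toTy ◂ appMap (base (plam b)) :=
  (PTy.posAt_congr rfl (congrArg (fun c : Tm (Y ◂ p X) => (sh c).1) (papp_plam b).symm) _ _).trans
    (posAt_app (base (plam b)))

theorem dirM_plam (b : Tm (Y ◂ p X)) {Θ : C} (σ : Θ ⟶ Γ.shape ▹ PTy.shape X) (x : Term Θ) (h h') :
    (dirM (plam b)).map σ x h = (pdir b).map σ x h' := by
  have : ∀ (c : Tm (Y ◂ p X)) (_ : c = b) (h), (pdir c).map σ x h = (pdir b).map σ x h' := by
    rintro _ rfl h; rfl
  exact this _ (papp_plam b) (h.trans (congrArg (· ◂ σ) (posAt_app (base (plam b))).symm))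

theorem dirM_idFun {Θ : C} (σ : Θ ⟶ Γ.shape ▹ PTy.shape X) (x : Term Θ) (h h') :
    (dirM (idFun X)).map σ x h =
      (FibHom.inr (Γ.pos ◂ p (PTy.shape X)) (PTy.pos X).toTy).map σ x h' :=
  dirM_plam (var X) σ x h (h'.trans (by
    exact congrArg (· ◂ σ) (PTy.sub_posAt X (p (PTy.shape X)) (q _) (ty_q _)).symm))

theorem dirM_comp (G : Tm (Arr Y Z)) (F : Tm (Arr X Y)) {Θ : C} (σ : Θ ⟶ Γ.shape ▹ PTy.shape X)
    (x : Term Θ) (h h' h'') :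
    (dirM (comp G F)).map σ x h = (FibHom.copair (FibHom.inl _ _) (dirM F)).map σ
      ((dirM G).map (σ ≫ appMap (base F)) x h') h'' := by
  refine (dirM_plam _ σ x h (h.trans (congrArg (· ◂ σ) (posAt_plam _).symm))).trans ?_
  let a : PTerm (Γ ▹ X) := (papp F).1
  have ha : a.type.posAt a.shape a.ty_shape = (PTy.pos Y).obj (p (PTy.shape X)) a.shape a.ty_shape :=
    PTy.sub_posAt Y (p (PTy.shape X)) a.shape a.ty_shape
  refine FibHom.copair_congr (f := Hom.pos (p X : Γ ▹ X ⟶ Γ)) (g := a.pos.cast ha rfl)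
    (f' := FibHom.inl _ _) (g' := dirM F) rfl (ha.symm.trans (posAt_app (base F)))
    (fun _ _ _ _ => rfl) (fun _ _ _ _ => rfl) σ
    ((dirM G).map (σ ≫ appMap (base F)) x h') ?_ h''

end Functions

end Poly

/-! ### Equivalences of the polynomial model are total on positions -/

section Paths

variable {C : Type u} [Category.{v} C] [NaturalModel.{w} C] [HasPi C] [HasSigma C] [HasId C]
  {Γ Δ Θ : C} {A B : Ty Γ}

theorem Path.fst {B : Ty (Γ ▹ A)} {t t' : Tm (Sig A B)} (h : Path t.1 t'.1) :
    Path (fst t).1 (fst t').1 := by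
  have hv : Sig A B ◂ p (Sig A B) = Sig (A ◂ p _) (B ◂ lift (p _) A) := Sig_sub A B _
  have key : ∀ t : Tm (Sig A B), (HasSigma.fst ((var (Sig A B)).cast hv)).1 ◃ inst t =
      (HasSigma.fst t).1 := fun t =>
    fst_sub_eq (inst t) (by simp [inst_eq]) (by simp [inst_eq, lift_eq, liftTo_eq])
      (by simp [inst_eq])
  rw [← key t, ← key t']
  exact Path.ap (σ := inst t) (τ := inst t') (B := A) (by simp [inst_eq])
    (by simpa [inst_eq] using h) (Tm.prop _)

/-- A type over the domain of a retract that is inhabited over the retraction is inhabited. -/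
theorem inh_of_appMap {P : Ty (Γ ▹ A)} {f : Tm (Arr A B)} {s : Tm (Arr B A)}
    (h : Path (comp s f).1 (idFun A).1) (hP : Inh (P ◂ appMap s)) : Inh P := by
  have h1 := hP.sub (appMap f)
  rw [tySub_tySub, ← appMap_comp] at h1
  have h2 := transport (σ := appMap (comp s f)) (τ := appMap (idFun A)) (by simp [appMap_eq])
    (by simpa [appMap_eq] using Path.happly h) h1
  rwa [appMap_idFun, tySub_id] at h2

end Paths

section Total

variable {C : Type u} [Category.{v} C] [NaturalModel.{w} C] [HasPi C] {Γ Δ Θ : C}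

namespace FibHom

theorem toFun_comp {A B D : Ty Γ} (f : FibHom A B) (g : FibHom B D) :
    (f.comp g).toFun = TT.comp g.toFun f.toFun := by
  refine arr_ext ((congrArg Tm.val (app_arrLam _)).trans (Eq.trans ?_ (app_comp _ _).symm))
  have h1 : app g.toFun = g.toTm := app_lam _
  have h2 : app f.toFun = f.toTm := app_lam _
  rw [h1, appMap_eq, h2]
  exact (g.toTm_pair _ _ _).symm

theorem appMap_toFun_inl [HasEmpty C] [HasSumTy C] [ExtensiveCoproducts C] (A B : Ty Γ) :
    appMap (FibHom.inl A B).toFun = inlMap A B := by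
  have h : app (FibHom.inl A B).toFun = (FibHom.inl A B).toTm := app_lam _
  rw [appMap_eq, inlMap_eq, h]; rfl

theorem appMap_toFun_inr [HasEmpty C] [HasSumTy C] [ExtensiveCoproducts C] (A B : Ty Γ) :
    appMap (FibHom.inr A B).toFun = inrMap A B := by
  have h : app (FibHom.inr A B).toFun = (FibHom.inr A B).toTm := app_lam _
  rw [appMap_eq, inrMap_eq, h]; rfl

end FibHom

end Total

section Directions

variable {C : Type u} [Category.{v} C] [NaturalModel.{w} C] [HasPi C] [HasSigma C] [HasUnit C]
  [HasEmpty C] [HasSumTy C] [ExtensiveCoproducts C] {Γ Δ Θ : C}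

theorem forgetLeft_sub_eq (σ : Δ ⟶ Γ) {Z Y : Ty Γ} {Z' Y' : Ty Δ} (hZ : Z ◂ σ = Z')
    (hY : Y ◂ σ = Y') (τ : Θ ⟶ Δ) (x : Term Θ) (h h') :
    (forgetLeft Z Y).map (τ ≫ σ) x h = (forgetLeft Z' Y').map τ x h' := by
  subst hZ hY
  refine FibHom.sum_ext_map (SumTy_sub Z Y σ) rfl
    (((forgetLeft Z Y).sub σ).cast rfl (sumUnit_sub_eq σ rfl)) (forgetLeft (Z ◂ σ) (Y ◂ σ))
    (fun ρ z k k₁ k₂ => ?_) (fun ρ y k k₁ k₂ => ?_) τ x (h.trans (tySub_tySub _ _ _).symm) h'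
  · have kz := k.trans (tySub_tySub _ _ _)
    rw [forgetLeft_inl]
    refine Eq.trans ((forgetLeft Z Y).map_congr rfl (FibHom.inl_sub Z Y σ ρ z k kz) _
      (FibHom.ty_map _ _ _ _)) ((forgetLeft_inl Z Y (ρ ≫ σ) z kz _).trans ?_)
    exact inl_congr (by rw [UnitTy_sub, UnitTy_sub]) (by simp) rfl
  · have ky := k.trans (tySub_tySub _ _ _)
    rw [forgetLeft_inr (h := k)]
    refine Eq.trans ((forgetLeft Z Y).map_congr rfl (FibHom.inr_sub Z Y σ ρ y k ky) _
      (FibHom.ty_map _ _ _ _)) ((forgetLeft_inr Z Y (ρ ≫ σ) y ky _).trans ?_)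
    exact inr_congr (by rw [UnitTy_sub, UnitTy_sub]) (by simp) rfl

theorem NoInc_congr {D D' Q : Ty Γ} (hD : D = D') {φ : Tm (Arr D (SumTy (UnitTy Γ) Q))}
    {φ' : Tm (Arr D' (SumTy (UnitTy Γ) Q))} (h : φ.1 = φ'.1) : NoInc φ = NoInc φ' := by
  subst hD; rw [Tm.ext h]

theorem IsoDir_congr [HasIdIntro C] {D D' Q : Ty Γ} (hD : D = D')
    {φ : Tm (Arr D (SumTy (UnitTy Γ) Q))} {φ' : Tm (Arr D' (SumTy (UnitTy Γ) Q))}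
    (h : φ.1 = φ'.1) : IsoDir φ = IsoDir φ' := by
  subst hD; rw [Tm.ext h]

theorem inh_IsoDir_inrFun [HasId C] (Q : Ty Γ) : Inh (IsoDir (inrFun Q)) :=
  inh_IsoDir.2 ⟨idFun Q, isCEq_idFun', Path.of_eq (by rw [comp_idFun_right])⟩

/-- A partial function that factors through the right inclusion is total. -/
theorem NoInc.of_isoDir [HasId C] {D Q : Ty Γ} {φ : Tm (Arr D (SumTy (UnitTy Γ) Q))}
    (h : Inh (IsoDir φ)) : Inh (NoInc φ) := by
  obtain ⟨κ, -, hκ⟩ := inh_IsoDir.1 h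
  let I := isInc0 Q ◂ appMap φ
  have h1 := hκ.symm.happly.sub (p I)
  have h2 := transport (σ := p I ≫ appMap φ) (τ := p I ≫ appMap (comp (inrFun Q) κ))
    (by simp [appMap_eq]) (by simpa [appMap_eq] using h1)
    (P := isInc0 Q) ((var I).inh.cast (by rw [← tySub_tySub]))
  have e : isInc0 Q ◂ (p I ≫ appMap (comp (inrFun Q) κ)) = EmptyTy _ ◂ p I := by
    rw [appMap_comp, inrFun, FibHom.appMap_toFun_inr, ← Category.assoc, ← tySub_tySub, isInc0_inr,
      EmptyTy_sub, EmptyTy_sub]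
  rw [e] at h2
  obtain ⟨k⟩ := h2
  exact inh_NoInc.2 ⟨FibHom.ofTm k⟩

/-- The type family over `Z + Y` that is the unit type on the left summand and empty on the right
summand. -/
def isLeft (Z Y : Ty Γ) : Ty (Γ ▹ SumTy Z Y) := isInc0 Y ◂ appMap (forgetLeft Z Y).toFun

theorem isLeft_inl (Z Y : Ty Γ) : isLeft Z Y ◂ inlMap Z Y = UnitTy _ := by
  have : (FibHom.inl Z Y).comp (forgetLeft Z Y) =
      (FibHom.const Z (star Γ)).comp (FibHom.inl _ _) :=
    FibHom.ext fun σ x h => FibHom.copair_inl _ _ σ x h _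
  rw [isLeft, tySub_tySub, ← FibHom.appMap_toFun_inl, ← appMap_comp, ← FibHom.toFun_comp, this,
    FibHom.toFun_comp, appMap_comp, FibHom.appMap_toFun_inl, ← tySub_tySub, isInc0_inl, UnitTy_sub]

theorem isLeft_inr (Z Y : Ty Γ) : isLeft Z Y ◂ inrMap Z Y = EmptyTy _ := by
  have : (FibHom.inr Z Y).comp (forgetLeft Z Y) = FibHom.inr _ _ :=
    FibHom.ext fun σ x h => FibHom.copair_inr _ _ σ x h _
  rw [isLeft, tySub_tySub, ← FibHom.appMap_toFun_inr, ← appMap_comp, ← FibHom.toFun_comp, this,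
    FibHom.appMap_toFun_inr, isInc0_inr]

/-- A partial function that is extended along another one stays undefined where it is. -/
def isLeftBind {Z Y Y' : Ty Γ} (g : FibHom Y (SumTy Z Y')) : FibHom (isLeft Z Y)
    (isLeft Z Y' ◂ appMap (FibHom.copair (FibHom.inl Z Y') g).toFun) :=
  FibHom.caseHom ((FibHom.id (UnitTy _)).cast (isLeft_inl Z Y).symm (by
    have : (FibHom.inl Z Y).comp (FibHom.copair (FibHom.inl Z Y') g) = FibHom.inl Z Y' :=
      FibHom.ext fun σ x h => FibHom.copair_inl _ _ σ x h _
    rw [tySub_tySub, ← FibHom.appMap_toFun_inl, ← appMap_comp, ← FibHom.toFun_comp, this,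
      FibHom.appMap_toFun_inl, isLeft_inl])) ((FibHom.empty _).cast (isLeft_inr Z Y).symm rfl)

/-- If the extension of a partial function along another one is total, the first one is total. -/
theorem NoInc.of_bind {Z Y Y' D : Ty Γ} (f : FibHom D (SumTy Z Y)) (g : FibHom Y (SumTy Z Y'))
    (h : Inh (NoInc ((f.comp (FibHom.copair (FibHom.inl Z Y') g)).comp
      (forgetLeft Z Y')).toFun)) : Inh (NoInc (f.comp (forgetLeft Z Y)).toFun) := by
  obtain ⟨k⟩ := inh_NoInc.1 h
  refine inh_NoInc.2 ⟨FibHom.comp (((isLeftBind g).sub (appMap f.toFun)).cast ?_ ?_) k⟩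
  · rw [FibHom.toFun_comp, appMap_comp, isLeft, tySub_tySub]
  · rw [FibHom.toFun_comp, FibHom.toFun_comp, appMap_comp, appMap_comp, isLeft, tySub_tySub,
      tySub_tySub, Category.assoc]

end Directions

namespace Poly

section Functions

variable {C : Type u} [Category.{v} C] [NaturalModel.{w} C] [HasPi C] [HasSigma C] [HasUnit C]
  [HasId C] [HasEmpty C] [HasSumTy C] [ExtensiveCoproducts C] {Γ Δ : Poly C} {X Y Z : Ty Γ}

theorem inh_bare {S : Ty Γ.shape} : Inh (C := Poly C) (Γ := Γ) (PTy.bare S) ↔ Inh S :=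
  ⟨fun ⟨t⟩ => ⟨sh t⟩, fun ⟨s⟩ => ⟨bareTm s⟩⟩

/-- Paths of the polynomial model are paths of shapes. -/
theorem path_sh {a b : Tm X} : Path a.1 b.1 ↔ Path (sh a).1 (sh b).1 :=
  path_iff.trans (Iff.trans inh_bare path_iff.symm)

/-- The partial function on positions of a function of the polynomial model. -/
def tdir (F : Tm (Arr X Y)) : Tm (Arr ((PTy.pos Y).toTy ◂ appMap (base F))
    (SumTy (UnitTy _) (PTy.pos X).toTy)) := ((dirM F).comp (forgetLeft _ _)).toFun

theorem IsoDir_dirFun (F : Tm (Arr X Y)) : IsoDir (dirFun (shArr F)) = IsoDir (tdir F) :=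
  IsoDir_congr (posAt_app (base F)) (dirFun_shArr F)

theorem NoInc_dirFun (F : Tm (Arr X Y)) : NoInc (dirFun (shArr F)) = NoInc (tdir F) :=
  NoInc_congr (posAt_app (base F)) (dirFun_shArr F)

theorem inh_IsoDir_tdir_idFun : Inh (IsoDir (tdir (idFun X))) := by
  refine (inh_IsoDir_inrFun (PTy.pos X).toTy).cast (IsoDir_congr ?_ ?_)
  · rw [base_idFun, appMap_idFun, tySub_id]
  · refine FibHom.toFun_congr ?_ fun σ x h h' => ?_
    · rw [base_idFun, appMap_idFun, tySub_id]
    · have h1 := dirM_idFun σ x h' h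
      refine Eq.symm (Eq.trans ?_ (forgetLeft_inr (Γ.pos ◂ p (PTy.shape X)) _ σ x h
        (FibHom.ty_map _ _ _ _)))
      exact FibHom.map_congr (forgetLeft _ _) rfl h1 _ _

theorem inh_IsoDir_tdir {F : Tm (Arr X X)} (h : Path F.1 (idFun X).1) : Inh (IsoDir (tdir F)) := by
  rw [← IsoDir_dirFun]
  refine inh_isoDir_of_path (path_sh.1 h).symm ?_
  exact (inh_IsoDir_tdir_idFun (X := X)).cast (IsoDir_dirFun (idFun X)).symm

theorem path_base {F G : Tm (Arr X Y)} (h : Path F.1 G.1) : Path (base F).1 (base G).1 :=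
  (path_sh.1 h).fst (t := shArr F) (t' := shArr G)

/-- An equivalence of the polynomial model is a total function on positions. -/
theorem inh_NoInc_tdir {F : Tm (Arr X Y)} {s : Tm (Arr Y X)}
    (h : Path (comp F s).1 (idFun Y).1) (h' : Path (comp s F).1 (idFun X).1) :
    Inh (NoInc (tdir F)) := by
  have hb := path_base h'
  rw [base_comp, base_idFun] at hb
  refine inh_of_appMap hb ?_
  have h1 := NoInc.of_isoDir (inh_IsoDir_tdir h)
  have e : (PTy.pos Y).toTy ◂ appMap (base F) ◂ appMap (base s) =
      (PTy.pos Y).toTy ◂ appMap (base (comp F s)) := by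
    rw [base_comp, appMap_comp, tySub_tySub]
  have e' : SumTy (Γ.pos ◂ p (PTy.shape X)) (PTy.pos X).toTy ◂ appMap (base s) =
      SumTy (Γ.pos ◂ p (PTy.shape Y)) ((PTy.pos X).toTy ◂ appMap (base s)) := by
    rw [SumTy_sub, tySub_tySub]; simp [appMap_eq]
  let f : FibHom ((PTy.pos Y).toTy ◂ appMap (base F) ◂ appMap (base s))
      (SumTy (Γ.pos ◂ p (PTy.shape Y)) ((PTy.pos X).toTy ◂ appMap (base s))) :=
    ((dirM F).sub (appMap (base s))).cast rfl e'
  have h2 := NoInc.of_bind f (dirM s) (h1.cast (NoInc_congr e.symm (FibHom.toFun_congr e.symm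
    fun σ x k k' => (forgetLeft (Γ.pos ◂ p (PTy.shape Y)) (PTy.pos Y).toTy).map_congr rfl
      (dirM_comp F s σ x k (k'.trans (tySub_tySub _ _ _)) (f.ty_map σ x k')) _ _)))
  refine h2.cast (NoInc_sub_eq (appMap (base s)) rfl rfl ?_).symm
  exact FibHom.toFun_sub _ _ _ rfl fun τ x k k' =>
    forgetLeft_sub_eq (appMap (base s)) (by simp [appMap_eq]) rfl τ _ _ (f.ty_map τ x k')

/-- There are no positions over a function whose action on positions is total, because the positions
over a function are the arguments at which the action takes the value in the left summand. -/
theorem posEmpty_of_noInc {F : Tm (Arr X Y)} (h : Inh (NoInc (tdir F))) :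
    Nonempty (FibHom (PTy.posAt (Arr X Y) (sh F).1 (sh F).2) (EmptyTy _)) := by
  rw [← NoInc_dirFun, inh_NoInc] at h
  obtain ⟨k⟩ := h
  have e : appMap (dirFun (shArr F)) = cons (p _) (piDir (shArr F)) := by
    rw [appMap, dirFun]; exact cons_congr (congrArg Tm.val (app_arrLam _))
  rw [e] at k
  have k' := ((k.cast rfl (by rw [EmptyTy_sub, EmptyTy_sub]) :
    FibHom _ (EmptyTy Γ.shape ◂ p (PTy.shape X) ◂ p _)).uncurry).uncurry
  exact ⟨k'.cast (PPi_posAt (shArr F)).symm rfl⟩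

end Functions

end Poly

/-! ### Equivalences in contexts without positions -/

section Cancel

variable {C : Type u} [Category.{v} C] [NaturalModel.{w} C] [HasPi C] [HasSigma C] [HasUnit C]
  [HasId C] [HasEmpty C] [HasSumTy C] [ExtensiveCoproducts C] {Γ Δ Θ : C}

theorem app_comp_inrFun {D Q : Ty Γ} (κ : Tm (Arr D Q)) : (app (comp (inrFun Q) κ)).1 =
    (FibHom.inr (UnitTy _) (Q ◂ p D)).map (𝟙 _) (app κ).1 ((app κ).2.trans (tySub_id _).symm) := by
  have h : app (inrFun Q) = (FibHom.inr (UnitTy _) Q).toTm := app_lam _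
  rw [app_comp, h, appMap_eq, FibHom.toTm_pair]
  exact inr_congr (by simp [UnitTy_sub]) (by simp) rfl

/-- Functions that become equal after the right inclusion are equal. -/
theorem Path.of_comp_inrFun (hFE : FunExt C) {D Q : Ty Γ} {κ k : Tm (Arr D Q)}
    (h : Path (comp (inrFun Q) κ).1 (comp (inrFun Q) k).1) : Path κ.1 k.1 := by
  refine hFE.path ?_
  -- a retraction of the right inclusion, which needs a default value
  let c : FibHom (SumTy (UnitTy _) (Q ◂ p D)) (Q ◂ p D) :=
    FibHom.copair (FibHom.const _ (app κ)) (FibHom.id _)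
  have key : ∀ (k : Tm (Arr D Q)) (h'), c.toTm.1 ◃
      pair (𝟙 _) (SumTy (UnitTy _) (Q ◂ p D)) (app (comp (inrFun Q) k)).1 h' = (app k).1 := by
    intro k h'
    rw [FibHom.toTm_pair]
    refine (c.map_congr rfl (app_comp_inrFun k) _ (FibHom.ty_map _ _ _ _)).trans ?_
    exact FibHom.copair_inr _ _ _ _ _ _
  have hty : ∀ k : Tm (Arr D Q), ty (app (comp (inrFun Q) k)).1 =
      SumTy (UnitTy _) (Q ◂ p D) ◂ 𝟙 _ := fun k => by
    rw [Tm.prop, SumTy_sub, UnitTy_sub, tySub_id]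
  rw [← key κ (hty κ), ← key k (hty k)]
  exact Path.ap (B := Q ◂ p D) (by simp) (by simpa using h.happly) (Tm.prop _)

end Cancel

section AppMap

variable {C : Type u} [Category.{v} C] [NaturalModel.{w} C] [HasPi C] [HasSumTyIntro C]
  {Γ Δ : C} {A B : Ty Γ}

theorem sub_appMap (Z : Ty Γ) (f : Tm (Arr A B)) (σ : Δ ⟶ Γ ▹ A) :
    Z ◂ p B ◂ (σ ≫ appMap f) = Z ◂ p A ◂ σ := by
  simp [appMap_eq]

theorem sumTy_appMap (Z : Ty Γ) (f : Tm (Arr A B)) (D : Ty (Γ ▹ B)) (σ : Δ ⟶ Γ ▹ A) :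
    SumTy (Z ◂ p B) D ◂ (σ ≫ appMap f) = SumTy (Z ◂ p A) (D ◂ appMap f) ◂ σ := by
  rw [SumTy_sub, SumTy_sub, sub_appMap, tySub_tySub D]

end AppMap

section Zero

variable {C : Type u} [Category.{v} C] [NaturalModel.{w} C] [HasEmpty C] [HasSumTy C]
  [ExtensiveCoproducts C] {Γ Δ Θ : C}

/-- Collapsing an empty left summand. -/
def collapse {Z : Ty Γ} (hZ : Z = EmptyTy Γ) (Y : Ty Γ) : FibHom (SumTy Z Y) Y :=
  FibHom.copair ((FibHom.empty Y).cast hZ.symm rfl) (FibHom.id Y)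

theorem collapse_inr {Z : Ty Γ} (hZ : Z = EmptyTy Γ) {Y : Ty Γ} (σ : Δ ⟶ Γ) (y : Term Δ) (h h') :
    (collapse hZ Y).map σ ((FibHom.inr Z Y).map σ y h) h' = y :=
  FibHom.copair_inr _ _ σ y h h'

theorem inr_collapse {Z : Ty Γ} (hZ : Z = EmptyTy Γ) {Y : Ty Γ} (σ : Δ ⟶ Γ) (x : Term Δ) (h h') :
    (FibHom.inr Z Y).map σ ((collapse hZ Y).map σ x h) h' = x := by
  have : (collapse hZ Y).comp (FibHom.inr Z Y) = FibHom.id _ := by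
    refine FibHom.sum_ext rfl _ _ (fun σ z k k' => ?_) fun σ y k k' => ?_
    · have := FibHom.empty_uniq hZ ((FibHom.inl Z Y).comp ((collapse hZ Y).comp (FibHom.inr Z Y)))
        (FibHom.inl Z Y)
      exact congrArg (fun f : FibHom Z (SumTy Z Y) => f.map σ z k) this
    · exact FibHom.map_congr (FibHom.inr Z Y) rfl (collapse_inr hZ σ y k k') _ _
  exact congrArg (fun f : FibHom (SumTy Z Y) (SumTy Z Y) => f.map σ x h) this

/-- Morphisms out of a type with a morphism to the empty type are unique. -/
theorem FibHom.uniq_of_empty {E A : Ty Γ} (e : FibHom E (EmptyTy Γ)) (f g : FibHom E A) : f = g := by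
  let f' : FibHom (EmptyTy (Γ ▹ E)) (A ◂ p E) := FibHom.const _ f.toTm
  let g' : FibHom (EmptyTy (Γ ▹ E)) (A ◂ p E) := FibHom.const _ g.toTm
  have h := FibHom.empty_uniq rfl f' g'
  have h2 := congrArg (fun k : FibHom (EmptyTy (Γ ▹ E)) (A ◂ p E) => k.map (𝟙 _) e.toTm.1
    (e.toTm.2.trans (by rw [EmptyTy_sub, EmptyTy_sub]))) h
  have h3 : f.toTm.1 = g.toTm.1 := by simpa [f', g', FibHom.const] using h2
  exact (FibHom.equiv E A).injective (Tm.ext h3)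

end Zero

namespace Poly

section Zero

variable {C : Type u} [Category.{v} C] [NaturalModel.{w} C] [HasPi C] [HasSigma C] [HasUnit C]
  [HasId C] [HasEmpty C] [HasSumTy C] [ExtensiveCoproducts C]

/-- A context of the base model, as a context without positions. -/
def zero (Δ : C) : Poly C := ⟨Δ, EmptyTy Δ⟩

variable {Δ : C} {X Y Z : Ty (zero Δ)}

theorem zero_pos (σ : Δ ⟶ Δ') : (zero Δ').pos ◂ σ = EmptyTy Δ := EmptyTy_sub σ

/-- In a context without positions, the action of a function on positions is a map backwards. -/
def back (F : Tm (Arr X Y)) :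
    FibHom ((PTy.pos Y).toTy ◂ appMap (base F)) (PTy.pos X).toTy :=
  (dirM F).comp (collapse (zero_pos (p (PTy.shape X))) _)

theorem inr_back (F : Tm (Arr X Y)) {Θ : C} (σ : Θ ⟶ Δ ▹ PTy.shape X) (x : Term Θ) (h h') :
    (FibHom.inr ((zero Δ).pos ◂ p (PTy.shape X)) (PTy.pos X).toTy).map σ
      ((back F).map σ x h) h' = (dirM F).map σ x h :=
  inr_collapse (zero_pos _) _ _ _ _

theorem back_comp (G : Tm (Arr Y Z)) (F : Tm (Arr X Y)) {Θ : C} (σ : Θ ⟶ Δ ▹ PTy.shape X)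
    (x : Term Θ) (h h' h'') : (back (comp G F)).map σ x h =
      (back F).map σ ((back G).map (σ ≫ appMap (base F)) x h') h'' := by
  have e := sumTy_appMap (zero Δ).pos (base F) (PTy.pos Y).toTy σ
  refine FibHom.map_congr (collapse (zero_pos _) _) rfl ?_ _ (FibHom.ty_map _ _ _ _)
  refine (dirM_comp G F σ x h h' ((FibHom.ty_map _ _ _ _).trans e)).trans ?_
  have hi : (dirM G).map (σ ≫ appMap (base F)) x h' =
      (FibHom.inr ((zero Δ).pos ◂ p (PTy.shape X)) ((PTy.pos Y).toTy ◂ appMap (base F))).map σ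
        ((back G).map (σ ≫ appMap (base F)) x h') h'' := by
    refine (inr_back G _ x h' (FibHom.ty_map _ _ _ _)).symm.trans ?_
    exact inr_congr (sub_appMap _ _ σ) (tySub_tySub _ _ _).symm rfl
  refine Eq.trans (FibHom.map_congr (FibHom.copair (FibHom.inl _ _) (dirM F)) rfl hi _
    (FibHom.ty_map _ _ _ _)) ?_
  exact FibHom.copair_inr _ _ σ _ _ _

theorem tdir_eq (F : Tm (Arr X Y)) : tdir F = comp (inrFun _) (back F).toFun := by
  have : (dirM F).comp (forgetLeft _ _) = (back F).comp (FibHom.inr _ _) :=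
    FibHom.ext fun σ x h => by
      refine Eq.trans (FibHom.map_congr (forgetLeft _ _) rfl (inr_back F σ x h
        (FibHom.ty_map _ _ _ _)).symm _ (FibHom.ty_map _ _ _ _)) ?_
      exact forgetLeft_inr _ _ _ _ _ _
  rw [tdir, this, FibHom.toFun_comp]; rfl

/-- A function equal to the identity acts on positions by an equivalence: up to a path, its partial
function on positions is an equivalence followed by the right inclusion, and that inclusion can be
cancelled. -/
theorem isCEq_back_of_path (hFE : FunExt C) {F : Tm (Arr X X)} (h : Path F.1 (idFun X).1) :
    IsCEq (back F).toFun := by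
  obtain ⟨κ, hκ, h'⟩ := inh_IsoDir.1 (inh_IsoDir_tdir h)
  rw [tdir_eq] at h'
  exact hκ.of_path (h'.of_comp_inrFun hFE)

theorem IsCEq_congr {C : Type u} [Category.{v} C] [NaturalModel.{w} C] [HasPi C] [HasId C] {Γ : C}
    {A A' B : Ty Γ} (hA : A = A') {f : Tm (Arr A B)} {f' : Tm (Arr A' B)} (h : f.1 = f'.1)
    (hf : IsCEq f) : IsCEq f' := by
  subst hA; rwa [← Tm.ext h]

/-- In a context without positions, an equivalence acts on positions by equivalences. -/
theorem isCEq_back (hFE : FunExt C) {F : Tm (Arr X Y)} {s : Tm (Arr Y X)}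
    (h : Path (comp F s).1 (idFun Y).1) (h' : Path (comp s F).1 (idFun X).1) :
    IsCEq (back F).toFun := by
  have hb := path_base h'
  rw [base_comp, base_idFun] at hb
  have e₁ : (PTy.pos X).toTy ◂ appMap (base s) ◂ appMap (base F) =
      (PTy.pos X).toTy ◂ appMap (base (comp s F)) := by
    rw [base_comp, appMap_comp, tySub_tySub]
  have e₂ : (PTy.pos Y).toTy ◂ appMap (base F) ◂ appMap (base s) =
      (PTy.pos Y).toTy ◂ appMap (base (comp F s)) := by
    rw [base_comp, appMap_comp, tySub_tySub]
  have h₁ : IsCEq (((back s).sub (appMap (base F))).comp (back F)).toFun :=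
    IsCEq_congr e₁.symm (FibHom.toFun_congr e₁.symm fun σ x k k' => back_comp s F σ x k _ _)
      (isCEq_back_of_path hFE h')
  have h₂ : IsCEq (((back F).sub (appMap (base s))).comp (back s)).toFun :=
    IsCEq_congr e₂.symm (FibHom.toFun_congr e₂.symm fun σ x k k' => back_comp F s σ x k _ _)
      (isCEq_back_of_path hFE h)
  rw [FibHom.toFun_comp] at h₁ h₂
  obtain ⟨⟨g, hg⟩, -⟩ := h₁
  obtain ⟨-, r, hr⟩ := h₂
  refine ⟨⟨comp ((back s).sub (appMap (base F))).toFun g, ?_⟩, ?_⟩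
  · rwa [← comp_assoc] at hg
  · rw [← inh_Ret]
    refine inh_of_appMap hb ?_
    rw [Ret_sub_eq (appMap (base s)) rfl rfl (f' := ((back F).sub (appMap (base s))).toFun)
      (FibHom.toFun_sub _ _ _ rfl fun _ _ _ _ => rfl), inh_Ret]
    exact ⟨comp r (back s).toFun, by rwa [← comp_assoc]⟩

end Zero

end Poly

/-! ### Codes of families of types -/

section FamilyCodes

variable {C : Type u} [Category.{v} C] [NaturalModel.{w} C] [HasPi C] [HasSigma C] [HasUniv C]
  {Γ Δ Θ : C}

theorem El_sub_eq {A : Tm (U Γ)} {A' : Tm (U Δ)} {σ : Δ ⟶ Γ} (h : A.1 ◃ σ = A'.1) :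
    El A ◂ σ = El A' := (El_sub A σ).trans (congrArg El (Tm.ext h))

/-- The code of the type of shapes of a family. -/
def famShape (t : Tm (Poly.FamTy (emp : C) ◂ toEmp Γ)) : Tm (U Γ) :=
  usub (Poly.shapeCode emp) (cons (toEmp Γ) t)

theorem El_famShape (t : Tm (Poly.FamTy (emp : C) ◂ toEmp Γ)) :
    El (Poly.shapeCode emp) ◂ cons (toEmp Γ) t = El (famShape t) := El_sub _ _

/-- The code of the type of positions of a family. -/
def famPos (t : Tm (Poly.FamTy (emp : C) ◂ toEmp Γ)) : Tm (U (Γ ▹ El (famShape t))) :=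
  usub (Poly.posCode emp) (liftTo (cons (toEmp Γ) t) (El_famShape t))

theorem famShape_val (t : Tm (Poly.FamTy (emp : C) ◂ toEmp Γ)) :
    (famShape t).1 = (fstAt (toEmp Γ) (U emp) _ t.1 t.2).1 := by
  rw [famShape, usub_val, Poly.shapeCode, Tm.cast_val]
  refine (fstAt_sub (C := C) _ _ _ _ _ _).trans (fstAt_congr' ?_ ?_ _ _) <;> simp [cons_eq]

theorem famTy_arr (t : Tm (U Γ)) (a : Tm (U (emp : C) ◂ toEmp Γ)) (h : a.1 = t.1) :
    Arr (El (uvar (emp : C))) (U (emp ▹ U emp)) ◂ cons (toEmp Γ) a = Arr (El t) (U Γ) :=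
  Arr_sub_eq _ (El_sub_eq (by simp [uvar, cons_eq, h])) (U_sub _)

theorem famPos_val (t : Tm (Poly.FamTy (emp : C) ◂ toEmp Γ)) :
    (famPos t).1 = (app ((sndAt (toEmp Γ) (U emp) _ t.1 t.2).cast
      (famTy_arr (famShape t) _ (famShape_val t).symm))).1 := by
  rw [famPos, usub_val, Poly.posCode, Tm.cast_val]
  refine app_sub_eq _ (El_famShape t) ?_ ?_
  · simp [U_sub]
  · refine (sndAt_sub (C := C) _ _ _ _ (ty_q _) _).trans
      (sndAt_congr' ?_ ?_ (comp_pair_ty _ (ty_q _)) t.2)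
    · exact (congrArg (· ≫ _) (cons_eq _ _)).trans (pair_p _ _ _ _)
    · exact (congrArg (_ ◃ ·) (cons_eq _ _)).trans (pair_q _ _ _ _)

/-- The family with given codes of the types of shapes and of positions. -/
def famMk (A : Tm (U Γ)) (P : Tm (U (Γ ▹ El A))) : Tm (Poly.FamTy (emp : C) ◂ toEmp Γ) :=
  dpairAt (toEmp Γ) (A.cast (U_sub _).symm)
    ((lam (P.cast (U_sub _).symm) : Tm (Arr (El A) (U Γ))).cast (famTy_arr A _ rfl).symm)

theorem famShape_mk (A : Tm (U Γ)) (P : Tm (U (Γ ▹ El A))) : famShape (famMk A P) = A :=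
  Tm.ext ((famShape_val _).trans (fstAt_dpairAt _ _ _ _))

theorem famPos_mk (A : Tm (U Γ)) (P : Tm (U (Γ ▹ El A))) :
    (famPos (famMk A P)).1 ◃ liftTo (𝟙 Γ) (by rw [famShape_mk, tySub_id]) = P.1 := by
  rw [famPos_val]
  refine (app_sub_eq (𝟙 Γ) ?_ ?_ ?_).trans (congrArg (fun a => a.1)
    (app_lam (B := U Γ ◂ p (El A)) (P.cast (U_sub _).symm)))
  · simp [U_sub]
  · rw [tmSub_id]
    exact sndAt_dpairAt (B := Arr (El (uvar emp)) (U (emp ▹ U emp))) _ _ _ (famMk A P).2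

theorem famMk_eta (t : Tm (Poly.FamTy (emp : C) ◂ toEmp Γ)) :
    famMk (famShape t) (famPos t) = t := by
  refine Tm.ext (Eq.trans (dpairAt_congr rfl (famShape_val t) ?_)
    (dpairAt_eta (toEmp Γ) t.1 t.2))
  refine (lam_congr (b := (famPos t).cast (U_sub _).symm) (b' := app _) (famPos_val t)).trans ?_
  exact congrArg Tm.val (lam_app _)

theorem famMk_sub_eq (σ : Δ ⟶ Γ) {A : Tm (U Γ)} {P : Tm (U (Γ ▹ El A))} {A' : Tm (U Δ)}
    {P' : Tm (U (Δ ▹ El A'))} (hA : A.1 ◃ σ = A'.1) (hP : P.1 ◃ liftTo σ (El_sub_eq hA) = P'.1) :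
    (famMk A P).1 ◃ σ = (famMk A' P').1 := by
  have e : σ ≫ toEmp Γ = toEmp Δ := toEmp_comp σ
  refine (dpairAt_sub (B := Arr (El (uvar emp)) (U (emp ▹ U emp))) (toEmp Γ) _ _ σ
    (A'.cast (by rw [e]; exact (U_sub (Γ := (emp : C)) (toEmp Δ)).symm))
    ((lam (P'.cast (U_sub _).symm) : Tm (Arr (El A') (U Δ))).cast ?_) hA ?_).trans
    (dpairAt_congr e rfl rfl)
  · exact (Arr_sub_eq _ (El_sub_eq (by simp [uvar, cons_eq])) (U_sub _)).symm
  · exact lam_sub_eq σ (El_sub_eq hA) hP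

end FamilyCodes

section Families

variable {C : Type u} [Category.{v} C] [NaturalModel.{w} C] {Γ Δ : C}

/-- The type of the polynomial model with given shapes and positions. -/
def PTy.ofTy (S : Ty Γ) (T : Ty (Γ ▹ S)) : PTy Γ := ⟨S, Fam.ofTy T⟩

theorem PTy.toTy_ofTy (S : Ty Γ) (T : Ty (Γ ▹ S)) : (PTy.ofTy S T).pos.toTy = T :=
  (Fam.equiv S).right_inv T

theorem PTy.ofTy_sub_eq {S : Ty Γ} {T : Ty (Γ ▹ S)} (σ : Δ ⟶ Γ) {S' : Ty Δ} {T' : Ty (Δ ▹ S')}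
    (hS : S ◂ σ = S') (hT : T ◂ liftTo σ hS = T') : (PTy.ofTy S T).sub σ = PTy.ofTy S' T' := by
  subst hS; subst hT
  refine PTy.ext rfl fun ρ a h h' => ?_
  change T ◂ pair (ρ ≫ σ) S a _ = (T ◂ liftTo σ rfl) ◂ pair ρ _ a h'
  rw [tySub_tySub, liftTo_eq, comp_pair]
  exact congrArg (T ◂ ·) (pair_congr
    ((congrArg (· ≫ σ) (pair_p ρ _ a h')).symm.trans (Category.assoc _ _ _))
    (pair_q ρ _ a h').symm _ _)

end Families

theorem El_famPos_pair {C : Type u} [Category.{v} C] [NaturalModel.{w} C] [HasPi C] [HasSigma C]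
    [HasUniv C] {Γ Δ : C} (t : Tm (Poly.FamTy (emp : C) ◂ toEmp Γ)) (σ : Δ ⟶ Γ) (a : Term Δ)
    (h : ty a = El (Poly.shapeCode emp) ◂ (σ ≫ cons (toEmp Γ) t)) (h') :
    El (Poly.posCode emp) ◂ pair (σ ≫ cons (toEmp Γ) t) (El (Poly.shapeCode emp)) a h =
      El (famPos t) ◂ pair σ _ a h' := by
  rw [famPos, ← El_sub, tySub_tySub, liftTo_eq, comp_pair]
  refine congrArg (_ ◂ ·) (pair_congr ?_ ?_ _ _) <;> simp

namespace Poly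

section Codes

variable {C : Type u} [Category.{v} C] [NaturalModel.{w} C] [HasPi C] [HasSigma C] [HasUniv C]
  [HasId C] [HasEmpty C] [HasSumTy C] [ExtensiveCoproducts C] {Γ Δ Θ : C}

/-- The code of a family of types of the base model. -/
def code (A : Tm (U Γ)) (P : Tm (U (Γ ▹ El A))) : Tm (U (zero Γ)) :=
  bareTm (Γ := zero Γ) (famMk A P)

theorem exists_eq_code (A : Tm (U (zero Γ))) : ∃ A₀ P, A = code A₀ P :=
  ⟨famShape (sh A), famPos (sh A), Tm.ext (bare_ext rfl
    (congrArg Tm.val (famMk_eta (sh A)).symm))⟩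

theorem El_eq (A : Tm (U (zero Γ))) :
    El A = PTy.ofTy (El (famShape (sh A))) (El (famPos (sh A))) := by
  refine PTy.ext (El_famShape (sh A)) fun σ a h h' => ?_
  exact El_famPos_pair (sh A) σ a (h.trans (tySub_tySub _ _ _)) h'

theorem El_code (A : Tm (U Γ)) (P : Tm (U (Γ ▹ El A))) :
    El (code A P) = PTy.ofTy (El A) (El P) := by
  refine (El_eq _).trans ?_
  refine (PTy.sub_id _).symm.trans (PTy.ofTy_sub_eq (𝟙 Γ) ?_ ?_)
  · refine (tySub_id _).trans (congrArg El (famShape_mk A P))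
  · exact El_sub_eq (famPos_mk A P)

/-- The action of a substitution on contexts without positions. -/
def zMap (σ : Δ ⟶ Γ) : zero Δ ⟶ zero Γ := ⟨σ, (FibHom.id _).cast (EmptyTy_sub σ).symm rfl⟩

theorem code_sub_eq (σ : Δ ⟶ Γ) {A : Tm (U Γ)} {P : Tm (U (Γ ▹ El A))} {A' : Tm (U Δ)}
    {P' : Tm (U (Δ ▹ El A'))} (hA : A.1 ◃ σ = A'.1) (hP : P.1 ◃ liftTo σ (El_sub_eq hA) = P'.1) :
    (code A P).1 ◃ zMap σ = (code A' P').1 :=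
  (bare_ext (s := code A' P') (U_sub (zMap σ)).symm (t := (code A P).sub (zMap σ))
    (famMk_sub_eq σ hA hP).symm).symm

end Codes

end Poly

/-! ### Functions between families of types -/

namespace Poly

section Functions

variable {C : Type u} [Category.{v} C] [NaturalModel.{w} C] [HasPi C] [HasSigma C] [HasUnit C]
  [HasId C] [HasEmpty C] [HasSumTy C] [ExtensiveCoproducts C]

theorem pos_liftTo_inr {Γ Δ : Poly C} (A : Ty Γ) (σ : Δ ⟶ Γ) {A' : Ty Δ} (hA : A ◂ σ = A') {Θ : C}
    (ρ : Θ ⟶ Δ.shape ▹ PTy.shape A') (z : Term Θ) (e e' e'') :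
    (Hom.pos (liftTo σ hA)).map ρ ((FibHom.inr
        (Γ.pos ◂ p (PTy.shape A) ◂ liftTo (Hom.shape σ) (congrArg PTy.shape hA))
        ((PTy.pos A).toTy ◂ liftTo (Hom.shape σ) (congrArg PTy.shape hA))).map ρ z e) e' =
      (FibHom.inr (Δ.pos ◂ p (PTy.shape A')) (PTy.pos A').toTy).map ρ z e'' := by
  subst hA; exact pos_lift_inr A σ ρ z e e' e''

variable {Γ Δ : C}

/-- A family of types of the base model, as a type of the polynomial model. -/
def fam (S : Ty Γ) (T : Ty (Γ ▹ S)) : Ty (zero Γ) := PTy.ofTy S T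

theorem fam_toTy (S : Ty Γ) (T : Ty (Γ ▹ S)) : (PTy.pos (fam S T)).toTy = T := PTy.toTy_ofTy S T

variable {S S' : Ty Γ} {T : Ty (Γ ▹ S)} {T' : Ty (Γ ▹ S')}

theorem fam_posAt (f : Tm (Arr S S')) :
    PTy.posAt (fam S' T' ◂ p (fam S T)) (app f).1 (app f).2 = T' ◂ appMap f :=
  (posAt_app (X := fam S T) (Y := fam S' T') f).trans (congrArg (· ◂ appMap f) (fam_toTy S' T'))

/-- A function on shapes and a backwards function on positions, as a term in context. -/
def polyTm (f : Tm (Arr S S')) (K : Tm (Arr (T' ◂ appMap f) T)) :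
    Tm (fam S' T' ◂ p (fam S T)) :=
  ptm (A := fam S' T' ◂ p (fam S T)) (app f) (((FibHom.ofFun K).comp (FibHom.inr _ T)).cast
    (fam_posAt f).symm (congrArg (SumTy _) (fam_toTy S T).symm))

/-- The function of the polynomial model given by a function on shapes and by a backwards function
on positions. -/
def polyFun (f : Tm (Arr S S')) (K : Tm (Arr (T' ◂ appMap f) T)) :
    Tm (Arr (fam S T) (fam S' T')) := lam (polyTm f K)

theorem polyFun_eta (F : Tm (Arr (fam S T) (fam S' T'))) {f : Tm (Arr S S')} (hf : f = base F)
    (K : Tm (Arr (T' ◂ appMap f) T)) (hK : K.1 = (back F).toFun.1) : polyFun f K = F := by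
  subst hf
  refine Eq.trans ?_ (lam_app F)
  refine congrArg lam (ptm_ext (b := papp F) rfl fun σ x h h' => ?_)
  have h₁ := h.trans (congrArg (· ◂ σ) (fam_posAt (T := T) (T' := T') (base F)))
  have h₂ := h.trans (congrArg (· ◂ σ) (posAt_app (base F)))
  refine Eq.trans ?_ (inr_back F σ x h₂ (FibHom.ty_map _ _ _ _))
  have hm : (FibHom.ofFun K).map σ x h₁ = (back F).map σ x h₂ :=
    (FibHom.ofFun_congr (congrArg (· ◂ appMap (base F)) (fam_toTy S' T').symm) (fam_toTy S T).symm
      hK σ x h₁ h₂).trans (congrArg (fun k => FibHom.map k σ x h₂) (FibHom.ofFun_toFun (back F)))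
  have h₃ := ((back F).ty_map σ x h₂).trans (congrArg (· ◂ σ) (fam_toTy S T))
  exact (FibHom.map_congr _ rfl hm ((FibHom.ofFun K).ty_map σ x h₁) h₃).trans
    (FibHom.inr_map_congr rfl (fam_toTy S T).symm σ _ _ ((back F).ty_map σ x h₂))

theorem polyFun_id {f : Tm (Arr S S)} {K : Tm (Arr (T ◂ appMap f) T)} (hf : f = idFun S)
    (hK : K.1 = (idFun T).1) : polyFun f K = idFun (fam S T) := by
  subst hf
  have hT : T ◂ appMap (idFun S) = T := by rw [appMap_idFun, tySub_id]
  refine congrArg lam (ptm_ext (b := var (fam S T)) (congrArg Tm.val app_idFun)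
    fun σ x h h' => ?_)
  have h₁ := h.trans (congrArg (· ◂ σ) (fam_posAt (T := T) (T' := T) (idFun S)))
  have h₂ := h₁.trans (congrArg (· ◂ σ) hT)
  have hm : (FibHom.ofFun K).map σ x h₁ = x :=
    (FibHom.ofFun_congr hT rfl hK σ x h₁ h₂).trans
      (congrArg (fun k => FibHom.map k σ x h₂) (FibHom.ofFun_toFun (FibHom.id T)))
  exact (FibHom.map_congr _ rfl hm ((FibHom.ofFun K).ty_map σ x h₁) h₂).trans
    (FibHom.inr_map_congr rfl (fam_toTy S T).symm σ _ _
      (h₂.trans (congrArg (· ◂ σ) (fam_toTy S T).symm)))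

theorem polyFun_sub_eq (σ : Δ ⟶ Γ) {S₁ S₁' : Ty Δ} {T₁ : Ty (Δ ▹ S₁)} {T₁' : Ty (Δ ▹ S₁')}
    (hS : S ◂ σ = S₁) (hT : T ◂ liftTo σ hS = T₁) (hS' : S' ◂ σ = S₁')
    (hT' : T' ◂ liftTo σ hS' = T₁') {f : Tm (Arr S S')} {K : Tm (Arr (T' ◂ appMap f) T)}
    {f₁ : Tm (Arr S₁ S₁')} {K₁ : Tm (Arr (T₁' ◂ appMap f₁) T₁)} (hf : f.1 ◃ σ = f₁.1)
    (hK : K.1 ◃ liftTo σ hS = K₁.1) : (polyFun f K).1 ◃ zMap σ = (polyFun f₁ K₁).1 := by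
  have hX : fam S T ◂ zMap σ = fam S₁ T₁ := PTy.ofTy_sub_eq σ hS hT
  have hY : fam S' T' ◂ zMap σ = fam S₁' T₁' := PTy.ofTy_sub_eq σ hS' hT'
  have hYp : fam S' T' ◂ p (fam S T) ◂ liftTo (zMap σ) hX = fam S₁' T₁' ◂ p (fam S₁ T₁) := by
    rw [← hY]; simp [liftTo_eq]
  have hs : (app f).1 ◃ liftTo σ hS = (app f₁).1 :=
    app_sub_eq σ hS (by simp [← hS', liftTo_eq]) hf
  refine lam_sub_eq (zMap σ) hX ?_
  refine term_ext (a := (polyTm f K).sub (liftTo (zMap σ) hX)) (b := polyTm f₁ K₁) hYp hs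
    fun ρ x h h' => ?_
  have h₁ := h'.trans (congrArg (· ◂ ρ) (fam_posAt (T := T₁) (T' := T₁') f₁))
  have eT : T' ◂ appMap f ◂ liftTo σ hS = T₁' ◂ appMap f₁ := by
    rw [← hT', tySub_tySub, tySub_tySub, appMap_sub_eq σ hS hS' hf]
  have h₂ : ty x = T' ◂ appMap f ◂ (ρ ≫ liftTo σ hS) :=
    h₁.trans ((congrArg (· ◂ ρ) eT.symm).trans (tySub_tySub _ _ _))
  have hm : (FibHom.ofFun K).map (ρ ≫ liftTo σ hS) x h₂ = (FibHom.ofFun K₁).map ρ x h₁ :=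
    (FibHom.ofFun_sub (liftTo σ hS) eT hT K K₁ hK ρ x h₁ h₂).symm
  have k₁ := (FibHom.ofFun K₁).ty_map ρ x h₁
  have k₂ : ty ((FibHom.ofFun K₁).map ρ x h₁) = (PTy.pos (fam S₁ T₁)).toTy ◂ ρ :=
    k₁.trans (congrArg (· ◂ ρ) (fam_toTy S₁ T₁).symm)
  have k₃ : ty ((FibHom.ofFun K₁).map ρ x h₁) = T ◂ liftTo σ hS ◂ ρ :=
    k₁.trans (congrArg (· ◂ ρ) hT.symm)
  have k₄ : ty ((FibHom.ofFun K₁).map ρ x h₁) = T ◂ (ρ ≫ liftTo σ hS) :=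
    k₃.trans (tySub_tySub _ _ _)
  have k₅ : ty ((FibHom.ofFun K₁).map ρ x h₁) = (PTy.pos (fam S T)).toTy ◂ liftTo σ hS ◂ ρ :=
    k₃.trans (congrArg (· ◂ liftTo σ hS ◂ ρ) (fam_toTy S T).symm)
  have e₁ : (FibHom.inr ((zero Γ).pos ◂ p S) T).map (ρ ≫ liftTo σ hS)
      ((FibHom.ofFun K).map (ρ ≫ liftTo σ hS) x h₂) ((FibHom.ofFun K).ty_map _ _ _) =
      (FibHom.inr ((zero Γ).pos ◂ p S ◂ liftTo σ hS)
        ((PTy.pos (fam S T)).toTy ◂ liftTo σ hS)).map ρ ((FibHom.ofFun K₁).map ρ x h₁) k₅ :=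
    (FibHom.map_congr _ rfl hm _ k₄).trans (((FibHom.inr_sub _ _ _ _ _ k₃ k₄).symm).trans
      (FibHom.inr_map_congr rfl (congrArg (· ◂ liftTo σ hS) (fam_toTy S T).symm) _ _ _ _))
  have hE : SumTy ((zero Γ).pos ◂ p S) T ◂ (ρ ≫ liftTo σ hS) =
      SumTy ((zero Γ).pos ◂ p S) (PTy.pos (fam S T)).toTy ◂ liftTo σ hS ◂ ρ :=
    (tySub_tySub _ _ _).symm.trans
      (congrArg (fun t => SumTy _ t ◂ liftTo σ hS ◂ ρ) (fam_toTy S T).symm)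
  refine (FibHom.map_congr (Hom.pos (liftTo (zMap σ) hX)) rfl e₁
    ((FibHom.ty_map _ _ _ _).trans hE) ((FibHom.ty_map _ _ _ _).trans
      (congrArg (· ◂ ρ) (SumTy_sub _ _ _).symm))).trans ?_
  refine (pos_liftTo_inr (fam S T) (zMap σ) hX ρ _ k₅ ((FibHom.ty_map _ _ _ _).trans
      (congrArg (· ◂ ρ) (SumTy_sub _ _ _).symm)) k₂).trans ?_
  exact FibHom.inr_map_congr rfl (fam_toTy S₁ T₁) _ _ _ _

end Functions

end Poly

/-! ### Equivalences of families as functions of the polynomial model -/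

section ArrowPairs

variable {C : Type u} [Category.{v} C] [NaturalModel.{w} C] [HasPi C] [HasSigma C] [HasUniv C]
  {Γ Δ : C}

/-- The functions from the type coded by `A` to types in the universe. -/
def ArrFam (A : Tm (U Γ)) : Ty (Γ ▹ U Γ) := Arr (El (usub A (p (U Γ)))) (El (uvar Γ))

theorem ArrFam_inst (A B : Tm (U Γ)) : ArrFam A ◂ inst B = Arr (El A) (El B) :=
  Arr_sub_eq _ (El_inst A B) (El_uvar_inst B)

/-- A code together with a function into the type that it codes. -/
def arrPair {A B : Tm (U Γ)} (F : Tm (Arr (El A) (El B))) : Tm (Sig (U Γ) (ArrFam A)) :=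
  dpair B (F.cast (ArrFam_inst A B).symm)

theorem ArrFam_sub_eq (σ : Δ ⟶ Γ) {A : Tm (U Γ)} {A' : Tm (U Δ)} (hA : A.1 ◃ σ = A'.1) :
    ArrFam A ◂ liftTo σ (U_sub σ) = ArrFam A' :=
  Arr_sub_eq _ (El_sub_eq (by simp [liftTo_eq, ← hA])) (El_sub_eq (by simp [liftTo_eq, uvar]))

theorem arrPair_sub_eq (σ : Δ ⟶ Γ) {A B : Tm (U Γ)} {F : Tm (Arr (El A) (El B))} {A' B' : Tm (U Δ)}
    {F' : Tm (Arr (El A') (El B'))} (hA : A.1 ◃ σ = A'.1) (hB : B.1 ◃ σ = B'.1)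
    (hF : F.1 ◃ σ = F'.1) : (arrPair F).1 ◃ σ = (arrPair F').1 :=
  dpair_sub_eq σ (U_sub σ) (ArrFam_sub_eq σ hA) hB hF

theorem arrPair_congr {A B B' : Tm (U Γ)} {F : Tm (Arr (El A) (El B))}
    {F' : Tm (Arr (El A) (El B'))} (hB : B = B') (hF : F.1 = F'.1) : arrPair F = arrPair F' := by
  subst hB; rw [Tm.ext hF]

end ArrowPairs

section Telescope

variable {C : Type u} [Category.{v} C] [NaturalModel.{w} C] [HasPi C] [HasSigma C] [HasId C]
  [HasUniv C] {Γ Δ : C}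

/-- The type of families of codes over the type coded by `B`. -/
abbrev FamPi (B : Tm (U Γ)) : Ty Γ := Pi (El B) (U (Γ ▹ El B))

theorem FamPi_sub_eq (σ : Δ ⟶ Γ) {B : Tm (U Γ)} {B' : Tm (U Δ)} (hB : B.1 ◃ σ = B'.1) :
    FamPi B ◂ σ = FamPi B' := Pi_sub_eq σ (El_sub_eq hB) (U_sub _)

/-- The generic family of codes over the type coded by `B`. -/
def genFam (B : Tm (U Γ)) : Tm (U (Γ ▹ FamPi B ▹ El (usub B (p (FamPi B))))) :=
  app ((var (FamPi B)).cast (FamPi_sub_eq _ rfl))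

theorem genFam_sub_eq {B : Tm (U Γ)} (τ : Δ ⟶ Γ ▹ FamPi B) {B' : Tm (U Δ)}
    (hB : (usub B (p (FamPi B))).1 ◃ τ = B'.1) {Q : Tm (U (Δ ▹ El B'))}
    (hQ : q (FamPi B) ◃ τ = (lam Q).1) :
    (genFam B).1 ◃ liftTo τ (El_sub_eq hB) = Q.1 :=
  (app_sub_eq τ (El_sub_eq hB) (U_sub _) hQ).trans (congrArg Tm.val (app_lam Q))

theorem fst_Eqv_sub_eq (σ : Δ ⟶ Γ) {A B : Ty Γ} {A' B' : Ty Δ} (hA : A ◂ σ = A') (hB : B ◂ σ = B')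
    {t : Tm (Eqv A B)} {t' : Tm (Eqv A' B')} (ht : t.1 ◃ σ = t'.1) :
    (fst t).1 ◃ σ = (fst t').1 := by
  refine fst_sub_eq σ (Arr_sub_eq σ hA hB) ?_ ht
  refine isEquiv_sub_eq _ ?_ ?_ ?_
  all_goals simp [liftTo_eq, ← hA, ← hB]

variable {A B : Tm (U Γ)}

/-- The type of equivalences between the family `P` and the reindexing of the family `Q` along an
equivalence of the base types. -/
def FamEqv (P : Tm (U (Γ ▹ El A))) (ε : Tm (Eqv (El A) (El B))) (Q : Tm (U (Γ ▹ El B))) :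
    Ty (Γ ▹ El A) := Eqv (El P) (El Q ◂ appMap (fst ε))

variable {P : Tm (U (Γ ▹ El A))} {ε : Tm (Eqv (El A) (El B))} {Q : Tm (U (Γ ▹ El B))}
  (σ : Δ ⟶ Γ) {A' B' : Tm (U Δ)} {P' : Tm (U (Δ ▹ El A'))} {ε' : Tm (Eqv (El A') (El B'))}
  {Q' : Tm (U (Δ ▹ El B'))} (hA : A.1 ◃ σ = A'.1)

theorem El_appMap_sub_eq (hB : B.1 ◃ σ = B'.1) (hε : ε.1 ◃ σ = ε'.1)
    (hQ : Q.1 ◃ liftTo σ (El_sub_eq hB) = Q'.1) :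
    El Q ◂ appMap (fst ε) ◂ liftTo σ (El_sub_eq hA) =
    El Q' ◂ appMap (fst ε') := by
  rw [tySub_tySub, appMap_sub_eq σ (El_sub_eq hA) (El_sub_eq hB)
    (fst_Eqv_sub_eq σ (El_sub_eq hA) (El_sub_eq hB) hε), ← tySub_tySub, El_sub_eq hQ]

theorem FamEqv_sub_eq (hP : P.1 ◃ liftTo σ (El_sub_eq hA) = P'.1) (hB : B.1 ◃ σ = B'.1)
    (hε : ε.1 ◃ σ = ε'.1) (hQ : Q.1 ◃ liftTo σ (El_sub_eq hB) = Q'.1) :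
    FamEqv P ε Q ◂ liftTo σ (El_sub_eq hA) = FamEqv P' ε' Q' :=
  Eqv_sub_eq _ (El_sub_eq hP) (El_appMap_sub_eq σ hA hB hε hQ)

/-- The type of fibrewise equivalences between two families over equivalent types. -/
def EqvPi (P : Tm (U (Γ ▹ El A))) (ε : Tm (Eqv (El A) (El B))) (Q : Tm (U (Γ ▹ El B))) : Ty Γ :=
  Pi (El A) (FamEqv P ε Q)

theorem EqvPi_sub_eq (hP : P.1 ◃ liftTo σ (El_sub_eq hA) = P'.1) (hB : B.1 ◃ σ = B'.1)
    (hε : ε.1 ◃ σ = ε'.1) (hQ : Q.1 ◃ liftTo σ (El_sub_eq hB) = Q'.1) :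
    EqvPi P ε Q ◂ σ = EqvPi P' ε' Q' :=
  Pi_sub_eq σ (El_sub_eq hA) (FamEqv_sub_eq σ hA hP hB hε hQ)

end Telescope

section GenericEquivalence

variable {C : Type u} [Category.{v} C] [NaturalModel.{w} C] [HasPi C] [HasSigma C] [HasId C]
  [HasUniv C] {Γ Δ : C}

theorem sub_liftTo_section {σ : Δ ⟶ Γ} {τ : Γ ⟶ Δ} (h : τ ≫ σ = 𝟙 Γ) {A : Ty Γ} {A' : Ty Δ}
    (hA : A ◂ σ = A') (hA' : A' ◂ τ = A) (a : Term (Γ ▹ A)) :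
    (a ◃ liftTo σ hA) ◃ liftTo τ hA' = a := by
  rw [tmSub_tmSub]
  have : liftTo τ hA' ≫ liftTo σ hA = 𝟙 _ := by
    rw [liftTo_eq, liftTo_eq, comp_pair]
    refine Eq.trans ?_ (pair_pq A (by simp))
    refine pair_congr ?_ ?_ _ _
    · rw [← Category.assoc, pair_p, Category.assoc, h, Category.comp_id]
    · simp
  rw [this, tmSub_id]

theorem Cov.liftTo {i : Δ ⟶ Γ} (hi : Cov i) {A : Ty Γ} {A' : Ty Δ} (h : A ◂ i = A') :
    Cov (TT.liftTo i h) := by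
  subst h; exact cov_lift hi A

variable {A : Tm (U Γ)} (P : Tm (U (Γ ▹ El A)))

/-- The code of the codomain of the generic equivalence out of the type coded by `A`. -/
def genCode (A : Tm (U Γ)) : Tm (U (Γ ▹ U Γ ▹ EqvFam A)) := usub (uvar Γ) (p (EqvFam A))

/-- The generic equivalence out of the type coded by `A`. -/
def genEqv (A : Tm (U Γ)) :
    Tm (Eqv (El (usub A (p (EqvFam A) ≫ p (U Γ)))) (El (genCode A))) :=
  (var (EqvFam A)).cast (Eqv_sub_eq _ (El_sub_eq (by simp)) (El_sub _ _))

/-- The type of fibrewise equivalences from the family `P` to the generic family over the codomain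
of the generic equivalence. -/
def genEqvPi : Ty (Γ ▹ U Γ ▹ EqvFam A ▹ FamPi (genCode A)) :=
  EqvPi (A := usub A (p (FamPi (genCode A)) ≫ p (EqvFam A) ≫ p (U Γ)))
    (B := usub (genCode A) (p (FamPi (genCode A))))
    (usub P (liftTo _ (El_sub A _)))
    (((genEqv A).sub (p (FamPi (genCode A)))).cast
      (Eqv_sub_eq _ (El_sub_eq (by simp)) (El_sub _ _)))
    (genFam (genCode A))

/-- The generic fibrewise equivalence. -/
def genFamEqv : Tm (FamEqv (A := usub A (p (genEqvPi P) ≫ p (FamPi (genCode A)) ≫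
      p (EqvFam A) ≫ p (U Γ))) (B := usub (genCode A) (p (genEqvPi P) ≫ p (FamPi (genCode A))))
    (usub P (liftTo _ (El_sub A _)))
    (((genEqv A).sub (p (genEqvPi P) ≫ p (FamPi (genCode A)))).cast
      (Eqv_sub_eq _ (El_sub_eq (by simp)) (El_sub _ _)))
    (usub (genFam (genCode A)) (liftTo (p (genEqvPi P)) (El_sub_eq (by simp))))) :=
  app ((var (genEqvPi P)).cast (EqvPi_sub_eq _ (by simp) (by simp [liftTo_eq]) (by simp) (by simp)
    rfl))

/-- The substitution `τ` instantiates the generic equivalence and the generic fibrewise equivalence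
by `ε` and `K`. -/
structure IsEqvMap {P : Tm (U (Γ ▹ El A))} {B : Tm (U Γ)} {Q : Tm (U (Γ ▹ El B))}
    (τ : Γ ⟶ Γ ▹ U Γ ▹ EqvFam A ▹ FamPi (genCode A) ▹ genEqvPi P) (ε : Tm (Eqv (El A) (El B)))
    (K : Tm (FamEqv P ε Q)) : Prop where
  base : τ ≫ p (genEqvPi P) ≫ p (FamPi (genCode A)) ≫ p (EqvFam A) ≫ p (U Γ) = 𝟙 Γ
  code : q (U Γ) ◃ (τ ≫ p (genEqvPi P) ≫ p (FamPi (genCode A)) ≫ p (EqvFam A)) = B.1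
  eqv : q (EqvFam A) ◃ (τ ≫ p (genEqvPi P) ≫ p (FamPi (genCode A))) = ε.1
  family : q (FamPi (genCode A)) ◃ (τ ≫ p (genEqvPi P)) = (lam Q).1
  famEqv : q (genEqvPi P) ◃ τ = (lam K).1

end GenericEquivalence

namespace Poly

section EquivalencePairs

variable {C : Type u} [Category.{v} C] [NaturalModel.{w} C] [HasPi C] [HasSigma C] [HasUnit C]
  [HasId C] [HasEmpty C] [HasSumTy C] [ExtensiveCoproducts C] [HasUniv C] {Γ Δ : C}
  {A B : Tm (U Γ)} {P : Tm (U (Γ ▹ El A))} {Q : Tm (U (Γ ▹ El B))}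

/-- An equivalence of types together with a fibrewise equivalence of families over them, as a
function of the polynomial model out of the type coded by the first family. -/
def eqvPair (ε : Tm (Eqv (El A) (El B))) (K : Tm (FamEqv P ε Q)) :
    Tm (Sig (U (zero Γ)) (ArrFam (code A P))) :=
  arrPair (B := code B Q) ((polyFun (T := El P) (T' := El Q) (fst ε) (eqvInv K)).cast
    (congrArg₂ Arr (El_code A P).symm (El_code B Q).symm))

theorem eqvPair_sub_eq (σ : Δ ⟶ Γ) {ε : Tm (Eqv (El A) (El B))} {K : Tm (FamEqv P ε Q)}
    {A' B' : Tm (U Δ)} {P' : Tm (U (Δ ▹ El A'))} {Q' : Tm (U (Δ ▹ El B'))}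
    {ε' : Tm (Eqv (El A') (El B'))} {K' : Tm (FamEqv P' ε' Q')} (hA : A.1 ◃ σ = A'.1)
    (hP : P.1 ◃ liftTo σ (El_sub_eq hA) = P'.1) (hB : B.1 ◃ σ = B'.1) (hε : ε.1 ◃ σ = ε'.1)
    (hQ : Q.1 ◃ liftTo σ (El_sub_eq hB) = Q'.1) (hK : K.1 ◃ liftTo σ (El_sub_eq hA) = K'.1) :
    (eqvPair ε K).1 ◃ zMap σ = (eqvPair ε' K').1 := by
  refine arrPair_sub_eq (zMap σ) (code_sub_eq σ hA hP) (code_sub_eq σ hB hQ) ?_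
  refine polyFun_sub_eq σ (El_sub_eq hA) (El_sub_eq hP) (El_sub_eq hB) (El_sub_eq hQ)
    (fst_Eqv_sub_eq σ (El_sub_eq hA) (El_sub_eq hB) hε) ?_
  exact eqvInv_sub_eq _ (El_sub_eq hP) (El_appMap_sub_eq σ hA hB hε hQ) hK

theorem eqvPair_idEqv {K : Tm (FamEqv P (idEqv (El A)) P)} (hK : K.1 = (idEqv (El P)).1) :
    eqvPair (idEqv (El A)) K = arrPair (idFun (El (code A P))) := by
  refine arrPair_congr rfl ?_
  have h : El P ◂ appMap (fst (idEqv (El A))) = El P := by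
    rw [fst_idEqv, appMap_idFun, tySub_id]
  have hK' : (eqvInv K).1 = (idFun (El P)).1 := by
    have e : ∀ {T : Ty (Γ ▹ El A)} (hT : T = El P) (K : Tm (Eqv (El P) T))
        (_ : K.1 = (idEqv (El P)).1), (eqvInv K).1 = (idFun (El P)).1 := by
      rintro _ rfl K hK
      rw [Tm.ext hK, eqvInv_idEqv]
    exact e h K hK
  refine (congrArg Tm.val (polyFun_id fst_idEqv hK')).trans ?_
  exact congrArg (fun X => (idFun X).1) (El_code A P).symm

/-- The function of the polynomial model given by the generic equivalence and by the generic
fibrewise equivalence. -/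
def genPair (P : Tm (U (Γ ▹ El A))) := eqvPair _ (genFamEqv P)

theorem genPair_sub_eq {τ : Γ ⟶ Γ ▹ U Γ ▹ EqvFam A ▹ FamPi (genCode A) ▹ genEqvPi P}
    {ε : Tm (Eqv (El A) (El B))} {K : Tm (FamEqv P ε Q)} (h : IsEqvMap τ ε K) :
    (genPair P).1 ◃ zMap τ = (eqvPair ε K).1 := by
  obtain ⟨h, hB, hε, hQ, hK⟩ := h
  have hA' : (usub A (p (genEqvPi P) ≫ p (FamPi (genCode A)) ≫ p (EqvFam A) ≫ p (U Γ))).1 ◃ τ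
      = A.1 := by simp [h]
  have hB' : (usub (genCode A) (p (genEqvPi P) ≫ p (FamPi (genCode A)))).1 ◃ τ = B.1 := by
    refine Eq.trans ?_ hB
    change ((q (U Γ) ◃ p (EqvFam A)) ◃ (p (genEqvPi P) ≫ p (FamPi (genCode A)))) ◃ τ = _
    simp only [tmSub_tmSub, Category.assoc]
  have hP' : (usub P (liftTo (p (genEqvPi P) ≫ p (FamPi (genCode A)) ≫ p (EqvFam A) ≫ p (U Γ))
      (El_sub A _))).1 ◃ liftTo τ (El_sub_eq hA') = P.1 :=
    sub_liftTo_section h _ _ _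
  refine eqvPair_sub_eq τ hA' hP' hB' ?_ ?_ ?_
  · exact (tmSub_tmSub _ _ _).trans hε
  · refine (tmSub_tmSub _ _ _).trans ((congrArg (_ ◃ ·) (liftTo_comp _ _ _ _ _)).trans
      (genFam_sub_eq (τ ≫ p (genEqvPi P)) ?_ ?_))
    · rw [← hB']; exact (tmSub_tmSub _ _ _).trans (by simp)
    · exact hQ
  · refine (app_sub_eq τ _ ?_ hK).trans (congrArg Tm.val (app_lam K))
    exact FamEqv_sub_eq τ hA' hP' hB' ((tmSub_tmSub _ _ _).trans hε)
      ((tmSub_tmSub _ _ _).trans ((congrArg (_ ◃ ·) (liftTo_comp _ _ _ _ _)).trans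
      (genFam_sub_eq (τ ≫ p (genEqvPi P)) (by rw [← hB']; exact (tmSub_tmSub _ _ _).trans (by simp))
        hQ)))

end EquivalencePairs

end Poly

section EquivalenceContext

variable {C : Type u} [Category.{v} C] [NaturalModel.{w} C] [HasPi C] [HasSigma C] [HasId C]
  [HasUniv C] {Γ Δ : C} {A : Tm (U Γ)} {P : Tm (U (Γ ▹ El A))}

theorem genEqvPi_sub_eq (τ : Δ ⟶ Γ ▹ U Γ ▹ EqvFam A ▹ FamPi (genCode A)) {A' B : Tm (U Δ)}
    {P' : Tm (U (Δ ▹ El A'))} {ε : Tm (Eqv (El A') (El B))} {Q : Tm (U (Δ ▹ El B))}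
    (hA : A.1 ◃ (τ ≫ p (FamPi (genCode A)) ≫ p (EqvFam A) ≫ p (U Γ)) = A'.1)
    (hP : P.1 ◃ liftTo (τ ≫ p (FamPi (genCode A)) ≫ p (EqvFam A) ≫ p (U Γ)) (El_sub_eq hA) = P'.1)
    (hB : q (U Γ) ◃ (τ ≫ p (FamPi (genCode A)) ≫ p (EqvFam A)) = B.1)
    (hε : q (EqvFam A) ◃ (τ ≫ p (FamPi (genCode A))) = ε.1)
    (hQ : q (FamPi (genCode A)) ◃ τ = (lam Q).1) :
    genEqvPi P ◂ τ = EqvPi P' ε Q := by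
  have hB' : (usub (genCode A) (p (FamPi (genCode A)))).1 ◃ τ = B.1 := by
    refine Eq.trans ?_ hB
    change ((q (U Γ) ◃ p (EqvFam A)) ◃ p (FamPi (genCode A))) ◃ τ = _
    simp only [tmSub_tmSub, Category.assoc]
  refine EqvPi_sub_eq τ ((tmSub_tmSub _ _ _).trans hA) ?_ hB' ?_ (genFam_sub_eq τ hB' hQ)
  · refine (tmSub_tmSub _ _ _).trans (Eq.trans ?_ hP)
    exact congrArg (_ ◃ ·) (liftTo_comp _ _ _ _ _)
  · exact (tmSub_tmSub _ _ _).trans hε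

theorem exists_isEqvMap {B : Tm (U Γ)} {Q : Tm (U (Γ ▹ El B))} (ε : Tm (Eqv (El A) (El B)))
    (K : Tm (FamEqv P ε Q)) : ∃ τ, IsEqvMap τ ε K := by
  let i : Γ ⟶ Γ ▹ U Γ ▹ EqvFam A := cons (inst B) (ε.cast (EqvFam_inst A B).symm)
  have h₁ : FamPi (genCode A) ◂ i = FamPi B :=
    FamPi_sub_eq i (by simp [i, genCode, uvar, cons_eq, inst_eq])
  let i' := cons i ((lam Q).cast h₁.symm)
  have e : i' ≫ p (FamPi (genCode A)) = i := by simp [i', cons_eq]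
  have e' : i ≫ p (EqvFam A) ≫ p (U Γ) = 𝟙 Γ := by simp [i, cons_eq, inst_eq]
  have e'' : i ≫ p (EqvFam A) = inst B := by simp [i, cons_eq]
  have h₂ : genEqvPi P ◂ i' = EqvPi P ε Q := by
    refine genEqvPi_sub_eq i' ?_ ?_ ?_ ?_ ?_
    · rw [reassoc_of% e, e', tmSub_id]
    · refine Eq.trans (congrArg (P.1 ◃ ·) ?_) (tmSub_id _)
      rw [liftTo_eq]
      refine Eq.trans (pair_congr ?_ rfl _ ?_) (pair_pq _ (by simp))
      · rw [reassoc_of% e, e', Category.comp_id]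
      · simp
    · rw [reassoc_of% e, e'']; simp [inst_eq]
    · rw [e]; simp [i, cons_eq]
    · simp [i', cons_eq]
  refine ⟨cons i' ((lam K).cast h₂.symm), ?_⟩
  have e₃ : cons i' ((lam K).cast h₂.symm) ≫ p (genEqvPi P) = i' := by simp [cons_eq]
  refine ⟨?_, ?_, ?_, ?_, ?_⟩
  · rw [reassoc_of% e₃, reassoc_of% e, e']
  · rw [reassoc_of% e₃, reassoc_of% e, e'']; simp [inst_eq]
  · rw [reassoc_of% e₃, e]; simp [i, cons_eq]
  · rw [e₃]; simp [i', cons_eq]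
  · simp [cons_eq]; rfl

theorem piSnd_EqvFam (P : Tm (U (Γ ▹ El A))) : piSnd (EqvFam P) =
    EqvPi (A := usub A (p (FamPi A))) (usub P (liftTo (p (FamPi A)) (El_sub _ _)))
      (idEqv (El (usub A (p (FamPi A))))) (genFam A) := by
  have hX := El_sub A (p (FamPi A))
  let v : Tm (FamPi (usub A (p (FamPi A)))) := (var (FamPi A)).cast (FamPi_sub_eq _ rfl)
  let b : Tm (U (Γ ▹ El A) ◂ liftTo (p (FamPi A)) hX) := (genFam A).cast (U_sub _).symm
  have hv : (lam b).1 = q (FamPi A) :=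
    (lam_congr (b := b) (b' := app v) rfl).trans (congrArg Tm.val (lam_app v))
  have hid : cons (p (FamPi A)) (var (FamPi A)) = 𝟙 _ := (cons_eq _ _).trans (pair_pq _ _)
  have h := ((tySub_id _).symm.trans (congrArg (piSnd (EqvFam P) ◂ ·) hid).symm).trans
    (piSnd_cons (Q := EqvFam P) (p (FamPi A)) hX b (var (FamPi A)) hv.symm)
  refine h.trans (congrArg (Pi _) ?_)
  refine Eqv_sub_eq _ ?_ ?_
  · exact El_sub_eq (by simp [cons_eq, b])
  · rw [fst_idEqv, appMap_idFun, tySub_id]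
    exact El_sub_eq (by simp [cons_eq, uvar, b])

end EquivalenceContext

section EquivalenceContext

variable {C : Type u} [Category.{v} C] [NaturalModel.{w} C] [ITT C] {Γ Δ : C} {A : Tm (U Γ)}

theorem liftTo_congr {σ σ' : Δ ⟶ Γ} (hσ : σ = σ') {B : Ty Γ} {B' : Ty Δ} (h : B ◂ σ = B')
    (h' : B ◂ σ' = B') : liftTo σ h = liftTo σ' h' := by
  subst hσ; rfl

theorem lam_genFam (B : Tm (U Γ)) : (lam (genFam B)).1 = q (FamPi B) :=
  congrArg Tm.val (lam_app ((var (FamPi B)).cast (FamPi_sub_eq (B' := usub B (p (FamPi B))) _ rfl)))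

/-- The identity equivalence and the fibrewise identity equivalence are generic among equivalences
and fibrewise equivalences. -/
theorem exists_cov_isEqvMap (hFE : FunExt C) (hUA : Univalence C) (P : Tm (U (Γ ▹ El A))) :
    ∃ (τ : _) (K : Tm (FamEqv P (idEqv (El A)) P)), Cov τ ∧ K.1 = (idEqv (El P)).1 ∧
      IsEqvMap τ (idEqv (El A)) K := by
  have hK : FamEqv P (idEqv (El A)) P = Eqv (El P) (El P) := by
    rw [FamEqv, fst_idEqv, appMap_idFun, tySub_id]
  let i : Γ ⟶ Γ ▹ U Γ ▹ EqvFam A := cons (inst A) ((idEqv (El A)).cast (EqvFam_inst A A).symm)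
  -- univalence at `A` contracts the equivalence, univalence at the fibres `P` contracts the fibrewise
  -- equivalence
  have hi : Cov i := hUA.cov A
  have e' : i ≫ p (EqvFam A) ≫ p (U Γ) = 𝟙 Γ := by simp [i, cons_eq, inst_eq]
  have e'' : i ≫ p (EqvFam A) = inst A := by simp [i, cons_eq]
  have h₁ : FamPi (genCode A) ◂ i = FamPi A :=
    FamPi_sub_eq i (by simp [i, genCode, uvar, cons_eq, inst_eq])
  have e : liftTo i h₁ ≫ p (FamPi (genCode A)) = p (FamPi A) ≫ i := by simp [liftTo_eq]
  have e₃ : liftTo i h₁ ≫ p (FamPi (genCode A)) ≫ p (EqvFam A) ≫ p (U Γ) = p (FamPi A) := by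
    rw [reassoc_of% e, e', Category.comp_id]
  have h₂ : genEqvPi P ◂ liftTo i h₁ = piSnd (EqvFam P) := by
    refine (genEqvPi_sub_eq (liftTo i h₁) (A' := usub A (p (FamPi A)))
      (B := usub A (p (FamPi A))) ?_ ?_ ?_ ?_ ?_).trans (piSnd_EqvFam P).symm
    · exact congrArg (A.1 ◃ ·) e₃
    · exact congrArg (P.1 ◃ ·) (liftTo_congr e₃ _ _)
    · rw [reassoc_of% e, e'']; simp [inst_eq]
    · rw [e, ← tmSub_tmSub]
      refine Eq.trans (congrArg (· ◃ _) ?_) (idEqv_sub_eq (p (FamPi A)) (El_sub _ _))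
      simp [i, cons_eq]
    · rw [lam_genFam, liftTo_eq, pair_q]
  let a' : Tm (U (Γ ▹ El A) ◂ liftTo (𝟙 Γ) (tySub_id (El A))) := P.cast (U_sub _).symm
  have hb : EqvFam P ◂ cons (liftTo (𝟙 Γ) (tySub_id (El A))) a' = Eqv (El P) (El P) := by
    rw [← EqvFam_inst P P]
    refine congrArg (EqvFam P ◂ ·) ?_
    exact cons_congr rfl (liftTo_id _)
  have hj := cov_lamMap hFE (X := El A) (Q := EqvFam P) P
    ((idEqv (El P)).cast (EqvFam_inst P P).symm) (hUA.cov P) a' ((idEqv (El P)).cast hb.symm)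
    rfl rfl
  refine ⟨lamMap (𝟙 Γ) (tySub_id (El A)) a' ((idEqv (El P)).cast hb.symm) ≫
    liftTo (liftTo i h₁) h₂, (idEqv (El P)).cast hK.symm, ((hi.liftTo h₁).liftTo h₂).comp hj, rfl,
    ?_⟩
  generalize hl : lamMap (𝟙 Γ) (tySub_id (El A)) a' ((idEqv (El P)).cast hb.symm) = l at hj ⊢
  have l₁ : l ≫ p (piSnd (EqvFam P)) ≫ p (FamPi A) = 𝟙 Γ := by simp [← hl, lamMap, cons_eq]
  have j₁ : (l ≫ liftTo (liftTo i h₁) h₂) ≫ p (genEqvPi P) =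
      l ≫ p (piSnd (EqvFam P)) ≫ liftTo i h₁ := by
    rw [liftTo_eq (liftTo i h₁), Category.assoc, pair_p]
  have j₂ : (l ≫ liftTo (liftTo i h₁) h₂) ≫ p (genEqvPi P) ≫ p (FamPi (genCode A)) = i := by
    rw [← Category.assoc, j₁, Category.assoc, Category.assoc, e, reassoc_of% l₁]
  refine ⟨?_, ?_, ?_, ?_, ?_⟩
  · simpa using (congrArg (· ≫ p (EqvFam A) ≫ p (U Γ)) j₂).trans e'
  · have := congrArg (· ≫ p (EqvFam A)) j₂
    rw [e''] at this
    simp only [Category.assoc] at this ⊢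
    rw [this]; simp [inst_eq]
  · rw [j₂]; simp [i, cons_eq]
  · rw [j₁]; simp [liftTo_eq, ← hl, lamMap, cons_eq]; exact lam_congr rfl
  · simp [liftTo_eq, ← hl, lamMap, cons_eq]; exact lam_congr rfl

end EquivalenceContext

/-! ### Univalence for families of types -/

namespace Poly

section Univalence

variable {C : Type u} [Category.{v} C] [NaturalModel.{w} C] [ITT C] [ExtensiveCoproducts C]
  {Γ Δ : C}

/-- Paths in contexts without positions are instances of a path at a generic substitution. -/
theorem path_of_cov {j : Δ ⟶ Γ} (hj : Cov j) {X : Ty (zero Γ)} {a b : Tm X}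
    (h : Path (a.1 ◃ zMap j) (b.1 ◃ zMap j)) : Path a.1 b.1 := by
  refine path_iff.2 (inh_bare.2 (hj _ ?_))
  have h' := inh_bare.1 (path_iff.1 (show Path (a.sub (zMap j)).1 (b.sub (zMap j)).1 from h))
  exact h'.cast (IdTy_sub (sh a) (sh b) j).symm

/-- An equivalence of families is equal to the identity. By univalence and function extensionality
this holds for the generic equivalence of families, as it holds at the centre of contraction. -/
theorem path_eqvPair (hFE : FunExt C) (hUA : Univalence C) {A B : Tm (U Γ)} {P : Tm (U (Γ ▹ El A))}
    {Q : Tm (U (Γ ▹ El B))} (ε : Tm (Eqv (El A) (El B))) (K : Tm (FamEqv P ε Q)) :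
    Path (arrPair (idFun (El (code A P)))).1 (eqvPair ε K).1 := by
  obtain ⟨j, K₀, hj, hK₀, hj'⟩ := exists_cov_isEqvMap hFE hUA P
  obtain ⟨k, hk⟩ := exists_isEqvMap ε K
  have key : ∀ {B : Tm (U Γ)} {Q : Tm (U (Γ ▹ El B))} {ε : Tm (Eqv (El A) (El B))}
      {K : Tm (FamEqv P ε Q)} {τ} (h : IsEqvMap τ ε K),
      (arrPair (idFun (El (code (usub A (p (genEqvPi P) ≫ p (FamPi (genCode A)) ≫
        p (EqvFam A) ≫ p (U Γ))) (usub P (liftTo _ (El_sub A _))))))).1 ◃ zMap τ =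
      (arrPair (idFun (El (code A P)))).1 := by
    intro B Q ε K τ h
    have hA : (usub A (p (genEqvPi P) ≫ p (FamPi (genCode A)) ≫ p (EqvFam A) ≫ p (U Γ))).1 ◃ τ
      = A.1 := by simp [h.base]
    have hc := code_sub_eq τ hA (P := usub P (liftTo _ (El_sub A _))) (P' := P)
      (sub_liftTo_section h.base _ _ _)
    exact arrPair_sub_eq (zMap τ) hc hc (idFun_sub_eq _ (El_sub_eq hc))
  have h := path_of_cov hj (b := genPair P) (a := arrPair (idFun _))
    (Path.of_eq ((key hj').trans ((congrArg Tm.val (eqvPair_idEqv hK₀)).symm.trans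
      (genPair_sub_eq hj').symm)))
  have := h.sub (zMap k)
  rwa [key hk, genPair_sub_eq hk] at this

theorem IsCEq_cast {C : Type u} [Category.{v} C] [NaturalModel.{w} C] [HasPi C] [HasId C] {Γ : C}
    {A A' B B' : Ty Γ} (hA : A = A') (hB : B = B') {f : Tm (Arr A B)} (hf : IsCEq f) :
    IsCEq (f.cast (congrArg₂ Arr hA hB)) := by
  subst hA hB; exact hf

/-- In a context without positions, categorical equivalences out of a type in the universe are
equal to the identity. -/
theorem path_arrPair_zero (hFE : FunExt C) (hUA : Univalence C) {A B : Tm (U (zero Γ))}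
    {F : Tm (Arr (El A) (El B))} (hF : IsCEq F) :
    Path (arrPair (idFun (El A))).1 (arrPair F).1 := by
  obtain ⟨A, P, rfl⟩ := exists_eq_code A
  obtain ⟨B, Q, rfl⟩ := exists_eq_code B
  let X : Ty (zero Γ) := fam (El A) (El P)
  let Y : Ty (zero Γ) := fam (El B) (El Q)
  let G : Tm (Arr X Y) := F.cast (congrArg₂ Arr (El_code A P) (El_code B Q))
  have hG : IsCEq G := IsCEq_cast (El_code A P) (El_code B Q) hF
  obtain ⟨⟨s, hs⟩, r, hr⟩ := hG
  have hr' := section_retraction hs hr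
  have hs' := path_base hs
  have hr'' := path_base hr'
  rw [base_comp, base_idFun] at hs' hr''
  obtain ⟨ε, hε, -⟩ := exists_eqv hs' hr''
  have hY : (PTy.pos Y).toTy ◂ appMap (base G) = El Q ◂ appMap (fst ε) :=
    (congrArg (· ◂ appMap (base G)) (fam_toTy _ _)).trans
      (congrArg (fun f => El Q ◂ appMap f) hε.symm)
  -- the function goes forwards on shapes and backwards on positions, so its action on positions is
  -- the inverse of an equivalence `K` of families
  obtain ⟨⟨g, hg⟩, r', hr₁⟩ := IsCEq_cast hY (fam_toTy _ _) (isCEq_back hFE hs hr')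
  obtain ⟨K, -, hK⟩ := exists_eqv hr₁ (retraction_section hg hr₁)
  have e : (polyFun (T := El P) (T' := El Q) (fst ε) (eqvInv K)).1 = G.1 :=
    congrArg (fun t => t.1) (polyFun_eta G hε _ (congrArg Tm.val hK))
  exact (path_eqvPair hFE hUA (P := P) (Q := Q) ε K).trans
    (Path.of_eq (congrArg Tm.val (arrPair_congr rfl e)))

end Univalence

end Poly

/-! ### Restriction to contexts without positions -/

namespace Poly

section Restriction

variable {C : Type u} [Category.{v} C] [NaturalModel.{w} C] [ITT C] [ExtensiveCoproducts C]
  {Γ Δ : Poly C}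

/-- The projection of a context of the polynomial model to its shapes. -/
def toZero (Γ : Poly C) : Γ ⟶ zero Γ.shape :=
  ⟨𝟙 _, (FibHom.empty _).cast (EmptyTy_sub _).symm rfl⟩

/-- The projection to the shapes reflects paths, since paths only see shapes. -/
theorem path_of_toZero {X : Ty (zero Γ.shape)} {a b : Tm X}
    (h : Path (a.1 ◃ toZero Γ) (b.1 ◃ toZero Γ)) : Path a.1 b.1 := by
  refine path_iff.2 (inh_bare.2 ?_)
  have h' := inh_bare.1 (path_iff.1 (show Path (a.sub (toZero Γ)).1 (b.sub (toZero Γ)).1 from h))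
  exact h'.cast ((IdTy_sub (sh a) (sh b) (𝟙 Γ.shape)).symm.trans (tySub_id _))

/-- A term whose type has no positions at the shape of the term does not depend on the positions of
the context. -/
def restrict {A : Ty Γ} (a : Tm A)
    (e : FibHom (PTy.posAt A (sh a).1 (sh a).2) (EmptyTy Γ.shape)) :
    Tm (C := Poly C) (Γ := zero Γ.shape) A := ptm (Γ := zero Γ.shape) (A := A) (sh a) e

theorem restrict_toZero {A : Ty Γ} (a : Tm A)
    (e : FibHom (PTy.posAt A (sh a).1 (sh a).2) (EmptyTy Γ.shape)) :
    (restrict a e).1 ◃ toZero Γ = a.1 := by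
  refine term_ext (a := (restrict a e).sub (toZero Γ)) (b := a) (PTy.sub_id A) (tmSub_id _)
    fun σ x h h' => ?_
  let f : FibHom (PTy.posAt A (sh a).1 (sh a).2) Γ.pos :=
    (ps ((restrict a e).sub (toZero Γ))).cast
      (PTy.posAt_congr (PTy.sub_id A) (tmSub_id _) _ _) rfl
  exact congrArg (fun g : FibHom _ Γ.pos => g.map σ x h') (FibHom.uniq_of_empty e f (ps a))

/-- Categorical equivalences out of a type in the universe are equal to the identity. There are no
positions over an equivalence, so that it can be restricted to the context without positions. -/
theorem path_arrPair (hFE : FunExt C) (hUA : Univalence C) {A B : Tm (U Γ)}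
    {F : Tm (Arr (El A) (El B))} (hF : IsCEq F) :
    Path (arrPair (idFun (El A))).1 (arrPair F).1 := by
  let A₀ : Tm (U (zero Γ.shape)) := bareTm (Γ := zero Γ.shape) (sh A)
  let B₀ : Tm (U (zero Γ.shape)) := bareTm (Γ := zero Γ.shape) (sh B)
  have hA : A₀.1 ◃ toZero Γ = A.1 := (bare_ext (s := A) (t := A₀.sub (toZero Γ))
    (U_sub (toZero Γ)).symm (tmSub_id _).symm).symm
  have hB : B₀.1 ◃ toZero Γ = B.1 := (bare_ext (s := B) (t := B₀.sub (toZero Γ))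
    (U_sub (toZero Γ)).symm (tmSub_id _).symm).symm
  have hA' : El A₀ ◂ toZero Γ = El A := El_sub_eq hA
  have hB' : El B₀ ◂ toZero Γ = El B := El_sub_eq hB
  obtain ⟨⟨s, hs⟩, r, hr⟩ := hF
  have hr' := section_retraction hs hr
  obtain ⟨e⟩ := posEmpty_of_noInc (inh_NoInc_tdir hs hr')
  obtain ⟨e'⟩ := posEmpty_of_noInc (inh_NoInc_tdir hr' hs)
  let F₀ : Tm (Arr (El A₀) (El B₀)) := show Tm (C := Poly C) (Γ := zero Γ.shape)
    (Arr (Γ := Γ) (El A) (El B) : Ty Γ) from restrict F e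
  -- the section is restricted together with the function, as a section of the restriction
  let s₀ : Tm (Arr (El B₀) (El A₀)) := show Tm (C := Poly C) (Γ := zero Γ.shape)
    (Arr (Γ := Γ) (El B) (El A) : Ty Γ) from restrict s e'
  have hF₀ : F₀.1 ◃ toZero Γ = F.1 := restrict_toZero F e
  have hs₀ : s₀.1 ◃ toZero Γ = s.1 := restrict_toZero s e'
  have h₁ : Path (comp F₀ s₀).1 (idFun (El B₀)).1 := path_of_toZero (by
    rwa [comp_sub_eq (toZero Γ) hB' hA' hB' hF₀ hs₀, idFun_sub_eq (toZero Γ) hB'])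
  have h₂ : Path (comp s₀ F₀).1 (idFun (El A₀)).1 := path_of_toZero (by
    rwa [comp_sub_eq (toZero Γ) hA' hB' hA' hs₀ hF₀, idFun_sub_eq (toZero Γ) hA'])
  have h := (path_arrPair_zero hFE hUA (F := F₀) ⟨⟨s₀, h₁⟩, s₀, h₂⟩).sub (toZero Γ)
  rwa [arrPair_sub_eq (toZero Γ) hA hA (idFun_sub_eq _ hA'),
    arrPair_sub_eq (toZero Γ) hA hB hF₀] at h

end Restriction

end Poly

/-! ### The type of categorical equivalences out of a given type -/

section Singleton

variable {C : Type u} [Category.{v} C] [NaturalModel.{w} C] [HasPi C] [HasSigma C] [HasId C]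
  {Γ Δ : C}

theorem path_isCEq {A : Ty Γ} {f : Tm (Arr A A)} (hf : f = idFun A) (c c' : Tm (isCEq f)) :
    Path c.1 c'.1 := by
  subst hf; exact (path_isCEq_idFun c).symm.trans (path_isCEq_idFun c')

variable [HasUniv C]

/-- The categorical equivalences from the type coded by `A` to types in the universe. -/
def CEqFam (A : Tm (U Γ)) : Ty (Γ ▹ U Γ) := CEq (El (usub A (p (U Γ)))) (El (uvar Γ))

theorem CEqFam_inst (A B : Tm (U Γ)) : CEqFam A ◂ inst B = CEq (El A) (El B) :=
  CEq_sub_eq _ (El_inst A B) (El_uvar_inst B)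

/-- The property of being a categorical equivalence, over the generic function. -/
def genIsCEq (A : Tm (U Γ)) : Ty (Γ ▹ U Γ ▹ ArrFam A) :=
  isCEq (fvar (El (usub A (p (U Γ)))) (El (uvar Γ)))

/-- Instances of the generic pair of a code and a function. -/
theorem gpair_arrPair (A : Tm (U Γ)) {σ : Δ ⟶ Γ ▹ U Γ ▹ ArrFam A} {A' B' : Tm (U Δ)}
    {F : Tm (Arr (El A') (El B'))} (hA : A.1 ◃ (σ ≫ p (ArrFam A) ≫ p (U Γ)) = A'.1)
    (hB : q (U Γ) ◃ (σ ≫ p (ArrFam A)) = B'.1) (hF : q (ArrFam A) ◃ σ = F.1) :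
    (gpair (U Γ) (ArrFam A)).1 ◃ σ = (arrPair F).1 := by
  refine dpair_sub_eq σ ?_ ?_ ((tmSub_tmSub _ _ _).trans hB) hF
  · exact (tySub_tySub _ _ _).trans (U_sub _)
  · rw [tySub_tySub]
    exact (congrArg (ArrFam A ◂ ·) (liftTo_comp _ _ _ _ (U_sub _))).trans (ArrFam_sub_eq _ hA)

/-- If every categorical equivalence out of a type is equal to the identity as a function, then the
categorical equivalences out of that type are contractible, as identity functions are categorical
equivalences in a unique way. -/
theorem cov_idCEq (H : ∀ {Δ : C} {A B : Tm (U Δ)} {F : Tm (Arr (El A) (El B))}, IsCEq F →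
    Path (arrPair (idFun (El A))).1 (arrPair F).1) (A : Tm (U Γ)) :
    Cov (cons (inst A) ((idCEq (El A)).cast (CEqFam_inst A A).symm)) := by
  let i : Γ ⟶ Γ ▹ U Γ ▹ ArrFam A := cons (inst A) ((idFun (El A)).cast (ArrFam_inst A A).symm)
  have e : i ≫ p (ArrFam A) = inst A := by simp [i, cons_eq]
  have e' : i ≫ p (ArrFam A) ≫ p (U Γ) = 𝟙 Γ := by rw [← Category.assoc, e]; simp [inst_eq]
  have hD : genIsCEq A ◂ i = isCEq (idFun (El A)) := by
    refine isCEq_sub_eq i ?_ ?_ ?_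
    · exact (tySub_tySub _ _ _).trans ((congrArg (_ ◂ ·) e).trans (El_inst A A))
    · exact (tySub_tySub _ _ _).trans ((congrArg (_ ◂ ·) e).trans (El_uvar_inst A))
    · change q (ArrFam A) ◃ i = _
      simp [i, cons_eq]
  let d : Tm (genIsCEq A ◂ i) := (isCEq_idFun (El A)).cast hD.symm
  -- contractibility of the triples of a code, a function and a proof, before they are reassociated
  have hc : Cov (cons i d) := by
    refine cov_cons e' d ?_ ?_
    · have hT : genIsCEq A ◂ i ◂ p (genIsCEq A ◂ i) = isCEq (fsub (idFun (El A)) (p (genIsCEq A ◂ i))) :=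
        (congrArg (· ◂ p (genIsCEq A ◂ i)) hD).trans (isCEq_sub_eq _ rfl rfl rfl)
      exact path_isCEq (Tm.ext (idFun_sub_eq _ rfl)) ((d.sub (p (genIsCEq A ◂ i))).cast hT)
        ((var (genIsCEq A ◂ i)).cast hT)
    · let π : Γ ▹ U Γ ▹ ArrFam A ▹ genIsCEq A ⟶ Γ := p (genIsCEq A) ≫ p (ArrFam A) ≫ p (U Γ)
      let A' := usub A π
      let B' := usub (uvar Γ) (p (genIsCEq A) ≫ p (ArrFam A))
      have hA : El (usub A (p (U Γ))) ◂ p (ArrFam A) ◂ p (genIsCEq A) = El A' := by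
        rw [tySub_tySub]; exact El_sub_eq (by simp [A', π])
      have hB : El (uvar Γ) ◂ p (ArrFam A) ◂ p (genIsCEq A) = El B' := by
        rw [tySub_tySub]; exact El_sub_eq (by simp [B'])
      let F : Tm (Arr (El A') (El B')) :=
        ((var (ArrFam A)).sub (p (genIsCEq A))).cast (
          (tySub_tySub _ _ _).trans (Arr_sub_eq _ ((tySub_tySub _ _ _).symm.trans hA)
            ((tySub_tySub _ _ _).symm.trans hB)))
      have hF : IsCEq F := by
        refine inh_isCEq.1 ⟨(var (genIsCEq A)).cast ?_⟩
        exact isCEq_sub_eq _ hA hB rfl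
      have h₁ : (gpair (U Γ) (ArrFam A)).1 ◃ (π ≫ i) = (arrPair (idFun (El A'))).1 := by
        refine gpair_arrPair A ?_ ?_ ?_
        · simp [e', A']
        · simp [e, A', inst_eq]
        · refine (tmSub_tmSub _ _ _).symm.trans (Eq.trans (congrArg (· ◃ π) ?_)
            (idFun_sub_eq π (El_sub A π)))
          simp [i, cons_eq]
      have h₂ : (gpair (U Γ) (ArrFam A)).1 ◃ p (genIsCEq A) = (arrPair F).1 :=
        gpair_arrPair A rfl rfl rfl
      have h := H hF
      rw [← h₁, ← h₂] at h
      simpa [π] using h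
  have h := (cov_of_section (unpair_pairMap (A := ArrFam A) (B := genIsCEq A))).comp hc
  have hX := El_inst A A
  have hY := El_uvar_inst A
  have hp : cons i d ≫ p (genIsCEq A) ≫ p (ArrFam A) = inst A := by simp [e, cons_eq]
  have hB : ArrFam A ◂ (p (genIsCEq A) ≫ p (ArrFam A)) ◂ cons i d = Arr (El A) (El A) := by
    rw [tySub_tySub, hp, ArrFam_inst]
  have hg : (gpair (ArrFam A) (genIsCEq A)).1 ◃ cons i d = (idCEq (El A)).1 := by
    refine dpair_sub_eq (cons i d) hB ?_ ?_ ?_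
    · rw [tySub_tySub]
      have hL : liftTo (cons i d) hB ≫ lift (p (genIsCEq A) ≫ p (ArrFam A)) (ArrFam A) ≫
          p (ArrFam A) = p (Arr (El A) (El A)) ≫ inst A := by
        rw [lift_eq, pair_p, ← Category.assoc, liftTo_eq, pair_p, Category.assoc, hp]
      refine isCEq_sub_eq _ ?_ ?_ ?_
      · exact (tySub_tySub _ _ _).trans ((congrArg (_ ◂ ·) ((Category.assoc _ _ _).trans hL)).trans
          ((tySub_tySub _ _ _).symm.trans (congrArg (· ◂ _) hX)))
      · exact (tySub_tySub _ _ _).trans ((congrArg (_ ◂ ·) ((Category.assoc _ _ _).trans hL)).trans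
          ((tySub_tySub _ _ _).symm.trans (congrArg (· ◂ _) hY)))
      · change q (ArrFam A) ◃ (_ ≫ _) = q _
        rw [lift_eq, liftTo_eq, ← tmSub_tmSub, pair_q, pair_q]
    · change (q (ArrFam A) ◃ p (genIsCEq A)) ◃ cons i d = _
      simp [i, cons_eq]
    · change q (genIsCEq A) ◃ cons i d = _
      simp [cons_eq, d]
  have hm : cons i d ≫ pairMap (ArrFam A) (genIsCEq A) =
      cons (inst A) ((idCEq (El A)).cast (CEqFam_inst A A).symm) := by
    rw [pairMap, cons_eq, cons_eq, cons_eq, comp_pair]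
    refine pair_congr ?_ ?_ _ _
    · exact (congrArg (· ≫ _) (cons_eq i d)).symm.trans hp
    · exact (congrArg (_ ◃ ·) (cons_eq i d)).symm.trans hg
  rwa [hm] at h

end Singleton

/-! ### Function extensionality for types without positions -/

section SigPath

variable {C : Type u} [Category.{v} C] [NaturalModel.{w} C] [HasSigma C] [HasId C] [HasPi C]
  {Γ Δ : C}

/-- Pairs with a path between their first components are equal if the type of the second component
over the first pair has at most one element in every context. -/
theorem path_of_fst {A : Ty Γ} {B : Ty (Γ ▹ A)} {t t' : Tm (Sig A B)}
    (h : Path (fst t).1 (fst t').1)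
    (hu : ∀ {Δ : C} (σ : Δ ⟶ Γ) (y y' : Tm (B ◂ inst (fst t) ◂ σ)), y = y') : Path t.1 t'.1 := by
  have ht : ∀ t : Tm (Sig A B), t.1 = (gpair A B).1 ◃ cons (inst (fst t)) (snd t) := fun t => by
    rw [gpair_inst, dpair_eta]
  -- the type over `x : A` that states that `t` is equal to all pairs with first component `x`
  let P : Ty (Γ ▹ A) := Pi B (IdTy (t.sub (p B ≫ p A)) (gpair A B))
  have h₁ : Inh (P ◂ inst (fst t)) := by
    have e : p (B ◂ inst (fst t)) ≫ cons (inst (fst t)) (snd t) = lift (inst (fst t)) B := by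
      have := hu (p _) ((snd t).sub (p _)) (var (B ◂ inst (fst t)))
      have := congrArg Tm.val this
      apply pair_uniq
      · simp [lift_eq, cons_eq]
      · simpa [lift_eq, cons_eq] using this
    rw [Pi_sub, inh_Pi, inh_IdTy_sub]
    refine Path.of_eq ?_
    rw [← e, ← tmSub_tmSub, ← tmSub_tmSub (gpair A B).1, ← ht t, Tm.sub_val, tmSub_tmSub]
    simp [cons_eq, inst_eq]
  have h₂ : Inh (P ◂ inst (fst t')) :=
    transport (by simp [inst_eq]) (by simpa [inst_eq] using h) h₁
  rw [Pi_sub, inh_Pi] at h₂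
  have h₃ := h₂.sub (inst (snd t'))
  have e : inst (snd t') ≫ lift (inst (fst t')) B = cons (inst (fst t')) (snd t') := by
    apply pair_uniq <;> simp [lift_eq, inst_eq, cons_eq]
  rw [tySub_tySub, e, inh_IdTy_sub, ← ht t'] at h₃
  simpa [cons_eq, inst_eq] using h₃

/-- The function in a term of `Sec f` is a section of `f`. -/
theorem path_fst_Sec {X Y : Ty Γ} {f : Tm (Arr X Y)} (t : Tm (Sec f)) :
    Path (comp f (fst t)).1 (idFun Y).1 := by
  have h := (snd t).inh
  rwa [inh_IdTy_sub, app_inst_comp, idFun_sub_eq (A' := Y) (inst _) (by simp [inst_eq])] at h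

/-- The function in a term of `Ret f` is a retraction of `f`. -/
theorem path_fst_Ret {X Y : Ty Γ} {f : Tm (Arr X Y)} (t : Tm (Ret f)) :
    Path (comp (fst t) f).1 (idFun X).1 := by
  have h := (snd t).inh
  rwa [inh_IdTy_sub, app_inst_comp', idFun_sub_eq (A' := X) (inst _) (by simp [inst_eq])] at h

end SigPath

section Uniq

variable {C : Type u} [Category.{v} C] [NaturalModel.{w} C] [HasPi C] [HasEmpty C] [HasSumTy C]
  [ExtensiveCoproducts C] {Γ Δ : C}

/-- Dependent functions on an empty family of types are unique. -/
theorem pi_arr_uniq {S : Ty Γ} {E W : Ty (Γ ▹ S)} (e : FibHom E (EmptyTy (Γ ▹ S))) (σ : Δ ⟶ Γ)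
    (y y' : Tm (Pi S (Arr E W) ◂ σ)) : y = y' := by
  have hT : Pi S (Arr E W) ◂ σ = Pi (S ◂ σ) (Arr (E ◂ lift σ S) (W ◂ lift σ S)) := by
    rw [Pi_sub, Arr_sub]
  have key : ∀ z z' : Tm (Pi (S ◂ σ) (Arr (E ◂ lift σ S) (W ◂ lift σ S))), z = z' := fun z z' => by
    rw [← lam_app z, ← lam_app z', ← FibHom.toFun_ofFun (app z), ← FibHom.toFun_ofFun (app z')]
    rw [FibHom.uniq_of_empty ((e.sub (lift σ S)).cast rfl (EmptyTy_sub _)) (FibHom.ofFun (app z))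
      (FibHom.ofFun (app z'))]
  exact Tm.ext (congrArg (fun z => z.1) (key (y.cast hT) (y'.cast hT)))

end Uniq

namespace Poly

section NoPos

variable {C : Type u} [Category.{v} C] [NaturalModel.{w} C] [ITT C] [ExtensiveCoproducts C]
  {Γ : Poly C}

/-- Function extensionality for functions of the polynomial model into a type without positions.
The action of such a function on positions is a function out of an empty type, so that only the
actions on shapes have to be compared. Without the hypothesis on `Y` this may fail. -/
theorem path_of_pos_empty (hFE : FunExt C) {X Y : Ty Γ}
    (e : FibHom (PTy.pos Y).toTy (EmptyTy (Γ.shape ▹ PTy.shape Y))) {f g : Tm (Arr X Y)}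
    (h : Path (app f).1 (app g).1) : Path f.1 g.1 := by
  refine path_sh.2 (path_of_fst (t := shArr f) (t' := shArr g) ?_ ?_)
  · exact FunExt.path hFE (path_sh.1 h)
  · have k := (e.sub (appMap (base f))).cast (posAt_app (base f)).symm (EmptyTy_sub _)
    have hT := piFam_inst (Γ := Γ.shape) X (PTy.sub Y (p (PTy.shape X))) (base f)
    intro Δ σ y y'
    exact Tm.ext (congrArg (fun z => z.1) (pi_arr_uniq k σ (y.cast (congrArg (· ◂ σ) hT))
      (y'.cast (congrArg (· ◂ σ) hT))))

/-- There are no positions over a term. -/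
def NoPos {A : Ty Γ} (t : Tm A) : Prop :=
  Nonempty (FibHom (PTy.posAt A (sh t).1 (sh t).2) (EmptyTy Γ.shape))

theorem NoPos.of_cast {A B : Ty Γ} {t : Tm A} (h : A = B) (ht : NoPos (t.cast h)) : NoPos t := by
  subst h; exact ht

theorem NoPos.sig {A : Ty Γ} {B : Ty (Γ ▹ A)} {t : Tm (Sig A B)} (h : NoPos (fst t))
    (h' : NoPos (snd t)) : NoPos t := by
  obtain ⟨k⟩ := h
  obtain ⟨k'⟩ := h'
  exact ⟨(k.copair k').cast (PSig_posAt (Γ := Γ.shape) A B (sh t)).symm rfl⟩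

/-- There are no positions over equivalences and over their sections and retractions, which are
equivalences themselves. -/
theorem noPos_sec_ret {X Y : Ty Γ} {F : Tm (Arr X Y)} (t : Tm (Sec F)) (t' : Tm (Ret F)) :
    NoPos F ∧ NoPos t ∧ NoPos t' := by
  have hs := path_fst_Sec t
  have hr := path_fst_Ret t'
  have hs' := section_retraction hs hr
  have hr' := retraction_section hs hr
  exact ⟨posEmpty_of_noInc (inh_NoInc_tdir hs hs'),
    NoPos.sig (posEmpty_of_noInc (inh_NoInc_tdir hs' hs)) ⟨FibHom.id _⟩,
    NoPos.sig (posEmpty_of_noInc (inh_NoInc_tdir hr hr')) ⟨FibHom.id _⟩⟩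

theorem noPos_CEq {X Y : Ty Γ} (t : Tm (CEq X Y)) : NoPos t := by
  have hT : isCEq (fvar X Y) ◂ inst (fst t) = isCEq (fst t) :=
    isCEq_sub_eq _ (by simp [inst_eq]) (by simp [inst_eq]) (by simp [inst_eq])
  let c : Tm (Sig (Sec (fst t)) (Ret (fst t) ◂ p _)) := (snd t).cast hT
  have hR : Ret (fst t) ◂ p (Sec (fst t)) ◂ inst (fst c) = Ret (fst t) := by simp [inst_eq]
  obtain ⟨h, h', h''⟩ := noPos_sec_ret (fst c) ((snd c).cast hR)
  exact NoPos.sig h (NoPos.of_cast hT (NoPos.sig (t := c) h' (NoPos.of_cast hR h'')))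

/-- Types of categorical equivalences have no positions, because such equivalences are total
functions on positions. -/
theorem CEq_pos_empty (X Y : Ty Γ) :
    Nonempty (FibHom (PTy.pos (CEq X Y)).toTy (EmptyTy (Γ.shape ▹ PTy.shape (CEq X Y)))) := by
  obtain ⟨k⟩ := NoPos.of_cast (CEq_sub_eq (p (CEq X Y)) rfl rfl)
    (noPos_CEq ((var (CEq X Y)).cast (CEq_sub_eq (p (CEq X Y)) rfl rfl)))
  exact ⟨k.cast (PTy.sub_posAt (CEq X Y) (p (PTy.shape (CEq X Y))) _ (ty_q _)) rfl⟩

/-- The canonical map from paths in the universe of the polynomial model to categorical equivalences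
is a categorical equivalence. The homotopies obtained from contractibility become paths between
functions since neither identity types nor types of categorical equivalences have positions. -/
theorem isCEq_idToCEq (hFE : FunExt C) (hUA : Univalence C) (A B : Tm (U Γ)) :
    IsCEq (idToCEq A B) := by
  have hc := cov_idCEq (fun h => path_arrPair hFE hUA h) A
  obtain ⟨⟨s, hs⟩, r, hr⟩ := exists_inverse_of_cov hc B
  obtain ⟨e⟩ := CEq_pos_empty (El A) (El B)
  refine IsCEq_cast rfl (CEqFam_inst A B)
    ⟨⟨s, path_of_pos_empty hFE ?_ hs⟩, r, path_of_pos_empty hFE ?_ hr⟩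
  · rw [CEqFam_inst]; exact e
  · exact FibHom.id _

end NoPos

end Poly

end TT

theorem mainTheorem6 {C : Type u} [CategoryTheory.Category.{v} C] [TT.NaturalModel.{w} C]
    [TT.ITT C] [TT.ExtensiveCoproducts C] (hFE : TT.FunExt C) (hUA : TT.Univalence C) :
    TT.CategoricalCategoricalUnivalence (TT.Poly C) :=
  fun A B => TT.inh_isCEq.2 (TT.Poly.isCEq_idToCEq hFE hUA A B)
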